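/- Let $n\ge 2$ and write $\mathbb R^n=\mathbb C\times\mathbb R^{n-2}$ with points $p=(z,t)$, $r=|z|$, and let $B_1$ be the open unit ball. Let $V$ be the flat real line bundle over $\mathbb C^*\times\mathbb R^{n-2}$ with holonomy $-1$ around $\{0\}\times\mathbb R^{n-2}$; its sections, extended by $0$ over $\{0\}\times\mathbb R^{n-2}$, are identified with the functions $s(w,t)$ on the branched cover $(w,t)\mapsto(z,t)=(w^2,t)$ that are odd in $w$. Fix $\alpha\in(0,\tfrac12)$ and for a section $s$ of $V$ set $$\|s\|_{,\alpha}=\sup\frac{|s(p)-s(p')|}{|p-p'|^{\alpha}},$$ the supremum being over pairs $p=(z,t)\neq p'=(z',t')$ with $|p-p'|\le\tfrac12\min(|z|,|z'|)$, where $s(p)$ and $s(p')$ are compared by parallel transport along the segment from $p$ to $p'$. Let $\mathcal L^2_1$ be the completion of the smooth sections of $V$ with compact support in $\mathbb C^*\times\mathbb R^{n-2}$ under the norm $\|\nabla u\|_{L^2}$ (realized as a space of locally square integrable sections), and let $\mathbf G(\rho)=u$ be the weak solution in $\mathcal L^2_1$ of $\Delta u=\rho$, i.e. $\int_{\mathbb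 R^n}\nabla u\cdot\nabla\psi=-\int_{\mathbb R^n}\rho\,\psi$ for all smooth compactly supported sections $\psi$ over $\mathbb C^*\times\mathbb R^{n-2}$. For $t\in\mathbb R^{n-2}$ set $$\mathbf H(\rho)(t)=\int_{\mathbb R^n}H(t'-t,z')\,\rho(z',t')\,dp',\qquad H(\tau,z)=\kappa_n\,\frac{\overline{z}^{\,1/2}}{(|z|^2+|\tau|^2)^{(n-1)/2}},\qquad \kappa_n=-\frac{2}{\pi\,\mathrm{Vol}(S^{n-2})},$$ where the product $\overline{z'}^{\,1/2}\rho(z',t')$ does not depend on the choice of the square root. Finally, for $f:\mathbb R^{n-2}\to\mathbb C$ of class $C^1$ let $\|f\|_{C^{1,\beta}}$ be the sum of $\sup|f|$ and the $\beta$-Hölder seminorm of the derivative of $f$. Then there is a constant $C$, depending only on $n$ and $\alpha$, such that for every section $\rho$ of $V$ that vanishes outside $B_1$ and has $\|\rho\|_{,\alpha}<\infty$: 1. the integrals defining $A=\mathbf H(\rho)$ converge absolutely, $A$ is of class $C^1$, and $\|A\|_{C^{1,\alpha+1/2}}\le C\,\|\rho\|_{,\alpha}$; 2. $\mathbf G(\rho)$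 exists, is unique (almost everywhere) and is represented by a continuous section, for which, at all $(z,t)$, $$\mathbf G(\rho)(z,t)=\mathrm{Re}\bigl(A(t)\,z^{1/2}\bigr)+E(z,t),\qquad |E(z,t)|\le C\,r^{3/2}\,\|\rho\|_{,\alpha}.$$ -/

import Mathlib

open MeasureTheory Filter Topology
open scoped NNReal ENNReal ContDiff ComplexConjugate

noncomputable section

namespace FlatModel

/-- The singular set `ℝ^m`, where `m = n - 2`. -/
abbrev Sing (m : ℕ) : Type := EuclideanSpace ℝ (Fin m)

/-- `s : ℂ × ℝ^m → ℝ` is regarded as a function of `(w, t)` on the branched cover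
`(w, t) ↦ (w ^ 2, t)` of `ℝ^n = ℂ × ℝ^m`. Sections of the flat real line bundle `V` over
`ℂ^* × ℝ^m` with holonomy `-1`, extended by zero over the singular set, are exactly the
functions which are odd in `w`. -/
def IsSection {m : ℕ} (s : ℂ × Sing m → ℝ) : Prop :=
  ∀ (w : ℂ) (t : Sing m), s (-w, t) = -s (w, t)

/-- The expression of a section as a function of `(z, t)` in `ℝ^n`, in the trivialization of `V` by
the principal branch of `z ^ (1/2)`. The cut is a null set, and replacing the branch changes the
sign only, so integrals over `ℝ^n` of products of two sections, or of their gradients, may be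
computed through it. -/
def branch {m : ℕ} (s : ℂ × Sing m → ℝ) (p : ℂ × Sing m) : ℝ :=
  s (p.1 ^ (1 / 2 : ℂ), p.2)

/-- The Euclidean norm of `(z, t)` in `ℝ^n = ℂ × ℝ^m`. -/
def eucNorm {m : ℕ} (z : ℂ) (t : Sing m) : ℝ := Real.sqrt (‖z‖ ^ 2 + ‖t‖ ^ 2)

/-- For points `p = (w, t)`, `p' = (w', t')` of the cover over `(z, t)`, `(z', t')`:
`|(z, t) - (z', t')| ≤ (1/2) min (|z|, |z'|)`, and `w'` is the lift of `z'` which is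
reached from `w` along the segment (under the first condition the angle between `z` and `z'` is
at most `π / 6`, so of the two square roots of `z'` it is the one in the half-plane of `w`). -/
def Close {m : ℕ} (p p' : ℂ × Sing m) : Prop :=
  eucNorm (p.1 ^ 2 - p'.1 ^ 2) (p.2 - p'.2) ≤ 1 / 2 * min ‖p.1 ^ 2‖ ‖p'.1 ^ 2‖ ∧
    0 < inner ℝ p.1 p'.1

/-- The norm `‖s‖_{,α}` of a section of `V`. -/
def sectionNorm {m : ℕ} (α : ℝ≥0) (s : ℂ × Sing m → ℝ) : ℝ≥0∞ :=
  ⨆ (p : ℂ × Sing m) (p' : ℂ × Sing m) (_ : Close p p'),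
    ‖s p - s p'‖ₑ /
      ENNReal.ofReal (eucNorm (p.1 ^ 2 - p'.1 ^ 2) (p.2 - p'.2)) ^ (α : ℝ)

/-- The Euclidean inner product of the gradients of two functions on `ℝ^n = ℂ × ℝ^m`. -/
def gradInner {m : ℕ} (f g : ℂ × Sing m → ℝ) (p : ℂ × Sing m) : ℝ :=
  inner ℝ (gradient (fun z => f (z, p.2)) p.1) (gradient (fun z => g (z, p.2)) p.1) +
    inner ℝ (gradient (fun t => f (p.1, t)) p.2) (gradient (fun t => g (p.1, t)) p.2)

/-- `∫ ⟨∇φ, ∇ψ⟩` over `ℝ^n`, for sections `φ`, `ψ`. -/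
def dirichletForm {m : ℕ} (φ ψ : ℂ × Sing m → ℝ) : ℝ :=
  ∫ p : ℂ × Sing m, gradInner (branch φ) (branch ψ) p

/-- Smooth sections of `V` with compact support in `ℂ^* × ℝ^m`. -/
structure IsTestSection {m : ℕ} (φ : ℂ × Sing m → ℝ) : Prop where
  odd : IsSection φ
  smooth : ContDiff ℝ ∞ φ
  compact : HasCompactSupport φ
  away : tsupport φ ⊆ {p | p.1 ≠ 0}

/-- `u` is a solution of `Δ u = ρ`, in the weak sense, in the completion of the test
sections under `‖∇ φ‖_{L²}`. By Hardy's inequality for sections of `V` this completion is a space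
of locally square integrable sections: `u` belongs to it if some sequence of test sections is
Cauchy in that norm and converges to `u` in `L²` on compact sets. The integral of `⟨∇u, ∇ψ⟩` is
the limit of those of `⟨∇(φ j), ∇ψ⟩`. -/
structure IsWeakSolution {m : ℕ} (ρ u : ℂ × Sing m → ℝ) : Prop where
  odd : IsSection u
  measurable : AEStronglyMeasurable (branch u) volume
  approx : ∃ φ : ℕ → ℂ × Sing m → ℝ,
    (∀ j, IsTestSection (φ j)) ∧
    Tendsto (fun jk : ℕ × ℕ => dirichletForm (φ jk.1 - φ jk.2) (φ jk.1 - φ jk.2)) atTop (𝓝 0) ∧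
    (∀ K : Set (ℂ × Sing m), IsCompact K →
      Tendsto (fun j => ∫⁻ p in K, ‖branch (φ j) p - branch u p‖ₑ ^ 2) atTop (𝓝 0)) ∧
    ∀ ψ : ℂ × Sing m → ℝ, IsTestSection ψ →
      Tendsto (fun j => dirichletForm (φ j) ψ) atTop
        (𝓝 (-∫ p : ℂ × Sing m, branch ρ p * branch ψ p))

/-- The constant `-2 / (π Vol(S^m))`, where `m = n - 2` and
`Vol(S^m) = 2 π ^ ((m + 1) / 2) / Γ((m + 1) / 2)`. -/
def kappa (m : ℕ) : ℝ :=
  -2 / (Real.pi * (2 * Real.pi ^ (((m : ℝ) + 1) / 2) / Real.Gamma (((m : ℝ) + 1) / 2)))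

/-- The coefficient `H(τ, z)` of the leading term of the Green's function, as a function of `τ` and
of a square root `w` of `z`: `κ * conj w / R ^ (n - 1)`, `R = |(z, τ)|`. -/
def leadKernel {m : ℕ} (τ : Sing m) (w : ℂ) : ℂ :=
  (kappa m : ℂ) * conj w / ((eucNorm (w ^ 2) τ : ℝ) : ℂ) ^ (m + 1)

/-- The integrand `H(t' - t, z') ρ(z', t')` at `p = (z', t')`. -/
def leadIntegrand {m : ℕ} (ρ : ℂ × Sing m → ℝ) (t : Sing m) (p : ℂ × Sing m) : ℂ :=
  leadKernel (p.2 - t) (p.1 ^ (1 / 2 : ℂ)) * ((branch ρ p : ℝ) : ℂ)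

/-- The integral operator `ρ ↦ H(ρ)`. -/
def leadCoeff {m : ℕ} (ρ : ℂ × Sing m → ℝ) (t : Sing m) : ℂ :=
  ∫ p : ℂ × Sing m, leadIntegrand ρ t p

/-- The `C^{1,β}` norm: the supremum of `|f|` plus the `β`-Hölder seminorm of the derivative. -/
def c1HolderNorm {m : ℕ} (β : ℝ≥0) (f : Sing m → ℂ) : ℝ≥0∞ :=
  (⨆ t, ‖f t‖ₑ) + eHolderNorm β (fderiv ℝ f)

end FlatModel

end

/-! The argument is carried out on the branched cover, where a section is simply a function odd in
`w`. Lebesgue measure pulls back to a multiple of `|w|² dw dt`, and the Dirichlet energy to that of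
the Grushin operator `Δ_w + 4|w|² Δ_t` (`dirichletForm_eq`). Oddness under a half turn gives Hardy's
inequality (`hardy`), so pairing with `ρ` is bounded in the energy norm and Dirichlet's principle
produces a solution (`exists_cauchy_weak`, `exists_locL2_limit`).

The Green's function is explicit. With `q = ⟨w, w'⟩` and `a = (n - 1) / 2` it is `κ ∫₀¹ q (|z - z'|²
+ |t - t'|² + 4x²q²)^(-a) dx`. After the substitution `y = 2xq` this is Sommerfeld's construction:
the Newton kernel of `ℝ^(n+1)`, integrated over the part from `0` to `2q` of the additional
coordinate, which makes it odd in `w`. Adding `e > 0` to the base regularizes it. The Grushin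
operator applied to the integrand is then an exact `x`-derivative of something vanishing at `0` and
`1`, plus a term proportional to `e` (`grushin_kern`, `hasDerivAt_kern_primitive`). That term is an
approximate identity whose mass is found by Gaussian integration; `kappa_mul_mass` says that `κ` is
the right normalization. Testing an arbitrary weak solution with the regularized kernel and letting
`e → 0` shows that it agrees almost everywhere with the potential of `ρ`
(`IsSource.ae_eq_solution`). This yields the continuous representative and uniqueness together.

For the expansion, replace the Green's function by its leading term as `w'` tends to the singular
set, `q (|z|² + |t - t'|²)^(-a)`. Since `q` is the real part of `conj w * w'`, the integral of `ρ`
against `κ` times this term is `Re (A(t') w')`. The error is `|w'|³` times integrable kernels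
(`exists_green_sub_lead_le`).

For the regularity of `A`, the Hölder condition along a circle around the singular set, together
with the change of sign after one turn, gives `|ρ| ≤ 8 ‖ρ‖ r^α` (`abs_section_le`). Apart from
measurability and support, nothing else about `ρ` is used (`IsSource`). The integrand of `A(t)` is
then of size `d^(α + 1/2 - (n - 1))` at distance `d` from `(0, t)`; its first `t`-derivative is
locally integrable and its second is not. Splitting at distance `2|k|` gives a first-order Taylor
estimate with remainder `|k|^(1 + α + 1/2)` (`exists_lead_taylor_bound`), and such an estimate,
uniform in `t`, by itself implies `C^{1, α + 1/2}`. -/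

namespace FlatModel

/-! ### Lifting integrals over `ℝ^n` to the branched cover -/

/-- The lift of `(z, t)` to the cover given by the principal square root of `z`. -/
noncomputable def root {m : ℕ} (p : ℂ × Sing m) : ℂ × Sing m := (p.1 ^ (1 / 2 : ℂ), p.2)

/-- The deck transformation of the cover. -/
def deck {m : ℕ} (p : ℂ × Sing m) : ℂ × Sing m := (-p.1, p.2)

theorem branch_eq {m : ℕ} (s : ℂ × Sing m → ℝ) (p : ℂ × Sing m) : branch s p = s (root p) := rfl

theorem sqrt_sq (z : ℂ) : (z ^ (1 / 2 : ℂ)) ^ 2 = z := by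
  rw [one_div]; exact Complex.cpow_nat_inv_pow z two_ne_zero

theorem root_fst_sq {m : ℕ} (p : ℂ × Sing m) : (root p).1 ^ 2 = p.1 := sqrt_sq p.1

theorem norm_root_fst_sq {m : ℕ} (p : ℂ × Sing m) : ‖(root p).1‖ ^ 2 = ‖p.1‖ := by
  rw [← norm_pow, root_fst_sq]

theorem measurable_root {m : ℕ} : Measurable (root (m := m)) := by
  unfold root
  fun_prop

theorem continuous_deck {m : ℕ} : Continuous (deck (m := m)) := by
  unfold deck; fun_prop

theorem volume_re_eq_zero : volume {w : ℂ | w.re = 0} = 0 := by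
  have h := Measure.addHaar_submodule (volume : Measure ℂ) (LinearMap.ker Complex.reLm) (by
    intro h
    have : (1 : ℂ) ∈ LinearMap.ker Complex.reLm := by rw [h]; trivial
    simp at this)
  convert h using 2
  ext w; simp

theorem volume_im_eq_zero : volume {w : ℂ | w.im = 0} = 0 := by
  have h := Measure.addHaar_submodule (volume : Measure ℂ) (LinearMap.ker Complex.imLm) (by
    intro h
    have : (Complex.I : ℂ) ∈ LinearMap.ker Complex.imLm := by rw [h]; trivial
    simp at this)
  convert h using 2
  ext w; simp

theorem ae_mem_slitPlane : ∀ᵐ z : ℂ, z ∈ Complex.slitPlane := by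
  refine (measure_eq_zero_iff_ae_notMem.1 volume_im_eq_zero).mono fun z hz => ?_
  exact Or.inr hz

theorem sq_image_re_pos : (fun w : ℂ => w ^ 2) '' {w | 0 < w.re} = Complex.slitPlane := by
  ext z
  constructor
  · rintro ⟨w, hw, rfl⟩
    simp only [Complex.mem_slitPlane_iff, Set.mem_ofPred_eq] at *
    by_contra! h
    have h1 : w.re ^ 2 - w.im ^ 2 ≤ 0 := by simpa [pow_two] using h.1
    have h2 : w.re * w.im + w.im * w.re = 0 := by simpa [pow_two] using h.2
    have : w.im = 0 := by
      have : w.re * w.im = 0 := by linarith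
      rcases mul_eq_zero.1 this with h | h
      · exact absurd h hw.ne'
      · exact h
    rw [this] at h1
    nlinarith [pow_pos hw 2]
  · intro hz
    refine ⟨z ^ (1 / 2 : ℂ), ?_, sqrt_sq z⟩
    have hz0 : z ≠ 0 := Complex.slitPlane_ne_zero hz
    simp only [Set.mem_ofPred_eq]
    rw [Complex.cpow_def_of_ne_zero hz0, Complex.exp_re]
    refine mul_pos (Real.exp_pos _) (Real.cos_pos_of_mem_Ioo ?_)
    have h1 := Complex.neg_pi_lt_arg z
    have h2 : z.arg < Real.pi := lt_of_le_of_ne (Complex.arg_le_pi z)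
      (Complex.mem_slitPlane_iff_arg.1 hz).1
    have : (Complex.log z * (1 / 2)).im = z.arg / 2 := by
      have : ((1 : ℂ) / 2) = ((1 / 2 : ℝ) : ℂ) := by push_cast; rfl
      rw [this, Complex.im_mul_ofReal, Complex.log_im]; ring
    rw [this]
    constructor <;> linarith

theorem re_sqrt_pos {z : ℂ} (hz : z ∈ Complex.slitPlane) : 0 < (z ^ (1 / 2 : ℂ)).re := by
  rw [← sq_image_re_pos] at hz
  obtain ⟨w, hw, rfl⟩ := hz
  have := Complex.sq_cpow_two_inv hw
  rw [one_div]
  simp only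
  rw [this]
  exact hw

/-- Change of variables for `w ↦ w ^ 2`, which is injective on the right half-plane and covers the
plane up to the cut; the principal root is its inverse there. -/
theorem map_sqrt_volume :
    Measure.map (fun z : ℂ => z ^ (1 / 2 : ℂ)) volume =
      (volume.restrict {w : ℂ | 0 < w.re}).withDensity fun w => ((4 * ‖w‖₊ ^ 2 : ℝ≥0) : ℝ≥0∞) := by
  have hs : MeasurableSet {w : ℂ | 0 < w.re} := measurableSet_lt measurable_const Complex.measurable_re
  have hd : ∀ w : ℂ, HasFDerivAt (fun w : ℂ => w ^ 2)
      ((ContinuousLinearMap.toSpanSingleton ℂ ((2 : ℕ) * w ^ (2 - 1) : ℂ)).restrictScalars ℝ) w :=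
    fun w => (hasDerivAt_pow 2 w).hasFDerivAt.restrictScalars ℝ
  have key := map_withDensity_abs_det_fderiv_eq_addHaar (volume : Measure ℂ) hs.nullMeasurableSet
    (fun w _ => (hd w).hasFDerivWithinAt) (by
      intro w hw w' hw' h
      have h1 := Complex.sq_cpow_two_inv hw
      have h2 := Complex.sq_cpow_two_inv hw'
      rw [← h1, ← h2]
      simp only at h
      rw [h])
  have hdet : ∀ w : ℂ, ENNReal.ofReal
      |((ContinuousLinearMap.toSpanSingleton ℂ
        ((2 : ℕ) * w ^ (2 - 1) : ℂ)).restrictScalars ℝ).det| =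
        ((4 * ‖w‖₊ ^ 2 : ℝ≥0) : ℝ≥0∞) := by
    intro w
    -- The real determinant of multiplication by `2w` is the field norm `|2w|²`.
    have h1 : ((ContinuousLinearMap.toSpanSingleton ℂ
        ((2 : ℕ) * w ^ (2 - 1) : ℂ)).restrictScalars ℝ).det = 4 * ‖w‖ ^ 2 := by
      rw [ContinuousLinearMap.det, ContinuousLinearMap.coe_restrictScalars,
        LinearMap.det_restrictScalars, Algebra.norm_complex_apply, LinearMap.det_ring]
      simp [Complex.normSq_eq_norm_sq, mul_pow]
      norm_num
    rw [h1, abs_of_nonneg (by positivity), ← ENNReal.ofReal_coe_nnreal]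
    simp
  simp only [hdet] at key
  rw [sq_image_re_pos, Measure.restrict_eq_self_of_ae_mem ae_mem_slitPlane] at key
  generalize hν : (volume.restrict {w : ℂ | 0 < w.re}).withDensity
    (fun w => ((4 * ‖w‖₊ ^ 2 : ℝ≥0) : ℝ≥0∞)) = ν at key ⊢
  rw [← key, Measure.map_map (by fun_prop) (by fun_prop)]
  conv_rhs => rw [← Measure.map_id (μ := ν)]
  apply Measure.map_congr
  have : ∀ᵐ w ∂(volume.restrict {w : ℂ | 0 < w.re}), 0 < w.re := ae_restrict_mem hs
  have hac : ν ≪ volume.restrict {w : ℂ | 0 < w.re} :=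
    hν ▸ withDensity_absolutelyContinuous _ _
  filter_upwards [hac.ae_le this] with w hw
  simp only [Function.comp, id]
  rw [one_div]
  exact Complex.sq_cpow_two_inv hw

/-- The pullback to the cover of twice the Lebesgue measure of `ℝ^n`. -/
noncomputable def coverMeasure (m : ℕ) : Measure (ℂ × Sing m) :=
  volume.withDensity fun p => ((4 * ‖p.1‖₊ ^ 2 : ℝ≥0) : ℝ≥0∞)

theorem map_root_volume {m : ℕ} :
    Measure.map (root (m := m)) volume = (coverMeasure m).restrict {p | 0 < p.1.re} := by
  have h1 : MeasurePreserving (fun z : ℂ => z ^ (1 / 2 : ℂ)) volume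
      ((volume.restrict {w : ℂ | 0 < w.re}).withDensity fun w => ((4 * ‖w‖₊ ^ 2 : ℝ≥0) : ℝ≥0∞)) :=
    ⟨by fun_prop, map_sqrt_volume⟩
  have h2 := h1.prod (MeasurePreserving.id (volume : Measure (Sing m)))
  have h3 := h2.map_eq
  have hr : (Prod.map (fun z : ℂ => z ^ (1 / 2 : ℂ)) (id : Sing m → Sing m)) = root := rfl
  rw [hr, prod_withDensity_left (by fun_prop)] at h3
  rw [Measure.volume_eq_prod, h3, coverMeasure, restrict_withDensity
    (measurableSet_lt measurable_const (by fun_prop))]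
  congr 1
  rw [Measure.volume_eq_prod]
  conv_lhs => rw [← Measure.restrict_univ (μ := (volume : Measure (Sing m)))]
  rw [Measure.prod_restrict]
  congr 1
  ext p; simp

theorem measurePreserving_deck {m : ℕ} :
    MeasurePreserving (deck (m := m)) volume volume := by
  have := (Measure.measurePreserving_neg (volume : Measure ℂ)).prod
    (MeasurePreserving.id (volume : Measure (Sing m)))
  exact this

theorem map_deck_coverMeasure {m : ℕ} : (coverMeasure m).map deck = coverMeasure m := by
  ext s hs
  rw [Measure.map_apply continuous_deck.measurable hs, coverMeasure, withDensity_apply _ hs,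
    withDensity_apply _ (continuous_deck.measurable hs)]
  rw [← measurePreserving_deck.setLIntegral_comp_preimage hs (by fun_prop)]
  simp [deck]

/-- The two square roots sweep out the two half-spaces `Re w > 0` and `Re w < 0`, and the hyperplane
between them is null. -/
theorem map_root_add_map_deck_root {m : ℕ} :
    Measure.map (root (m := m)) volume + Measure.map (fun p => deck (root p)) volume =
      coverMeasure m := by
  have hc : Measure.map (fun p : ℂ × Sing m => deck (root p)) volume =
      (coverMeasure m).restrict {p | p.1.re < 0} := by
    have : (fun p : ℂ × Sing m => deck (root p)) = deck ∘ root := rfl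
    rw [this, ← Measure.map_map continuous_deck.measurable measurable_root, map_root_volume]
    have hm : MeasurableSet {p : ℂ × Sing m | p.1.re < 0} :=
      measurableSet_lt (by fun_prop) measurable_const
    have h := Measure.restrict_map (μ := coverMeasure m) continuous_deck.measurable hm
    rw [map_deck_coverMeasure] at h
    rw [h]
    congr 2
    ext p; simp [deck]
  rw [hc, map_root_volume, ← Measure.restrict_union]
  · apply Measure.restrict_eq_self_of_ae_mem
    apply withDensity_absolutelyContinuous
    have : ∀ᵐ w : ℂ, w.re ≠ 0 := measure_eq_zero_iff_ae_notMem.1 volume_re_eq_zero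
    have h2 := (Measure.quasiMeasurePreserving_fst (μ := (volume : Measure ℂ))
      (ν := (volume : Measure (Sing m)))).ae this
    refine h2.mono fun p hp => ?_
    rcases lt_or_gt_of_ne hp with h | h
    · exact Or.inr h
    · exact Or.inl h
  · rw [Set.disjoint_left]
    intro p hp hp'
    simp only [Set.mem_ofPred_eq] at hp hp'
    linarith
  · exact measurableSet_lt (by fun_prop) measurable_const

/-- An even integrand contributes equally on both sheets, whence the factor `2`. -/
theorem lintegral_root {m : ℕ} {F : ℂ × Sing m → ℝ≥0∞} (hF : AEMeasurable F volume)
    (heven : ∀ p, F (deck p) = F p) :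
    2 * ∫⁻ p, F (root p) = ∫⁻ p, ((4 * ‖p.1‖₊ ^ 2 : ℝ≥0) : ℝ≥0∞) * F p := by
  have hF' : AEMeasurable F (coverMeasure m) := hF.mono_ac (withDensity_absolutelyContinuous _ _)
  have h1 : AEMeasurable F (Measure.map (root (m := m)) volume) := by
    refine hF'.mono_measure ?_
    rw [map_root_volume]; exact Measure.restrict_le_self
  have h2 : AEMeasurable F (Measure.map (fun p : ℂ × Sing m => deck (root p)) volume) := by
    refine hF'.mono_measure ?_
    rw [← map_root_add_map_deck_root]; exact Measure.le_add_left le_rfl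
  have := lintegral_withDensity_eq_lintegral_mul₀ (μ := (volume : Measure (ℂ × Sing m)))
    (f := fun p => ((4 * ‖p.1‖₊ ^ 2 : ℝ≥0) : ℝ≥0∞)) (by fun_prop) hF
  simp only [Pi.mul_apply] at this
  rw [← this]
  change _ = ∫⁻ p, F p ∂(coverMeasure m)
  rw [← map_root_add_map_deck_root, lintegral_add_measure,
    lintegral_map' h1 measurable_root.aemeasurable,
    lintegral_map' h2 (continuous_deck.measurable.comp measurable_root).aemeasurable]
  simp only [heven]
  ring

theorem integrable_root_iff {m : ℕ} {F : ℂ × Sing m → ℝ} (hF : AEStronglyMeasurable F volume)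
    (heven : ∀ p, F (deck p) = F p) :
    Integrable (fun p => F (root p)) ↔ Integrable fun p : ℂ × Sing m => 4 * ‖p.1‖ ^ 2 * F p := by
  have hF' : AEStronglyMeasurable F (coverMeasure m) :=
    hF.mono_ac (withDensity_absolutelyContinuous _ _)
  have h1 : AEStronglyMeasurable F (Measure.map (root (m := m)) volume) := by
    refine hF'.mono_measure ?_
    rw [map_root_volume]; exact Measure.restrict_le_self
  have h2 : AEStronglyMeasurable F (Measure.map (fun p : ℂ × Sing m => deck (root p)) volume) := by
    refine hF'.mono_measure ?_
    rw [← map_root_add_map_deck_root]; exact Measure.le_add_left le_rfl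
  have h := integrable_withDensity_iff_integrable_smul (μ := (volume : Measure (ℂ × Sing m)))
    (f := fun p => (4 * ‖p.1‖₊ ^ 2 : ℝ≥0)) (by fun_prop) (g := F)
  change Integrable F (coverMeasure m) ↔ _ at h
  have h3 : (fun p : ℂ × Sing m => (4 * ‖p.1‖₊ ^ 2 : ℝ≥0) • F p) =
      fun p => 4 * ‖p.1‖ ^ 2 * F p := by
    ext p; simp [NNReal.smul_def]
  rw [h3, ← map_root_add_map_deck_root, integrable_add_measure,
    integrable_map_measure h1 measurable_root.aemeasurable,
    integrable_map_measure h2 (continuous_deck.measurable.comp measurable_root).aemeasurable] at h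
  simp only [Function.comp_def, heven, and_self] at h
  exact h

theorem integral_root {m : ℕ} {F : ℂ × Sing m → ℝ} (hF : AEStronglyMeasurable F volume)
    (heven : ∀ p, F (deck p) = F p) :
    ∫ p, F (root p) = 1 / 2 * ∫ p : ℂ × Sing m, 4 * ‖p.1‖ ^ 2 * F p := by
  -- Without integrability both sides are `0` by convention, since integrability on the base and on
  -- the cover are equivalent.
  by_cases hi : Integrable (fun p => F (root p))
  swap
  · rw [integral_undef hi, integral_undef (fun h => hi ((integrable_root_iff hF heven).2 h)),
      mul_zero]
  have hF' : AEStronglyMeasurable F (coverMeasure m) :=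
    hF.mono_ac (withDensity_absolutelyContinuous _ _)
  have h1 : AEStronglyMeasurable F (Measure.map (root (m := m)) volume) := by
    refine hF'.mono_measure ?_
    rw [map_root_volume]; exact Measure.restrict_le_self
  have h2 : AEStronglyMeasurable F (Measure.map (fun p : ℂ × Sing m => deck (root p)) volume) := by
    refine hF'.mono_measure ?_
    rw [← map_root_add_map_deck_root]; exact Measure.le_add_left le_rfl
  have h := integral_withDensity_eq_integral_smul (μ := (volume : Measure (ℂ × Sing m)))
    (f := fun p => (4 * ‖p.1‖₊ ^ 2 : ℝ≥0)) (by fun_prop) F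
  change ∫ p, F p ∂(coverMeasure m) = _ at h
  have h3 : (fun p : ℂ × Sing m => (4 * ‖p.1‖₊ ^ 2 : ℝ≥0) • F p) =
      fun p => 4 * ‖p.1‖ ^ 2 * F p := by
    ext p; simp [NNReal.smul_def]
  have hm2 : AEMeasurable (fun p : ℂ × Sing m => deck (root p)) volume :=
    (continuous_deck.measurable.comp measurable_root).aemeasurable
  rw [h3, ← map_root_add_map_deck_root, integral_add_measure
    ((integrable_map_measure h1 measurable_root.aemeasurable).2 hi)
    ((integrable_map_measure h2 hm2).2 (by simpa only [Function.comp_def, heven] using hi)),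
    integral_map measurable_root.aemeasurable h1, integral_map hm2 h2] at h
  simp only [heven] at h
  rw [← h]; ring

/-! ### The Dirichlet energy on the cover and integration by parts -/

instance isAddHaarMeasure_volume {m : ℕ} :
    (volume : Measure (ℂ × Sing m)).IsAddHaarMeasure :=
  Measure.prod.instIsAddHaarMeasure (volume : Measure ℂ) (volume : Measure (Sing m))

/-- The unit vector of the cover in the direction of the `i`-th coordinate of `ℝ^m`. -/
noncomputable def singDir {m : ℕ} (i : Fin m) : ℂ × Sing m := (0, EuclideanSpace.single i 1)

/-- The pullback to the cover of the energy density, multiplied by the Jacobian `4 |w| ^ 2`. -/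
noncomputable def energy {m : ℕ} (φ ψ : ℂ × Sing m → ℝ) (p : ℂ × Sing m) : ℝ :=
  fderiv ℝ φ p (1, 0) * fderiv ℝ ψ p (1, 0) +
    fderiv ℝ φ p (Complex.I, 0) * fderiv ℝ ψ p (Complex.I, 0) +
    4 * ‖p.1‖ ^ 2 * ∑ i, fderiv ℝ φ p (singDir i) * fderiv ℝ ψ p (singDir i)

/-- The pullback to the cover of the Laplacian, multiplied by the Jacobian `4 |w| ^ 2`. -/
noncomputable def grushin {m : ℕ} (ψ : ℂ × Sing m → ℝ) (p : ℂ × Sing m) : ℝ :=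
  fderiv ℝ (fun x => fderiv ℝ ψ x (1, 0)) p (1, 0) +
    fderiv ℝ (fun x => fderiv ℝ ψ x (Complex.I, 0)) p (Complex.I, 0) +
    4 * ‖p.1‖ ^ 2 * ∑ i, fderiv ℝ (fun x => fderiv ℝ ψ x (singDir i)) p (singDir i)

theorem fderiv_apply_fst {m : ℕ} (A : (ℂ × Sing m) →L[ℝ] ℝ) (c : ℂ) :
    A (c, 0) = c.re * A (1, 0) + c.im * A (Complex.I, 0) := by
  have : (c, (0 : Sing m)) = c.re • ((1 : ℂ), (0 : Sing m)) + c.im • (Complex.I, (0 : Sing m)) := by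
    ext <;> simp
  conv_lhs => rw [this]
  rw [map_add, map_smul, map_smul, smul_eq_mul, smul_eq_mul]

/-- The square root is conformal with derivative `1 / (2w)`: the `w`-part of the energy is divided
by `4|w|²`, while the `t`-part is unchanged. This explains the weight `4|w|²` on the `t`-derivatives
in `energy`. -/
theorem gradInner_branch {m : ℕ} {φ ψ : ℂ × Sing m → ℝ} (hφ : Differentiable ℝ φ)
    (hψ : Differentiable ℝ ψ) {p : ℂ × Sing m} (hp : p.1 ∈ Complex.slitPlane) :
    gradInner (branch φ) (branch ψ) p =
      energy φ ψ (root p) / (4 * ‖(root p).1‖ ^ 2) := by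
  obtain ⟨z, t⟩ := p
  simp only at hp
  have hz0 : z ≠ 0 := Complex.slitPlane_ne_zero hp
  set w : ℂ := z ^ (1 / 2 : ℂ) with hw
  have hw0 : w ≠ 0 := by
    intro h; apply hz0; rw [← sqrt_sq z, ← hw, h]; simp
  set c : ℂ := (1 / 2 : ℂ) * z ^ ((1 / 2 : ℂ) - 1) with hc
  have hcw : c * (2 * w) = 1 := by
    rw [hc, Complex.cpow_sub _ _ hz0, Complex.cpow_one, ← hw]
    have : z = w ^ 2 := (sqrt_sq z).symm
    rw [this]; field_simp
  have hd : HasDerivAt (fun z : ℂ => z ^ (1 / 2 : ℂ)) c z := by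
    have := (hasDerivAt_id z).cpow_const (c := (1 / 2 : ℂ)) hp
    simpa [hc] using this
  have hdz : ∀ f : ℂ × Sing m → ℝ, Differentiable ℝ f → ∀ v : ℂ,
      fderiv ℝ (fun z => branch f (z, t)) z v = fderiv ℝ f (w, t) (c * v, 0) := by
    intro f hf v
    have h1 : HasFDerivAt (fun z : ℂ => (z ^ (1 / 2 : ℂ), t))
        (((ContinuousLinearMap.toSpanSingleton ℂ c).restrictScalars ℝ).prod 0) z :=
      (hd.hasFDerivAt.restrictScalars ℝ).prodMk (hasFDerivAt_const t z)
    have h2 := (hf (w, t)).hasFDerivAt.comp z h1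
    have h3 : (fun z => branch f (z, t)) = f ∘ fun z : ℂ => (z ^ (1 / 2 : ℂ), t) := rfl
    rw [h3, h2.fderiv]
    simp [mul_comm]
  have hdt : ∀ f : ℂ × Sing m → ℝ, Differentiable ℝ f → ∀ v : Sing m,
      fderiv ℝ (fun t => branch f (z, t)) t v = fderiv ℝ f (w, t) (0, v) := by
    intro f hf v
    have h1 : HasFDerivAt (fun t : Sing m => (w, t))
        ((0 : Sing m →L[ℝ] ℂ).prod (ContinuousLinearMap.id ℝ (Sing m))) t :=
      (hasFDerivAt_const w t).prodMk (hasFDerivAt_id t)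
    have h2 := (hf (w, t)).hasFDerivAt.comp t h1
    have h3 : (fun t => branch f (z, t)) = f ∘ fun t : Sing m => (w, t) := rfl
    rw [h3, h2.fderiv]
    simp
  have hg : ∀ {E : Type} [NormedAddCommGroup E] [InnerProductSpace ℝ E] [CompleteSpace E]
      (f : E → ℝ) (x v : E), inner ℝ (gradient f x) v = fderiv ℝ f x v := by
    intro E _ _ _ f x v
    simp [gradient]
  have hg' : ∀ {E : Type} [NormedAddCommGroup E] [InnerProductSpace ℝ E] [CompleteSpace E]
      (f : E → ℝ) (x v : E), inner ℝ v (gradient f x) = fderiv ℝ f x v := by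
    intro E _ _ _ f x v
    rw [real_inner_comm, hg]
  have hroot : root (z, t) = (w, t) := rfl
  have hn : ‖w‖ ^ 2 ≠ 0 := by positivity
  -- `c` and `c * I` are orthogonal of the same length `1 / (2|w|)`, so the cross terms in the two
  -- derivatives cancel.
  have hcn : c.re ^ 2 + c.im ^ 2 = 1 / (4 * ‖w‖ ^ 2) := by
    have h1 : ‖c‖ * (2 * ‖w‖) = 1 := by
      have := congrArg norm hcw
      simpa using this
    have h2 : ‖c‖ ^ 2 = c.re ^ 2 + c.im ^ 2 := by
      rw [← Complex.normSq_eq_norm_sq, Complex.normSq_apply]; ring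
    rw [← h2]
    field_simp
    nlinarith [h1]
  unfold gradInner
  simp only
  rw [← Complex.orthonormalBasisOneI.sum_inner_mul_inner,
    ← (EuclideanSpace.basisFun (Fin m) ℝ).sum_inner_mul_inner]
  simp only [Fin.sum_univ_two, hg, hg', Complex.coe_orthonormalBasisOneI,
    EuclideanSpace.basisFun_apply, hdz _ hφ, hdz _ hψ, hdt _ hφ, hdt _ hψ, energy, hroot]
  simp only [Matrix.cons_val_zero, Matrix.cons_val_one, mul_one]
  rw [fderiv_apply_fst _ c, fderiv_apply_fst _ (c * Complex.I), fderiv_apply_fst _ c,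
    fderiv_apply_fst _ (c * Complex.I), add_div, mul_div_cancel_left₀ _ (by positivity)]
  simp only [Complex.mul_re, Complex.mul_im, Complex.I_re, Complex.I_im, singDir]
  congr 1
  rw [div_eq_mul_one_div, ← hcn]
  ring

theorem fderiv_deck {m : ℕ} {φ : ℂ × Sing m → ℝ} (hodd : IsSection φ)
    (p v : ℂ × Sing m) : fderiv ℝ φ (deck p) (deck v) = -fderiv ℝ φ p v := by
  let L : (ℂ × Sing m) ≃L[ℝ] (ℂ × Sing m) :=
    (ContinuousLinearEquiv.neg ℝ).prodCongr (ContinuousLinearEquiv.refl ℝ _)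
  have hL : ∀ x, L x = deck x := fun x => rfl
  have h1 : φ ∘ L = fun x => -φ x := by
    ext x; exact hodd x.1 x.2
  have h2 := L.comp_right_fderiv (f := φ) (x := p)
  rw [h1, fderiv_fun_neg] at h2
  have h3 := congrArg (fun A => A v) h2
  simp only [ContinuousLinearMap.comp_apply, ContinuousLinearEquiv.coe_coe, hL] at h3
  rw [← h3]; simp

/-- For an odd function the `w`-derivatives are even and the `t`-derivatives odd; products of two of
the same kind are even. -/
theorem energy_deck {m : ℕ} {φ ψ : ℂ × Sing m → ℝ} (hφ : IsSection φ) (hψ : IsSection ψ)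
    (p : ℂ × Sing m) : energy φ ψ (deck p) = energy φ ψ p := by
  have h1 : ∀ c : ℂ, ((c, 0) : ℂ × Sing m) = deck (-c, 0) := fun c => by simp [deck]
  have h2 : ∀ i : Fin m, singDir i = deck (singDir i) := fun i => by simp [deck, singDir]
  have h3 : ∀ f : ℂ × Sing m → ℝ, IsSection f → ∀ c : ℂ,
      fderiv ℝ f (deck p) (c, 0) = fderiv ℝ f p (c, 0) := by
    intro f hf c
    conv_lhs => rw [h1, fderiv_deck hf, ← map_neg]
    simp
  have h4 : ∀ f : ℂ × Sing m → ℝ, IsSection f → ∀ i,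
      fderiv ℝ f (deck p) (singDir i) = -fderiv ℝ f p (singDir i) := by
    intro f hf i
    rw [h2, fderiv_deck hf, ← h2]
  simp only [energy, h3 _ hφ, h3 _ hψ, h4 _ hφ, h4 _ hψ]
  simp [deck]

theorem continuous_fderiv_dir {m : ℕ} {φ : ℂ × Sing m → ℝ} (hφ : ContDiff ℝ ∞ φ)
    (v : ℂ × Sing m) : Continuous fun p => fderiv ℝ φ p v :=
  (hφ.continuous_fderiv (by simp)).clm_apply continuous_const

theorem contDiff_fderiv_dir {m : ℕ} {φ : ℂ × Sing m → ℝ} (hφ : ContDiff ℝ ∞ φ)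
    (v : ℂ × Sing m) : ContDiff ℝ ∞ fun p => fderiv ℝ φ p v :=
  (hφ.fderiv_right (m := ∞) (by simp)).clm_apply contDiff_const

theorem hasCompactSupport_fderiv_dir {m : ℕ} {φ : ℂ × Sing m → ℝ} (hφ : HasCompactSupport φ)
    (v : ℂ × Sing m) : HasCompactSupport fun p => fderiv ℝ φ p v :=
  hφ.fderiv_apply ℝ v

theorem continuous_energy {m : ℕ} {φ ψ : ℂ × Sing m → ℝ} (hφ : ContDiff ℝ ∞ φ)
    (hψ : ContDiff ℝ ∞ ψ) : Continuous (energy φ ψ) := by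
  unfold energy
  have := continuous_fderiv_dir hφ
  have := continuous_fderiv_dir hψ
  fun_prop

theorem hasCompactSupport_energy {m : ℕ} {φ ψ : ℂ × Sing m → ℝ} (hφ : HasCompactSupport φ) :
    HasCompactSupport (energy φ ψ) := by
  have h := hφ.fderiv (𝕜 := ℝ)
  refine h.mono ?_
  intro p hp
  contrapose! hp
  simp only [Function.mem_support, not_not] at *
  simp [energy, hp]

theorem integrable_energy {m : ℕ} {φ ψ : ℂ × Sing m → ℝ} (hφ : IsTestSection φ)
    (hψ : IsTestSection ψ) : Integrable (energy φ ψ) :=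
  (continuous_energy hφ.smooth hψ.smooth).integrable_of_hasCompactSupport
    (hasCompactSupport_energy hφ.compact)

theorem ae_fst_ne_zero {m : ℕ} : ∀ᵐ p : ℂ × Sing m, p.1 ≠ 0 := by
  have h2 := (Measure.quasiMeasurePreserving_fst (μ := (volume : Measure ℂ))
      (ν := (volume : Measure (Sing m)))).ae ae_mem_slitPlane
  exact h2.mono fun p hp => Complex.slitPlane_ne_zero hp

/-- The Jacobian of the cover cancels the conformal factor, so the energy becomes an unweighted
integral; `1 / 2` accounts for the two sheets. -/
theorem dirichletForm_eq {m : ℕ} {φ ψ : ℂ × Sing m → ℝ} (hφ : IsTestSection φ)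
    (hψ : IsTestSection ψ) : dirichletForm φ ψ = 1 / 2 * ∫ p, energy φ ψ p := by
  have h2 := (Measure.quasiMeasurePreserving_fst (μ := (volume : Measure ℂ))
      (ν := (volume : Measure (Sing m)))).ae ae_mem_slitPlane
  have h3 : dirichletForm φ ψ =
      ∫ p : ℂ × Sing m, (fun x => energy φ ψ x / (4 * ‖x.1‖ ^ 2)) (root p) := by
    unfold dirichletForm
    apply integral_congr_ae
    refine Filter.Eventually.mono h2 fun p hp => ?_
    exact gradInner_branch (hφ.smooth.differentiable (by simp)) (hψ.smooth.differentiable (by simp))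
      hp
  rw [h3, integral_root (F := fun x => energy φ ψ x / (4 * ‖x.1‖ ^ 2))]
  · congr 1
    apply integral_congr_ae
    filter_upwards [ae_fst_ne_zero] with p hp
    field_simp
  · refine AEStronglyMeasurable.div₀ ?_ ?_
    · exact (continuous_energy hφ.smooth hψ.smooth).aestronglyMeasurable
    · exact Continuous.aestronglyMeasurable (by fun_prop)
  · intro p
    rw [energy_deck hφ.odd hψ.odd]
    simp [deck]

/-- A weight constant in the direction `v` passes through the integration by parts. It is used with
`1` for the `w`-directions and `4|w|²` for the `t`-directions. -/
theorem integral_fderiv_mul_fderiv {m : ℕ} {φ ψ : ℂ × Sing m → ℝ} (hφ : IsTestSection φ)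
    (hψ : IsTestSection ψ) (v : ℂ × Sing m) (c : ℂ × Sing m → ℝ) (hc : ContDiff ℝ ∞ c)
    (hcv : ∀ p, fderiv ℝ c p v = 0) :
    ∫ p, c p * (fderiv ℝ φ p v * fderiv ℝ ψ p v) =
      -∫ p, φ p * (c p * fderiv ℝ (fun x => fderiv ℝ ψ x v) p v) := by
  have hg : ContDiff ℝ ∞ fun p => c p * fderiv ℝ ψ p v :=
    hc.mul (contDiff_fderiv_dir hψ.smooth v)
  have hd : ∀ p, fderiv ℝ (fun p => c p * fderiv ℝ ψ p v) p v =
      c p * fderiv ℝ (fun x => fderiv ℝ ψ x v) p v := by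
    intro p
    rw [fderiv_fun_mul (hc.differentiable (by simp) p)
      ((contDiff_fderiv_dir hψ.smooth v).differentiable (by simp) p)]
    simp [hcv]
  have h := integral_mul_fderiv_eq_neg_fderiv_mul_of_integrable
    (μ := (volume : Measure (ℂ × Sing m))) (f := φ) (g := fun p => c p * fderiv ℝ ψ p v) (v := v)
    (((continuous_fderiv_dir hφ.smooth v).mul hg.continuous).integrable_of_hasCompactSupport
      (hasCompactSupport_fderiv_dir hφ.compact v).mul_right)
    ((hφ.smooth.continuous.mul (continuous_fderiv_dir hg v)).integrable_of_hasCompactSupport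
      hφ.compact.mul_right)
    ((hφ.smooth.continuous.mul hg.continuous).integrable_of_hasCompactSupport
      hφ.compact.mul_right)
    (fun p _ => hφ.smooth.differentiable (by simp) p) (fun p _ => hg.differentiable (by simp) p)
  simp only [hd] at h
  rw [h, neg_neg]
  congr 1; ext p; ring

theorem integral_energy {m : ℕ} {φ ψ : ℂ × Sing m → ℝ} (hφ : IsTestSection φ)
    (hψ : IsTestSection ψ) : ∫ p, energy φ ψ p = -∫ p, φ p * grushin ψ p := by
  have c1 := continuous_fderiv_dir hφ.smooth
  have c2 := continuous_fderiv_dir hψ.smooth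
  have c3 := fun v => continuous_fderiv_dir (contDiff_fderiv_dir hψ.smooth v) v
  have s1 := hasCompactSupport_fderiv_dir hφ.compact
  have i1 : ∀ c : ℂ × Sing m → ℝ, Continuous c → ∀ v,
      Integrable fun p => c p * (fderiv ℝ φ p v * fderiv ℝ ψ p v) := fun c hc v =>
    (hc.mul ((c1 v).mul (c2 v))).integrable_of_hasCompactSupport (s1 v).mul_right.mul_left
  have i2 : ∀ c : ℂ × Sing m → ℝ, Continuous c → ∀ v,
      Integrable fun p => φ p * (c p * fderiv ℝ (fun x => fderiv ℝ ψ x v) p v) := fun c hc v =>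
    (hφ.smooth.continuous.mul (hc.mul (c3 v))).integrable_of_hasCompactSupport
      hφ.compact.mul_right
  have hN : ContDiff ℝ ∞ fun p : ℂ × Sing m => 4 * ‖p.1‖ ^ 2 :=
    contDiff_const.mul (contDiff_fst.norm_sq ℝ)
  have hNv : ∀ (i : Fin m) (p : ℂ × Sing m),
      fderiv ℝ (fun p : ℂ × Sing m => 4 * ‖p.1‖ ^ 2) p (singDir i) = 0 := by
    intro i p
    have h := (((hasFDerivAt_fst (𝕜 := ℝ) (p := p)).norm_sq).const_mul 4)
    rw [h.fderiv]
    simp [singDir]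
  have e1 : ∀ p, energy φ ψ p = 1 * (fderiv ℝ φ p (1, 0) * fderiv ℝ ψ p (1, 0)) +
      1 * (fderiv ℝ φ p (Complex.I, 0) * fderiv ℝ ψ p (Complex.I, 0)) +
      ∑ i, 4 * ‖p.1‖ ^ 2 * (fderiv ℝ φ p (singDir i) * fderiv ℝ ψ p (singDir i)) := by
    intro p; simp only [energy, Finset.mul_sum, one_mul]
  have e2 : ∀ p, φ p * grushin ψ p =
      φ p * (1 * fderiv ℝ (fun x => fderiv ℝ ψ x (1, 0)) p (1, 0)) +
      φ p * (1 * fderiv ℝ (fun x => fderiv ℝ ψ x (Complex.I, 0)) p (Complex.I, 0)) +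
      ∑ i, φ p * (4 * ‖p.1‖ ^ 2 * fderiv ℝ (fun x => fderiv ℝ ψ x (singDir i)) p (singDir i)) := by
    intro p; simp only [grushin, Finset.mul_sum, one_mul, mul_add]
  simp only [e1, e2]
  rw [integral_add, integral_add, integral_add, integral_add,
    integral_finsetSum, integral_finsetSum]
  · rw [integral_fderiv_mul_fderiv hφ hψ (1, 0) (fun _ => 1) contDiff_const (by simp),
      integral_fderiv_mul_fderiv hφ hψ (Complex.I, 0) (fun _ => 1) contDiff_const (by simp),
      Finset.sum_congr rfl fun i _ => integral_fderiv_mul_fderiv hφ hψ (singDir i) _ hN (hNv i),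
      Finset.sum_neg_distrib]
    ring
  · exact fun i _ => i2 _ hN.continuous _
  · exact fun i _ => i1 _ hN.continuous _
  · exact i2 (fun _ => 1) continuous_const _
  · exact i2 (fun _ => 1) continuous_const _
  · exact (i2 (fun _ => 1) continuous_const _).add (i2 (fun _ => 1) continuous_const _)
  · exact integrable_finsetSum _ fun i _ => i2 _ hN.continuous _
  · exact i1 (fun _ => 1) continuous_const _
  · exact i1 (fun _ => 1) continuous_const _
  · exact (i1 (fun _ => 1) continuous_const _).add (i1 (fun _ => 1) continuous_const _)
  · exact integrable_finsetSum _ fun i _ => i1 _ hN.continuous _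

/-! ### Hardy's inequality -/

/-- Cauchy–Schwarz against a constant, in the form that the variance of `g` is nonnegative. -/
theorem sq_intervalIntegral_le {g : ℝ → ℝ} (hg : Continuous g) {b : ℝ} (hb : 0 < b) :
    (∫ s in (0 : ℝ)..b, g s) ^ 2 ≤ b * ∫ s in (0 : ℝ)..b, g s ^ 2 := by
  set I := ∫ s in (0 : ℝ)..b, g s
  have h1 : 0 ≤ ∫ s in (0 : ℝ)..b, (g s - I / b) ^ 2 :=
    intervalIntegral.integral_nonneg hb.le fun s _ => sq_nonneg _
  have h2 : ∫ s in (0 : ℝ)..b, (g s - I / b) ^ 2 =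
      (∫ s in (0 : ℝ)..b, g s ^ 2) - 2 * (I / b) * I + b * (I / b) ^ 2 := by
    have : ∀ s, (g s - I / b) ^ 2 = g s ^ 2 - 2 * (I / b) * g s + (I / b) ^ 2 := fun s => by ring
    simp only [this]
    rw [intervalIntegral.integral_add, intervalIntegral.integral_sub,
      intervalIntegral.integral_const_mul, intervalIntegral.integral_const]
    · simp [I]
    all_goals exact Continuous.intervalIntegrable (by fun_prop) _ _
  rw [h2] at h1
  have h3 : 2 * (I / b) * I = 2 * (I ^ 2 / b) := by ring
  have h4 : b * (I / b) ^ 2 = I ^ 2 / b := by field_simp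
  rw [h3, h4] at h1
  have h5 : I ^ 2 / b ≤ ∫ s in (0 : ℝ)..b, g s ^ 2 := by linarith
  rw [div_le_iff₀ hb] at h5
  linarith

/-- Rotation of the cover by the angle `s`. -/
noncomputable def rotate {m : ℕ} (s : ℝ) (p : ℂ × Sing m) : ℂ × Sing m :=
  (Complex.exp (s * Complex.I) * p.1, p.2)

theorem measurePreserving_rotate {m : ℕ} (s : ℝ) :
    MeasurePreserving (rotate (m := m) s) volume volume := by
  have h1 : MeasurePreserving (rotation (Circle.exp s)) volume volume :=
    LinearIsometryEquiv.measurePreserving _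
  have := h1.prod (MeasurePreserving.id (volume : Measure (Sing m)))
  have h2 : Prod.map (rotation (Circle.exp s)) (id : Sing m → Sing m) = rotate s := by
    ext p <;> simp [rotate, rotation_apply, Prod.map, Circle.coe_exp]
  rw [← h2]
  exact this

theorem energy_self {m : ℕ} (φ : ℂ × Sing m → ℝ) (p : ℂ × Sing m) :
    energy φ φ p = fderiv ℝ φ p (1, 0) ^ 2 + fderiv ℝ φ p (Complex.I, 0) ^ 2 +
      4 * ‖p.1‖ ^ 2 * ∑ i, fderiv ℝ φ p (singDir i) ^ 2 := by
  simp only [energy, pow_two]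

theorem fderiv_fst_sq_le_energy {m : ℕ} (φ : ℂ × Sing m → ℝ) (p : ℂ × Sing m) (c : ℂ) :
    fderiv ℝ φ p (c, 0) ^ 2 ≤ ‖c‖ ^ 2 * energy φ φ p := by
  rw [fderiv_apply_fst, energy_self, ← Complex.normSq_eq_norm_sq, Complex.normSq_apply]
  set x := fderiv ℝ φ p (1, 0)
  set y := fderiv ℝ φ p (Complex.I, 0)
  have h : 0 ≤ 4 * ‖p.1‖ ^ 2 * ∑ i, fderiv ℝ φ p (singDir i) ^ 2 := by positivity
  have h2 : 0 ≤ (c.re * c.re + c.im * c.im) *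
    (4 * ‖p.1‖ ^ 2 * ∑ i, fderiv ℝ φ p (singDir i) ^ 2) := 
    mul_nonneg (add_nonneg (mul_self_nonneg _) (mul_self_nonneg _)) h
  nlinarith [sq_nonneg (c.re * y - c.im * x)]

theorem energy_self_nonneg {m : ℕ} (φ : ℂ × Sing m → ℝ) (p : ℂ × Sing m) :
    0 ≤ energy φ φ p := by
  rw [energy_self]; positivity

/-- A half turn of the cover maps `w` to `-w`, so `-2φ` is the integral of the angular derivative
over it. That derivative is taken in a direction of length `|w|`, hence its square is at most `|w|²`
times the energy density; squaring the integral gives `π / 4`. -/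
theorem sq_le_integral_energy_rotate {m : ℕ} {φ : ℂ × Sing m → ℝ} (hodd : IsSection φ)
    (hφ : ContDiff ℝ ∞ φ) (p : ℂ × Sing m) :
    φ p ^ 2 ≤ Real.pi / 4 * ‖p.1‖ ^ 2 * ∫ s in (0 : ℝ)..Real.pi, energy φ φ (rotate s p) := by
  obtain ⟨w, t⟩ := p
  set g : ℝ → ℝ := fun s => fderiv ℝ φ (rotate s (w, t))
    (Complex.exp (s * Complex.I) * Complex.I * w, 0) with hg
  have hrot : Continuous fun s : ℝ => rotate s (w, t) := by unfold rotate; fun_prop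
  have hgc : Continuous g := by
    have h1 := hφ.continuous_fderiv (by simp)
    exact (h1.comp hrot).clm_apply (by fun_prop)
  have hd : ∀ s : ℝ, HasDerivAt (fun s : ℝ => φ (rotate s (w, t))) (g s) s := by
    intro s
    have h1 : HasDerivAt (fun s : ℝ => Complex.exp (s * Complex.I) * w)
        (Complex.exp (s * Complex.I) * Complex.I * w) s := by
      have := ((Complex.ofRealCLM.hasDerivAt (x := s)).mul_const Complex.I).cexp.mul_const w
      simpa using this
    have h2 : HasDerivAt (fun s : ℝ => rotate s (w, t))
        (Complex.exp (s * Complex.I) * Complex.I * w, 0) s := h1.prodMk (hasDerivAt_const s t)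
    exact ((hφ.differentiable (by simp)) _).hasFDerivAt.comp_hasDerivAt s h2
  have hint : ∫ s in (0 : ℝ)..Real.pi, g s = -(2 * φ (w, t)) := by
    rw [intervalIntegral.integral_eq_sub_of_hasDerivAt (fun s _ => hd s)
      (hgc.intervalIntegrable _ _)]
    have : rotate Real.pi (w, t) = (-w, t) := by simp [rotate]
    rw [this, hodd w t]
    simp [rotate]; ring
  have h1 := sq_intervalIntegral_le hgc Real.pi_pos
  have h2 : ∫ s in (0 : ℝ)..Real.pi, g s ^ 2 ≤
      ∫ s in (0 : ℝ)..Real.pi, ‖w‖ ^ 2 * energy φ φ (rotate s (w, t)) := by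
    apply intervalIntegral.integral_mono_on Real.pi_pos.le
    · exact (hgc.pow 2).intervalIntegrable _ _
    · exact (continuous_const.mul ((continuous_energy hφ hφ).comp hrot)).intervalIntegrable _ _
    · intro s _
      have := fderiv_fst_sq_le_energy φ (rotate s (w, t)) (Complex.exp (s * Complex.I) * Complex.I * w)
      simpa [Complex.norm_exp_ofReal_mul_I] using this
  rw [intervalIntegral.integral_const_mul] at h2
  rw [hint] at h1
  have h3 := mul_le_mul_of_nonneg_left h2 Real.pi_pos.le
  simp only
  nlinarith

theorem lintegral_energy_rotate {m : ℕ} (φ : ℂ × Sing m → ℝ)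
    (hφ : ContDiff ℝ ∞ φ) :
    ∫⁻ p : ℂ × Sing m, ∫⁻ s in Set.Ioc 0 Real.pi, ENNReal.ofReal (energy φ φ (rotate s p)) =
      ENNReal.ofReal Real.pi * ∫⁻ p, ENNReal.ofReal (energy φ φ p) := by
  have hc : Continuous fun x : (ℂ × Sing m) × ℝ => energy φ φ (rotate x.2 x.1) := by
    refine (continuous_energy hφ hφ).comp ?_
    unfold rotate; fun_prop
  rw [lintegral_lintegral_swap (by exact (ENNReal.measurable_ofReal.comp hc.measurable).aemeasurable)]
  have : ∀ s : ℝ, ∫⁻ p : ℂ × Sing m, ENNReal.ofReal (energy φ φ (rotate s p)) =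
      ∫⁻ p, ENNReal.ofReal (energy φ φ p) := fun s =>
    (measurePreserving_rotate s).lintegral_comp
      (ENNReal.measurable_ofReal.comp (continuous_energy hφ hφ).measurable)
  simp only [this]
  simp [mul_comm]

/-- Hardy's inequality for sections of the flat bundle. -/
theorem hardy {m : ℕ} {φ : ℂ × Sing m → ℝ} (hφ : IsTestSection φ) :
    ∫⁻ p : ℂ × Sing m, ‖branch φ p / ‖p.1‖‖ₑ ^ 2 ≤
      ENNReal.ofReal (Real.pi ^ 2 * dirichletForm φ φ) := by
  have h1 : 2 * ∫⁻ p : ℂ × Sing m, ‖branch φ p / ‖p.1‖‖ₑ ^ 2 =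
      ∫⁻ p : ℂ × Sing m, ((4 * ‖p.1‖₊ ^ 2 : ℝ≥0) : ℝ≥0∞) * ‖φ p / ‖p.1‖ ^ 2‖ₑ ^ 2 := by
    rw [← lintegral_root (F := fun p : ℂ × Sing m => ‖φ p / ‖p.1‖ ^ 2‖ₑ ^ 2)]
    · simp only [branch_eq, norm_root_fst_sq]
    · have := hφ.smooth.continuous.measurable
      fun_prop
    · intro p
      have := hφ.odd p.1 p.2
      simp [deck, this, neg_div]
  -- The left side is `4 φ² / |w|²`. Integrating over the cover, rotation invariance turns the inner
  -- integral into a second factor `π`, which gives the constant `π²`.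
  have h2 : ∀ᵐ p : ℂ × Sing m, ((4 * ‖p.1‖₊ ^ 2 : ℝ≥0) : ℝ≥0∞) * ‖φ p / ‖p.1‖ ^ 2‖ₑ ^ 2 ≤
      ENNReal.ofReal Real.pi * ∫⁻ s in Set.Ioc 0 Real.pi, ENNReal.ofReal (energy φ φ (rotate s p)) := by
    filter_upwards [ae_fst_ne_zero] with p hp
    have hc : Continuous fun s : ℝ => energy φ φ (rotate s p) := by
      refine (continuous_energy hφ.smooth hφ.smooth).comp ?_
      unfold rotate; fun_prop
    rw [← ofReal_integral_eq_lintegral_ofReal, ← intervalIntegral.integral_of_le Real.pi_pos.le,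
      ← ENNReal.ofReal_mul Real.pi_pos.le]
    rotate_left
    · exact (intervalIntegrable_iff_integrableOn_Ioc_of_le Real.pi_pos.le).1
        (hc.intervalIntegrable _ _)
    · exact Filter.Eventually.of_forall fun s => energy_self_nonneg _ _
    have h3 : ((4 * ‖p.1‖₊ ^ 2 : ℝ≥0) : ℝ≥0∞) * ‖φ p / ‖p.1‖ ^ 2‖ₑ ^ 2 =
        ENNReal.ofReal (4 * ‖p.1‖ ^ 2 * (φ p / ‖p.1‖ ^ 2) ^ 2) := by
      rw [ENNReal.ofReal_mul (by positivity), ← ENNReal.ofReal_coe_nnreal]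
      congr 1
      rw [← sq_abs (φ p / ‖p.1‖ ^ 2), ENNReal.ofReal_pow (abs_nonneg _), ← Real.enorm_eq_ofReal_abs]
    rw [h3]
    apply ENNReal.ofReal_le_ofReal
    have h4 := sq_le_integral_energy_rotate hφ.odd hφ.smooth p
    have hn : 0 < ‖p.1‖ ^ 2 := by positivity
    have h5 : 4 * ‖p.1‖ ^ 2 * (φ p / ‖p.1‖ ^ 2) ^ 2 = 4 * (φ p ^ 2 / ‖p.1‖ ^ 2) := by
      field_simp
    rw [h5]
    have h6 : φ p ^ 2 / ‖p.1‖ ^ 2 ≤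
        Real.pi / 4 * ∫ s in (0 : ℝ)..Real.pi, energy φ φ (rotate s p) := by
      rw [div_le_iff₀ hn]; linarith
    linarith
  have h3 := lintegral_mono_ae h2
  rw [lintegral_const_mul' _ _ ENNReal.ofReal_ne_top, lintegral_energy_rotate φ hφ.smooth, ← h1,
    ← ofReal_integral_eq_lintegral_ofReal (integrable_energy hφ hφ)
      (Filter.Eventually.of_forall fun s => energy_self_nonneg _ _)] at h3
  have h4 : ∫ p, energy φ φ p = 2 * dirichletForm φ φ := by
    rw [dirichletForm_eq hφ hφ]; ring
  rw [h4, ENNReal.ofReal_mul (by norm_num), ENNReal.ofReal_ofNat] at h3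
  rw [pow_two, mul_assoc, ENNReal.ofReal_mul Real.pi_pos.le, ENNReal.ofReal_mul Real.pi_pos.le]
  refine (ENNReal.mul_le_mul_iff_right (a := 2) (by norm_num) (by norm_num)).1 ?_
  refine h3.trans (le_of_eq ?_)
  ring

/-! ### Existence of a Cauchy sequence solving the weak equation -/

theorem memLp_two_of_lintegral {α : Type*} [MeasurableSpace α] {μ : Measure α} {f : α → ℝ}
    (hf : AEStronglyMeasurable f μ) (h : ∫⁻ x, ‖f x‖ₑ ^ 2 ∂μ ≠ ⊤) : MemLp f 2 μ := by
  refine ⟨hf, ?_⟩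
  rw [eLpNorm_lt_top_iff_lintegral_rpow_enorm_lt_top (by norm_num) (by norm_num)]
  simpa using h.lt_top

theorem sq_integral_mul_le {α : Type*} [MeasurableSpace α] {μ : Measure α} {f g : α → ℝ}
    (hf : MemLp f 2 μ) (hg : MemLp g 2 μ) :
    (∫ x, f x * g x ∂μ) ^ 2 ≤ (∫ x, f x ^ 2 ∂μ) * ∫ x, g x ^ 2 ∂μ := by
  have hfg : Integrable (fun x => f x * g x) μ := hf.integrable_mul hg
  have hf2 := hf.integrable_sq
  have hg2 := hg.integrable_sq
  have key : ∀ s : ℝ, 0 ≤ (∫ x, g x ^ 2 ∂μ) * (s * s) + 2 * (∫ x, f x * g x ∂μ) * s +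
      ∫ x, f x ^ 2 ∂μ := by
    intro s
    have h1 : 0 ≤ ∫ x, (f x + s * g x) ^ 2 ∂μ := integral_nonneg fun x => sq_nonneg _
    have h2 : ∀ x, (f x + s * g x) ^ 2 = f x ^ 2 + (2 * s) * (f x * g x) + s ^ 2 * g x ^ 2 :=
      fun x => by ring
    simp only [h2] at h1
    have i1 : Integrable (fun x => f x ^ 2 + 2 * s * (f x * g x)) μ := hf2.add (hfg.const_mul _)
    rw [integral_add i1 (hg2.const_mul _),
      integral_add hf2 (hfg.const_mul _), integral_const_mul, integral_const_mul] at h1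
    nlinarith
  have := discrim_le_zero key
  unfold discrim at this
  nlinarith

/-- A bounded linear functional on a space with a positive semidefinite form is represented by
a Cauchy sequence. -/
theorem exists_cauchy_representing {E : Type*} [AddCommGroup E] [Module ℝ E]
    (B : E →ₗ[ℝ] E →ₗ[ℝ] ℝ) (hs : ∀ x y, B x y = B y x) (hpos : ∀ x, 0 ≤ B x x)
    (l : E →ₗ[ℝ] ℝ) {C : ℝ} (hC : 0 ≤ C) (hl : ∀ x, l x ^ 2 ≤ C * B x x) :
    ∃ φ : ℕ → E,
      Tendsto (fun jk : ℕ × ℕ => B (φ jk.1 - φ jk.2) (φ jk.1 - φ jk.2)) atTop (𝓝 0) ∧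
      ∀ ψ, Tendsto (fun j => B (φ j) ψ) atTop (𝓝 (l ψ)) := by
  -- Dirichlet's principle: an approximately minimizing sequence of `B x x / 2 - l x` replaces the
  -- Riesz representation theorem, so that no completion has to be formed.
  set J : E → ℝ := fun x => B x x / 2 - l x with hJ
  have hbdd : BddBelow (Set.range J) := by
    refine ⟨-(C / 2), ?_⟩
    rintro _ ⟨x, rfl⟩
    have h1 := hl x
    have h2 := hpos x
    have : l x ≤ (B x x + C) / 2 := by
      by_contra! h
      nlinarith [sq_nonneg (B x x - C)]
    simp only [hJ]; linarith
  set I := iInf J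
  have hI : ∀ x, I ≤ J x := fun x => ciInf_le hbdd x
  have hex : ∀ j : ℕ, ∃ x, J x < I + 1 / ((j : ℝ) + 1) := fun j =>
    exists_lt_of_ciInf_lt (lt_add_of_pos_right _ (by positivity))
  choose φ hφ using hex
  refine ⟨φ, ?_, ?_⟩
  · have hle : ∀ jk : ℕ × ℕ, B (φ jk.1 - φ jk.2) (φ jk.1 - φ jk.2) ≤
        4 * (1 / ((jk.1 : ℝ) + 1) + 1 / ((jk.2 : ℝ) + 1)) := by
      intro jk
      -- The parallelogram law: comparing with the value at the midpoint forces two near-minimizers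
      -- to be close.
      have h1 := hI ((1 / 2 : ℝ) • (φ jk.1 + φ jk.2))
      have h2 := hφ jk.1
      have h3 := hφ jk.2
      have h4 := hs (φ jk.1) (φ jk.2)
      simp only [hJ, map_smul, map_add, map_sub, LinearMap.smul_apply, LinearMap.add_apply,
        LinearMap.sub_apply, smul_eq_mul] at *
      nlinarith
    have hlim : Tendsto (fun jk : ℕ × ℕ => 4 * (1 / ((jk.1 : ℝ) + 1) + 1 / ((jk.2 : ℝ) + 1)))
        atTop (𝓝 0) := by
      have h0 := tendsto_one_div_add_atTop_nhds_zero_nat (𝕜 := ℝ)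
      rw [← prod_atTop_atTop_eq]
      have h1 : Tendsto (fun jk : ℕ × ℕ => 1 / ((jk.1 : ℝ) + 1) + 1 / ((jk.2 : ℝ) + 1))
          (atTop ×ˢ atTop) (𝓝 (0 + 0)) := (h0.comp tendsto_fst).add (h0.comp tendsto_snd)
      simpa using h1.const_mul (4 : ℝ)
    exact squeeze_zero (fun jk => hpos _) hle hlim
  · intro ψ
    rw [tendsto_iff_norm_sub_tendsto_zero]
    have hle : ∀ j, ‖B (φ j) ψ - l ψ‖ ≤ Real.sqrt (2 * B ψ ψ * (1 / ((j : ℝ) + 1))) := by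
      intro j
      rw [Real.norm_eq_abs]
      apply Real.abs_le_sqrt
      -- Moving from `φ j` in the direction `ψ` can lower `J` by at most `1 / (j + 1)`. The
      -- discriminant of this quadratic in `s` bounds the defect in the weak equation.
      have key : ∀ s : ℝ, 0 ≤ (B ψ ψ / 2) * (s * s) + (B (φ j) ψ - l ψ) * s +
          1 / ((j : ℝ) + 1) := by
        intro s
        have h1 := hI (φ j + s • ψ)
        have h2 := hφ j
        have h3 := hs (φ j) ψ
        simp only [hJ, map_smul, map_add, LinearMap.smul_apply, LinearMap.add_apply,
          smul_eq_mul] at *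
        rw [← h3] at h1
        nlinarith
      have := discrim_le_zero key
      unfold discrim at this
      nlinarith
    refine squeeze_zero (fun j => norm_nonneg _) hle ?_
    have h0 := (tendsto_one_div_add_atTop_nhds_zero_nat (𝕜 := ℝ)).const_mul (2 * B ψ ψ)
    simpa using h0.sqrt

/-- The space of test sections. -/
def testSections (m : ℕ) : Submodule ℝ (ℂ × Sing m → ℝ) where
  carrier := {φ | IsTestSection φ}
  zero_mem' :=
    { odd := fun w t => by simp
      smooth := contDiff_const
      compact := HasCompactSupport.zero
      away := by simp [tsupport] }
  add_mem' := fun {a b} ha hb =>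
    { odd := fun w t => by simp [ha.odd w t, hb.odd w t]; ring
      smooth := ha.smooth.add hb.smooth
      compact := ha.compact.add hb.compact
      away := (tsupport_add a b).trans (Set.union_subset ha.away hb.away) }
  smul_mem' := fun c a ha =>
    { odd := fun w t => by simp [ha.odd w t]
      smooth := contDiff_const.smul ha.smooth
      compact := ha.compact.smul_left
      away := (tsupport_smul_subset_right (fun _ => c) a).trans ha.away }

theorem energy_comm {m : ℕ} (φ ψ : ℂ × Sing m → ℝ) : energy φ ψ = energy ψ φ := by
  ext p
  simp only [energy, mul_comm (fderiv ℝ φ p _)]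

theorem energy_add_left {m : ℕ} {φ φ' : ℂ × Sing m → ℝ} (hφ : Differentiable ℝ φ)
    (hφ' : Differentiable ℝ φ') (ψ : ℂ × Sing m → ℝ) :
    energy (φ + φ') ψ = energy φ ψ + energy φ' ψ := by
  ext p
  simp only [energy, fderiv_add (hφ p) (hφ' p), _root_.add_apply, Pi.add_apply, add_mul,
    Finset.sum_add_distrib, mul_add]
  ring

theorem energy_smul_left {m : ℕ} {φ : ℂ × Sing m → ℝ} (hφ : Differentiable ℝ φ) (c : ℝ)
    (ψ : ℂ × Sing m → ℝ) : energy (c • φ) ψ = c • energy φ ψ := by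
  ext p
  simp only [energy, fderiv_const_smul (hφ p), _root_.smul_apply, Pi.smul_apply,
    smul_eq_mul, mul_assoc, ← Finset.mul_sum]
  ring

theorem dirichletForm_comm {m : ℕ} {φ ψ : ℂ × Sing m → ℝ} (hφ : IsTestSection φ)
    (hψ : IsTestSection ψ) : dirichletForm φ ψ = dirichletForm ψ φ := by
  rw [dirichletForm_eq hφ hψ, dirichletForm_eq hψ hφ, energy_comm]

theorem dirichletForm_add_left {m : ℕ} {φ φ' ψ : ℂ × Sing m → ℝ} (hφ : IsTestSection φ)
    (hφ' : IsTestSection φ') (hψ : IsTestSection ψ) :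
    dirichletForm (φ + φ') ψ = dirichletForm φ ψ + dirichletForm φ' ψ := by
  rw [dirichletForm_eq hφ hψ, dirichletForm_eq hφ' hψ,
    dirichletForm_eq ((testSections m).add_mem hφ hφ') hψ,
    energy_add_left (hφ.smooth.differentiable (by simp)) (hφ'.smooth.differentiable (by simp)),
    integral_add' (integrable_energy hφ hψ) (integrable_energy hφ' hψ)]
  ring

theorem dirichletForm_smul_left {m : ℕ} {φ ψ : ℂ × Sing m → ℝ} (c : ℝ) (hφ : IsTestSection φ)
    (hψ : IsTestSection ψ) : dirichletForm (c • φ) ψ = c * dirichletForm φ ψ := by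
  rw [dirichletForm_eq hφ hψ, dirichletForm_eq ((testSections m).smul_mem c hφ) hψ,
    energy_smul_left (hφ.smooth.differentiable (by simp))]
  simp only [Pi.smul_apply]
  rw [integral_smul, smul_eq_mul]
  ring

/-- The Dirichlet form as a bilinear form on the space of test sections. -/
noncomputable def dirichletBilin (m : ℕ) : testSections m →ₗ[ℝ] testSections m →ₗ[ℝ] ℝ :=
  LinearMap.mk₂ ℝ (fun φ ψ => dirichletForm φ.1 ψ.1)
    (fun φ φ' ψ => dirichletForm_add_left φ.2 φ'.2 ψ.2)
    (fun c φ ψ => dirichletForm_smul_left c φ.2 ψ.2)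
    (fun φ ψ ψ' => by
      rw [dirichletForm_comm φ.2 (ψ + ψ').2, dirichletForm_comm φ.2 ψ.2,
        dirichletForm_comm φ.2 ψ'.2]
      exact dirichletForm_add_left ψ.2 ψ'.2 φ.2)
    (fun c φ ψ => by
      rw [dirichletForm_comm φ.2 (c • ψ).2, dirichletForm_comm φ.2 ψ.2]
      exact dirichletForm_smul_left c ψ.2 φ.2)

theorem dirichletForm_self_nonneg {m : ℕ} {φ : ℂ × Sing m → ℝ} (hφ : IsTestSection φ) :
    0 ≤ dirichletForm φ φ := by
  rw [dirichletForm_eq hφ hφ]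
  exact mul_nonneg (by norm_num) (integral_nonneg fun p => energy_self_nonneg _ _)

theorem aestronglyMeasurable_branch {m : ℕ} {φ : ℂ × Sing m → ℝ} (hφ : Continuous φ) :
    AEStronglyMeasurable (branch φ) volume :=
  (hφ.measurable.comp measurable_root).aestronglyMeasurable

theorem memLp_branch_div {m : ℕ} {φ : ℂ × Sing m → ℝ} (hφ : IsTestSection φ) :
    MemLp (fun p : ℂ × Sing m => branch φ p / ‖p.1‖) 2 := by
  apply memLp_two_of_lintegral
  · exact (aestronglyMeasurable_branch hφ.smooth.continuous).div₀
      (Continuous.aestronglyMeasurable (by fun_prop))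
  · exact ((hardy hφ).trans_lt ENNReal.ofReal_lt_top).ne

theorem integral_sq_branch_div_le {m : ℕ} {φ : ℂ × Sing m → ℝ} (hφ : IsTestSection φ) :
    ∫ p : ℂ × Sing m, (branch φ p / ‖p.1‖) ^ 2 ≤ Real.pi ^ 2 * dirichletForm φ φ := by
  have h0 : 0 ≤ Real.pi ^ 2 * dirichletForm φ φ :=
    mul_nonneg (by positivity) (dirichletForm_self_nonneg hφ)
  rw [← ENNReal.ofReal_le_ofReal_iff h0, ofReal_integral_eq_lintegral_ofReal
    (memLp_branch_div hφ).integrable_sq (Eventually.of_forall fun p => sq_nonneg _)]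
  refine le_trans (le_of_eq ?_) (hardy hφ)
  congr 1; ext p
  rw [← sq_abs, ENNReal.ofReal_pow (abs_nonneg _), ← Real.enorm_eq_ofReal_abs]

theorem mul_branch_eq {m : ℕ} (R : ℂ × Sing m → ℝ) (ψ : ℂ × Sing m → ℝ) :
    (fun p => R p * branch ψ p) =ᵐ[volume]
      fun p => (R p * ‖p.1‖) * (branch ψ p / ‖p.1‖) := by
  filter_upwards [ae_fst_ne_zero] with p hp
  field_simp

theorem integrable_mul_branch {m : ℕ} {R : ℂ × Sing m → ℝ}
    (hR : MemLp (fun p => R p * ‖p.1‖) 2) {ψ : ℂ × Sing m → ℝ} (hψ : IsTestSection ψ) :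
    Integrable fun p => R p * branch ψ p :=
  (integrable_congr (mul_branch_eq R ψ)).2 (hR.integrable_mul (memLp_branch_div hψ))

/-- Pairing with a fixed function, as a functional on test sections. -/
noncomputable def pairing {m : ℕ} {R : ℂ × Sing m → ℝ} (hR : MemLp (fun p => R p * ‖p.1‖) 2) :
    testSections m →ₗ[ℝ] ℝ where
  toFun ψ := -∫ p, R p * branch ψ.1 p
  map_add' ψ ψ' := by
    have : ∀ p, R p * branch (ψ + ψ').1 p = R p * branch ψ.1 p + R p * branch ψ'.1 p := by
      intro p; simp [branch]; ring
    simp only [this]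
    rw [integral_add (integrable_mul_branch hR ψ.2) (integrable_mul_branch hR ψ'.2)]
    ring
  map_smul' c ψ := by
    have : ∀ p, R p * branch (c • ψ).1 p = c * (R p * branch ψ.1 p) := by
      intro p; simp [branch]; ring
    simp only [this]
    rw [integral_const_mul]
    simp

/-- The functional is bounded because the pairing is that of `R |z|` with `ψ / |z|`, both square
integrable, the second one by Hardy's inequality. -/
theorem exists_cauchy_weak {m : ℕ} {R : ℂ × Sing m → ℝ}
    (hR : MemLp (fun p => R p * ‖p.1‖) 2) :
    ∃ φ : ℕ → ℂ × Sing m → ℝ, (∀ j, IsTestSection (φ j)) ∧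
      Tendsto (fun jk : ℕ × ℕ => dirichletForm (φ jk.1 - φ jk.2) (φ jk.1 - φ jk.2))
        atTop (𝓝 0) ∧
      ∀ ψ : ℂ × Sing m → ℝ, IsTestSection ψ →
        Tendsto (fun j => dirichletForm (φ j) ψ) atTop (𝓝 (-∫ p, R p * branch ψ p)) := by
  obtain ⟨φ, h1, h2⟩ := exists_cauchy_representing (dirichletBilin m)
    (fun φ ψ => dirichletForm_comm φ.2 ψ.2) (fun φ => dirichletForm_self_nonneg φ.2)
    (pairing hR) (C := (∫ p : ℂ × Sing m, (R p * ‖p.1‖) ^ 2) * Real.pi ^ 2)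
    (mul_nonneg (integral_nonneg fun p => sq_nonneg _) (by positivity)) (by
      intro ψ
      change (-∫ p, R p * branch ψ.1 p) ^ 2 ≤ _ * dirichletForm ψ.1 ψ.1
      rw [neg_sq, integral_congr_ae (mul_branch_eq R ψ.1)]
      refine (sq_integral_mul_le hR (memLp_branch_div ψ.2)).trans ?_
      rw [mul_assoc]
      exact mul_le_mul_of_nonneg_left (integral_sq_branch_div_le ψ.2)
        (integral_nonneg fun p => sq_nonneg _))
  exact ⟨fun j => (φ j).1, fun j => (φ j).2, h1, fun ψ hψ => h2 ⟨ψ, hψ⟩⟩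

/-- By Hardy's inequality the quotients `φ j / |z|` are Cauchy in `L²`. If `G` is their limit, take
`V = |z| G`, since `|z|` is bounded on compact sets. -/
theorem exists_locL2_limit {m : ℕ} {φ : ℕ → ℂ × Sing m → ℝ} (hφ : ∀ j, IsTestSection (φ j))
    (hc : Tendsto (fun jk : ℕ × ℕ => dirichletForm (φ jk.1 - φ jk.2) (φ jk.1 - φ jk.2))
        atTop (𝓝 0)) :
    ∃ V : ℂ × Sing m → ℝ, AEStronglyMeasurable V volume ∧
      ∀ K : Set (ℂ × Sing m), IsCompact K →
        Tendsto (fun j => ∫⁻ p in K, ‖branch (φ j) p - V p‖ₑ ^ 2) atTop (𝓝 0) := by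
  set g : ℕ → Lp ℝ 2 (volume : Measure (ℂ × Sing m)) :=
    fun j => (memLp_branch_div (hφ j)).toLp with hg
  have hnorm : ∀ {f : ℂ × Sing m → ℝ}, eLpNorm f 2 volume ^ 2 = ∫⁻ p, ‖f p‖ₑ ^ 2 := by
    intro f
    rw [eLpNorm_eq_lintegral_rpow_enorm_toReal (by norm_num) (by norm_num), ← ENNReal.rpow_natCast,
      ← ENNReal.rpow_mul]
    simp
  have hdist : ∀ j k, edist (g j) (g k) ^ 2 ≤
      ENNReal.ofReal (Real.pi ^ 2 * dirichletForm (φ j - φ k) (φ j - φ k)) := by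
    intro j k
    rw [hg, Lp.edist_toLp_toLp, hnorm]
    refine le_trans (le_of_eq ?_) (hardy ((testSections m).sub_mem (hφ j) (hφ k)))
    congr 1; ext p
    simp [branch, sub_div]
  have hcauchy : CauchySeq g := by
    rw [EMetric.cauchySeq_iff]
    intro ε hε
    have h2 : Tendsto (fun jk : ℕ × ℕ =>
        ENNReal.ofReal (Real.pi ^ 2 * dirichletForm (φ jk.1 - φ jk.2) (φ jk.1 - φ jk.2)))
        atTop (𝓝 0) := by
      have := ENNReal.tendsto_ofReal (hc.const_mul (Real.pi ^ 2))
      simpa using this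
    have h3 := (h2.eventually_lt_const (u := ε ^ 2) (by positivity))
    rw [eventually_atTop] at h3
    obtain ⟨N, hN⟩ := h3
    refine ⟨max N.1 N.2, fun j hj k hk => ?_⟩
    have h4 := (hdist j k).trans_lt (hN (j, k) ⟨(le_max_left _ _).trans hj, (le_max_right _ _).trans hk⟩)
    exact lt_of_pow_lt_pow_left' 2 h4
  obtain ⟨G, hG⟩ := cauchySeq_tendsto_of_complete hcauchy
  refine ⟨fun p => ‖p.1‖ * G p, (Continuous.aestronglyMeasurable (by fun_prop)).mul
    (Lp.aestronglyMeasurable G), fun K hK => ?_⟩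
  obtain ⟨C, hC⟩ := hK.isBounded.exists_norm_le
  have h5 : Tendsto (fun j => ENNReal.ofReal C ^ 2 * edist (g j) G ^ 2) atTop (𝓝 0) := by
    have h6 : Tendsto (fun j => edist (g j) G) atTop (𝓝 0) := tendsto_iff_edist_tendsto_0.1 hG
    have h7 := ENNReal.Tendsto.const_mul (a := ENNReal.ofReal C ^ 2) (ENNReal.Tendsto.pow (n := 2) h6)
      (Or.inr (by simp))
    simpa using h7
  refine tendsto_of_tendsto_of_tendsto_of_le_of_le tendsto_const_nhds h5 (fun _ => zero_le) ?_
  intro j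
  simp only
  rw [Lp.edist_def, hnorm, ← lintegral_const_mul' _ _ (by simp)]
  refine le_trans ?_ (setLIntegral_le_lintegral K _)
  apply lintegral_mono_ae
  have hKm : ∀ᵐ p ∂(volume.restrict K), p ∈ K := ae_restrict_mem hK.measurableSet
  filter_upwards [hKm, ae_restrict_of_ae ae_fst_ne_zero,
    ae_restrict_of_ae (memLp_branch_div (hφ j)).coeFn_toLp] with p hp hp0 hgp
  rw [← mul_pow]
  gcongr
  have h8 : branch (φ j) p - ‖p.1‖ * G p = ‖p.1‖ * (g j p - G p) := by
    rw [hg]; simp only; rw [hgp]; field_simp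
  rw [h8, enorm_mul]
  simp only [Pi.sub_apply]
  gcongr
  rw [Real.enorm_eq_ofReal_abs, abs_norm]
  exact ENNReal.ofReal_le_ofReal ((norm_fst_le p).trans (hC p hp))

/-! ### The kernel whose `x`-integral is the Green's function -/

/-- The exponent `(n - 1) / 2` of the Green's function. -/
noncomputable def expo (m : ℕ) : ℝ := ((m : ℝ) + 1) / 2

/-- The quadratic form `e + |z - z'|² + |t - t'|² + 4 x² q²`, where `q = ⟨w, w'⟩`, written as a
polynomial on the cover. -/
noncomputable def quad {m : ℕ} (e x : ℝ) (c p : ℂ × Sing m) : ℝ :=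
  e + (‖p.1‖ ^ 2 + ‖c.1‖ ^ 2) ^ 2 - 4 * (1 - x ^ 2) * inner ℝ c.1 p.1 ^ 2 + ‖p.2 - c.2‖ ^ 2

/-- The integrand in the representation of the (regularized) Green's function. -/
noncomputable def kern {m : ℕ} (e x : ℝ) (p' p : ℂ × Sing m) : ℝ :=
  inner ℝ p'.1 p.1 * quad e x p' p ^ (-expo m)

theorem expo_pos (m : ℕ) : 0 < expo m := by unfold expo; positivity

theorem norm_sq_complex (w : ℂ) : ‖w‖ ^ 2 = w.re ^ 2 + w.im ^ 2 := by
  rw [← Complex.normSq_eq_norm_sq, Complex.normSq_apply]; ring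

theorem inner_complex (w w' : ℂ) : inner ℝ w w' = w.re * w'.re + w.im * w'.im := by
  rw [Complex.inner]; simp; ring

/-- Rests on `|w² - w'²|² = (|w|² + |w'|²)² - 4⟨w, w'⟩²`. The polynomial form in the definition is
the one to differentiate; this one shows positivity and is the one to estimate. -/
theorem quad_eq {m : ℕ} (e x : ℝ) (p' p : ℂ × Sing m) :
    quad e x p' p = e + ‖p.1 ^ 2 - p'.1 ^ 2‖ ^ 2 + ‖p.2 - p'.2‖ ^ 2 +
      4 * x ^ 2 * inner ℝ p'.1 p.1 ^ 2 := by
  rw [quad, norm_sq_complex, norm_sq_complex, norm_sq_complex, inner_complex]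
  simp only [pow_two, Complex.sub_re, Complex.sub_im, Complex.mul_re, Complex.mul_im]
  ring

theorem le_quad {m : ℕ} (e x : ℝ) (p' p : ℂ × Sing m) : e ≤ quad e x p' p := by
  rw [quad_eq]
  have : 0 ≤ ‖p.1 ^ 2 - p'.1 ^ 2‖ ^ 2 + ‖p.2 - p'.2‖ ^ 2 + 4 * x ^ 2 * inner ℝ p'.1 p.1 ^ 2 := by
    positivity
  linarith

theorem quad_pos {m : ℕ} {e : ℝ} (he : 0 < e) (x : ℝ) (p' p : ℂ × Sing m) : 0 < quad e x p' p :=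
  he.trans_le (le_quad e x p' p)

theorem contDiff_quad {m : ℕ} (e x : ℝ) (p' : ℂ × Sing m) : ContDiff ℝ ∞ (quad e x p') := by
  unfold quad
  have h1 : ContDiff ℝ ∞ fun p : ℂ × Sing m => ‖p.1‖ ^ 2 := contDiff_fst.norm_sq ℝ
  have h2 : ContDiff ℝ ∞ fun p : ℂ × Sing m => ‖p.2 - p'.2‖ ^ 2 :=
    (contDiff_snd.sub contDiff_const).norm_sq ℝ
  have h3 : ContDiff ℝ ∞ fun p : ℂ × Sing m => inner ℝ p'.1 p.1 :=
    contDiff_const.inner ℝ contDiff_fst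
  exact ((contDiff_const.add ((h1.add contDiff_const).pow 2)).sub
    (contDiff_const.mul (h3.pow 2))).add h2

theorem contDiff_kern {m : ℕ} {e : ℝ} (he : 0 < e) (x : ℝ) (p' : ℂ × Sing m) :
    ContDiff ℝ ∞ (kern e x p') := by
  unfold kern
  exact (contDiff_const.inner ℝ contDiff_fst).mul
    ((contDiff_quad e x p').rpow_const_of_ne fun p => (quad_pos he x p' p).ne')

theorem fderiv_mul_rpow {E : Type*} [NormedAddCommGroup E] [NormedSpace ℝ E] {q Q : E → ℝ}
    (hq : Differentiable ℝ q) (hQ : Differentiable ℝ Q) (hpos : ∀ p, 0 < Q p) (s : ℝ) (p v : E) :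
    fderiv ℝ (fun p => q p * Q p ^ s) p v =
      fderiv ℝ q p v * Q p ^ s + s * (q p * fderiv ℝ Q p v) * Q p ^ (s - 1) := by
  have h := (hq p).hasFDerivAt.mul ((hQ p).hasFDerivAt.rpow_const (p := s) (Or.inl (hpos p).ne'))
  have := h.fderiv
  change fderiv ℝ (fun p => q p * Q p ^ s) p = _ at this
  rw [this]
  simp
  ring

theorem fderiv_inner_fst {m : ℕ} (c : ℂ) (p v : ℂ × Sing m) :
    fderiv ℝ (fun p : ℂ × Sing m => inner ℝ c p.1) p v = inner ℝ c v.1 := by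
  have h := ((innerSL ℝ c).comp (ContinuousLinearMap.fst ℝ ℂ (Sing m))).hasFDerivAt (x := p)
  have h2 := h.fderiv
  change fderiv ℝ (fun p : ℂ × Sing m => inner ℝ c p.1) p = _ at h2
  rw [h2]; simp

theorem fderiv_quad {m : ℕ} (e x : ℝ) (p' p v : ℂ × Sing m) :
    fderiv ℝ (quad e x p') p v = 4 * (‖p.1‖ ^ 2 + ‖p'.1‖ ^ 2) * inner ℝ v.1 p.1 -
      8 * (1 - x ^ 2) * inner ℝ p'.1 v.1 * inner ℝ p'.1 p.1 + 2 * inner ℝ v.2 (p.2 - p'.2) := by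
  have h1 := (hasFDerivAt_fst (𝕜 := ℝ) (p := p)).norm_sq
  have h2 := ((hasFDerivAt_snd (𝕜 := ℝ) (p := p)).sub_const p'.2).norm_sq
  have h3 := ((innerSL ℝ p'.1).comp (ContinuousLinearMap.fst ℝ ℂ (Sing m))).hasFDerivAt (x := p)
  have h := ((((h1.add_const (‖p'.1‖ ^ 2)).pow 2).const_add e).sub
    ((h3.pow 2).const_mul (4 * (1 - x ^ 2)))).add h2
  have h4 := h.fderiv
  change fderiv ℝ (quad e x p') p = _ at h4
  rw [h4, inner_sub_right, real_inner_comm p.2 v.2, real_inner_comm p'.2 v.2]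
  simp
  ring

theorem fderiv_fderiv_quad {m : ℕ} (e x : ℝ) (p' p v : ℂ × Sing m) :
    fderiv ℝ (fun p => fderiv ℝ (quad e x p') p v) p v =
      8 * inner ℝ v.1 p.1 ^ 2 + 4 * (‖p.1‖ ^ 2 + ‖p'.1‖ ^ 2) * ‖v.1‖ ^ 2 -
      8 * (1 - x ^ 2) * inner ℝ p'.1 v.1 ^ 2 + 2 * ‖v.2‖ ^ 2 := by
  simp only [fderiv_quad]
  have h1 := (hasFDerivAt_fst (𝕜 := ℝ) (p := p)).norm_sq
  have h3 := ((innerSL ℝ p'.1).comp (ContinuousLinearMap.fst ℝ ℂ (Sing m))).hasFDerivAt (x := p)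
  have h5 := ((innerSL ℝ v.1).comp (ContinuousLinearMap.fst ℝ ℂ (Sing m))).hasFDerivAt (x := p)
  have h6 := ((innerSL ℝ v.2).hasFDerivAt (x := p.2 - p'.2)).comp p
    ((hasFDerivAt_snd (𝕜 := ℝ) (p := p)).sub_const p'.2)
  have h := ((((h1.add_const (‖p'.1‖ ^ 2)).const_mul 4).mul h5).sub
    (h3.const_mul (8 * (1 - x ^ 2) * inner ℝ p'.1 v.1))).add (h6.const_mul 2)
  have h4 := h.fderiv
  change fderiv ℝ (fun p : ℂ × Sing m => 4 * (‖p.1‖ ^ 2 + ‖p'.1‖ ^ 2) * inner ℝ v.1 p.1 -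
      8 * (1 - x ^ 2) * inner ℝ p'.1 v.1 * inner ℝ p'.1 p.1 + 2 * inner ℝ v.2 (p.2 - p'.2)) p = _
    at h4
  rw [h4]
  simp
  ring

theorem fderiv_kern {m : ℕ} {e : ℝ} (he : 0 < e) (x : ℝ) (p' p v : ℂ × Sing m) :
    fderiv ℝ (kern e x p') p v = inner ℝ p'.1 v.1 * quad e x p' p ^ (-expo m) -
      expo m * (inner ℝ p'.1 p.1 * fderiv ℝ (quad e x p') p v) *
        quad e x p' p ^ (-expo m - 1) := by
  have hq : Differentiable ℝ fun p : ℂ × Sing m => inner ℝ p'.1 p.1 :=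
    (contDiff_const.inner ℝ contDiff_fst (n := ∞)).differentiable (by simp)
  have := fderiv_mul_rpow hq ((contDiff_quad e x p').differentiable (by simp)) (quad_pos he x p')
    (-expo m) p v
  change fderiv ℝ (kern e x p') p v = _ at this
  rw [this, fderiv_inner_fst]
  ring

theorem fderiv_fderiv_kern {m : ℕ} {e : ℝ} (he : 0 < e) (x : ℝ) (p' p v : ℂ × Sing m) :
    fderiv ℝ (fun p => fderiv ℝ (kern e x p') p v) p v =
      -expo m * (2 * inner ℝ p'.1 v.1 * fderiv ℝ (quad e x p') p v +
        inner ℝ p'.1 p.1 * fderiv ℝ (fun p => fderiv ℝ (quad e x p') p v) p v) *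
        quad e x p' p ^ (-expo m - 1) +
      expo m * (expo m + 1) * (inner ℝ p'.1 p.1 * fderiv ℝ (quad e x p') p v ^ 2) *
        quad e x p' p ^ (-expo m - 2) := by
  have hq : Differentiable ℝ fun p : ℂ × Sing m => inner ℝ p'.1 p.1 :=
    (contDiff_const.inner ℝ contDiff_fst (n := ∞)).differentiable (by simp)
  have hQ : Differentiable ℝ (quad e x p') := (contDiff_quad e x p').differentiable (by simp)
  have hQv : Differentiable ℝ fun p => fderiv ℝ (quad e x p') p v :=
    (contDiff_fderiv_dir (contDiff_quad e x p') v).differentiable (by simp)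
  have hpos := quad_pos he x p'
  have hqQ : Differentiable ℝ fun p : ℂ × Sing m =>
      expo m * (inner ℝ p'.1 p.1 * fderiv ℝ (quad e x p') p v) := (hq.mul hQv).const_mul _
  simp only [fderiv_kern he]
  have hd : ∀ (f : ℂ × Sing m → ℝ) (s : ℝ), Differentiable ℝ f →
      DifferentiableAt ℝ (fun p => f p * quad e x p' p ^ s) p := fun f s hf =>
    (hf p).mul ((hQ p).rpow_const (Or.inl (hpos p).ne'))
  rw [fderiv_fun_sub (hd _ _ (differentiable_const _)) (hd _ _ hqQ), _root_.sub_apply,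
    fderiv_mul_rpow (differentiable_const _) hQ hpos, fderiv_mul_rpow hqQ hQ hpos,
    fderiv_const_mul ((hq p).fun_mul (hQv p))]
  rw [_root_.smul_apply, fderiv_fun_mul (hq p) (hQv p)]
  have h2 : -expo m - 1 - 1 = -expo m - 2 := by ring
  simp only [_root_.add_apply, _root_.smul_apply, fderiv_inner_fst, smul_eq_mul, h2, fderiv_fun_const,
    Pi.zero_apply, _root_.zero_apply]
  ring

/-- The decisive computation. The first two terms together form an exact derivative in `x`, by
`hasDerivAt_kern_primitive`; only the last, which carries the factor `e`, survives integration over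
`[0, 1]`. -/
theorem grushin_kern {m : ℕ} {e : ℝ} (he : 0 < e) (x : ℝ) (p' p : ℂ × Sing m) :
    grushin (kern e x p') p =
      8 * expo m * ‖p'.1‖ ^ 2 * (1 - 3 * x ^ 2) * inner ℝ p'.1 p.1 *
          quad e x p' p ^ (-expo m - 1) -
        64 * expo m * (expo m + 1) * x ^ 2 * (1 - x ^ 2) * inner ℝ p'.1 p.1 ^ 3 * ‖p'.1‖ ^ 2 *
          quad e x p' p ^ (-expo m - 2) -
        16 * expo m * (expo m + 1) * ‖p.1‖ ^ 2 * e * inner ℝ p'.1 p.1 *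
          quad e x p' p ^ (-expo m - 2) := by
  have hpow : quad e x p' p ^ (-expo m - 1) = quad e x p' p * quad e x p' p ^ (-expo m - 2) := by
    have : -expo m - 1 = 1 + (-expo m - 2) := by ring
    rw [this, Real.rpow_add (quad_pos he x p' p), Real.rpow_one]
  simp only [grushin, fderiv_fderiv_kern he, fderiv_fderiv_quad]
  simp only [fderiv_quad, hpow]
  set P := quad e x p' p ^ (-expo m - 2)
  have hsum : ∑ i : Fin m, (p.2 - p'.2) i ^ 2 = ‖p.2 - p'.2‖ ^ 2 := by
    rw [EuclideanSpace.norm_sq_eq]; simp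
  have hs : ∀ i : Fin m, inner ℝ (singDir i : ℂ × Sing m).2 (p.2 - p'.2) = (p.2 - p'.2) i := by
    intro i; simp [singDir, EuclideanSpace.inner_single_left]
  have hs1 : ∀ i : Fin m, ‖(singDir i : ℂ × Sing m).2‖ = 1 := by intro i; simp [singDir]
  have hs2 : ∀ i : Fin m, (singDir i : ℂ × Sing m).1 = 0 := by intro i; simp [singDir]
  simp only [hs, hs1, hs2, inner_zero_right, inner_zero_left, mul_zero, zero_add, sub_zero, norm_zero,
    one_pow, mul_one, zero_mul, ne_eq, OfNat.ofNat_ne_zero, not_false_eq_true, zero_pow, add_zero]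
  have e1 : ∀ i : Fin m, -expo m * (inner ℝ p'.1 p.1 * 2) * (quad e x p' p * P) +
      expo m * (expo m + 1) * (inner ℝ p'.1 p.1 * (2 * (p.2 - p'.2) i) ^ 2) * P =
      -expo m * (inner ℝ p'.1 p.1 * 2) * (quad e x p' p * P) +
      (4 * expo m * (expo m + 1) * inner ℝ p'.1 p.1 * P) * (p.2 - p'.2) i ^ 2 := fun i => by ring
  simp only [e1, Finset.sum_add_distrib, ← Finset.mul_sum, hsum, Finset.sum_const, Finset.card_univ,
    Fintype.card_fin, nsmul_eq_mul]
  -- Here the choice of the exponent enters: with `m = 2a - 1` the trace over the `t`-directions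
  -- combines with the other terms.
  have hm : (m : ℝ) = 2 * expo m - 1 := by unfold expo; ring
  rw [hm]
  simp only [quad, norm_sq_complex, inner_complex, Complex.one_re, Complex.one_im, Complex.I_re,
    Complex.I_im, norm_one, Complex.norm_I]
  ring

/-- What matters is the factor `x - x ^ 3`, which vanishes at both ends of `[0, 1]`. -/
theorem hasDerivAt_kern_primitive {m : ℕ} {e : ℝ} (he : 0 < e) (x : ℝ) (p' p : ℂ × Sing m) :
    HasDerivAt (fun x => 8 * expo m * ‖p'.1‖ ^ 2 * inner ℝ p'.1 p.1 * (x - x ^ 3) *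
        quad e x p' p ^ (-expo m - 1))
      (8 * expo m * ‖p'.1‖ ^ 2 * (1 - 3 * x ^ 2) * inner ℝ p'.1 p.1 *
          quad e x p' p ^ (-expo m - 1) -
        64 * expo m * (expo m + 1) * x ^ 2 * (1 - x ^ 2) * inner ℝ p'.1 p.1 ^ 3 * ‖p'.1‖ ^ 2 *
          quad e x p' p ^ (-expo m - 2)) x := by
  have h1 : HasDerivAt (fun x => quad e x p' p) (8 * x * inner ℝ p'.1 p.1 ^ 2) x := by
    have := ((((((hasDerivAt_id x).pow 2).const_sub 1).const_mul 4).mul_const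
      (inner ℝ p'.1 p.1 ^ 2)).const_sub (e + (‖p.1‖ ^ 2 + ‖p'.1‖ ^ 2) ^ 2)).add_const
      (‖p.2 - p'.2‖ ^ 2)
    refine this.congr_deriv ?_
    simp only [id]; push_cast; ring
  have h2 := h1.rpow_const (p := -expo m - 1) (Or.inl (quad_pos he x p' p).ne')
  have h3 := ((hasDerivAt_id x).sub ((hasDerivAt_id x).pow 3)).const_mul
    (8 * expo m * ‖p'.1‖ ^ 2 * inner ℝ p'.1 p.1)
  refine (h3.mul h2).congr_deriv ?_
  have : -expo m - 1 - 1 = -expo m - 2 := by ring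
  simp [this]
  ring

/-! ### Scale-invariant cutoff functions -/

theorem fderiv_fderiv_mul {E : Type*} [NormedAddCommGroup E] [NormedSpace ℝ E] {F G : E → ℝ}
    (hF : ContDiff ℝ ∞ F) (hG : ContDiff ℝ ∞ G) (p v : E) :
    fderiv ℝ (fun x => fderiv ℝ (fun y => F y * G y) x v) p v =
      F p * fderiv ℝ (fun x => fderiv ℝ G x v) p v + 2 * (fderiv ℝ F p v * fderiv ℝ G p v) +
        G p * fderiv ℝ (fun x => fderiv ℝ F x v) p v := by
  have dF : Differentiable ℝ F := hF.differentiable (by simp)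
  have dG : Differentiable ℝ G := hG.differentiable (by simp)
  have dF' : Differentiable ℝ fun x => fderiv ℝ F x v :=
    ((hF.fderiv_right (m := ∞) (by simp)).clm_apply contDiff_const).differentiable (by simp)
  have dG' : Differentiable ℝ fun x => fderiv ℝ G x v :=
    ((hG.fderiv_right (m := ∞) (by simp)).clm_apply contDiff_const).differentiable (by simp)
  have h1 : ∀ x, fderiv ℝ (fun y => F y * G y) x v =
      F x * fderiv ℝ G x v + G x * fderiv ℝ F x v := by
    intro x
    rw [fderiv_fun_mul (dF x) (dG x)]; simp
  simp only [h1]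
  rw [fderiv_fun_add ((dF p).fun_mul (dG' p)) ((dG p).fun_mul (dF' p)),
    fderiv_fun_mul (dF p) (dG' p), fderiv_fun_mul (dG p) (dF' p)]
  simp
  ring

theorem grushin_mul {m : ℕ} {F G : ℂ × Sing m → ℝ} (hF : ContDiff ℝ ∞ F) (hG : ContDiff ℝ ∞ G)
    (p : ℂ × Sing m) :
    grushin (fun p => F p * G p) p = F p * grushin G p + 2 * energy F G p + G p * grushin F p := by
  simp only [grushin, fderiv_fderiv_mul hF hG, energy, Finset.sum_add_distrib, ← Finset.mul_sum]
  ring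

/-- Scale-invariant bounds on a function and its derivatives up to second order. -/
structure IsSymbol {m : ℕ} (C : ℝ) (F : ℂ × Sing m → ℝ) : Prop where
  smooth : ContDiff ℝ ∞ F
  zeroth : ∀ p, |F p| ≤ C
  one : ∀ p, ‖p.1‖ * |fderiv ℝ F p (1, 0)| ≤ C
  imag : ∀ p, ‖p.1‖ * |fderiv ℝ F p (Complex.I, 0)| ≤ C
  sing : ∀ p i, ‖p.1‖ ^ 2 * |fderiv ℝ F p (singDir i)| ≤ C
  second : ∀ p, ‖p.1‖ ^ 2 * |grushin F p| ≤ C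

theorem IsSymbol.nonneg {m : ℕ} {C : ℝ} {F : ℂ × Sing m → ℝ} (h : IsSymbol C F) : 0 ≤ C :=
  (abs_nonneg _).trans (h.zeroth 0)

theorem IsSymbol.mono {m : ℕ} {C C' : ℝ} {F : ℂ × Sing m → ℝ} (h : IsSymbol C F) (hC : C ≤ C') :
    IsSymbol C' F :=
  ⟨h.smooth, fun p => (h.zeroth p).trans hC, fun p => (h.one p).trans hC,
    fun p => (h.imag p).trans hC, fun p i => (h.sing p i).trans hC,
    fun p => (h.second p).trans hC⟩

theorem abs_energy_le {m : ℕ} {C D : ℝ} {F f : ℂ × Sing m → ℝ} {p : ℂ × Sing m}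
    (hF : IsSymbol C F) (h1 : ‖p.1‖ * |fderiv ℝ f p (1, 0)| ≤ D)
    (h2 : ‖p.1‖ * |fderiv ℝ f p (Complex.I, 0)| ≤ D)
    (h3 : ∀ i, ‖p.1‖ ^ 2 * |fderiv ℝ f p (singDir i)| ≤ D) :
    ‖p.1‖ ^ 2 * |energy F f p| ≤ (2 + 4 * m) * (C * D) := by
  have hC := hF.nonneg
  have hD : 0 ≤ D := le_trans (by positivity) h1
  have e1 : ‖p.1‖ ^ 2 * |fderiv ℝ F p (1, 0) * fderiv ℝ f p (1, 0)| ≤ C * D := by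
    rw [abs_mul]
    calc _ = (‖p.1‖ * |fderiv ℝ F p (1, 0)|) * (‖p.1‖ * |fderiv ℝ f p (1, 0)|) := by ring
      _ ≤ C * D := mul_le_mul (hF.one p) h1 (by positivity) hC
  have e2 : ‖p.1‖ ^ 2 * |fderiv ℝ F p (Complex.I, 0) * fderiv ℝ f p (Complex.I, 0)| ≤ C * D := by
    rw [abs_mul]
    calc _ = (‖p.1‖ * |fderiv ℝ F p (Complex.I, 0)|) * (‖p.1‖ * |fderiv ℝ f p (Complex.I, 0)|) := by
          ring
      _ ≤ C * D := mul_le_mul (hF.imag p) h2 (by positivity) hC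
  have e3 : ‖p.1‖ ^ 2 * |4 * ‖p.1‖ ^ 2 * ∑ i, fderiv ℝ F p (singDir i) * fderiv ℝ f p (singDir i)| ≤
      4 * m * (C * D) := by
    rw [abs_mul, abs_of_nonneg (by positivity : (0 : ℝ) ≤ 4 * ‖p.1‖ ^ 2)]
    have : |∑ i, fderiv ℝ F p (singDir i) * fderiv ℝ f p (singDir i)| ≤
        ∑ i, |fderiv ℝ F p (singDir i)| * |fderiv ℝ f p (singDir i)| := by
      refine (Finset.abs_sum_le_sum_abs _ _).trans (le_of_eq ?_)
      simp [abs_mul]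
    calc _ ≤ ‖p.1‖ ^ 2 * (4 * ‖p.1‖ ^ 2 *
          ∑ i, |fderiv ℝ F p (singDir i)| * |fderiv ℝ f p (singDir i)|) := by gcongr
      _ = 4 * ∑ i, (‖p.1‖ ^ 2 * |fderiv ℝ F p (singDir i)|) *
          (‖p.1‖ ^ 2 * |fderiv ℝ f p (singDir i)|) := by
          simp only [Finset.mul_sum]
          refine Finset.sum_congr rfl fun i _ => ?_
          ring
      _ ≤ 4 * ∑ i : Fin m, C * D := by
          gcongr with i
          · exact hF.sing p i
          · exact h3 i
      _ = _ := by simp; ring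
  have : |energy F f p| ≤ |fderiv ℝ F p (1, 0) * fderiv ℝ f p (1, 0)| +
      |fderiv ℝ F p (Complex.I, 0) * fderiv ℝ f p (Complex.I, 0)| +
      |4 * ‖p.1‖ ^ 2 * ∑ i, fderiv ℝ F p (singDir i) * fderiv ℝ f p (singDir i)| := abs_add_three _ _ _
  calc _ ≤ _ := mul_le_mul_of_nonneg_left this (by positivity)
    _ ≤ _ := by rw [mul_add, mul_add]; linarith

/-- Leibniz' rule. The constant is dictated by the second-order term, `1 + 2 (2 + 4m) + 1`, the
middle part coming from `abs_energy_le`. -/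
theorem IsSymbol.mul {m : ℕ} {C : ℝ} {F G : ℂ × Sing m → ℝ} (hF : IsSymbol C F)
    (hG : IsSymbol C G) : IsSymbol ((6 + 8 * m) * (C * C)) (fun p => F p * G p) := by
  have hC := hF.nonneg
  have hCC : 0 ≤ C * C := by positivity
  have hm : (0 : ℝ) ≤ m * (C * C) := by positivity
  have hd : ∀ p v, fderiv ℝ (fun p => F p * G p) p v =
      F p * fderiv ℝ G p v + G p * fderiv ℝ F p v := by
    intro p v
    rw [fderiv_fun_mul (hF.smooth.differentiable (by simp) p)
      (hG.smooth.differentiable (by simp) p)]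
    simp
  have hfirst : ∀ (p : ℂ × Sing m) (r : ℝ) (v), 0 ≤ r → r * |fderiv ℝ F p v| ≤ C →
      r * |fderiv ℝ G p v| ≤ C →
      r * |fderiv ℝ (fun p => F p * G p) p v| ≤ (6 + 8 * m) * (C * C) := by
    intro p r v hr h1 h2
    rw [hd]
    calc _ ≤ r * (|F p * fderiv ℝ G p v| + |G p * fderiv ℝ F p v|) := by
          gcongr; exact abs_add_le _ _
      _ = |F p| * (r * |fderiv ℝ G p v|) + |G p| * (r * |fderiv ℝ F p v|) := by
          rw [abs_mul, abs_mul]; ring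
      _ ≤ C * C + C * C := add_le_add (mul_le_mul (hF.zeroth p) h2 (by positivity) hC)
          (mul_le_mul (hG.zeroth p) h1 (by positivity) hC)
      _ ≤ _ := by nlinarith
  refine ⟨hF.smooth.mul hG.smooth, fun p => ?_, fun p => ?_, fun p => ?_, fun p i => ?_,
    fun p => ?_⟩
  · rw [abs_mul]
    calc _ ≤ C * C := mul_le_mul (hF.zeroth p) (hG.zeroth p) (abs_nonneg _) hC
      _ ≤ _ := by nlinarith
  · exact hfirst p _ _ (by positivity) (hF.one p) (hG.one p)
  · exact hfirst p _ _ (by positivity) (hF.imag p) (hG.imag p)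
  · exact hfirst p _ _ (by positivity) (hF.sing p i) (hG.sing p i)
  · rw [grushin_mul hF.smooth hG.smooth]
    have he := abs_energy_le hF (hG.one p) (hG.imag p) (hG.sing p)
    have e1 : ‖p.1‖ ^ 2 * |F p * grushin G p| ≤ C * C := by
      rw [abs_mul]
      calc _ = |F p| * (‖p.1‖ ^ 2 * |grushin G p|) := by ring
        _ ≤ _ := mul_le_mul (hF.zeroth p) (hG.second p) (by positivity) hC
    have e2 : ‖p.1‖ ^ 2 * |G p * grushin F p| ≤ C * C := by
      rw [abs_mul]
      calc _ = |G p| * (‖p.1‖ ^ 2 * |grushin F p|) := by ring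
        _ ≤ _ := mul_le_mul (hG.zeroth p) (hF.second p) (by positivity) hC
    calc _ ≤ ‖p.1‖ ^ 2 * (|F p * grushin G p| + |2 * energy F G p| + |G p * grushin F p|) := by
          gcongr; exact abs_add_three _ _ _
      _ ≤ _ := by
          rw [abs_mul 2, abs_two]
          nlinarith

/-- The dilation of the cover which lifts multiplication by `c ^ 2`. -/
noncomputable def dilate {m : ℕ} (c : ℝ) : (ℂ × Sing m) →L[ℝ] (ℂ × Sing m) :=
  (c • ContinuousLinearMap.id ℝ ℂ).prodMap ((c ^ 2) • ContinuousLinearMap.id ℝ (Sing m))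

theorem dilate_apply {m : ℕ} (c : ℝ) (p : ℂ × Sing m) : dilate c p = (c • p.1, c ^ 2 • p.2) := rfl

theorem fderiv_comp_dilate {m : ℕ} {F : ℂ × Sing m → ℝ} (hF : Differentiable ℝ F) (c : ℝ)
    (p v : ℂ × Sing m) :
    fderiv ℝ (fun p => F (dilate c p)) p v = fderiv ℝ F (dilate c p) (dilate c v) := by
  have := (hF (dilate c p)).hasFDerivAt.comp p (dilate c).hasFDerivAt
  have h2 := this.fderiv
  change fderiv ℝ (fun p => F (dilate c p)) p = _ at h2
  rw [h2]; rfl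

theorem fderiv_comp_dilate_of_eq {m : ℕ} {F : ℂ × Sing m → ℝ} (hF : Differentiable ℝ F) {c k : ℝ}
    {v : ℂ × Sing m} (hv : dilate c v = k • v) (p : ℂ × Sing m) :
    fderiv ℝ (fun p => F (dilate c p)) p v = k * fderiv ℝ F (dilate c p) v := by
  rw [fderiv_comp_dilate hF, hv, map_smul, smul_eq_mul]

theorem fderiv_fderiv_comp_dilate {m : ℕ} {F : ℂ × Sing m → ℝ} (hF : ContDiff ℝ ∞ F) {c k : ℝ}
    {v : ℂ × Sing m} (hv : dilate c v = k • v) (p : ℂ × Sing m) :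
    fderiv ℝ (fun x => fderiv ℝ (fun p => F (dilate c p)) x v) p v =
      k ^ 2 * fderiv ℝ (fun x => fderiv ℝ F x v) (dilate c p) v := by
  simp only [fderiv_comp_dilate_of_eq (hF.differentiable (by simp)) hv]
  have hd := (contDiff_fderiv_dir hF v).differentiable (by simp)
  have hd2 : DifferentiableAt ℝ (fun x => fderiv ℝ F (dilate c x) v) p :=
    (hd.comp (dilate c).differentiable) p
  rw [fderiv_const_mul hd2]
  change k * fderiv ℝ (fun p => (fun x => fderiv ℝ F x v) (dilate c p)) p v = _
  rw [fderiv_comp_dilate_of_eq hd hv]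
  ring

/-- The powers of `|w|` in `IsSymbol` are those of the homogeneity under `(w, t) ↦ (c w, c² t)`,
under which the Grushin operator has degree two; hence the same constant serves at every scale. -/
theorem IsSymbol.dilate {m : ℕ} {C : ℝ} {F : ℂ × Sing m → ℝ} (hF : IsSymbol C F) {c : ℝ}
    (hc : 0 < c) : IsSymbol C (fun p => F (dilate c p)) := by
  have h1 : ∀ d : ℂ, FlatModel.dilate c (d, (0 : Sing m)) = c • (d, (0 : Sing m)) := fun d => by
    simp [dilate_apply]
  have h2 : ∀ i : Fin m, FlatModel.dilate c (singDir i) = (c ^ 2) • (singDir i) := fun i => by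
    simp [dilate_apply, singDir]
  have hn : ∀ p : ℂ × Sing m, ‖(FlatModel.dilate c p).1‖ = c * ‖p.1‖ := fun p => by
    simp [dilate_apply, abs_of_pos hc]
  have hd := hF.smooth.differentiable (by simp)
  refine ⟨hF.smooth.comp (FlatModel.dilate c).contDiff, fun p => hF.zeroth _, fun p => ?_,
    fun p => ?_, fun p i => ?_, fun p => ?_⟩
  · rw [fderiv_comp_dilate_of_eq hd (h1 1), abs_mul, abs_of_pos hc]
    have := hF.one (FlatModel.dilate c p)
    rw [hn] at this
    linarith
  · rw [fderiv_comp_dilate_of_eq hd (h1 _), abs_mul, abs_of_pos hc]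
    have := hF.imag (FlatModel.dilate c p)
    rw [hn] at this
    linarith
  · rw [fderiv_comp_dilate_of_eq hd (h2 _), abs_mul, abs_of_pos (by positivity)]
    have := hF.sing (FlatModel.dilate c p) i
    rw [hn] at this
    linarith
  · have : grushin (fun p => F (FlatModel.dilate c p)) p = c ^ 2 * grushin F (FlatModel.dilate c p) := by
      simp only [grushin, fderiv_fderiv_comp_dilate hF.smooth (h1 1),
        fderiv_fderiv_comp_dilate hF.smooth (h1 Complex.I),
        fderiv_fderiv_comp_dilate hF.smooth (h2 _), hn, ← Finset.mul_sum]
      ring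
    rw [this, abs_mul, abs_of_pos (by positivity)]
    have := hF.second (FlatModel.dilate c p)
    rw [hn] at this
    linarith

theorem continuous_grushin {m : ℕ} {F : ℂ × Sing m → ℝ} (hF : ContDiff ℝ ∞ F) :
    Continuous (grushin F) := by
  unfold grushin
  have := fun v => continuous_fderiv_dir (contDiff_fderiv_dir hF v) v
  fun_prop

theorem grushin_congr {m : ℕ} {F G : ℂ × Sing m → ℝ} {p : ℂ × Sing m}
    (h : F =ᶠ[𝓝 p] G) : grushin F p = grushin G p := by
  have h1 : ∀ v, (fun x => fderiv ℝ F x v) =ᶠ[𝓝 p] fun x => fderiv ℝ G x v := fun v =>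
    h.eventuallyEq_nhds.mono fun x hx => by simp only; rw [hx.fderiv_eq]
  simp only [grushin, (h1 _).fderiv_eq]

theorem hasCompactSupport_grushin {m : ℕ} {F : ℂ × Sing m → ℝ} (hF : HasCompactSupport F) :
    HasCompactSupport (grushin F) := by
  apply HasCompactSupport.intro hF
  intro p hp
  have h : F =ᶠ[𝓝 p] fun _ => 0 := notMem_tsupport_iff_eventuallyEq.1 hp
  rw [grushin_congr h]
  simp [grushin]

theorem exists_isSymbol_of_compact {m : ℕ} {F : ℂ × Sing m → ℝ} (hF : ContDiff ℝ ∞ F)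
    (hc : HasCompactSupport F) : ∃ C, IsSymbol C F := by
  have hb : ∀ f g : ℂ × Sing m → ℝ, Continuous g → Continuous f → HasCompactSupport f →
      ∃ C, ∀ p, |g p| * |f p| ≤ C := by
    intro f g hg hf hcf
    obtain ⟨C, hC⟩ := (hg.mul hf).bounded_above_of_compact_support hcf.mul_left
    exact ⟨C, fun p => by have := hC p; rwa [Pi.mul_apply, norm_mul] at this⟩
  obtain ⟨C0, h0⟩ := hb F (fun _ => 1) continuous_const hF.continuous hc
  obtain ⟨C1, h1⟩ := hb _ (fun p => ‖p.1‖) (by fun_prop) (continuous_fderiv_dir hF (1, 0))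
    (hasCompactSupport_fderiv_dir hc _)
  obtain ⟨C2, h2⟩ := hb _ (fun p => ‖p.1‖) (by fun_prop) (continuous_fderiv_dir hF (Complex.I, 0))
    (hasCompactSupport_fderiv_dir hc _)
  have h3' : ∀ i : Fin m, ∃ C, ∀ p : ℂ × Sing m,
      ‖p.1‖ ^ 2 * |fderiv ℝ F p (singDir i)| ≤ C := by
    intro i
    obtain ⟨C, h⟩ := hb _ (fun p => ‖p.1‖ ^ 2) (by fun_prop) (continuous_fderiv_dir hF (singDir i))
      (hasCompactSupport_fderiv_dir hc _)
    exact ⟨C, fun p => by simpa using h p⟩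
  choose C3 h3 using h3'
  obtain ⟨C4, h4⟩ := hb _ (fun p => ‖p.1‖ ^ 2) (by fun_prop) (continuous_grushin hF)
    (hasCompactSupport_grushin hc)
  have n3 : ∀ i, 0 ≤ C3 i := fun i => le_trans (by positivity) (h3 i 0)
  have n0 : 0 ≤ C0 := le_trans (by positivity) (h0 0)
  have n1 : 0 ≤ C1 := le_trans (by positivity) (h1 0)
  have n2 : 0 ≤ C2 := le_trans (by positivity) (h2 0)
  have n4 : 0 ≤ C4 := le_trans (by positivity) (h4 0)
  have ns : 0 ≤ ∑ i, C3 i := Finset.sum_nonneg fun i _ => n3 i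
  refine ⟨C0 + C1 + C2 + C4 + ∑ i, C3 i, hF, fun p => ?_, fun p => ?_, fun p => ?_, fun p i => ?_,
    fun p => ?_⟩
  · have := h0 p; simp at this; linarith
  · have := h1 p; rw [abs_norm] at this; linarith
  · have := h2 p; rw [abs_norm] at this; linarith
  · have := h3 i p
    have h5 : C3 i ≤ ∑ i, C3 i := Finset.single_le_sum (fun i _ => n3 i) (Finset.mem_univ i)
    linarith
  · have := h4 p; rw [abs_pow, abs_norm] at this; linarith

theorem fderiv_comp_fst {m : ℕ} {g : ℂ → ℝ} (hg : Differentiable ℝ g) (p v : ℂ × Sing m) :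
    fderiv ℝ (fun p : ℂ × Sing m => g p.1) p v = fderiv ℝ g p.1 v.1 := by
  have := (hg p.1).hasFDerivAt.comp p (hasFDerivAt_fst (𝕜 := ℝ) (p := p))
  have h2 := this.fderiv
  change fderiv ℝ (fun p : ℂ × Sing m => g p.1) p = _ at h2
  rw [h2]; rfl

/-- Provides the factor that cuts out a neighbourhood of the singular set. It is not compactly
supported, but it depends on `w` alone and its derivatives are compactly supported in `w`. -/
theorem exists_isSymbol_comp_fst {m : ℕ} {g : ℂ → ℝ} (hg : ContDiff ℝ ∞ g)
    (hc : HasCompactSupport g) : ∃ C, IsSymbol C fun p : ℂ × Sing m => 1 - g p.1 := by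
  have hb : ∀ f r : ℂ → ℝ, Continuous r → Continuous f → HasCompactSupport f →
      ∃ C, ∀ w, |r w| * |f w| ≤ C := by
    intro f r hr hf hcf
    obtain ⟨C, hC⟩ := (hr.mul hf).bounded_above_of_compact_support hcf.mul_left
    exact ⟨C, fun p => by have := hC p; rwa [Pi.mul_apply, norm_mul] at this⟩
  have hgd := hg.differentiable (by simp)
  have hgv : ∀ v, ContDiff ℝ ∞ fun w => fderiv ℝ g w v := fun v =>
    (hg.fderiv_right (m := ∞) (by simp)).clm_apply contDiff_const
  have hcv : ∀ v, HasCompactSupport fun w => fderiv ℝ g w v := fun v => hc.fderiv_apply ℝ v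
  have hgvv : ∀ v, Continuous fun w => fderiv ℝ (fun y => fderiv ℝ g y v) w v := fun v =>
    ((hgv v).continuous_fderiv (by simp)).clm_apply continuous_const
  have hcvv : ∀ v, HasCompactSupport fun w => fderiv ℝ (fun y => fderiv ℝ g y v) w v := fun v =>
    (hcv v).fderiv_apply ℝ v
  obtain ⟨C0, h0⟩ := hb g (fun _ => 1) continuous_const hg.continuous hc
  obtain ⟨C1, h1⟩ := hb _ (fun w => ‖w‖) (by fun_prop) (hgv 1).continuous (hcv 1)
  obtain ⟨C2, h2⟩ := hb _ (fun w => ‖w‖) (by fun_prop) (hgv Complex.I).continuous (hcv Complex.I)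
  obtain ⟨C3, h3⟩ := hb _ (fun w => ‖w‖ ^ 2) (by fun_prop) (hgvv 1) (hcvv 1)
  obtain ⟨C4, h4⟩ := hb _ (fun w => ‖w‖ ^ 2) (by fun_prop) (hgvv Complex.I) (hcvv Complex.I)
  have n0 : 0 ≤ C0 := le_trans (by positivity) (h0 0)
  have n1 : 0 ≤ C1 := le_trans (by positivity) (h1 0)
  have n2 : 0 ≤ C2 := le_trans (by positivity) (h2 0)
  have n3 : 0 ≤ C3 := le_trans (by positivity) (h3 0)
  have n4 : 0 ≤ C4 := le_trans (by positivity) (h4 0)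
  have d1 : ∀ p v : ℂ × Sing m, fderiv ℝ (fun p : ℂ × Sing m => 1 - g p.1) p v =
      -fderiv ℝ g p.1 v.1 := by
    intro p v
    rw [fderiv_const_sub, _root_.neg_apply, fderiv_comp_fst hgd]
  have d2 : ∀ p v : ℂ × Sing m,
      fderiv ℝ (fun x => fderiv ℝ (fun p : ℂ × Sing m => 1 - g p.1) x v) p v =
      -fderiv ℝ (fun y => fderiv ℝ g y v.1) p.1 v.1 := by
    intro p v
    simp only [d1]
    rw [fderiv_fun_neg, _root_.neg_apply,
      fderiv_comp_fst (g := fun y => fderiv ℝ g y v.1) ((hgv v.1).differentiable (by simp))]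
  refine ⟨1 + C0 + C1 + C2 + C3 + C4, contDiff_const.sub (hg.comp contDiff_fst), fun p => ?_,
    fun p => ?_, fun p => ?_, fun p i => ?_, fun p => ?_⟩
  · have := h0 p.1
    simp only [abs_one, one_mul] at this
    have h6 : |1 - g p.1| ≤ 1 + |g p.1| := by
      calc _ ≤ |(1 : ℝ)| + |g p.1| := abs_sub _ _
        _ = _ := by simp
    linarith
  · have := h1 p.1; rw [abs_norm] at this; rw [d1, abs_neg]; linarith
  · have := h2 p.1; rw [abs_norm] at this; rw [d1, abs_neg]; linarith
  · rw [d1]; simp only [singDir, map_zero, neg_zero, abs_zero, mul_zero]; linarith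
  · have e3 := h3 p.1
    have e4 := h4 p.1
    rw [abs_pow, abs_norm] at e3 e4
    have : grushin (fun p : ℂ × Sing m => 1 - g p.1) p =
        -(fderiv ℝ (fun y => fderiv ℝ g y 1) p.1 1 +
          fderiv ℝ (fun y => fderiv ℝ g y Complex.I) p.1 Complex.I) := by
      simp only [grushin, d2, singDir, map_zero]
      simp; ring
    rw [this, abs_neg]
    calc _ ≤ ‖p.1‖ ^ 2 * (|fderiv ℝ (fun y => fderiv ℝ g y 1) p.1 1| +
          |fderiv ℝ (fun y => fderiv ℝ g y Complex.I) p.1 Complex.I|) := by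
          gcongr; exact abs_add_le _ _
      _ ≤ _ := by linarith

/-- Dilates of two fixed functions, so that the symbol bound does not depend on `k`. Derivatives of
the cutoffs then cost only powers of `1 / |w|`, which kernels vanishing to first order at `w = 0`
can afford. -/
theorem exists_cutoff (m : ℕ) : ∃ (χ : ℕ → ℂ × Sing m → ℝ) (C : ℝ),
    (∀ k, IsSymbol C (χ k)) ∧ (∀ k, HasCompactSupport (χ k)) ∧
    (∀ k p, χ k (deck p) = χ k p) ∧ (∀ k, tsupport (χ k) ⊆ {p | p.1 ≠ 0}) ∧
    ∀ p : ℂ × Sing m, p.1 ≠ 0 → ∀ᶠ k in atTop, χ k =ᶠ[𝓝 p] fun _ => 1 := by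
  let b : ContDiffBump (0 : ℂ) := ⟨1, 2, by norm_num, by norm_num⟩
  let b' : ContDiffBump (0 : Sing m) := ⟨1, 2, by norm_num, by norm_num⟩
  let F : ℂ × Sing m → ℝ := fun p => b p.1 * b' p.2
  have hF : ContDiff ℝ ∞ F := (b.contDiff.comp contDiff_fst).mul (b'.contDiff.comp contDiff_snd)
  have hFc : HasCompactSupport F := by
    apply HasCompactSupport.intro (K := Metric.closedBall (0 : ℂ) 2 ×ˢ Metric.closedBall (0 : Sing m) 2)
    · exact (isCompact_closedBall _ _).prod (isCompact_closedBall _ _)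
    · intro p hp
      by_contra h
      apply hp
      have h1 : b p.1 ≠ 0 := left_ne_zero_of_mul h
      have h2 : b' p.2 ≠ 0 := right_ne_zero_of_mul h
      have h1' : p.1 ∈ Function.support b := h1
      have h2' : p.2 ∈ Function.support b' := h2
      rw [b.support_eq] at h1'
      rw [b'.support_eq] at h2'
      exact ⟨Metric.ball_subset_closedBall h1', Metric.ball_subset_closedBall h2'⟩
  obtain ⟨C1, h1⟩ := exists_isSymbol_of_compact hF hFc
  obtain ⟨C2, h2⟩ := exists_isSymbol_comp_fst (m := m) b.contDiff b.hasCompactSupport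
  have h1' := h1.mono (le_max_left C1 C2)
  have h2' := h2.mono (le_max_right C1 C2)
  let c : ℕ → ℝ := fun k => (k : ℝ) + 1
  have hc : ∀ k, 0 < c k := fun k => by positivity
  -- The first factor removes `|w| ≤ 1 / c k`, the second truncates at `|w| ~ c k` and `|t| ~ (c
  -- k)²`.
  let χ : ℕ → ℂ × Sing m → ℝ := fun k p =>
    (fun p => 1 - b (dilate (c k) p).1) p * (fun p => F (dilate (c k)⁻¹ p)) p
  have hsupp : ∀ k p, χ k p ≠ 0 → 1 ≤ c k * ‖p.1‖ ∧ ‖p.1‖ ≤ 2 * c k ∧ ‖p.2‖ ≤ 2 * c k ^ 2 := by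
    intro k p hp
    have e1 : 1 - b (dilate (c k) p).1 ≠ 0 := left_ne_zero_of_mul hp
    have e2 : F (dilate (c k)⁻¹ p) ≠ 0 := right_ne_zero_of_mul hp
    have e3 : (dilate (c k)⁻¹ p).1 ∈ Function.support b := left_ne_zero_of_mul e2
    have e4 : (dilate (c k)⁻¹ p).2 ∈ Function.support b' := right_ne_zero_of_mul e2
    rw [b.support_eq] at e3
    rw [b'.support_eq] at e4
    simp only [dilate_apply, mem_ball_zero_iff, norm_smul, norm_inv, Real.norm_eq_abs, norm_pow,
      abs_of_pos (hc k)] at e3 e4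
    change (c k)⁻¹ * ‖p.1‖ < 2 at e3
    change (c k)⁻¹ ^ 2 * ‖p.2‖ < 2 at e4
    have hck := hc k
    refine ⟨?_, ?_, ?_⟩
    · by_contra! h
      apply e1
      rw [b.one_of_mem_closedBall, sub_self]
      simp only [dilate_apply, mem_closedBall_zero_iff, norm_smul, Real.norm_eq_abs, abs_of_pos hck]
      exact h.le
    · rw [inv_mul_lt_iff₀ hck] at e3; linarith
    · rw [inv_pow, inv_mul_lt_iff₀ (by positivity)] at e4; linarith
  have hclosed : ∀ k, IsClosed {p : ℂ × Sing m |
      1 ≤ c k * ‖p.1‖ ∧ ‖p.1‖ ≤ 2 * c k ∧ ‖p.2‖ ≤ 2 * c k ^ 2} := by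
    intro k
    have i1 : IsClosed {p : ℂ × Sing m | 1 ≤ c k * ‖p.1‖} := isClosed_le (by fun_prop) (by fun_prop)
    have i2 : IsClosed {p : ℂ × Sing m | ‖p.1‖ ≤ 2 * c k} := isClosed_le (by fun_prop) (by fun_prop)
    have i3 : IsClosed {p : ℂ × Sing m | ‖p.2‖ ≤ 2 * c k ^ 2} :=
      isClosed_le (by fun_prop) (by fun_prop)
    exact i1.inter (i2.inter i3)
  have htsupp : ∀ k, tsupport (χ k) ⊆ {p : ℂ × Sing m |
      1 ≤ c k * ‖p.1‖ ∧ ‖p.1‖ ≤ 2 * c k ∧ ‖p.2‖ ≤ 2 * c k ^ 2} := fun k =>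
    closure_minimal (hsupp k) (hclosed k)
  refine ⟨χ, _, fun k => (h2'.dilate (hc k)).mul (h1'.dilate (inv_pos.2 (hc k))), fun k => ?_,
    fun k p => ?_, fun k p hp => ?_, fun p hp => ?_⟩
  · apply HasCompactSupport.intro (K := Metric.closedBall (0 : ℂ) (2 * c k) ×ˢ
      Metric.closedBall (0 : Sing m) (2 * c k ^ 2))
    · exact (isCompact_closedBall _ _).prod (isCompact_closedBall _ _)
    · intro p hp
      by_contra h
      apply hp
      have := hsupp k p h
      exact ⟨by simpa using this.2.1, by simpa using this.2.2⟩
  · simp [χ, F, deck, dilate_apply, b.neg]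
  · have := (htsupp k hp).1
    intro h
    rw [h] at this
    norm_num at this
  · have hn : 0 < ‖p.1‖ := norm_pos_iff.2 hp
    have l1 : ∀ᶠ k : ℕ in atTop, max (max (2 / ‖p.1‖) ‖p.1‖) ‖p.2‖ < c k := by
      have : Tendsto c atTop atTop := tendsto_atTop_add_const_right _ _ tendsto_natCast_atTop_atTop
      exact this.eventually_gt_atTop _
    filter_upwards [l1] with k hk
    simp only [max_lt_iff] at hk
    obtain ⟨⟨k1, k2⟩, k3⟩ := hk
    have hck := hc k
    have hck1 : 1 ≤ c k := by simp [c]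
    have o1 : ∀ᶠ y : ℂ × Sing m in 𝓝 p, 2 < c k * ‖y.1‖ := by
      rw [div_lt_iff₀ hn] at k1
      exact (Continuous.continuousAt (f := fun y : ℂ × Sing m => c k * ‖y.1‖)
        (by fun_prop)).eventually_const_lt k1
    have o2 : ∀ᶠ y : ℂ × Sing m in 𝓝 p, ‖y.1‖ < c k :=
      (Continuous.continuousAt (f := fun y : ℂ × Sing m => ‖y.1‖)
        (by fun_prop)).eventually_lt_const k2
    have o3 : ∀ᶠ y : ℂ × Sing m in 𝓝 p, ‖y.2‖ < c k :=
      (Continuous.continuousAt (f := fun y : ℂ × Sing m => ‖y.2‖)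
        (by fun_prop)).eventually_lt_const k3
    filter_upwards [o1, o2, o3] with y y1 y2 y3
    have b1 : b (dilate (c k) y).1 = 0 := by
      apply b.zero_of_le_dist
      simp only [dilate_apply, dist_zero_right, norm_smul, Real.norm_eq_abs, abs_of_pos hck]
      exact y1.le
    have b2 : b (dilate (c k)⁻¹ y).1 = 1 := by
      apply b.one_of_mem_closedBall
      simp only [dilate_apply, mem_closedBall_zero_iff, norm_smul, norm_inv, Real.norm_eq_abs,
        abs_of_pos hck]
      change (c k)⁻¹ * ‖y.1‖ ≤ 1
      rw [inv_mul_le_iff₀ hck]; linarith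
    have b3 : b' (dilate (c k)⁻¹ y).2 = 1 := by
      apply b'.one_of_mem_closedBall
      simp only [dilate_apply, mem_closedBall_zero_iff, norm_smul, norm_pow, norm_inv,
        Real.norm_eq_abs, abs_of_pos hck]
      change (c k)⁻¹ ^ 2 * ‖y.2‖ ≤ 1
      rw [inv_pow, inv_mul_le_iff₀ (by positivity)]; nlinarith
    simp [χ, F, b1, b2, b3]

/-! ### Decay of the kernels at infinity -/

/-- The weight `1 + |(z, t)| ^ 2` on the cover. -/
noncomputable def weight {m : ℕ} (p : ℂ × Sing m) : ℝ := 1 + ‖p.1‖ ^ 4 + ‖p.2‖ ^ 2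

theorem one_le_weight {m : ℕ} (p : ℂ × Sing m) : 1 ≤ weight p := by
  unfold weight; have : 0 ≤ ‖p.1‖ ^ 4 + ‖p.2‖ ^ 2 := by positivity
  linarith

theorem weight_pos {m : ℕ} (p : ℂ × Sing m) : 0 < weight p := one_pos.trans_le (one_le_weight p)

theorem norm_fst_sq_le_weight {m : ℕ} (p : ℂ × Sing m) : ‖p.1‖ ^ 2 ≤ weight p := by
  unfold weight; nlinarith [sq_nonneg (‖p.1‖ ^ 2 - 1), sq_nonneg ‖p.2‖]

theorem norm_fst_pow_four_le_weight {m : ℕ} (p : ℂ × Sing m) : ‖p.1‖ ^ 4 ≤ weight p := by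
  unfold weight; nlinarith [sq_nonneg ‖p.2‖]

theorem continuous_weight {m : ℕ} : Continuous (weight (m := m)) := by
  unfold weight; fun_prop

theorem integrable_weight_rpow (m : ℕ) :
    Integrable fun p : ℂ × Sing m => weight p ^ (-(2 * expo m)) := by
  have i1 : Integrable fun w : ℂ => (1 + ‖w‖) ^ (-(3 : ℝ)) :=
    integrable_one_add_norm (by rw [Complex.finrank_real_complex]; norm_num)
  have i2 : Integrable fun t : Sing m => (1 + ‖t‖) ^ (-(2 * (m : ℝ) + 1 / 2)) :=
    integrable_one_add_norm (by
      rw [finrank_euclideanSpace, Fintype.card_fin]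
      have : (0 : ℝ) ≤ m := by positivity
      linarith)
  have i3 := (i1.mul_prod i2).const_mul ((8 : ℝ) ^ (3 / 4 : ℝ) * 2 ^ ((m : ℝ) + 1 / 4))
  rw [← Measure.volume_eq_prod] at i3
  refine i3.mono' (Continuous.aestronglyMeasurable ?_) (Eventually.of_forall fun p => ?_)
  · exact continuous_weight.rpow_const fun p => Or.inl (weight_pos p).ne'
  · have hW := weight_pos p
    rw [Real.norm_eq_abs, abs_of_nonneg (by positivity)]
    -- The share `3/4` becomes a decay of order `3 > 2` in `w`, and the share `m + 1/4` one of order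
    -- `2m + 1/2 > m` in `t`, so that both factors are integrable.
    have e1 : -(2 * expo m) = -(3 / 4 : ℝ) + -((m : ℝ) + 1 / 4) := by unfold expo; ring
    rw [e1, Real.rpow_add hW]
    have h1 : (1 + ‖p.1‖) ^ 4 ≤ 8 * weight p := by
      unfold weight
      have := norm_nonneg p.1
      nlinarith [sq_nonneg (‖p.1‖ - 1), sq_nonneg (‖p.1‖ ^ 2 - 1), sq_nonneg (‖p.1‖ ^ 2 - ‖p.1‖),
        sq_nonneg ‖p.2‖]
    have h2 : (1 + ‖p.2‖) ^ 2 ≤ 2 * weight p := by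
      unfold weight
      nlinarith [sq_nonneg (‖p.2‖ - 1), pow_nonneg (norm_nonneg p.1) 4]
    have h3 : weight p ^ (-(3 / 4 : ℝ)) ≤ 8 ^ (3 / 4 : ℝ) * (1 + ‖p.1‖) ^ (-(3 : ℝ)) := by
      have : (1 + ‖p.1‖) ^ (-(3 : ℝ)) = ((1 + ‖p.1‖) ^ 4) ^ (-(3 / 4 : ℝ)) := by
        rw [← Real.rpow_natCast, ← Real.rpow_mul (by positivity)]; norm_num
      rw [this]
      have h4 : (8 * weight p) ^ (-(3 / 4 : ℝ)) ≤ ((1 + ‖p.1‖) ^ 4) ^ (-(3 / 4 : ℝ)) :=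
        Real.rpow_le_rpow_of_nonpos (by positivity) h1 (by norm_num)
      rw [Real.mul_rpow (by norm_num) hW.le, Real.rpow_neg (by norm_num)] at h4
      rwa [inv_mul_le_iff₀ (by positivity)] at h4
    have h5 : weight p ^ (-((m : ℝ) + 1 / 4)) ≤
        2 ^ ((m : ℝ) + 1 / 4) * (1 + ‖p.2‖) ^ (-(2 * (m : ℝ) + 1 / 2)) := by
      have : (1 + ‖p.2‖) ^ (-(2 * (m : ℝ) + 1 / 2)) =
          ((1 + ‖p.2‖) ^ 2) ^ (-((m : ℝ) + 1 / 4)) := by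
        rw [← Real.rpow_natCast, ← Real.rpow_mul (by positivity)]; congr 1; push_cast; ring
      rw [this]
      have h4 : (2 * weight p) ^ (-((m : ℝ) + 1 / 4)) ≤ ((1 + ‖p.2‖) ^ 2) ^ (-((m : ℝ) + 1 / 4)) :=
        Real.rpow_le_rpow_of_nonpos (by positivity) h2 (neg_nonpos.2 (by positivity))
      rw [Real.mul_rpow (by norm_num) hW.le, Real.rpow_neg (by norm_num)] at h4
      rwa [inv_mul_le_iff₀ (by positivity)] at h4
    calc _ ≤ (8 ^ (3 / 4 : ℝ) * (1 + ‖p.1‖) ^ (-(3 : ℝ))) *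
          (2 ^ ((m : ℝ) + 1 / 4) * (1 + ‖p.2‖) ^ (-(2 * (m : ℝ) + 1 / 2))) := by gcongr
      _ = _ := by ring

/-- The function on the cover which dominates the kernels multiplied by `|z|`. -/
noncomputable def majorant {m : ℕ} (p : ℂ × Sing m) : ℝ := weight p ^ (-expo m) / ‖p.1‖

theorem measurable_majorant {m : ℕ} : Measurable (majorant (m := m)) := by
  unfold majorant
  exact (continuous_weight.measurable.pow_const _).div (by fun_prop)

/-- On the cover the Jacobian `4|w|²` cancels the denominator of the squared majorant and leaves a
power of the weight. -/
theorem memLp_majorant_root {m : ℕ} : MemLp (fun p : ℂ × Sing m => majorant (root p)) 2 := by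
  have hm : AEStronglyMeasurable (fun p : ℂ × Sing m => majorant (root p)) volume :=
    (measurable_majorant.comp measurable_root).aestronglyMeasurable
  rw [memLp_two_iff_integrable_sq hm,
    integrable_root_iff (F := fun p => majorant p ^ 2)
      (measurable_majorant.pow_const 2).aestronglyMeasurable]
  · refine ((integrable_weight_rpow m).const_mul 4).congr ?_
    filter_upwards [ae_fst_ne_zero] with p hp
    have hW := weight_pos p
    have : weight p ^ (-(2 * expo m)) = (weight p ^ (-expo m)) ^ 2 := by
      rw [← Real.rpow_natCast, ← Real.rpow_mul hW.le]; congr 1; push_cast; ring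
    rw [this, majorant]
    field_simp
  · intro p
    simp [majorant, weight, deck]

/-- Triangle inequalities on the base. The constants do not involve `e`, so far from the origin
`quad` dominates `weight` uniformly in `e`. -/
theorem weight_le_quad_add {m : ℕ} {K : ℝ} {p' : ℂ × Sing m} (hp' : ‖p'‖ ≤ K) (e x : ℝ)
    (p : ℂ × Sing m) :
    weight p ≤ 2 * (quad e x p' p - e) + (1 + 2 * K ^ 4 + 2 * K ^ 2) := by
  have h1 : ‖p'.1‖ ≤ K := (norm_fst_le p').trans hp'
  have h2 : ‖p'.2‖ ≤ K := (norm_snd_le p').trans hp'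
  have h3 : ‖p.1‖ ^ 4 ≤ 2 * ‖p.1 ^ 2 - p'.1 ^ 2‖ ^ 2 + 2 * K ^ 4 := by
    have e1 : ‖p.1‖ ^ 2 ≤ ‖p.1 ^ 2 - p'.1 ^ 2‖ + ‖p'.1‖ ^ 2 := by
      have := norm_add_le (p.1 ^ 2 - p'.1 ^ 2) (p'.1 ^ 2)
      simpa using this
    have e2 : ‖p'.1‖ ^ 2 ≤ K ^ 2 := by gcongr
    have e3 : ‖p.1‖ ^ 2 ≤ ‖p.1 ^ 2 - p'.1 ^ 2‖ + K ^ 2 := e1.trans (by linarith)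
    have e4 : (‖p.1‖ ^ 2) ^ 2 ≤ (‖p.1 ^ 2 - p'.1 ^ 2‖ + K ^ 2) ^ 2 := by gcongr
    nlinarith [sq_nonneg (‖p.1 ^ 2 - p'.1 ^ 2‖ - K ^ 2)]
  have h4 : ‖p.2‖ ^ 2 ≤ 2 * ‖p.2 - p'.2‖ ^ 2 + 2 * K ^ 2 := by
    have e1 : ‖p.2‖ ≤ ‖p.2 - p'.2‖ + K := by
      have := norm_add_le (p.2 - p'.2) p'.2
      rw [sub_add_cancel] at this
      linarith
    have e4 : ‖p.2‖ ^ 2 ≤ (‖p.2 - p'.2‖ + K) ^ 2 := by gcongr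
    nlinarith [sq_nonneg (‖p.2 - p'.2‖ - K)]
  have h5 := quad_eq e x p' p
  have h8 : 0 ≤ 4 * x ^ 2 * inner ℝ p'.1 p.1 ^ 2 := by positivity
  unfold weight
  linarith

/-- The additive constant is absorbed by `quad ≥ e`; the resulting constant degenerates as `e → 0`,
so this serves only for fixed `e`. -/
theorem exists_weight_le_quad {m : ℕ} {e : ℝ} (he : 0 < e) (K : ℝ) :
    ∃ c, 0 < c ∧ ∀ (p' : ℂ × Sing m), ‖p'‖ ≤ K → ∀ x p, c * weight p ≤ quad e x p' p := by
  set A := 1 + 2 * K ^ 4 + 2 * K ^ 2 with hA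
  have hApos : 0 < A := by positivity
  refine ⟨(2 + A / e)⁻¹, by positivity, fun p' hp' x p => ?_⟩
  rw [inv_mul_le_iff₀ (by positivity)]
  have h7 : A ≤ A / e * quad e x p' p := by
    rw [div_mul_eq_mul_div, le_div_iff₀ he]
    exact mul_le_mul_of_nonneg_left (le_quad e x p' p) hApos.le
  have h8 := weight_le_quad_add hp' e x p
  rw [add_mul]
  linarith

theorem pow_le_one_add_pow_five {K : ℝ} (hK : 0 ≤ K) {j : ℕ} (hj : j ≤ 5) :
    K ^ j ≤ (1 + K) ^ 5 :=
  (pow_le_pow_left₀ hK (by linarith) j).trans (pow_le_pow_right₀ (by linarith) hj)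

theorem abs_one_sub_three_mul_sq_le {x : ℝ} (hx : x ∈ Set.Icc (0 : ℝ) 1) :
    0 ≤ 1 - x ^ 2 ∧ 1 - x ^ 2 ≤ 1 ∧ |1 - x ^ 2| ≤ 1 ∧ |1 - 3 * x ^ 2| ≤ 2 := by
  have h1 : x ^ 2 ≤ 1 := pow_le_one₀ hx.1 hx.2
  have h2 : 0 ≤ x ^ 2 := sq_nonneg x
  refine ⟨by linarith, by linarith, ?_, ?_⟩ <;> rw [abs_le] <;> constructor <;> linarith

set_option maxHeartbeats 1000000 in
/-- Bounds for the kernel and its derivatives which are uniform in `x` and in `p'` in bounded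
sets. -/
theorem exists_kern_bounds {m : ℕ} {e : ℝ} (he : 0 < e) (K : ℝ) :
    ∃ C, 0 ≤ C ∧ ∀ (p' : ℂ × Sing m), ‖p'‖ ≤ K → ∀ x ∈ Set.Icc (0 : ℝ) 1, ∀ p : ℂ × Sing m,
      |kern e x p' p| ≤ C * (‖p.1‖ * weight p ^ (-expo m)) ∧
      |fderiv ℝ (kern e x p') p (1, 0)| ≤ C * weight p ^ (-expo m) ∧
      |fderiv ℝ (kern e x p') p (Complex.I, 0)| ≤ C * weight p ^ (-expo m) ∧
      (∀ i, ‖p.1‖ * |fderiv ℝ (kern e x p') p (singDir i)| ≤ C * weight p ^ (-expo m)) ∧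
      ‖p.1‖ * |grushin (kern e x p') p| ≤ C * weight p ^ (-expo m) ∧
      ‖p.1‖ ^ 3 * |inner ℝ p'.1 p.1| * quad e x p' p ^ (-expo m - 2) ≤
        C * weight p ^ (-expo m) := by
  rcases lt_or_ge K 0 with hK | hK
  · exact ⟨1, zero_le_one, fun p' hp' => absurd ((norm_nonneg p').trans hp') (not_le.2 hK)⟩
  obtain ⟨c, hc, hcq⟩ := exists_weight_le_quad (m := m) he K
  have ha := expo_pos m
  set a := expo m with hadef
  set A := c ^ (-a) + c ^ (-a - 1) + c ^ (-a - 2) with hA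
  have hA0 : 0 < c ^ (-a) := by positivity
  have hA1 : 0 < c ^ (-a - 1) := by positivity
  have hA2 : 0 < c ^ (-a - 2) := by positivity
  have hApos : 0 < A := by positivity
  set M := (1 + a) ^ 2 * A * (200 * (1 + K) ^ 5) with hM
  -- One constant `M` is made large enough for every coefficient below: `A` collects the powers of
  -- `c`, `(1 + a)²` the coefficients in `a`, and `200 (1 + K)^5` those in `K`.
  have hbase : ∀ B : ℝ, 0 ≤ B → B ≤ (1 + a) ^ 2 * (200 * (1 + K) ^ 5) →
      B * c ^ (-a) ≤ M ∧ B * c ^ (-a - 1) ≤ M ∧ B * c ^ (-a - 2) ≤ M := by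
    intro B hB0 hB
    have : B * A ≤ M := (mul_le_mul_of_nonneg_right hB hApos.le).trans (le_of_eq (by rw [hM]; ring))
    have l0 : c ^ (-a) ≤ A := by linarith
    have l1 : c ^ (-a - 1) ≤ A := by linarith
    have l2 : c ^ (-a - 2) ≤ A := by linarith
    exact ⟨(mul_le_mul_of_nonneg_left l0 hB0).trans this,
      (mul_le_mul_of_nonneg_left l1 hB0).trans this, (mul_le_mul_of_nonneg_left l2 hB0).trans this⟩
  have hM0 : 0 ≤ M := by positivity
  refine ⟨4 * M, by positivity, fun p' hp' x hx p => ?_⟩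
  have h1 : ‖p'.1‖ ≤ K := (norm_fst_le p').trans hp'
  have h2 : ‖p'.2‖ ≤ K := (norm_snd_le p').trans hp'
  have hW := weight_pos p
  have hW1 := one_le_weight p
  have hQ := quad_pos he x p' p
  have hle := hcq p' hp' x p
  set W := weight p with hWdef
  set Q := quad e x p' p with hQdef
  set r := ‖p.1‖ with hr
  have hr0 : 0 ≤ r := norm_nonneg _
  have hr2 : r ^ 2 ≤ W := norm_fst_sq_le_weight p
  have hr4 : r ^ 4 ≤ W := norm_fst_pow_four_le_weight p
  have hcW : 0 < c * W := by positivity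
  have hp0 : Q ^ (-a) ≤ c ^ (-a) * W ^ (-a) := by
    rw [← Real.mul_rpow hc.le hW.le]
    exact Real.rpow_le_rpow_of_nonpos hcW hle (by linarith)
  have hp1 : Q ^ (-a - 1) ≤ c ^ (-a - 1) * W ^ (-a - 1) := by
    rw [← Real.mul_rpow hc.le hW.le]
    exact Real.rpow_le_rpow_of_nonpos hcW hle (by linarith)
  have hp2 : Q ^ (-a - 2) ≤ c ^ (-a - 2) * W ^ (-a - 2) := by
    rw [← Real.mul_rpow hc.le hW.le]
    exact Real.rpow_le_rpow_of_nonpos hcW hle (by linarith)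
  have w1 : W * W ^ (-a - 1) = W ^ (-a) := by
    have : -a = 1 + (-a - 1) := by ring
    conv_rhs => rw [this, Real.rpow_add hW, Real.rpow_one]
  have w2 : W * W ^ (-a - 2) ≤ W ^ (-a) := by
    have : W ^ (-a) = W ^ (2 : ℝ) * W ^ (-a - 2) := by
      rw [← Real.rpow_add hW]; congr 1; ring
    rw [this]
    gcongr
    rw [Real.rpow_two]; nlinarith
  have wpos : 0 < W ^ (-a) := by positivity
  -- The common scheme: a factor of size `1`, `W` or `W` against `Q` to the power `-a`, `-a - 1` or
  -- `-a - 2` is at most a constant times `W ^ (-a)`. In the last case a power of `W ≥ 1` is given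
  -- away.
  have t0 : ∀ X B : ℝ, 0 ≤ B → |X| ≤ B → B ≤ (1 + a) ^ 2 * (200 * (1 + K) ^ 5) →
      |X| * Q ^ (-a) ≤ M * W ^ (-a) := by
    intro X B hB h hB'
    calc _ ≤ B * (c ^ (-a) * W ^ (-a)) := by gcongr
      _ = (B * c ^ (-a)) * W ^ (-a) := by ring
      _ ≤ _ := by gcongr; exact (hbase B hB hB').1
  have t1 : ∀ X B : ℝ, 0 ≤ B → |X| ≤ B * W → B ≤ (1 + a) ^ 2 * (200 * (1 + K) ^ 5) →
      |X| * Q ^ (-a - 1) ≤ M * W ^ (-a) := by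
    intro X B hB h hB'
    calc _ ≤ (B * W) * (c ^ (-a - 1) * W ^ (-a - 1)) := by gcongr
      _ = (B * c ^ (-a - 1)) * (W * W ^ (-a - 1)) := by ring
      _ ≤ _ := by rw [w1]; gcongr; exact (hbase B hB hB').2.1
  have t2 : ∀ X B : ℝ, 0 ≤ B → |X| ≤ B * W → B ≤ (1 + a) ^ 2 * (200 * (1 + K) ^ 5) →
      |X| * Q ^ (-a - 2) ≤ M * W ^ (-a) := by
    intro X B hB h hB'
    calc _ ≤ (B * W) * (c ^ (-a - 2) * W ^ (-a - 2)) := by gcongr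
      _ = (B * c ^ (-a - 2)) * (W * W ^ (-a - 2)) := by ring
      _ ≤ (B * c ^ (-a - 2)) * W ^ (-a) := by gcongr
      _ ≤ _ := by gcongr; exact (hbase B hB hB').2.2
  have hq : |inner ℝ p'.1 p.1| ≤ K * r := (abs_real_inner_le_norm _ _).trans (by gcongr)
  obtain ⟨hx2, hx2', hxx, hx3⟩ := abs_one_sub_three_mul_sq_le hx
  have k1 : K ≤ (1 + K) ^ 5 := by simpa using pow_le_one_add_pow_five hK (j := 1) (by norm_num)
  have k2 : K ^ 2 ≤ (1 + K) ^ 5 := pow_le_one_add_pow_five hK (by norm_num)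
  have k3 : K ^ 3 ≤ (1 + K) ^ 5 := pow_le_one_add_pow_five hK (by norm_num)
  have k5 : K ^ 5 ≤ (1 + K) ^ 5 := pow_le_one_add_pow_five hK le_rfl
  have hK5 : (1 : ℝ) ≤ (1 + K) ^ 5 := one_le_pow₀ (by linarith)
  have ha2 : (1 : ℝ) ≤ (1 + a) ^ 2 := one_le_pow₀ (by linarith)
  have haa : a ≤ (1 + a) ^ 2 := by nlinarith
  have haa2 : a * (a + 1) ≤ (1 + a) ^ 2 := by nlinarith
  have haK : ∀ u v : ℝ, 0 ≤ u → u ≤ (1 + a) ^ 2 → 0 ≤ v → v ≤ 200 * (1 + K) ^ 5 →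
      u * v ≤ (1 + a) ^ 2 * (200 * (1 + K) ^ 5) := fun u v hu hu' hv hv' =>
    mul_le_mul hu' hv' hv (by positivity)
  have hKM : K ≤ (1 + a) ^ 2 * (200 * (1 + K) ^ 5) := by
    have := haK 1 K zero_le_one ha2 hK (by linarith only [k1, hK5])
    rwa [one_mul] at this
  have hdQ : ∀ d : ℂ, ‖d‖ = 1 → |fderiv ℝ (quad e x p') p (d, 0)| ≤ 4 * r ^ 3 + 12 * K ^ 2 * r := by
    intro d hd
    rw [fderiv_quad]
    simp only [inner_zero_left, mul_zero, add_zero]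
    have i1 : |inner ℝ d p.1| ≤ r := (abs_real_inner_le_norm _ _).trans (by rw [hd, one_mul])
    have i2 : |inner ℝ p'.1 d| ≤ K := (abs_real_inner_le_norm _ _).trans (by rw [hd, mul_one]; exact h1)
    have j1 : |4 * (r ^ 2 + ‖p'.1‖ ^ 2) * inner ℝ d p.1| ≤ 4 * (r ^ 2 + K ^ 2) * r := by
      rw [abs_mul, abs_of_nonneg (by positivity)]
      gcongr
    have j2 : |8 * (1 - x ^ 2) * inner ℝ p'.1 d * inner ℝ p'.1 p.1| ≤ 8 * 1 * K * (K * r) := by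
      rw [abs_mul, abs_mul, abs_mul, abs_of_pos (by norm_num : (0 : ℝ) < 8)]
      gcongr
    calc _ ≤ _ := abs_sub _ _
      _ ≤ 4 * (r ^ 2 + K ^ 2) * r + 8 * 1 * K * (K * r) := add_le_add j1 j2
      _ = _ := by ring
  have hder : ∀ d : ℂ, ‖d‖ = 1 → |fderiv ℝ (kern e x p') p (d, 0)| ≤ 4 * M * W ^ (-a) := by
    intro d hd
    rw [fderiv_kern he]
    have i2 : |inner ℝ p'.1 d| ≤ K := (abs_real_inner_le_norm _ _).trans (by rw [hd, mul_one]; exact h1)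
    have j1 : |inner ℝ p'.1 d * Q ^ (-a)| ≤ M * W ^ (-a) := by
      rw [abs_mul, abs_of_pos (by positivity : 0 < Q ^ (-a))]
      refine t0 _ K hK i2 ?_
      exact hKM
    have j2 : |a * (inner ℝ p'.1 p.1 * fderiv ℝ (quad e x p') p (d, 0)) * Q ^ (-a - 1)| ≤
        M * W ^ (-a) := by
      rw [abs_mul, abs_of_pos (by positivity : 0 < Q ^ (-a - 1))]
      refine t1 _ (a * (4 * K + 12 * K ^ 3)) (by positivity) ?_ ?_
      · rw [abs_mul, abs_of_pos ha, abs_mul]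
        calc _ ≤ a * ((K * r) * (4 * r ^ 3 + 12 * K ^ 2 * r)) := by
              gcongr; exact hdQ d hd
          _ = a * (4 * K * r ^ 4 + 12 * K ^ 3 * r ^ 2) := by ring
          _ ≤ a * (4 * K * W + 12 * K ^ 3 * W) := by gcongr
          _ = _ := by ring
      · refine haK _ _ ha.le haa (by positivity) ?_
        linarith only [k1, k2, k3, k5, hK5]
    calc _ ≤ _ := abs_sub _ _
      _ ≤ M * W ^ (-a) + M * W ^ (-a) := add_le_add j1 j2
      _ ≤ _ := by linarith only [mul_nonneg hM0 wpos.le]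
  have hMw : 0 ≤ M * W ^ (-a) := by positivity
  refine ⟨?_, hder 1 (by simp), hder Complex.I (by simp), fun i => ?_, ?_, ?_⟩
  · rw [kern, abs_mul, abs_of_pos (by positivity : 0 < Q ^ (-a))]
    have := t0 K K hK (by rw [abs_of_nonneg hK]) (by
      exact hKM)
    rw [abs_of_nonneg hK] at this
    calc _ ≤ (K * r) * Q ^ (-a) := by gcongr
      _ = r * (K * Q ^ (-a)) := by ring
      _ ≤ r * (M * W ^ (-a)) := by gcongr
      _ ≤ 4 * (r * (M * W ^ (-a))) := by linarith only [mul_nonneg hr0 hMw]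
      _ = _ := by ring
  · rw [fderiv_kern he, fderiv_quad]
    have hs : (singDir i : ℂ × Sing m).1 = 0 := by simp [singDir]
    simp only [hs, inner_zero_right, inner_zero_left, mul_zero, zero_mul, sub_zero, zero_add, zero_sub,
      abs_neg]
    have hs2 : |inner ℝ (singDir i : ℂ × Sing m).2 (p.2 - p'.2)| ≤ ‖p.2‖ + K := by
      refine (abs_real_inner_le_norm _ _).trans ?_
      have : ‖(singDir i : ℂ × Sing m).2‖ = 1 := by simp [singDir]
      rw [this, one_mul]
      exact (norm_sub_le _ _).trans (by linarith)
    have := t1 (r * (a * (inner ℝ p'.1 p.1 * (2 * inner ℝ (singDir i : ℂ × Sing m).2 (p.2 - p'.2)))))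
      (a * (2 * K + 2 * K ^ 2)) (by positivity) (by
        rw [abs_mul, abs_mul, abs_mul, abs_mul, abs_of_pos ha, abs_of_nonneg hr0, abs_two]
        have hrt : r ^ 2 * ‖p.2‖ ≤ W := by
          rw [hWdef, weight, ← hr]; nlinarith [sq_nonneg (r ^ 2 - ‖p.2‖)]
        calc _ ≤ r * (a * ((K * r) * (2 * (‖p.2‖ + K)))) := by gcongr
          _ = a * (2 * K * (r ^ 2 * ‖p.2‖) + 2 * K ^ 2 * r ^ 2) := by ring
          _ ≤ a * (2 * K * W + 2 * K ^ 2 * W) := by gcongr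
          _ = _ := by ring) (by
        refine haK _ _ ha.le haa (by positivity) ?_
        linarith only [k1, k2, k3, k5, hK5])
    calc _ = |r * (a * (inner ℝ p'.1 p.1 * (2 * inner ℝ (singDir i : ℂ × Sing m).2 (p.2 - p'.2))))| *
          Q ^ (-a - 1) := by
          rw [abs_mul, abs_of_pos (by positivity : 0 < Q ^ (-a - 1)), abs_mul r, abs_of_nonneg hr0]
          ring
      _ ≤ _ := this
      _ ≤ _ := by linarith
  · rw [grushin_kern he]
    have j1 := t1 (r * (8 * a * ‖p'.1‖ ^ 2 * (1 - 3 * x ^ 2) * inner ℝ p'.1 p.1)) (a * (16 * K ^ 3))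
      (by positivity) (by
        rw [abs_mul, abs_mul, abs_mul, abs_of_nonneg hr0,
          abs_of_nonneg (by positivity : (0 : ℝ) ≤ 8 * a * ‖p'.1‖ ^ 2)]
        calc _ ≤ r * (8 * a * K ^ 2 * 2 * (K * r)) := by gcongr
          _ = a * (16 * K ^ 3) * r ^ 2 := by ring
          _ ≤ _ := by gcongr) (by
        refine haK _ _ ha.le haa (by positivity) ?_
        linarith only [k1, k2, k3, k5, hK5])
    have j2 := t2 (r * (64 * a * (a + 1) * x ^ 2 * (1 - x ^ 2) * inner ℝ p'.1 p.1 ^ 3 * ‖p'.1‖ ^ 2))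
      ((a * (a + 1)) * (64 * K ^ 5)) (by positivity) (by
        have hx1 : x ^ 2 ≤ 1 := by linarith
        rw [abs_mul, abs_mul, abs_mul, abs_mul, abs_of_nonneg hr0, abs_pow, abs_pow, abs_norm,
          abs_of_nonneg (by positivity : (0 : ℝ) ≤ 64 * a * (a + 1) * x ^ 2)]
        calc _ ≤ r * (64 * a * (a + 1) * 1 * 1 * (K * r) ^ 3 * K ^ 2) := by gcongr
          _ = (a * (a + 1)) * (64 * K ^ 5) * r ^ 4 := by ring
          _ ≤ _ := by gcongr) (by
        refine haK _ _ (by positivity) haa2 (by positivity) ?_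
        linarith only [k1, k2, k3, k5, hK5])
    have j3 : |r * (16 * a * (a + 1) * r ^ 2 * e * inner ℝ p'.1 p.1)| * Q ^ (-a - 2) ≤
        M * W ^ (-a) := by
      -- Since `e ≤ Q`, the factor `e` absorbs one negative power of `Q`.
      have heQ : e * Q ^ (-a - 2) ≤ Q ^ (-a - 1) := by
        have : Q ^ (-a - 1) = Q * Q ^ (-a - 2) := by
          have h : -a - 1 = 1 + (-a - 2) := by ring
          rw [h, Real.rpow_add hQ, Real.rpow_one]
        rw [this]
        gcongr
        exact le_quad e x p' p
      have := t1 (r * (16 * a * (a + 1) * r ^ 2 * inner ℝ p'.1 p.1)) ((a * (a + 1)) * (16 * K))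
        (by positivity) (by
          rw [abs_mul, abs_mul, abs_of_nonneg hr0,
            abs_of_nonneg (by positivity : (0 : ℝ) ≤ 16 * a * (a + 1) * r ^ 2)]
          calc _ ≤ r * (16 * a * (a + 1) * r ^ 2 * (K * r)) := by gcongr
            _ = (a * (a + 1)) * (16 * K) * r ^ 4 := by ring
            _ ≤ _ := by gcongr) (by
          refine haK _ _ (by positivity) haa2 (by positivity) ?_
          linarith only [k1, k2, k3, k5, hK5])
      calc _ = |r * (16 * a * (a + 1) * r ^ 2 * inner ℝ p'.1 p.1)| * (e * Q ^ (-a - 2)) := by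
            have : r * (16 * a * (a + 1) * r ^ 2 * e * inner ℝ p'.1 p.1) =
              (r * (16 * a * (a + 1) * r ^ 2 * inner ℝ p'.1 p.1)) * e := by ring
            rw [this, abs_mul, abs_of_pos he]; ring
        _ ≤ |r * (16 * a * (a + 1) * r ^ 2 * inner ℝ p'.1 p.1)| * Q ^ (-a - 1) := by gcongr
        _ ≤ _ := this
    have q1 : 0 < Q ^ (-a - 1) := by positivity
    have q2 : 0 < Q ^ (-a - 2) := by positivity
    have habs : ∀ u v w : ℝ, |u - v - w| ≤ |u| + |v| + |w| := fun u v w =>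
      (abs_sub _ _).trans (add_le_add (abs_sub _ _) le_rfl)
    calc _ ≤ r * (|8 * a * ‖p'.1‖ ^ 2 * (1 - 3 * x ^ 2) * inner ℝ p'.1 p.1 * Q ^ (-a - 1)| +
          |64 * a * (a + 1) * x ^ 2 * (1 - x ^ 2) * inner ℝ p'.1 p.1 ^ 3 * ‖p'.1‖ ^ 2 *
            Q ^ (-a - 2)| + |16 * a * (a + 1) * r ^ 2 * e * inner ℝ p'.1 p.1 * Q ^ (-a - 2)|) :=
          mul_le_mul_of_nonneg_left (habs _ _ _) hr0
      _ ≤ M * W ^ (-a) + M * W ^ (-a) + M * W ^ (-a) := by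
          rw [abs_mul _ (Q ^ (-a - 1)), abs_mul _ (Q ^ (-a - 2)), abs_mul _ (Q ^ (-a - 2)),
            abs_of_pos q1, abs_of_pos q2, mul_add, mul_add]
          rw [abs_mul r, abs_of_nonneg hr0] at j1 j2 j3
          refine add_le_add (add_le_add ?_ ?_) ?_
          · rw [← mul_assoc]; exact j1
          · rw [← mul_assoc]; exact j2
          · rw [← mul_assoc]; exact j3
      _ ≤ _ := by linarith
  · have := t2 (r ^ 3 * inner ℝ p'.1 p.1) K hK (by
      rw [abs_mul, abs_of_nonneg (by positivity)]
      calc _ ≤ r ^ 3 * (K * r) := by gcongr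
        _ = K * r ^ 4 := by ring
        _ ≤ _ := by gcongr) (by
      exact hKM)
    rw [abs_mul, abs_of_nonneg (by positivity : 0 ≤ r ^ 3)] at this
    linarith

/-! ### Energy limits tested against the kernel -/

/-- `V` is a limit of test sections in the energy space, in terms of the principal branch. -/
structure IsEnergyLimit {m : ℕ} (φ : ℕ → ℂ × Sing m → ℝ) (V : ℂ × Sing m → ℝ) : Prop where
  test : ∀ j, IsTestSection (φ j)
  cauchy : Tendsto (fun jk : ℕ × ℕ => dirichletForm (φ jk.1 - φ jk.2) (φ jk.1 - φ jk.2))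
    atTop (𝓝 0)
  measurable : AEStronglyMeasurable V volume
  locL2 : ∀ K : Set (ℂ × Sing m), IsCompact K →
    Tendsto (fun j => ∫⁻ p in K, ‖branch (φ j) p - V p‖ₑ ^ 2) atTop (𝓝 0)

theorem dirichletForm_self_le {m : ℕ} {φ ψ : ℂ × Sing m → ℝ} (hφ : IsTestSection φ)
    (hψ : IsTestSection ψ) :
    dirichletForm φ φ ≤ 2 * dirichletForm (φ - ψ) (φ - ψ) + 2 * dirichletForm ψ ψ := by
  have h := dirichletForm_self_nonneg (φ := (φ - ψ) - ψ)
    ((testSections m).sub_mem ((testSections m).sub_mem hφ hψ) hψ)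
  have e : ∀ x y : testSections m, dirichletBilin m ((x - y) - y) ((x - y) - y) +
      dirichletBilin m x x = 2 * dirichletBilin m (x - y) (x - y) + 2 * dirichletBilin m y y := by
    intro x y
    simp only [map_sub, LinearMap.sub_apply]
    ring
  have e1 := e ⟨φ, hφ⟩ ⟨ψ, hψ⟩
  change dirichletForm ((φ - ψ) - ψ) ((φ - ψ) - ψ) + dirichletForm φ φ =
    2 * dirichletForm (φ - ψ) (φ - ψ) + 2 * dirichletForm ψ ψ at e1
  linarith

theorem IsEnergyLimit.exists_bound {m : ℕ} {φ : ℕ → ℂ × Sing m → ℝ} {V : ℂ × Sing m → ℝ}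
    (h : IsEnergyLimit φ V) : ∃ S : ℝ, ∀ᶠ j in atTop, dirichletForm (φ j) (φ j) ≤ S := by
  have h1 := h.cauchy.eventually_lt_const (u := 1) one_pos
  rw [eventually_atTop] at h1
  obtain ⟨N, hN⟩ := h1
  refine ⟨2 + 2 * dirichletForm (φ N.2) (φ N.2), ?_⟩
  filter_upwards [eventually_ge_atTop N.1] with j hj
  have h2 := hN (j, N.2) ⟨hj, le_rfl⟩
  have h3 := dirichletForm_self_le (h.test j) (h.test N.2)
  linarith

/-- Hardy's inequality for the `φ j`, whose energies are eventually bounded, passes to the limit on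
compact sets away from the singular set; these exhaust the space up to a null set. -/
theorem IsEnergyLimit.memLp {m : ℕ} {φ : ℕ → ℂ × Sing m → ℝ} {V : ℂ × Sing m → ℝ}
    (h : IsEnergyLimit φ V) : MemLp (fun p => V p / ‖p.1‖) 2 := by
  obtain ⟨S, hS⟩ := h.exists_bound
  have hmeas : AEStronglyMeasurable (fun p => V p / ‖p.1‖) volume :=
    h.measurable.div₀ (Continuous.aestronglyMeasurable (by fun_prop))
  apply memLp_two_of_lintegral hmeas
  -- On `K k` the factor `1 / |z|` is at most `k + 1`, so convergence in `L²(K k)` survives division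
  -- by `|z|`.
  let K : ℕ → Set (ℂ × Sing m) := fun k => {p | 1 ≤ ((k : ℝ) + 1) * ‖p.1‖ ∧ ‖p‖ ≤ (k : ℝ) + 1}
  have hKc : ∀ k, IsCompact (K k) := by
    intro k
    have i1 : IsClosed {p : ℂ × Sing m | 1 ≤ ((k : ℝ) + 1) * ‖p.1‖} :=
      isClosed_le (by fun_prop) (by fun_prop)
    have i2 : K k = {p : ℂ × Sing m | 1 ≤ ((k : ℝ) + 1) * ‖p.1‖} ∩
        Metric.closedBall 0 ((k : ℝ) + 1) := by
      ext p; simp [K]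
    rw [i2]
    exact (isCompact_closedBall _ _).inter_left i1
  have hKm : Monotone K := by
    intro k l hkl p hp
    have hkl' : (k : ℝ) ≤ l := by exact_mod_cast hkl
    refine ⟨hp.1.trans ?_, hp.2.trans (by linarith)⟩
    gcongr
  have hKb : ∀ k, ∫⁻ p in K k, ‖V p / ‖p.1‖‖ₑ ^ 2 ≤ 2 * ENNReal.ofReal (Real.pi ^ 2 * S) := by
    intro k
    have hlim : Tendsto (fun j => 2 * ENNReal.ofReal (Real.pi ^ 2 * S) +
        2 * (ENNReal.ofReal ((k : ℝ) + 1) ^ 2 *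
          ∫⁻ p in K k, ‖branch (φ j) p - V p‖ₑ ^ 2)) atTop
        (𝓝 (2 * ENNReal.ofReal (Real.pi ^ 2 * S))) := by
      have h1 := ENNReal.Tendsto.const_mul (a := ENNReal.ofReal ((k : ℝ) + 1) ^ 2)
        (h.locL2 (K k) (hKc k)) (Or.inr (by simp))
      have h2 := ENNReal.Tendsto.const_mul (a := 2) h1 (Or.inr (by simp))
      have h3 := h2.const_add (2 * ENNReal.ofReal (Real.pi ^ 2 * S))
      simpa using h3
    refine ge_of_tendsto hlim ?_
    filter_upwards [hS] with j hj
    have hb : ∫⁻ p in K k, ‖branch (φ j) p / ‖p.1‖‖ₑ ^ 2 ≤ ENNReal.ofReal (Real.pi ^ 2 * S) := by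
      refine (setLIntegral_le_lintegral _ _).trans ((hardy (h.test j)).trans ?_)
      apply ENNReal.ofReal_le_ofReal
      gcongr
    have hm1 : AEMeasurable (fun p => 2 * ‖branch (φ j) p / ‖p.1‖‖ₑ ^ 2) (volume.restrict (K k)) := by
      have := (memLp_branch_div (h.test j)).aestronglyMeasurable.enorm.restrict (s := K k)
      exact (this.pow_const 2).const_mul 2
    calc _ ≤ ∫⁻ p in K k, (2 * ‖branch (φ j) p / ‖p.1‖‖ₑ ^ 2 +
          2 * (ENNReal.ofReal ((k : ℝ) + 1) ^ 2 * ‖branch (φ j) p - V p‖ₑ ^ 2)) := by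
          apply setLIntegral_mono' (hKc k).measurableSet
          intro p hp
          have hp0 : 0 < ‖p.1‖ := by
            by_contra! h0
            have := hp.1
            have : ‖p.1‖ = 0 := le_antisymm h0 (norm_nonneg _)
            simp [this] at *
            linarith
          have e1 : ∀ x : ℝ, ‖x‖ₑ ^ 2 = ENNReal.ofReal (x ^ 2) := fun x => by
            rw [Real.enorm_eq_ofReal_abs, ← ENNReal.ofReal_pow (abs_nonneg _), sq_abs]
          rw [e1, e1, e1, ← ENNReal.ofReal_pow (by positivity), ← ENNReal.ofReal_mul (by positivity)]
          have e2 : (2 : ℝ≥0∞) = ENNReal.ofReal 2 := by simp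
          rw [e2, ← ENNReal.ofReal_mul (by norm_num), ← ENNReal.ofReal_mul (by norm_num),
            ← ENNReal.ofReal_add (by positivity) (by positivity)]
          apply ENNReal.ofReal_le_ofReal
          have e3 : V p / ‖p.1‖ = branch (φ j) p / ‖p.1‖ - (branch (φ j) p - V p) / ‖p.1‖ := by ring
          have e4 : ((branch (φ j) p - V p) / ‖p.1‖) ^ 2 ≤
              ((k : ℝ) + 1) ^ 2 * (branch (φ j) p - V p) ^ 2 := by
            rw [div_pow, div_le_iff₀ (by positivity)]
            have : 1 ≤ (((k : ℝ) + 1) * ‖p.1‖) ^ 2 := one_le_pow₀ hp.1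
            nlinarith [sq_nonneg (branch (φ j) p - V p)]
          rw [e3]
          nlinarith [sq_nonneg (branch (φ j) p / ‖p.1‖ + (branch (φ j) p - V p) / ‖p.1‖)]
      _ = 2 * (∫⁻ p in K k, ‖branch (φ j) p / ‖p.1‖‖ₑ ^ 2) + 2 * (ENNReal.ofReal ((k : ℝ) + 1) ^ 2 *
          ∫⁻ p in K k, ‖branch (φ j) p - V p‖ₑ ^ 2) := by
          rw [lintegral_add_left' hm1, lintegral_const_mul' _ _ (by simp),
            lintegral_const_mul' _ _ (by simp), lintegral_const_mul' _ _ (by simp)]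
      _ ≤ _ := by gcongr
  have hU : ∫⁻ p, ‖V p / ‖p.1‖‖ₑ ^ 2 = ∫⁻ p in ⋃ k, K k, ‖V p / ‖p.1‖‖ₑ ^ 2 := by
    rw [Measure.restrict_eq_self_of_ae_mem]
    filter_upwards [ae_fst_ne_zero] with p hp
    obtain ⟨k, hk⟩ := exists_nat_ge (max (‖p.1‖⁻¹) ‖p‖)
    refine Set.mem_iUnion.2 ⟨k, ?_, ?_⟩
    · have h1 : ‖p.1‖⁻¹ ≤ k := (le_max_left _ _).trans hk
      have hp0 : 0 < ‖p.1‖ := norm_pos_iff.2 hp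
      rw [inv_le_iff_one_le_mul₀ hp0] at h1
      nlinarith
    · have h1 : ‖p‖ ≤ k := (le_max_right _ _).trans hk
      linarith
  rw [hU, setLIntegral_iUnion_of_directed _ (directed_of_isDirected_le hKm)]
  exact ((iSup_le hKb).trans_lt (ENNReal.mul_lt_top (by simp) ENNReal.ofReal_lt_top)).ne

/-- Each coordinate direction is an eigenvector of the deck transformation with eigenvalue `s = ±1`,
and a second derivative sees only `s²`. -/
theorem grushin_deck {m : ℕ} {F : ℂ × Sing m → ℝ} (hF : IsSection F) (p : ℂ × Sing m) :
    grushin F (deck p) = -grushin F p := by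
  have key : ∀ v : ℂ × Sing m, ∀ s : ℝ, deck v = s • v → s ^ 2 = 1 →
      fderiv ℝ (fun x => fderiv ℝ F x v) (deck p) v =
        -fderiv ℝ (fun x => fderiv ℝ F x v) p v := by
    intro v s hv hs
    have h1 : ∀ x, fderiv ℝ F (deck x) v = -s * fderiv ℝ F x v := by
      intro x
      have := fderiv_deck hF x v
      rw [hv, map_smul, smul_eq_mul] at this
      calc _ = s ^ 2 * fderiv ℝ F (deck x) v := by rw [hs, one_mul]
        _ = s * (s * fderiv ℝ F (deck x) v) := by ring
        _ = _ := by rw [this]; ring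
    let L : (ℂ × Sing m) ≃L[ℝ] (ℂ × Sing m) :=
      (ContinuousLinearEquiv.neg ℝ).prodCongr (ContinuousLinearEquiv.refl ℝ _)
    have hL : ∀ x, L x = deck x := fun x => rfl
    have h2 : (fun x => fderiv ℝ F x v) ∘ L = fun x => (-s) • fderiv ℝ F x v := by
      ext x; exact h1 x
    have h3 := L.comp_right_fderiv (f := fun x => fderiv ℝ F x v) (x := p)
    have hs0 : -s ≠ 0 := by
      intro h; rw [neg_eq_zero] at h; rw [h] at hs; norm_num at hs
    have h5 : fderiv ℝ (fun x => (-s) • fderiv ℝ F x v) p =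
        (-s) • fderiv ℝ (fun x => fderiv ℝ F x v) p :=
      congrFun (fderiv_const_smul_field (𝕜 := ℝ) (f := fun x => fderiv ℝ F x v) (-s)) p
    rw [h2, h5] at h3
    have h4 := congrArg (fun A => A v) h3
    simp only [ContinuousLinearMap.comp_apply, ContinuousLinearEquiv.coe_coe, hL,
      _root_.smul_apply, smul_eq_mul] at h4
    rw [hv, map_smul, smul_eq_mul] at h4
    calc _ = s ^ 2 * fderiv ℝ (fun x => fderiv ℝ F x v) (deck p) v := by rw [hs, one_mul]
      _ = s * (s * fderiv ℝ (fun x => fderiv ℝ F x v) (deck p) v) := by ring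
      _ = s * (-s * fderiv ℝ (fun x => fderiv ℝ F x v) p v) := by rw [h4]
      _ = -(s ^ 2 * fderiv ℝ (fun x => fderiv ℝ F x v) p v) := by ring
      _ = _ := by rw [hs, one_mul]
  have h1 : ∀ c : ℂ, deck ((c, 0) : ℂ × Sing m) = (-1 : ℝ) • (c, 0) := fun c => by simp [deck]
  have h2 : ∀ i : Fin m, deck (singDir i) = (1 : ℝ) • singDir i := fun i => by simp [deck, singDir]
  simp only [grushin, key _ _ (h1 _) (by norm_num), key _ _ (h2 _) (by norm_num)]
  simp [deck]
  ring

theorem IsTestSection.exists_lower_bound {m : ℕ} {G : ℂ × Sing m → ℝ} (hG : IsTestSection G) :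
    ∃ δ : ℝ, 0 < δ ∧ ∀ p ∈ tsupport G, δ ≤ ‖p.1‖ := by
  rcases (tsupport G).eq_empty_or_nonempty with h | h
  · exact ⟨1, one_pos, by simp [h]⟩
  · obtain ⟨p, hp, hmin⟩ := IsCompact.exists_isMinOn hG.compact h
      (f := fun p : ℂ × Sing m => ‖p.1‖) (by fun_prop)
    exact ⟨‖p.1‖, norm_pos_iff.2 (hG.away hp), fun q hq => hmin hq⟩

theorem grushin_eq_zero_of_notMem {m : ℕ} {G : ℂ × Sing m → ℝ} {p : ℂ × Sing m}
    (hp : p ∉ tsupport G) : grushin G p = 0 := by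
  rw [grushin_congr (notMem_tsupport_iff_eventuallyEq.1 hp)]
  simp [grushin]

theorem memLp_grushin_root {m : ℕ} {G : ℂ × Sing m → ℝ} (hG : IsTestSection G) :
    MemLp (fun p => grushin G (root p) / 4) 2 := by
  have hc := continuous_grushin hG.smooth
  have hmeas : AEStronglyMeasurable (fun p : ℂ × Sing m => grushin G (root p) / 4) volume :=
    ((hc.measurable.comp measurable_root).div_const 4).aestronglyMeasurable
  rw [memLp_two_iff_integrable_sq hmeas, integrable_root_iff (F := fun p => (grushin G p / 4) ^ 2)]
  · apply Continuous.integrable_of_hasCompactSupport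
    · fun_prop
    · refine HasCompactSupport.mul_left ?_
      exact (hasCompactSupport_grushin hG.compact).comp_left (g := fun y => (y / 4) ^ 2) (by simp)
  · exact ((hc.div_const 4).pow 2).aestronglyMeasurable
  · intro p
    rw [grushin_deck hG.odd]; ring

/-- `grushin G / (4|w|²)` is the Laplacian of the section `G`, and `|w|² = |z|` at `root p`. With no
derivative left on `φ`, one can pass to limits in `L²`. -/
theorem dirichletForm_eq_integral_root {m : ℕ} {φ G : ℂ × Sing m → ℝ} (hφ : IsTestSection φ)
    (hG : IsTestSection G) :
    dirichletForm φ G = -∫ p : ℂ × Sing m, branch φ p * (grushin G (root p) / (4 * ‖p.1‖)) := by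
  rw [dirichletForm_eq hφ hG, integral_energy hφ hG]
  have h1 := integral_root (F := fun p : ℂ × Sing m => φ p * (grushin G p / (4 * ‖p.1‖ ^ 2))) (by
    refine (hφ.smooth.continuous.aestronglyMeasurable).mul
      (((continuous_grushin hG.smooth).aestronglyMeasurable).div₀ ?_)
    exact Continuous.aestronglyMeasurable (by fun_prop)) (by
    intro p
    have := hφ.odd p.1 p.2
    rw [grushin_deck hG.odd]
    simp only [deck, this, norm_neg]
    ring)
  simp only [norm_root_fst_sq] at h1
  change ∫ p, branch φ p * _ = _ at h1
  rw [h1, mul_neg]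
  congr 2
  apply integral_congr_ae
  filter_upwards [ae_fst_ne_zero] with p hp
  field_simp

theorem integrable_mul_of_div {m : ℕ} {V g : ℂ × Sing m → ℝ}
    (hV : MemLp (fun p => V p / ‖p.1‖) 2) (hg : MemLp g 2) :
    Integrable fun p => V p * (g p / ‖p.1‖) := by
  refine (hV.integrable_mul hg).congr (Eventually.of_forall fun p => ?_)
  simp only [Pi.mul_apply]
  ring

/-- The weak equation in its distributional form, both derivatives being on the test section. Its
Laplacian is supported in a compact set away from the singular set, where the approximating sections
converge in `L²`. -/
theorem integral_limit_mul_grushin {m : ℕ} {φ : ℕ → ℂ × Sing m → ℝ} {V R : ℂ × Sing m → ℝ}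
    (h : IsEnergyLimit φ V)
    (hw : ∀ ψ : ℂ × Sing m → ℝ, IsTestSection ψ →
      Tendsto (fun j => dirichletForm (φ j) ψ) atTop (𝓝 (-∫ p, R p * branch ψ p)))
    {G : ℂ × Sing m → ℝ} (hG : IsTestSection G) :
    ∫ p : ℂ × Sing m, V p * (grushin G (root p) / (4 * ‖p.1‖)) = ∫ p, R p * branch G p := by
  set g : ℂ × Sing m → ℝ := fun p => grushin G (root p) / (4 * ‖p.1‖) with hg
  have hgm : AEStronglyMeasurable g volume := by
    have : Measurable g := ((continuous_grushin hG.smooth).measurable.comp measurable_root).div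
      (by fun_prop)
    exact this.aestronglyMeasurable
  obtain ⟨δ, hδ, hδG⟩ := hG.exists_lower_bound
  have hg2 : MemLp g 2 := by
    refine (memLp_grushin_root hG).of_le_mul (c := (δ ^ 2)⁻¹) hgm (Eventually.of_forall fun p => ?_)
    by_cases hp : root p ∈ tsupport G
    · have h1 : δ ^ 2 ≤ ‖p.1‖ := by
        rw [← norm_root_fst_sq]; exact pow_le_pow_left₀ hδ.le (hδG _ hp) 2
      simp only [hg, norm_div, norm_mul, Real.norm_eq_abs, abs_norm]
      rw [div_mul_eq_div_div, abs_of_pos (by norm_num : (0 : ℝ) < 4), div_eq_inv_mul _ ‖p.1‖]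
      gcongr
    · simp [hg, grushin_eq_zero_of_notMem hp]
  set K : Set (ℂ × Sing m) := (fun p : ℂ × Sing m => (p.1 ^ 2, p.2)) '' tsupport G with hK
  have hKc : IsCompact K := IsCompact.image hG.compact (by fun_prop)
  have hgK : ∀ p, p ∉ K → g p = 0 := by
    intro p hp
    have : root p ∉ tsupport G := fun h => hp ⟨root p, h, by simp [root_fst_sq]; rfl⟩
    simp [hg, grushin_eq_zero_of_notMem this]
  have hVg : Integrable fun p => V p * g p := by
    have := integrable_mul_of_div h.memLp (memLp_grushin_root hG)
    refine this.congr (Eventually.of_forall fun p => ?_)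
    simp only [hg]; rw [div_div]
  have hφg : ∀ j, Integrable fun p => branch (φ j) p * g p := by
    intro j
    have := integrable_mul_of_div (memLp_branch_div (h.test j)) (memLp_grushin_root hG)
    refine this.congr (Eventually.of_forall fun p => ?_)
    simp only [hg]; rw [div_div]
  have hlim : Tendsto (fun j => ∫ p, branch (φ j) p * g p) atTop (𝓝 (∫ p, V p * g p)) := by
    rw [tendsto_iff_norm_sub_tendsto_zero]
    have h2 : Tendsto (fun j => Real.sqrt ((∫⁻ p in K, ‖branch (φ j) p - V p‖ₑ ^ 2).toReal *
        ∫ p in K, g p ^ 2)) atTop (𝓝 0) := by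
      have h3 := (ENNReal.tendsto_toReal (by simp)).comp (h.locL2 K hKc)
      have h4 := (h3.mul_const (∫ p in K, g p ^ 2)).sqrt
      simpa using h4
    refine squeeze_zero' (Eventually.of_forall fun j => norm_nonneg _) ?_ h2
    filter_upwards [(h.locL2 K hKc).eventually_lt_const (u := 1) one_pos] with j hj
    rw [← integral_sub (hφg j) hVg]
    have h5 : ∫ p, branch (φ j) p * g p - V p * g p = ∫ p in K, (branch (φ j) p - V p) * g p := by
      rw [← setIntegral_eq_integral_of_forall_compl_eq_zero (s := K)
        (f := fun p => branch (φ j) p * g p - V p * g p)]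
      · congr 1; ext p; ring
      · intro p hp; rw [hgK p hp]; ring
    rw [h5, Real.norm_eq_abs]
    apply Real.abs_le_sqrt
    have hm : AEStronglyMeasurable (fun p => branch (φ j) p - V p) (volume.restrict K) :=
      ((aestronglyMeasurable_branch (h.test j).smooth.continuous).sub h.measurable).restrict
    have hL : MemLp (fun p => branch (φ j) p - V p) 2 (volume.restrict K) :=
      memLp_two_of_lintegral hm (hj.trans (by simp)).ne
    have h6 := sq_integral_mul_le hL (hg2.restrict K)
    have h7 : ∫ p in K, (branch (φ j) p - V p) ^ 2 =
        (∫⁻ p in K, ‖branch (φ j) p - V p‖ₑ ^ 2).toReal := by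
      rw [integral_eq_lintegral_of_nonneg_ae (Eventually.of_forall fun p => sq_nonneg _)
        (hm.pow 2)]
      congr 2; ext p
      rw [Real.enorm_eq_ofReal_abs, ← ENNReal.ofReal_pow (abs_nonneg _), sq_abs]
    rwa [h7] at h6
  have h8 := hw G hG
  have h9 : (fun j => dirichletForm (φ j) G) = fun j => -∫ p, branch (φ j) p * g p := by
    ext j; exact dirichletForm_eq_integral_root (h.test j) hG
  rw [h9] at h8
  exact neg_injective (tendsto_nhds_unique hlim.neg h8)

theorem quad_deck {m : ℕ} (e x : ℝ) (p' p : ℂ × Sing m) : quad e x p' (deck p) = quad e x p' p := by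
  simp only [quad, deck, norm_neg, inner_neg_right, neg_sq]

theorem isSection_kern {m : ℕ} (e x : ℝ) (p' : ℂ × Sing m) : IsSection (kern e x p') := by
  intro w t
  have h := quad_deck e x p' (w, t)
  simp only [deck] at h
  simp only [kern, h, inner_neg_right, neg_mul]

theorem isTestSection_cutoff_mul {m : ℕ} {χ f : ℂ × Sing m → ℝ} (hχ : ContDiff ℝ ∞ χ)
    (hc : HasCompactSupport χ) (heven : ∀ p, χ (deck p) = χ p) (haway : tsupport χ ⊆ {p | p.1 ≠ 0})
    (hf : ContDiff ℝ ∞ f) (hodd : IsSection f) : IsTestSection fun p => χ p * f p where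
  odd := fun w t => by
    have := heven (w, t)
    simp only [deck] at this
    simp only [this, hodd w t]; ring
  smooth := hχ.mul hf
  compact := hc.mul_right
  away := (tsupport_mul_subset_left).trans haway

theorem integrable_mul_majorant {m : ℕ} {V : ℂ × Sing m → ℝ}
    (hV : MemLp (fun p => V p / ‖p.1‖) 2) :
    Integrable fun p => ‖V p‖ / ‖p.1‖ * majorant (root p) := by
  have h := (hV.norm).integrable_mul memLp_majorant_root
  refine h.congr (Eventually.of_forall fun p => ?_)
  simp [norm_div]

theorem integrable_source_mul_majorant {m : ℕ} {R : ℂ × Sing m → ℝ}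
    (hR : MemLp (fun p => R p * ‖p.1‖) 2) :
    Integrable fun p => ‖R p‖ * ‖p.1‖ * majorant (root p) := by
  have h := (hR.norm).integrable_mul memLp_majorant_root
  refine h.congr (Eventually.of_forall fun p => ?_)
  simp

theorem norm_fst_mul_weight {m : ℕ} {p : ℂ × Sing m} (hp : p.1 ≠ 0) :
    ‖p.1‖ * weight p ^ (-expo m) = ‖p.1‖ ^ 2 * majorant p := by
  have : ‖p.1‖ ≠ 0 := norm_ne_zero_iff.2 hp
  rw [majorant]; field_simp

theorem root_fst_ne_zero {m : ℕ} {p : ℂ × Sing m} (hp : p.1 ≠ 0) : (root p).1 ≠ 0 := by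
  intro h; apply hp; rw [← root_fst_sq, h]; simp

theorem norm_mul_div_le {V G r C M : ℝ} (hr : 0 ≤ r) (hG : |G| ≤ C * M) :
    ‖V * (G / (4 * r))‖ ≤ C / 4 * (‖V‖ / r * M) := by
  rw [norm_mul, norm_div, Real.norm_eq_abs G, norm_mul, Real.norm_eq_abs r, abs_of_nonneg hr]
  simp only [Real.norm_ofNat]
  calc _ ≤ ‖V‖ * (C * M / (4 * r)) := by gcongr
    _ = _ := by
      rcases eq_or_ne r 0 with h | h
      · simp [h]
      · field_simp

/-- `kern` is odd and smooth but neither compactly supported nor zero near the singular set.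
Multiply by the cutoffs of `exists_cutoff` and remove them by dominated convergence; because `kern`
is of order `|w|` at the singular set, the commutator terms stay below `majorant`. -/
theorem integral_mul_grushin_kern {m : ℕ} {φ : ℕ → ℂ × Sing m → ℝ} {V R : ℂ × Sing m → ℝ}
    (h : IsEnergyLimit φ V) (hRm : AEStronglyMeasurable R volume)
    (hR : MemLp (fun p => R p * ‖p.1‖) 2)
    (hw : ∀ ψ : ℂ × Sing m → ℝ, IsTestSection ψ →
      Tendsto (fun j => dirichletForm (φ j) ψ) atTop (𝓝 (-∫ p, R p * branch ψ p)))
    {e : ℝ} (he : 0 < e) {x : ℝ} (hx : x ∈ Set.Icc (0 : ℝ) 1) (p' : ℂ × Sing m) :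
    ∫ p : ℂ × Sing m, V p * (grushin (kern e x p') (root p) / (4 * ‖p.1‖)) =
      ∫ p, R p * branch (kern e x p') p := by
  obtain ⟨χ, Cχ, hs, hc, heven, haway, hone⟩ := exists_cutoff m
  obtain ⟨C, hC0, hC⟩ := exists_kern_bounds (m := m) he ‖p'‖
  have hk := hC p' le_rfl x hx
  set f := kern e x p' with hf
  have hfs : ContDiff ℝ ∞ f := contDiff_kern he x p'
  have htest : ∀ k, IsTestSection fun p => χ k p * f p := fun k =>
    isTestSection_cutoff_mul (hs k).smooth (hc k) (heven k) (haway k) hfs (isSection_kern e x p')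
  have hid := fun k => integral_limit_mul_grushin h hw (htest k)
  have hCχ : 0 ≤ Cχ := (hs 0).nonneg
  -- The three terms of Leibniz' rule, each multiplied by `|w|²` and bounded independently of `k`.
  have hgb : ∀ k, ∀ p : ℂ × Sing m, p.1 ≠ 0 →
      |grushin (fun p => χ k p * f p) p| ≤ (6 + 8 * m) * (Cχ * C) * majorant p := by
    intro k p hp
    obtain ⟨b0, b1, b2, b3, b4, -⟩ := hk p
    have hr : 0 < ‖p.1‖ := norm_pos_iff.2 hp
    set W := weight p ^ (-expo m) with hW
    have hWp : 0 < W := Real.rpow_pos_of_pos (weight_pos p) _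
    have e1 : ‖p.1‖ ^ 2 * |χ k p * grushin f p| ≤ Cχ * C * (‖p.1‖ * W) := by
      rw [abs_mul]
      calc _ = |χ k p| * (‖p.1‖ * (‖p.1‖ * |grushin f p|)) := by ring
        _ ≤ Cχ * (‖p.1‖ * (C * W)) := by gcongr; exact (hs k).zeroth p
        _ = _ := by ring
    have e2 : ‖p.1‖ ^ 2 * |f p * grushin (χ k) p| ≤ Cχ * C * (‖p.1‖ * W) := by
      rw [abs_mul]
      calc _ = (‖p.1‖ ^ 2 * |grushin (χ k) p|) * |f p| := by ring
        _ ≤ Cχ * (C * (‖p.1‖ * W)) := by gcongr; exact (hs k).second p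
        _ = _ := by ring
    have e3 := abs_energy_le (hs k) (D := C * (‖p.1‖ * W)) (f := f) (p := p)
      (by calc _ ≤ ‖p.1‖ * (C * W) := by gcongr
            _ = _ := by ring)
      (by calc _ ≤ ‖p.1‖ * (C * W) := by gcongr
            _ = _ := by ring)
      (fun i => by
        calc _ = ‖p.1‖ * (‖p.1‖ * |fderiv ℝ f p (singDir i)|) := by ring
            _ ≤ ‖p.1‖ * (C * W) := mul_le_mul_of_nonneg_left (b3 i) hr.le
            _ = _ := by ring)
    have e4 : ‖p.1‖ ^ 2 * |grushin (fun p => χ k p * f p) p| ≤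
        (6 + 8 * m) * (Cχ * C) * (‖p.1‖ * W) := by
      rw [grushin_mul (hs k).smooth hfs]
      calc _ ≤ ‖p.1‖ ^ 2 * (|χ k p * grushin f p| + |2 * energy (χ k) f p| +
            |f p * grushin (χ k) p|) := by gcongr; exact abs_add_three _ _ _
        _ ≤ _ := by
          rw [abs_mul 2, abs_two]
          linarith
    rw [hW, norm_fst_mul_weight hp] at e4
    have hr2 : 0 < ‖p.1‖ ^ 2 := by positivity
    refine le_of_mul_le_mul_left ?_ hr2
    linarith
  have hL : Tendsto (fun k => ∫ p : ℂ × Sing m,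
      V p * (grushin (fun p => χ k p * f p) (root p) / (4 * ‖p.1‖))) atTop
      (𝓝 (∫ p : ℂ × Sing m, V p * (grushin f (root p) / (4 * ‖p.1‖)))) := by
    apply tendsto_integral_of_dominated_convergence
      (fun p => (6 + 8 * m) * (Cχ * C) / 4 * (‖V p‖ / ‖p.1‖ * majorant (root p)))
    · intro k
      refine h.measurable.mul (Measurable.aestronglyMeasurable ?_)
      exact ((continuous_grushin (htest k).smooth).measurable.comp measurable_root).div
        (by fun_prop)
    · exact (integrable_mul_majorant h.memLp).const_mul _
    · intro k
      filter_upwards [ae_fst_ne_zero] with p hp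
      exact norm_mul_div_le (norm_nonneg _) (hgb k _ (root_fst_ne_zero hp))
    · filter_upwards [ae_fst_ne_zero] with p hp
      apply tendsto_const_nhds.congr'
      filter_upwards [hone (root p) (root_fst_ne_zero hp)] with k hk
      have : (fun p => χ k p * f p) =ᶠ[𝓝 (root p)] f := by
        filter_upwards [hk] with y hy
        rw [hy, one_mul]
      rw [grushin_congr this]
  have hRl : Tendsto (fun k => ∫ p : ℂ × Sing m, R p * branch (fun p => χ k p * f p) p) atTop
      (𝓝 (∫ p : ℂ × Sing m, R p * branch f p)) := by
    apply tendsto_integral_of_dominated_convergence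
      (fun p => (Cχ * C) * (‖R p‖ * ‖p.1‖ * majorant (root p)))
    · intro k
      exact hRm.mul (aestronglyMeasurable_branch (htest k).smooth.continuous)
    · exact (integrable_source_mul_majorant hR).const_mul _
    · intro k
      filter_upwards [ae_fst_ne_zero] with p hp
      have b0 := (hk (root p)).1
      rw [norm_fst_mul_weight (root_fst_ne_zero hp), norm_root_fst_sq] at b0
      rw [branch_eq, norm_mul, norm_mul, Real.norm_eq_abs (χ k _), Real.norm_eq_abs (f _)]
      calc _ ≤ ‖R p‖ * (Cχ * (C * (‖p.1‖ * majorant (root p)))) := by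
            gcongr; exact (hs k).zeroth _
        _ = _ := by ring
    · filter_upwards [ae_fst_ne_zero] with p hp
      apply tendsto_const_nhds.congr'
      filter_upwards [hone (root p) (root_fst_ne_zero hp)] with k hk
      simp only [branch_eq, hk.self_of_nhds, one_mul]
  simp only [hid] at hL
  exact tendsto_nhds_unique hL hRl

/-! ### Green's identity with regularization -/

/-- The regularized Green's function, up to normalization; it is Green's function for `e = 0`. -/
noncomputable def green {m : ℕ} (e : ℝ) (c p : ℂ × Sing m) : ℝ :=
  ∫ x in (0 : ℝ)..1, kern e x c p

/-- The regularization of the delta distribution, up to normalization. -/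
noncomputable def mollifier {m : ℕ} (e : ℝ) (p' p : ℂ × Sing m) : ℝ :=
  4 * expo m * (expo m + 1) * e * inner ℝ p'.1 p.1 *
    ∫ x in (0 : ℝ)..1, quad e x p' p ^ (-expo m - 2)

theorem continuous_quad {m : ℕ} (e : ℝ) :
    Continuous fun y : ℝ × (ℂ × Sing m) × (ℂ × Sing m) => quad e y.1 y.2.1 y.2.2 := by
  unfold quad; fun_prop

theorem continuous_quad_rpow {m : ℕ} {e : ℝ} (he : 0 < e) (s : ℝ) :
    Continuous fun y : ℝ × (ℂ × Sing m) × (ℂ × Sing m) => quad e y.1 y.2.1 y.2.2 ^ s :=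
  (continuous_quad e).rpow_const fun _ => Or.inl (quad_pos he _ _ _).ne'

theorem continuous_kern {m : ℕ} {e : ℝ} (he : 0 < e) :
    Continuous fun y : ℝ × (ℂ × Sing m) × (ℂ × Sing m) => kern e y.1 y.2.1 y.2.2 := by
  unfold kern
  have := continuous_quad_rpow (m := m) he (-expo m)
  fun_prop

theorem continuous_grushin_kern {m : ℕ} {e : ℝ} (he : 0 < e) :
    Continuous fun y : ℝ × (ℂ × Sing m) × (ℂ × Sing m) => grushin (kern e y.1 y.2.1) y.2.2 := by
  simp only [grushin_kern he]
  have h1 := continuous_quad_rpow (m := m) he (-expo m - 1)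
  have h2 := continuous_quad_rpow (m := m) he (-expo m - 2)
  fun_prop

/-- The exact `x`-derivative integrates to zero because of the factor `x - x ^ 3`. -/
theorem integral_grushin_kern {m : ℕ} {e : ℝ} (he : 0 < e) (p' p : ℂ × Sing m) :
    ∫ x in (0 : ℝ)..1, grushin (kern e x p') p = -(4 * ‖p.1‖ ^ 2) * mollifier e p' p := by
  have hq : Continuous fun x => quad e x p' p := by unfold quad; fun_prop
  have h1 : Continuous fun x => quad e x p' p ^ (-expo m - 1) :=
    hq.rpow_const fun x => Or.inl (quad_pos he x p' p).ne'
  have h2 : Continuous fun x => quad e x p' p ^ (-expo m - 2) :=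
    hq.rpow_const fun x => Or.inl (quad_pos he x p' p).ne'
  simp only [grushin_kern he]
  rw [intervalIntegral.integral_sub, intervalIntegral.integral_const_mul,
    intervalIntegral.integral_eq_sub_of_hasDerivAt
      (fun x _ => hasDerivAt_kern_primitive he x p' p)]
  · rw [mollifier]; ring
  all_goals exact Continuous.intervalIntegrable (by fun_prop) _ _

/-- Green's identity for the regularized kernel. -/
theorem integral_mul_mollifier {m : ℕ} {φ : ℕ → ℂ × Sing m → ℝ} {V R : ℂ × Sing m → ℝ}
    (h : IsEnergyLimit φ V) (hRm : AEStronglyMeasurable R volume)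
    (hR : MemLp (fun p => R p * ‖p.1‖) 2)
    (hw : ∀ ψ : ℂ × Sing m → ℝ, IsTestSection ψ →
      Tendsto (fun j => dirichletForm (φ j) ψ) atTop (𝓝 (-∫ p, R p * branch ψ p)))
    {e : ℝ} (he : 0 < e) (p' : ℂ × Sing m) :
    ∫ p : ℂ × Sing m, V p * mollifier e p' (root p) =
      -∫ p : ℂ × Sing m, R p * green e p' (root p) := by
  obtain ⟨C, hC0, hC⟩ := exists_kern_bounds (m := m) he ‖p'‖
  have hk := hC p' le_rfl
  set μ : Measure ℝ := volume.restrict (Set.Ioc 0 1) with hμ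
  have hmem : ∀ᵐ x ∂μ, x ∈ Set.Icc (0 : ℝ) 1 :=
    (ae_restrict_mem measurableSet_Ioc).mono fun x hx => ⟨hx.1.le, hx.2⟩
  have hid : ∫ x, (∫ p : ℂ × Sing m, V p * (grushin (kern e x p') (root p) / (4 * ‖p.1‖))) ∂μ =
      ∫ x, (∫ p : ℂ × Sing m, R p * kern e x p' (root p)) ∂μ := by
    apply integral_congr_ae
    filter_upwards [hmem] with x hx
    exact integral_mul_grushin_kern h hRm hR hw he hx p'
  have hmap : Measurable fun y : ℝ × (ℂ × Sing m) => (y.1, p', root y.2) :=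
    measurable_fst.prodMk (measurable_const.prodMk (measurable_root.comp measurable_snd))
  have hmemp : ∀ᵐ y : ℝ × (ℂ × Sing m) ∂(μ.prod volume), y.1 ∈ Set.Icc (0 : ℝ) 1 :=
    Measure.quasiMeasurePreserving_fst.ae hmem
  have hnep : ∀ᵐ y : ℝ × (ℂ × Sing m) ∂(μ.prod volume), y.2.1 ≠ 0 :=
    Measure.quasiMeasurePreserving_snd.ae ae_fst_ne_zero
  -- The bounds of `exists_kern_bounds` are uniform in `x`, which justifies exchanging the integrals
  -- over `x` and `p`.
  have i1 : Integrable (fun y : ℝ × (ℂ × Sing m) =>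
      V y.2 * (grushin (kern e y.1 p') (root y.2) / (4 * ‖y.2.1‖))) (μ.prod volume) := by
    have hdom := (integrable_const (μ := μ) (1 : ℝ)).mul_prod
      ((integrable_mul_majorant h.memLp).const_mul (C / 4))
    refine hdom.mono' ?_ ?_
    · refine (h.measurable.comp_snd).mul (Measurable.aestronglyMeasurable ?_)
      exact ((continuous_grushin_kern he).measurable.comp hmap).div (by fun_prop)
    · filter_upwards [hmemp, hnep] with y hy hy0
      rw [one_mul]
      refine norm_mul_div_le (norm_nonneg _) ?_
      have b := (hk y.1 hy (root y.2)).2.2.2.2.1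
      have hr : 0 < ‖(root y.2).1‖ := norm_pos_iff.2 (root_fst_ne_zero hy0)
      rw [majorant, mul_div_assoc', le_div_iff₀ hr]
      linarith
  have i2 : Integrable (fun y : ℝ × (ℂ × Sing m) => R y.2 * kern e y.1 p' (root y.2))
      (μ.prod volume) := by
    have hdom := (integrable_const (μ := μ) (1 : ℝ)).mul_prod
      ((integrable_source_mul_majorant hR).const_mul C)
    refine hdom.mono' ?_ ?_
    · refine (hRm.comp_snd).mul (Measurable.aestronglyMeasurable ?_)
      exact (continuous_kern he).measurable.comp hmap
    · filter_upwards [hmemp, hnep] with y hy hy0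
      have b := (hk y.1 hy (root y.2)).1
      rw [norm_fst_mul_weight (root_fst_ne_zero hy0), norm_root_fst_sq] at b
      rw [one_mul, norm_mul, Real.norm_eq_abs (kern _ _ _ _)]
      calc _ ≤ ‖R y.2‖ * (C * (‖y.2.1‖ * majorant (root y.2))) := by gcongr
        _ = _ := by ring
  rw [integral_integral_swap (f := fun x p =>
      V p * (grushin (kern e x p') (root p) / (4 * ‖p.1‖))) i1,
    integral_integral_swap (f := fun x p => R p * kern e x p' (root p)) i2] at hid
  have e1 : ∀ p : ℂ × Sing m, p.1 ≠ 0 →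
      ∫ x, V p * (grushin (kern e x p') (root p) / (4 * ‖p.1‖)) ∂μ =
        -(V p * mollifier e p' (root p)) := by
    intro p hp
    have hr : ‖p.1‖ ≠ 0 := norm_ne_zero_iff.2 hp
    rw [integral_const_mul, integral_div, hμ, ← intervalIntegral.integral_of_le zero_le_one,
      integral_grushin_kern he, norm_root_fst_sq]
    field_simp
  have e2 : ∀ p : ℂ × Sing m, ∫ x, R p * kern e x p' (root p) ∂μ = R p * green e p' (root p) := by
    intro p
    rw [integral_const_mul, hμ, ← intervalIntegral.integral_of_le zero_le_one, green]
  simp only [e2] at hid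
  rw [← hid, ← integral_neg]
  apply integral_congr_ae
  filter_upwards [ae_fst_ne_zero] with p hp
  rw [e1 p hp, neg_neg]

/-! ### The mollifier as an approximate identity -/

/-- The radial profile of the mollifier. -/
noncomputable def profile (m : ℕ) (N Y : ℝ) : ℝ := ∫ y in (0 : ℝ)..Y, (N + y ^ 2) ^ (-expo m - 2)

/-- Substitute `y = 2 q x / ε`. The parameter `e` is `ε²` so that `ε` is a length on the base, and
`ε ^ (m + 2)` is the Jacobian of scaling by `ε` in `ℝ^n`. -/
theorem mollifier_eq_profile {m : ℕ} {ε : ℝ} (hε : 0 < ε) {N : ℝ} (hN : 1 ≤ N) {p' p : ℂ × Sing m}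
    (h : ‖p.1 ^ 2 - p'.1 ^ 2‖ ^ 2 + ‖p.2 - p'.2‖ ^ 2 = ε ^ 2 * (N - 1)) :
    mollifier (ε ^ 2) p' p = 2 * expo m * (expo m + 1) * (ε ^ (m + 2))⁻¹ *
      profile m N (2 * inner ℝ p'.1 p.1 / ε) := by
  set q := inner ℝ p'.1 p.1 with hq
  set c := 2 * q / ε with hc
  have hqc : q = ε / 2 * c := by rw [hc]; field_simp
  have h1 : ∀ x : ℝ, quad (ε ^ 2) x p' p ^ (-expo m - 2) =
      (ε ^ 2) ^ (-expo m - 2) * (N + (c * x) ^ 2) ^ (-expo m - 2) := by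
    intro x
    rw [← Real.mul_rpow (by positivity) (by nlinarith [sq_nonneg (c * x)])]
    congr 1
    rw [quad_eq, ← hq, hqc]
    linear_combination h
  have h2 := intervalIntegral.mul_integral_comp_mul_left (a := 0) (b := 1)
    (f := fun y : ℝ => (N + y ^ 2) ^ (-expo m - 2)) c
  rw [mul_zero, mul_one] at h2
  have h3 : ε ^ 2 * (ε ^ 2) ^ (-expo m - 2) * ε = (ε ^ (m + 2))⁻¹ := by
    rw [← Real.rpow_natCast ε 2, ← Real.rpow_mul hε.le, ← Real.rpow_natCast ε (m + 2),
      ← Real.rpow_neg hε.le, ← Real.rpow_add hε, ← Real.rpow_add_one hε.ne']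
    congr 1
    unfold expo; push_cast; ring
  simp only [mollifier, h1]
  rw [intervalIntegral.integral_const_mul, profile, ← h2, ← h3, ← hq]
  nth_rewrite 1 [hqc]
  ring

/-- One unit of the exponent is spent on integrability in `y`; the rest still decays integrably in
the base variable, by `integrable_bracket_rpow`. -/
theorem profile_integrand_le {m : ℕ} {N : ℝ} (hN : 1 ≤ N) (y : ℝ) :
    (N + y ^ 2) ^ (-expo m - 2) ≤ N ^ (-expo m - 1) * (1 + y ^ 2)⁻¹ := by
  have hy := sq_nonneg y
  have ha := expo_pos m
  have h1 : -expo m - 2 = (-expo m - 1) + -1 := by ring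
  rw [h1, Real.rpow_add (by linarith), Real.rpow_neg_one]
  have h2 : (N + y ^ 2) ^ (-expo m - 1) ≤ N ^ (-expo m - 1) :=
    Real.rpow_le_rpow_of_nonpos (by linarith) (by linarith) (by linarith)
  have h3 : (N + y ^ 2)⁻¹ ≤ (1 + y ^ 2)⁻¹ := inv_anti₀ (by linarith) (by linarith)
  exact mul_le_mul h2 h3 (inv_nonneg.2 (by linarith)) (Real.rpow_nonneg (by linarith) _)

theorem continuous_profile_integrand {m : ℕ} {N : ℝ} (hN : 1 ≤ N) :
    Continuous fun y : ℝ => (N + y ^ 2) ^ (-expo m - 2) :=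
  Continuous.rpow_const (by fun_prop) fun y => Or.inl (by nlinarith [sq_nonneg y])

theorem integrable_profile_integrand {m : ℕ} {N : ℝ} (hN : 1 ≤ N) :
    Integrable fun y : ℝ => (N + y ^ 2) ^ (-expo m - 2) := by
  refine (integrable_inv_one_add_sq.const_mul (N ^ (-expo m - 1))).mono'
    (continuous_profile_integrand hN).aestronglyMeasurable (Eventually.of_forall fun y => ?_)
  rw [Real.norm_eq_abs, abs_of_nonneg (Real.rpow_nonneg (by nlinarith [sq_nonneg y]) _)]
  exact profile_integrand_le hN y

theorem abs_profile_le {m : ℕ} {N : ℝ} (hN : 1 ≤ N) (Y : ℝ) :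
    |profile m N Y| ≤ Real.pi * N ^ (-expo m - 1) := by
  have h0 : ∀ y : ℝ, 0 ≤ (N + y ^ 2) ^ (-expo m - 2) := fun y =>
    Real.rpow_nonneg (by nlinarith [sq_nonneg y]) _
  rw [profile, ← Real.norm_eq_abs]
  refine intervalIntegral.norm_integral_le_integral_norm_uIoc.trans ?_
  refine (setIntegral_le_integral (integrable_profile_integrand hN).norm
    (Eventually.of_forall fun y => norm_nonneg _)).trans ?_
  have : ∫ y : ℝ, ‖(N + y ^ 2) ^ (-expo m - 2)‖ ≤ ∫ y : ℝ, N ^ (-expo m - 1) * (1 + y ^ 2)⁻¹ := by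
    apply integral_mono (integrable_profile_integrand hN).norm
      (integrable_inv_one_add_sq.const_mul _)
    intro y
    simp only
    rw [Real.norm_eq_abs, abs_of_nonneg (h0 y)]
    exact profile_integrand_le hN y
  refine this.trans (le_of_eq ?_)
  rw [integral_const_mul, integral_univ_inv_one_add_sq]
  ring

theorem tendsto_profile {m : ℕ} {N : ℝ} (hN : 1 ≤ N) :
    Tendsto (profile m N) atTop (𝓝 (∫ y in Set.Ioi (0 : ℝ), (N + y ^ 2) ^ (-expo m - 2))) :=
  intervalIntegral_tendsto_integral_Ioi 0 (integrable_profile_integrand hN).integrableOn tendsto_id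

/-- `1 + |X| ^ 2` for the Euclidean norm. -/
noncomputable def bracket {m : ℕ} (X : ℂ × Sing m) : ℝ := 1 + ‖X.1‖ ^ 2 + ‖X.2‖ ^ 2

theorem one_le_bracket {m : ℕ} (X : ℂ × Sing m) : 1 ≤ bracket X := by
  unfold bracket; nlinarith [sq_nonneg ‖X.1‖, sq_nonneg ‖X.2‖]

theorem continuous_bracket {m : ℕ} : Continuous (bracket (m := m)) := by unfold bracket; fun_prop

theorem finrank_total (m : ℕ) : Module.finrank ℝ (ℂ × Sing m) = m + 2 := by
  rw [Module.finrank_prod, Complex.finrank_real_complex, finrank_euclideanSpace, Fintype.card_fin,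
    add_comm]

theorem integrable_bracket_rpow (m : ℕ) :
    Integrable fun X : ℂ × Sing m => bracket X ^ (-expo m - 1) := by
  have ha := expo_pos m
  have h1 : Integrable fun X : ℂ × Sing m => (1 + ‖X‖) ^ (-((m : ℝ) + 3)) :=
    integrable_one_add_norm (by rw [finrank_total]; push_cast; linarith)
  refine (h1.const_mul (2 ^ (expo m + 1))).mono' (Continuous.aestronglyMeasurable ?_)
    (Eventually.of_forall fun X => ?_)
  · exact continuous_bracket.rpow_const fun X => Or.inl (by linarith [one_le_bracket X])
  · have hb : 0 < bracket X := by linarith [one_le_bracket X]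
    rw [Real.norm_eq_abs, abs_of_nonneg (by positivity)]
    have h2 : (1 + ‖X‖) ^ 2 ≤ 2 * bracket X := by
      have h3 : ‖X‖ ^ 2 ≤ ‖X.1‖ ^ 2 + ‖X.2‖ ^ 2 := by
        rw [Prod.norm_def]
        rcases max_choice ‖X.1‖ ‖X.2‖ with h | h <;> rw [h] <;>
          nlinarith [sq_nonneg ‖X.1‖, sq_nonneg ‖X.2‖]
      unfold bracket
      nlinarith [sq_nonneg (‖X‖ - 1)]
    have h4 : (1 + ‖X‖) ^ (-((m : ℝ) + 3)) = ((1 + ‖X‖) ^ 2) ^ (-expo m - 1) := by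
      rw [← Real.rpow_natCast, ← Real.rpow_mul (by positivity)]
      congr 1; unfold expo; push_cast; ring
    have h5 : (2 * bracket X) ^ (-expo m - 1) ≤ ((1 + ‖X‖) ^ 2) ^ (-expo m - 1) :=
      Real.rpow_le_rpow_of_nonpos (by positivity) h2 (by linarith)
    have h6 : (2 : ℝ) ^ (expo m + 1) * 2 ^ (-expo m - 1) = 1 := by
      rw [← Real.rpow_add (by norm_num)]; ring_nf; simp
    rw [h4]
    rw [Real.mul_rpow (by norm_num) hb.le] at h5
    calc _ = (2 : ℝ) ^ (expo m + 1) * (2 ^ (-expo m - 1) * bracket X ^ (-expo m - 1)) := by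
          rw [← mul_assoc, h6, one_mul]
      _ ≤ _ := by gcongr

/-- The total mass of the mollifier. -/
noncomputable def mass (m : ℕ) : ℝ :=
  ∫ X : ℂ × Sing m, 2 * expo m * (expo m + 1) *
    ∫ y in Set.Ioi (0 : ℝ), (bracket X + y ^ 2) ^ (-expo m - 2)

/-- The lift of `(z', t')` to the half of the cover which contains `w`. -/
noncomputable def liftNear {m : ℕ} (w : ℂ) (p : ℂ × Sing m) : ℂ × Sing m :=
  (w * (p.1 / w ^ 2) ^ (1 / 2 : ℂ), p.2)

theorem liftNear_eq_or {m : ℕ} {w : ℂ} (hw : w ≠ 0) (p : ℂ × Sing m) :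
    liftNear w p = root p ∨ liftNear w p = deck (root p) := by
  have h : (w * (p.1 / w ^ 2) ^ (1 / 2 : ℂ)) ^ 2 = (p.1 ^ (1 / 2 : ℂ)) ^ 2 := by
    rw [mul_pow, sqrt_sq, sqrt_sq]; field_simp
  rcases sq_eq_sq_iff_eq_or_eq_neg.1 h with h | h
  · left; simp only [liftNear, root, h]
  · right; simp only [liftNear, root, deck, h]

theorem liftNear_fst_sq {m : ℕ} {w : ℂ} (hw : w ≠ 0) (p : ℂ × Sing m) :
    (liftNear w p).1 ^ 2 = p.1 := by
  simp only [liftNear, mul_pow, sqrt_sq]; field_simp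

theorem quad_comm {m : ℕ} (e x : ℝ) (p' p : ℂ × Sing m) : quad e x p' p = quad e x p p' := by
  simp only [quad, norm_sub_rev p.2, real_inner_comm p.1, add_comm (‖p.1‖ ^ 2)]

theorem mollifier_comm {m : ℕ} (e : ℝ) (p' p : ℂ × Sing m) :
    mollifier e p' p = mollifier e p p' := by
  simp only [mollifier, quad_comm e _ p', real_inner_comm p.1]

theorem mollifier_deck_left {m : ℕ} (e : ℝ) (p' p : ℂ × Sing m) :
    mollifier e (deck p') p = -mollifier e p' p := by
  rw [mollifier_comm, mollifier_comm e p']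
  simp only [mollifier, quad_deck]
  simp only [deck, inner_neg_right]
  ring

/-- The mollification of a section at a point of the cover. -/
noncomputable def mollify {m : ℕ} (e : ℝ) (ψ : ℂ × Sing m → ℝ) (p : ℂ × Sing m) : ℝ :=
  ∫ y : ℂ × Sing m, branch ψ y * mollifier e (root y) p

/-- The section and the mollifier change sign together when the root is replaced, so the principal
branch may be exchanged for the lift near `w`. Then the base is translated and scaled by `ε`. -/
theorem mollify_eq {m : ℕ} {ψ : ℂ × Sing m → ℝ} (hψ : IsSection ψ) {ε : ℝ} (hε : 0 < ε)
    {p : ℂ × Sing m} (hp : p.1 ≠ 0) :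
    mollify (ε ^ 2) ψ p = ∫ X : ℂ × Sing m,
      ψ (liftNear p.1 ((p.1 ^ 2, p.2) + ε • X)) * (2 * expo m * (expo m + 1) *
        profile m (bracket X)
          (2 * inner ℝ (liftNear p.1 ((p.1 ^ 2, p.2) + ε • X)).1 p.1 / ε)) := by
  have h1 : ∀ y : ℂ × Sing m, branch ψ y * mollifier (ε ^ 2) (root y) p =
      ψ (liftNear p.1 y) * mollifier (ε ^ 2) (liftNear p.1 y) p := by
    intro y
    rcases liftNear_eq_or hp y with h | h
    · rw [h]; rfl
    · rw [h, mollifier_deck_left, branch_eq]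
      have := hψ (root y).1 (root y).2
      simp only [deck, this]; ring
  set F : ℂ × Sing m → ℝ := fun y => ψ (liftNear p.1 y) * mollifier (ε ^ 2) (liftNear p.1 y) p
  have h2 : mollify (ε ^ 2) ψ p = ∫ y, F y := by
    unfold mollify; simp only [h1, F]
  have h3 := Measure.integral_comp_smul (volume : Measure (ℂ × Sing m))
    (fun X => F ((p.1 ^ 2, p.2) + X)) ε
  rw [integral_add_left_eq_self (μ := (volume : Measure (ℂ × Sing m))) F (p.1 ^ 2, p.2),
    finrank_total, abs_of_pos (by positivity), smul_eq_mul] at h3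
  -- The scaling Jacobian, to be cancelled against the factor in `mollifier_eq_profile`.
  have hεn : ε ^ (m + 2) ≠ 0 := by positivity
  have h4 : ∫ y, F y = ∫ X, ε ^ (m + 2) * F ((p.1 ^ 2, p.2) + ε • X) := by
    rw [integral_const_mul, h3, mul_inv_cancel_left₀ hεn]
  rw [h2, h4]
  congr 1; ext X
  simp only [F]
  rw [mollifier_eq_profile hε (one_le_bracket X)]
  · field_simp
  · rw [liftNear_fst_sq hp]
    have e1 : p.1 ^ 2 - ((p.1 ^ 2, p.2) + ε • X).1 = -(ε • X.1) := by simp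
    have e2 : p.2 - (liftNear p.1 ((p.1 ^ 2, p.2) + ε • X)).2 = -(ε • X.2) := by simp [liftNear]
    rw [e1, e2, norm_neg, norm_neg, norm_smul, norm_smul, Real.norm_eq_abs, abs_of_pos hε, bracket]
    ring

theorem measurable_liftNear {m : ℕ} (w : ℂ) : Measurable (liftNear (m := m) w) := by
  unfold liftNear; fun_prop

theorem abs_mollify_le {m : ℕ} {ψ : ℂ × Sing m → ℝ} (hψ : IsSection ψ) {B : ℝ}
    (hB : ∀ p, |ψ p| ≤ B) {ε : ℝ} (hε : 0 < ε) {p : ℂ × Sing m} (hp : p.1 ≠ 0) :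
    |mollify (ε ^ 2) ψ p| ≤ B * (2 * expo m * (expo m + 1) *
      (Real.pi * ∫ X : ℂ × Sing m, bracket X ^ (-expo m - 1))) := by
  have ha := expo_pos m
  have hB0 : 0 ≤ B := (abs_nonneg _).trans (hB 0)
  rw [mollify_eq hψ hε hp]
  have h1 : ∫ X : ℂ × Sing m, B * (2 * expo m * (expo m + 1) *
      (Real.pi * bracket X ^ (-expo m - 1))) = B * (2 * expo m * (expo m + 1) *
      (Real.pi * ∫ X : ℂ × Sing m, bracket X ^ (-expo m - 1))) := by
    rw [integral_const_mul, integral_const_mul, integral_const_mul]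
  rw [← h1, ← Real.norm_eq_abs]
  apply norm_integral_le_of_norm_le
  · exact (((integrable_bracket_rpow m).const_mul _).const_mul _).const_mul _
  · refine Eventually.of_forall fun X => ?_
    rw [norm_mul, norm_mul, Real.norm_eq_abs (ψ _), Real.norm_eq_abs (profile _ _ _),
      Real.norm_of_nonneg (by positivity : 0 ≤ 2 * expo m * (expo m + 1))]
    gcongr
    · exact hB _
    · exact abs_profile_le (one_le_bracket X) _

theorem continuous_profile_uncurry (m : ℕ) {N : ℂ × Sing m → ℝ} (hN : Continuous N)
    (hN1 : ∀ X, 1 ≤ N X) :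
    Continuous fun x : (ℂ × Sing m) × ℝ => profile m (N x.1) x.2 := by
  unfold profile
  have hc : Continuous fun y : ((ℂ × Sing m) × ℝ) × ℝ => (N y.1.1 + y.2 ^ 2) ^ (-expo m - 2) :=
    Continuous.rpow_const (by fun_prop) fun y => Or.inl (by nlinarith [sq_nonneg y.2, hN1 y.1.1])
  exact intervalIntegral.continuous_parametric_intervalIntegral_of_continuous
    (f := fun (x : (ℂ × Sing m) × ℝ) y => (N x.1 + y ^ 2) ^ (-expo m - 2)) hc continuous_snd

theorem tendsto_liftNear {m : ℕ} {p : ℂ × Sing m} (hp : p.1 ≠ 0) (X : ℂ × Sing m) :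
    Tendsto (fun ε : ℝ => liftNear p.1 ((p.1 ^ 2, p.2) + ε • X)) (𝓝[>] 0) (𝓝 p) := by
  have h0 : liftNear p.1 ((p.1 ^ 2, p.2) + (0 : ℝ) • X) = p := by
    have : p.1 ^ 2 / p.1 ^ 2 = 1 := div_self (pow_ne_zero 2 hp)
    simp [liftNear, this]
  have hc : ContinuousAt (fun ε : ℝ => liftNear p.1 ((p.1 ^ 2, p.2) + ε • X)) 0 := by
    unfold liftNear
    refine ContinuousAt.prodMk (continuousAt_const.mul ?_) (by fun_prop)
    refine ContinuousAt.cpow (by fun_prop) continuousAt_const ?_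
    simp [div_self (pow_ne_zero 2 hp)]
  have := hc.tendsto
  rw [h0] at this
  exact this.mono_left nhdsWithin_le_nhds

/-- As `ε → 0` the nearby lift tends to `p`, so the inner product tends to `|w|² > 0` and the upper
limit `2q / ε` of the profile tends to infinity. The choice of sheet matters here: on the other one
the limit would be `-∞`. -/
theorem tendsto_mollify {m : ℕ} {ψ : ℂ × Sing m → ℝ} (hψ : IsSection ψ) (hc : Continuous ψ) {B : ℝ}
    (hB : ∀ p, |ψ p| ≤ B) {p : ℂ × Sing m} (hp : p.1 ≠ 0) :
    Tendsto (fun ε : ℝ => mollify (ε ^ 2) ψ p) (𝓝[>] 0) (𝓝 (mass m * ψ p)) := by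
  have ha := expo_pos m
  have hB0 : 0 ≤ B := (abs_nonneg _).trans (hB 0)
  have hmass : mass m * ψ p = ∫ X : ℂ × Sing m, ψ p * (2 * expo m * (expo m + 1) *
      ∫ y in Set.Ioi (0 : ℝ), (bracket X + y ^ 2) ^ (-expo m - 2)) := by
    rw [mass, integral_const_mul (ψ p), mul_comm]
  rw [hmass]
  have heq : (fun ε : ℝ => mollify (ε ^ 2) ψ p) =ᶠ[𝓝[>] 0] fun ε => ∫ X : ℂ × Sing m,
      ψ (liftNear p.1 ((p.1 ^ 2, p.2) + ε • X)) * (2 * expo m * (expo m + 1) *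
        profile m (bracket X)
          (2 * inner ℝ (liftNear p.1 ((p.1 ^ 2, p.2) + ε • X)).1 p.1 / ε)) := by
    filter_upwards [self_mem_nhdsWithin] with ε hε
    exact mollify_eq hψ hε hp
  refine Tendsto.congr' heq.symm ?_
  apply tendsto_integral_filter_of_dominated_convergence
    (fun X => B * (2 * expo m * (expo m + 1) * (Real.pi * bracket X ^ (-expo m - 1))))
  · refine Eventually.of_forall fun ε => Measurable.aestronglyMeasurable ?_
    have hl : Measurable fun X : ℂ × Sing m => liftNear p.1 ((p.1 ^ 2, p.2) + ε • X) :=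
      (measurable_liftNear p.1).comp (by fun_prop)
    refine (hc.measurable.comp hl).mul (Measurable.const_mul ?_ _)
    have hin : Measurable fun X : ℂ × Sing m =>
        2 * inner ℝ (liftNear p.1 ((p.1 ^ 2, p.2) + ε • X)).1 p.1 / ε := by
      have : Continuous fun y : ℂ × Sing m => 2 * inner ℝ y.1 p.1 / ε := by fun_prop
      exact this.measurable.comp hl
    have hpair : Measurable fun X : ℂ × Sing m =>
        (X, 2 * inner ℝ (liftNear p.1 ((p.1 ^ 2, p.2) + ε • X)).1 p.1 / ε) :=
      measurable_id'.prodMk hin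
    have hprof := (continuous_profile_uncurry m continuous_bracket one_le_bracket).measurable
    have := hprof.comp hpair
    simpa only [Function.comp_def] using this
  · filter_upwards [self_mem_nhdsWithin] with ε hε
    refine Eventually.of_forall fun X => ?_
    rw [norm_mul, norm_mul, Real.norm_eq_abs (ψ _), Real.norm_eq_abs (profile _ _ _),
      Real.norm_of_nonneg (by positivity : 0 ≤ 2 * expo m * (expo m + 1))]
    gcongr
    · exact hB _
    · exact abs_profile_le (one_le_bracket X) _
  · exact (((integrable_bracket_rpow m).const_mul _).const_mul _).const_mul _
  · refine Eventually.of_forall fun X => ?_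
    have hl := tendsto_liftNear hp X
    refine ((hc.tendsto p).comp hl).mul (Tendsto.const_mul _ ?_)
    refine (tendsto_profile (one_le_bracket X)).comp ?_
    have h1 : Tendsto (fun ε : ℝ => 2 * inner ℝ (liftNear p.1 ((p.1 ^ 2, p.2) + ε • X)).1 p.1)
        (𝓝[>] 0) (𝓝 (2 * inner ℝ p.1 p.1)) := by
      have : Continuous fun y : ℂ × Sing m => 2 * inner ℝ y.1 p.1 := by fun_prop
      exact (this.tendsto p).comp hl
    have h2 : 0 < 2 * inner ℝ p.1 p.1 := by
      rw [real_inner_self_eq_norm_sq]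
      have := norm_pos_iff.2 hp
      positivity
    simp only [div_eq_mul_inv]
    exact h1.pos_mul_atTop h2 tendsto_inv_nhdsGT_zero

/-! ### The total mass of the mollifier -/

theorem lintegral_exp_neg_mul_sq_norm {V : Type*} [NormedAddCommGroup V] [InnerProductSpace ℝ V]
    [FiniteDimensional ℝ V] [MeasurableSpace V] [BorelSpace V] {b : ℝ} (hb : 0 < b) :
    ∫⁻ v : V, ENNReal.ofReal (Real.exp (-b * ‖v‖ ^ 2)) =
      ENNReal.ofReal ((Real.pi / b) ^ (Module.finrank ℝ V / 2 : ℝ)) := by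
  have h := GaussianFourier.integral_rexp_neg_mul_sq_norm (V := V) hb
  have hpos : 0 < (Real.pi / b) ^ (Module.finrank ℝ V / 2 : ℝ) := by positivity
  -- A non-integrable function has integral `0` by convention, which the positive value in `h`
  -- excludes.
  have hi : Integrable fun v : V => Real.exp (-b * ‖v‖ ^ 2) := by
    by_contra hni
    rw [integral_undef hni] at h
    exact hpos.ne h
  rw [← h, ofReal_integral_eq_lintegral_ofReal hi (Eventually.of_forall fun v => (Real.exp_pos _).le)]

theorem lintegral_exp_neg_mul_sq_Ioi {b : ℝ} (hb : 0 < b) :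
    ∫⁻ y in Set.Ioi (0 : ℝ), ENNReal.ofReal (Real.exp (-b * y ^ 2)) =
      ENNReal.ofReal ((Real.pi / b) ^ (1 / 2 : ℝ) / 2) := by
  rw [← Real.sqrt_eq_rpow, ← integral_gaussian_Ioi, ofReal_integral_eq_lintegral_ofReal
    (integrable_exp_neg_mul_sq hb).integrableOn (Eventually.of_forall fun v => (Real.exp_pos _).le)]

theorem lintegral_exp_neg_bracket (m : ℕ) {b : ℝ} (hb : 0 < b) :
    ∫⁻ X : ℂ × Sing m, ENNReal.ofReal (Real.exp (-b * bracket X)) =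
      ENNReal.ofReal (Real.exp (-b) * (Real.pi / b) ^ ((m : ℝ) / 2 + 1)) := by
  have h1 : ∀ X : ℂ × Sing m, ENNReal.ofReal (Real.exp (-b * bracket X)) =
      ENNReal.ofReal (Real.exp (-b)) * (ENNReal.ofReal (Real.exp (-b * ‖X.1‖ ^ 2)) *
        ENNReal.ofReal (Real.exp (-b * ‖X.2‖ ^ 2))) := by
    intro X
    rw [← ENNReal.ofReal_mul (Real.exp_pos _).le, ← ENNReal.ofReal_mul (Real.exp_pos _).le,
      ← Real.exp_add, ← Real.exp_add, bracket]
    congr 2; ring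
  simp only [h1]
  rw [lintegral_const_mul _ (by fun_prop), Measure.volume_eq_prod,
    lintegral_prod_mul (f := fun z : ℂ => ENNReal.ofReal (Real.exp (-b * ‖z‖ ^ 2)))
      (g := fun t : Sing m => ENNReal.ofReal (Real.exp (-b * ‖t‖ ^ 2))) (by fun_prop) (by fun_prop),
    lintegral_exp_neg_mul_sq_norm hb, lintegral_exp_neg_mul_sq_norm hb,
    ← ENNReal.ofReal_mul (by positivity), ← ENNReal.ofReal_mul (by positivity),
    ← Real.rpow_add (by positivity), Complex.finrank_real_complex, finrank_euclideanSpace,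
    Fintype.card_fin]
  congr 3
  push_cast; ring

theorem lintegral_rpow_mul_exp_Ioi {s r : ℝ} (hs : 0 < s) (hr : 0 < r) :
    ∫⁻ t in Set.Ioi (0 : ℝ), ENNReal.ofReal (t ^ (s - 1) * Real.exp (-(r * t))) =
      ENNReal.ofReal (r ^ (-s) * Real.Gamma s) := by
  have h := Real.integral_rpow_mul_exp_neg_mul_Ioi hs hr
  rw [one_div, Real.inv_rpow hr.le, ← Real.rpow_neg hr.le] at h
  have hpos : 0 < r ^ (-s) * Real.Gamma s := mul_pos (by positivity) (Real.Gamma_pos_of_pos hs)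
  have hi : IntegrableOn (fun t : ℝ => t ^ (s - 1) * Real.exp (-(r * t))) (Set.Ioi 0) := by
    by_contra hni
    rw [integral_undef hni] at h
    exact hpos.ne h
  rw [← h, ofReal_integral_eq_lintegral_ofReal hi]
  filter_upwards [ae_restrict_mem measurableSet_Ioi] with t ht
  have : 0 < t := ht
  simp only [Pi.zero_apply]
  positivity

/-- `Γ(s) r^(-s)` is the integral of `t^(s-1) e^(-rt)`. With `r = 1 + |X|² + y²` this makes the
integrals over `X` and `y` Gaussian, and Tonelli's theorem needs no integrability. -/
theorem lintegral_bracket_add_sq (m : ℕ) :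
    ENNReal.ofReal (Real.Gamma (expo m + 2)) * ∫⁻ X : ℂ × Sing m, ∫⁻ y in Set.Ioi (0 : ℝ),
      ENNReal.ofReal ((bracket X + y ^ 2) ^ (-expo m - 2)) =
      ENNReal.ofReal (Real.pi ^ (expo m + 1) / 2) := by
  have ha := expo_pos m
  have hG : 0 < Real.Gamma (expo m + 2) := Real.Gamma_pos_of_pos (by linarith)
  set G : (ℂ × Sing m) → ℝ → ℝ → ℝ≥0∞ := fun X y t =>
    ENNReal.ofReal (t ^ (expo m + 2 - 1) * Real.exp (-((bracket X + y ^ 2) * t))) with hGdef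
  have hbr := (continuous_bracket (m := m)).measurable
  have hb : ∀ X : ℂ × Sing m, ∀ y : ℝ, 0 < bracket X + y ^ 2 := fun X y => by
    nlinarith [one_le_bracket X, sq_nonneg y]
  have h1 : ∀ X : ℂ × Sing m, ∀ y : ℝ, ENNReal.ofReal (Real.Gamma (expo m + 2)) *
      ENNReal.ofReal ((bracket X + y ^ 2) ^ (-expo m - 2)) = ∫⁻ t in Set.Ioi (0 : ℝ), G X y t := by
    intro X y
    rw [hGdef, lintegral_rpow_mul_exp_Ioi (by linarith) (hb X y), ← ENNReal.ofReal_mul hG.le]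
    congr 1
    rw [mul_comm]; congr 2; ring
  have m1 : Measurable fun y : ((ℂ × Sing m) × ℝ) × ℝ => G y.1.1 y.1.2 y.2 := by
    simp only [hGdef]; fun_prop
  have h2 : ENNReal.ofReal (Real.Gamma (expo m + 2)) * ∫⁻ X : ℂ × Sing m,
      ∫⁻ y in Set.Ioi (0 : ℝ), ENNReal.ofReal ((bracket X + y ^ 2) ^ (-expo m - 2)) =
      ∫⁻ X : ℂ × Sing m, ∫⁻ y in Set.Ioi (0 : ℝ), ∫⁻ t in Set.Ioi (0 : ℝ), G X y t := by
    rw [← lintegral_const_mul']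
    · congr 1; ext X
      rw [← lintegral_const_mul' _ _ ENNReal.ofReal_ne_top]
      simp only [h1]
    · exact ENNReal.ofReal_ne_top
  have h3 : ∀ X : ℂ × Sing m, ∫⁻ y in Set.Ioi (0 : ℝ), ∫⁻ t in Set.Ioi (0 : ℝ), G X y t =
      ∫⁻ t in Set.Ioi (0 : ℝ), ∫⁻ y in Set.Ioi (0 : ℝ), G X y t := by
    intro X
    apply lintegral_lintegral_swap
    have hm : Measurable fun z : ℝ × ℝ => ((X, z.1), z.2) := by fun_prop
    exact (m1.comp hm).aemeasurable
  have h4 : ∫⁻ X : ℂ × Sing m, ∫⁻ t in Set.Ioi (0 : ℝ), ∫⁻ y in Set.Ioi (0 : ℝ), G X y t =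
      ∫⁻ t in Set.Ioi (0 : ℝ), ∫⁻ X : ℂ × Sing m, ∫⁻ y in Set.Ioi (0 : ℝ), G X y t := by
    apply lintegral_lintegral_swap
    have hm : Measurable fun z : ((ℂ × Sing m) × ℝ) × ℝ => ((z.1.1, z.2), z.1.2) := by fun_prop
    exact (Measurable.lintegral_prod_right' (m1.comp hm)).aemeasurable
  -- The powers of `t` cancel exactly. The factor `t ^ (1 - 1)` is kept so that what remains is the
  -- integral for `Γ(1)`.
  have h5 : ∀ t ∈ Set.Ioi (0 : ℝ), ∫⁻ X : ℂ × Sing m, ∫⁻ y in Set.Ioi (0 : ℝ), G X y t =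
      ENNReal.ofReal (Real.pi ^ (expo m + 1) / 2) * ENNReal.ofReal (t ^ ((1 : ℝ) - 1) *
        Real.exp (-(1 * t))) := by
    intro t ht
    have ht : 0 < t := ht
    have e1 : ∀ X : ℂ × Sing m, ∀ y : ℝ, G X y t = ENNReal.ofReal (t ^ (expo m + 2 - 1)) *
        (ENNReal.ofReal (Real.exp (-t * bracket X)) * ENNReal.ofReal (Real.exp (-t * y ^ 2))) := by
      intro X y
      rw [hGdef, ← ENNReal.ofReal_mul (Real.exp_pos _).le, ← ENNReal.ofReal_mul (by positivity),
        ← Real.exp_add]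
      ring_nf
    have e2 : ∀ X : ℂ × Sing m, ∫⁻ y in Set.Ioi (0 : ℝ), G X y t =
        ENNReal.ofReal (t ^ (expo m + 2 - 1)) * (ENNReal.ofReal ((Real.pi / t) ^ (1 / 2 : ℝ) / 2) *
        ENNReal.ofReal (Real.exp (-t * bracket X))) := by
      intro X
      simp only [e1]
      rw [lintegral_const_mul' _ _ ENNReal.ofReal_ne_top,
        lintegral_const_mul' _ _ ENNReal.ofReal_ne_top, lintegral_exp_neg_mul_sq_Ioi ht,
        mul_comm (ENNReal.ofReal (Real.exp _))]
    simp only [e2]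
    rw [lintegral_const_mul' _ _ ENNReal.ofReal_ne_top,
        lintegral_const_mul' _ _ ENNReal.ofReal_ne_top, lintegral_exp_neg_bracket m ht,
        ← ENNReal.ofReal_mul (by positivity), ← ENNReal.ofReal_mul (by positivity),
        ← ENNReal.ofReal_mul (by positivity)]
    congr 1
    have e3 : (Real.pi / t) ^ (1 / 2 : ℝ) * (Real.pi / t) ^ ((m : ℝ) / 2 + 1) =
        Real.pi ^ (expo m + 1) * t ^ (-(expo m + 1)) := by
      have e5 : (1 / 2 : ℝ) + ((m : ℝ) / 2 + 1) = expo m + 1 := by unfold expo; ring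
      rw [← Real.rpow_add (by positivity), e5, Real.div_rpow Real.pi_pos.le ht.le,
        Real.rpow_neg ht.le, div_eq_mul_inv]
    have e4 : t ^ (expo m + 2 - 1) * t ^ (-(expo m + 1)) = 1 := by
      rw [← Real.rpow_add ht]; ring_nf; simp
    rw [sub_self, Real.rpow_zero, one_mul, one_mul]
    calc _ = t ^ (expo m + 2 - 1) * (Real.exp (-t) / 2) *
          ((Real.pi / t) ^ (1 / 2 : ℝ) * (Real.pi / t) ^ ((m : ℝ) / 2 + 1)) := by ring
      _ = (t ^ (expo m + 2 - 1) * t ^ (-(expo m + 1))) * (Real.exp (-t) / 2) *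
          Real.pi ^ (expo m + 1) := by rw [e3]; ring
      _ = _ := by rw [e4]; ring
  rw [h2]
  simp only [h3]
  rw [h4, setLIntegral_congr_fun measurableSet_Ioi h5,
    lintegral_const_mul' _ _ ENNReal.ofReal_ne_top, lintegral_rpow_mul_exp_Ioi one_pos one_pos,
    Real.one_rpow, Real.Gamma_one]
  simp

theorem mass_eq (m : ℕ) : mass m = Real.pi ^ (expo m + 1) / Real.Gamma (expo m) := by
  have ha := expo_pos m
  have hG : 0 < Real.Gamma (expo m + 2) := Real.Gamma_pos_of_pos (by linarith)
  have hG0 : 0 < Real.Gamma (expo m) := Real.Gamma_pos_of_pos ha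
  have hb : ∀ X : ℂ × Sing m, ∀ y : ℝ, 0 < bracket X + y ^ 2 := fun X y => by
    nlinarith [one_le_bracket X, sq_nonneg y]
  have hcont : Continuous fun z : (ℂ × Sing m) × ℝ => (bracket z.1 + z.2 ^ 2) ^ (-expo m - 2) := by
    have := continuous_bracket (m := m)
    exact Continuous.rpow_const (by fun_prop) fun z => Or.inl (hb z.1 z.2).ne'
  set J : ℂ × Sing m → ℝ := fun X => ∫ y in Set.Ioi (0 : ℝ), (bracket X + y ^ 2) ^ (-expo m - 2)
    with hJ
  have h1 : ∀ X, ENNReal.ofReal (J X) =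
      ∫⁻ y in Set.Ioi (0 : ℝ), ENNReal.ofReal ((bracket X + y ^ 2) ^ (-expo m - 2)) := by
    intro X
    exact ofReal_integral_eq_lintegral_ofReal
      (integrable_profile_integrand (one_le_bracket X)).integrableOn
      (Eventually.of_forall fun y => (Real.rpow_pos_of_pos (hb X y) _).le)
  have h2 : ∫ X, J X = (∫⁻ X, ENNReal.ofReal (J X)).toReal := by
    apply integral_eq_lintegral_of_nonneg_ae
    · exact Eventually.of_forall fun X => integral_nonneg fun y =>
        (Real.rpow_pos_of_pos (hb X y) _).le
    · exact (StronglyMeasurable.integral_prod_right (ν := volume.restrict (Set.Ioi (0 : ℝ)))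
        (f := fun X y => (bracket X + y ^ 2) ^ (-expo m - 2))
        hcont.stronglyMeasurable).aestronglyMeasurable
  have h3 := lintegral_bracket_add_sq m
  simp only [← h1] at h3
  have h4 := congrArg ENNReal.toReal h3
  rw [ENNReal.toReal_mul, ← h2, ENNReal.toReal_ofReal hG.le,
    ENNReal.toReal_ofReal (by positivity)] at h4
  have h5 : Real.Gamma (expo m + 2) = (expo m + 1) * (expo m * Real.Gamma (expo m)) := by
    rw [← Real.Gamma_add_one ha.ne', ← Real.Gamma_add_one (by linarith)]; congr 1; ring
  rw [mass, integral_const_mul, eq_div_iff hG0.ne']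
  rw [h5] at h4
  linarith

/-- The normalization: `κ` times `green 0` is the Green's function of the Laplacian, with its sign.
-/
theorem kappa_mul_mass (m : ℕ) : kappa m * mass m = -1 := by
  have hG0 : 0 < Real.Gamma (expo m) := Real.Gamma_pos_of_pos (expo_pos m)
  have hpi := Real.pi_pos
  have h : kappa m = -2 / (Real.pi * (2 * Real.pi ^ expo m / Real.Gamma (expo m))) := rfl
  rw [mass_eq, h, Real.rpow_add_one hpi.ne']
  field_simp

/-! ### The regularized representation of the weak solution -/

theorem norm_fst_pow_three_le_weight {m : ℕ} (p : ℂ × Sing m) : ‖p.1‖ ^ 3 ≤ weight p := by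
  have h := norm_nonneg p.1
  unfold weight
  nlinarith [sq_nonneg (‖p.1‖ ^ 2 - ‖p.1‖), sq_nonneg (‖p.1‖ - 1), sq_nonneg ‖p.2‖,
    sq_nonneg (‖p.1‖ ^ 2 - 1)]

theorem continuous_mollifier {m : ℕ} {e : ℝ} (he : 0 < e) :
    Continuous fun y : (ℂ × Sing m) × (ℂ × Sing m) => mollifier e y.1 y.2 := by
  unfold mollifier
  have h := (continuous_quad_rpow (m := m) he (-expo m - 2))
  have h1 : Continuous fun y : ((ℂ × Sing m) × (ℂ × Sing m)) × ℝ =>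
      quad e y.2 y.1.1 y.1.2 ^ (-expo m - 2) := by
    have h2 : Continuous fun y : ((ℂ × Sing m) × (ℂ × Sing m)) × ℝ => (y.2, y.1.1, y.1.2) := by
      fun_prop
    have := h.comp h2
    simpa only [Function.comp_def] using this
  have h3 : Continuous fun y : (ℂ × Sing m) × (ℂ × Sing m) =>
      ∫ x in (0 : ℝ)..1, quad e x y.1 y.2 ^ (-expo m - 2) :=
    intervalIntegral.continuous_parametric_intervalIntegral_of_continuous'
      (f := fun (y : (ℂ × Sing m) × (ℂ × Sing m)) x => quad e x y.1 y.2 ^ (-expo m - 2)) h1 _ _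
  fun_prop

/-- The mollifier decays uniformly as long as `quad` is comparable to `weight`. -/
theorem norm_pow_mul_mollifier_le {m : ℕ} {e c K : ℝ} (he : 0 < e) (he1 : e ≤ 1) (hc : 0 < c)
    {p' p : ℂ × Sing m} (hp' : ‖p'‖ ≤ K) (hq : ∀ x, c * weight p ≤ quad e x p' p) :
    ‖p.1‖ ^ 3 * |mollifier e p' p| ≤
      4 * expo m * (expo m + 1) * K * c ^ (-expo m - 2) * weight p ^ (-expo m) := by
  have ha := expo_pos m
  have hW := weight_pos p
  have hK : 0 ≤ K := (norm_nonneg _).trans hp'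
  have h1 : |∫ x in (0 : ℝ)..1, quad e x p' p ^ (-expo m - 2)| ≤
      c ^ (-expo m - 2) * weight p ^ (-expo m - 2) := by
    have := intervalIntegral.norm_integral_le_of_norm_le_const (a := 0) (b := 1)
      (f := fun x => quad e x p' p ^ (-expo m - 2))
      (C := c ^ (-expo m - 2) * weight p ^ (-expo m - 2)) ?_
    · simpa using this
    · intro x _
      rw [Real.norm_of_nonneg (Real.rpow_nonneg (quad_pos he x p' p).le _),
        ← Real.mul_rpow hc.le hW.le]
      exact Real.rpow_le_rpow_of_nonpos (by positivity) (hq x) (by linarith)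
  have h2 : |inner ℝ p'.1 p.1| ≤ K * ‖p.1‖ :=
    (abs_real_inner_le_norm _ _).trans (by gcongr; exact (norm_fst_le p').trans hp')
  have h3 : ‖p.1‖ ^ 4 * weight p ^ (-expo m - 2) ≤ weight p ^ (-expo m) := by
    have e1 : weight p ^ (-expo m) = weight p ^ 2 * weight p ^ (-expo m - 2) := by
      rw [← Real.rpow_natCast, ← Real.rpow_add hW]; congr 1; push_cast; ring
    rw [e1]
    gcongr
    exact (norm_fst_pow_four_le_weight p).trans (by nlinarith [one_le_weight p])
  have h4 : |mollifier e p' p| ≤ 4 * expo m * (expo m + 1) * 1 * (K * ‖p.1‖) *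
      (c ^ (-expo m - 2) * weight p ^ (-expo m - 2)) := by
    rw [mollifier, abs_mul, abs_mul, abs_of_nonneg (by positivity : 0 ≤ 4 * expo m * (expo m + 1) * e)]
    gcongr
  calc _ ≤ ‖p.1‖ ^ 3 * (4 * expo m * (expo m + 1) * 1 * (K * ‖p.1‖) *
      (c ^ (-expo m - 2) * weight p ^ (-expo m - 2))) := by gcongr
    _ = 4 * expo m * (expo m + 1) * K * c ^ (-expo m - 2) *
      (‖p.1‖ ^ 4 * weight p ^ (-expo m - 2)) := by ring
    _ ≤ _ := by gcongr

theorem exists_test_bounds {m : ℕ} {ψ : ℂ × Sing m → ℝ} (hψ : IsTestSection ψ) :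
    ∃ B K : ℝ, 0 ≤ B ∧ 0 ≤ K ∧ (∀ p, |ψ p| ≤ B) ∧ ∀ p, ψ p ≠ 0 → ‖p‖ ≤ K := by
  obtain ⟨B, hB⟩ := hψ.compact.exists_bound_of_continuous hψ.smooth.continuous
  obtain ⟨K, hK⟩ := hψ.compact.isBounded.exists_norm_le
  refine ⟨B, max K 0, (norm_nonneg _).trans (hB 0), le_max_right _ _, hB, fun p hp => ?_⟩
  exact (hK p (subset_tsupport _ hp)).trans (le_max_left _ _)

theorem integrable_branch {m : ℕ} {ψ : ℂ × Sing m → ℝ} (hψ : IsTestSection ψ) :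
    Integrable (branch ψ) := by
  obtain ⟨B, K, hB0, hK0, hB, hK⟩ := exists_test_bounds hψ
  have hfin : volume (Metric.closedBall (0 : ℂ × Sing m) (K + K ^ 2)) ≠ ⊤ :=
    (isCompact_closedBall _ _).measure_lt_top.ne
  have hi : IntegrableOn (branch ψ) (Metric.closedBall (0 : ℂ × Sing m) (K + K ^ 2)) :=
    Measure.integrableOn_of_bounded (M := B) hfin (aestronglyMeasurable_branch hψ.smooth.continuous)
      (Eventually.of_forall fun p => hB _)
  refine (integrableOn_iff_integrable_of_support_subset fun p hp => ?_).1 hi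
  have h1 := hK _ (show ψ (root p) ≠ 0 from hp)
  have h2 : ‖p.1‖ ≤ K ^ 2 := by
    rw [← norm_root_fst_sq]
    have := (norm_fst_le _).trans h1
    gcongr
  have h3 : ‖p.2‖ ≤ K := (norm_snd_le (root p)).trans h1
  rw [mem_closedBall_zero_iff, Prod.norm_def]
  exact max_le (h2.trans (by linarith)) (h3.trans (by nlinarith))

/-- Uniformity in `ε` comes from two regimes. For bounded weight the mollified section is bounded by
its supremum times an absolute constant. For large weight `weight_le_quad_add` gives `quad ≥ weight
/ 4` on the support of `ψ`, whatever `ε` is. The factor `|w|³` is what `norm_mul_le_majorant`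
requires. -/
theorem exists_mollify_bound {m : ℕ} {ψ : ℂ × Sing m → ℝ} (hψ : IsTestSection ψ) :
    ∃ C, 0 ≤ C ∧ ∀ ε : ℝ, 0 < ε → ε ≤ 1 → ∀ p : ℂ × Sing m, p.1 ≠ 0 →
      ‖p.1‖ ^ 3 * |mollify (ε ^ 2) ψ p| ≤ C * weight p ^ (-expo m) := by
  obtain ⟨B, K, hB0, hK0, hB, hK⟩ := exists_test_bounds hψ
  have ha := expo_pos m
  set A := 1 + 2 * K ^ 4 + 2 * K ^ 2 with hA
  have hApos : 0 < A := by positivity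
  set M := B * (2 * expo m * (expo m + 1) *
      (Real.pi * ∫ X : ℂ × Sing m, bracket X ^ (-expo m - 1))) with hM
  have hM0 : 0 ≤ M := by
    have : 0 ≤ ∫ X : ℂ × Sing m, bracket X ^ (-expo m - 1) :=
      integral_nonneg fun X => Real.rpow_nonneg (by linarith [one_le_bracket X]) _
    positivity
  set D := 4 * expo m * (expo m + 1) * K * (1 / 4 : ℝ) ^ (-expo m - 2) with hD
  have hD0 : 0 ≤ D := by positivity
  have hI0 : 0 ≤ ∫ y, |branch ψ y| := integral_nonneg fun y => abs_nonneg _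
  refine ⟨2 * A * M * (2 * A) ^ expo m + (∫ y, |branch ψ y|) * D, by positivity,
    fun ε hε hε1 p hp => ?_⟩
  have hW := weight_pos p
  have hWr : 0 < weight p ^ (-expo m) := by positivity
  rw [add_mul]
  rcases le_total (weight p) (2 * A) with h | h
  · have h1 := abs_mollify_le hψ.odd hB hε hp
    have h2 : 1 ≤ (2 * A) ^ expo m * weight p ^ (-expo m) := by
      rw [Real.rpow_neg hW.le, ← div_eq_mul_inv, le_div_iff₀ (by positivity), one_mul]
      exact Real.rpow_le_rpow hW.le h ha.le
    have h3 : ‖p.1‖ ^ 3 * |mollify (ε ^ 2) ψ p| ≤ 2 * A * M :=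
      mul_le_mul ((norm_fst_pow_three_le_weight p).trans h) h1 (abs_nonneg _) (by positivity)
    have h4 : 0 ≤ (∫ y, |branch ψ y|) * D * weight p ^ (-expo m) := by positivity
    have h5 : 2 * A * M * 1 ≤ 2 * A * M * ((2 * A) ^ expo m * weight p ^ (-expo m)) := by gcongr
    linarith
  · have h1 : ∀ y : ℂ × Sing m, ‖branch ψ y * mollifier (ε ^ 2) (root y) p‖ ≤
        |branch ψ y| * (D * weight p ^ (-expo m) / ‖p.1‖ ^ 3) := by
      intro y
      rw [norm_mul, Real.norm_eq_abs, Real.norm_eq_abs]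
      by_cases h0 : ψ (root y) = 0
      · rw [branch_eq, h0]; simp
      gcongr
      have hr : 0 < ‖p.1‖ := norm_pos_iff.2 hp
      rw [le_div_iff₀ (by positivity), mul_comm]
      refine norm_pow_mul_mollifier_le (by positivity) (pow_le_one₀ hε.le hε1) (by norm_num)
        (hK _ h0) fun x => ?_
      have := weight_le_quad_add (hK _ h0) (ε ^ 2) x p
      have h6 : 0 < ε ^ 2 := by positivity
      linarith
    have h2 : |mollify (ε ^ 2) ψ p| ≤ ∫ y : ℂ × Sing m,
        |branch ψ y| * (D * weight p ^ (-expo m) / ‖p.1‖ ^ 3) := by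
      rw [mollify, ← Real.norm_eq_abs]
      exact norm_integral_le_of_norm_le ((integrable_branch hψ).abs.mul_const _)
        (Eventually.of_forall h1)
    rw [integral_mul_const] at h2
    have hr : 0 < ‖p.1‖ := norm_pos_iff.2 hp
    have h3 : ‖p.1‖ ^ 3 * |mollify (ε ^ 2) ψ p| ≤ (∫ y, |branch ψ y|) * D * weight p ^ (-expo m) := by
      calc _ ≤ ‖p.1‖ ^ 3 * ((∫ y, |branch ψ y|) * (D * weight p ^ (-expo m) / ‖p.1‖ ^ 3)) := by gcongr
        _ = _ := by field_simp
    have h4 : 0 ≤ 2 * A * M * (2 * A) ^ expo m * weight p ^ (-expo m) := by positivity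
    linarith

theorem norm_mul_le_majorant {m : ℕ} {C V G : ℝ} {p : ℂ × Sing m} (hp : p.1 ≠ 0)
    (hG : ‖(root p).1‖ ^ 3 * |G| ≤ C * weight (root p) ^ (-expo m)) :
    ‖V * G‖ ≤ C * (‖V‖ / ‖p.1‖ * majorant (root p)) := by
  have hr : 0 < ‖(root p).1‖ := norm_pos_iff.2 (root_fst_ne_zero hp)
  have h1 : |G| ≤ C * weight (root p) ^ (-expo m) / ‖(root p).1‖ ^ 3 := by
    rw [le_div_iff₀ (by positivity)]; linarith
  rw [norm_mul, Real.norm_eq_abs G, majorant, ← norm_root_fst_sq]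
  calc _ ≤ ‖V‖ * (C * weight (root p) ^ (-expo m) / ‖(root p).1‖ ^ 3) := by gcongr
    _ = _ := by field_simp

/-- Fubini's theorem moves the mollifier from the solution to the test section. Here `e` is fixed,
so constants depending on `e` are harmless. -/
theorem integral_mul_mollify {m : ℕ} {V ψ : ℂ × Sing m → ℝ} (hVm : AEStronglyMeasurable V volume)
    (hV : MemLp (fun p => V p / ‖p.1‖) 2) (hψ : IsTestSection ψ) {e : ℝ} (he : 0 < e)
    (he1 : e ≤ 1) :
    ∫ y, branch ψ y * ∫ p, V p * mollifier e (root y) (root p) =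
      ∫ p, V p * mollify e ψ (root p) := by
  obtain ⟨B, K, hB0, hK0, hB, hK⟩ := exists_test_bounds hψ
  obtain ⟨c, hc, hq⟩ := exists_weight_le_quad (m := m) he K
  have hm : Measurable fun z : (ℂ × Sing m) × (ℂ × Sing m) => mollifier e (root z.1) (root z.2) := by
    have h1 : Measurable fun z : (ℂ × Sing m) × (ℂ × Sing m) => (root z.1, root z.2) :=
      (measurable_root.comp measurable_fst).prodMk (measurable_root.comp measurable_snd)
    have := (continuous_mollifier (m := m) he).measurable.comp h1
    simpa only [Function.comp_def] using this
  have hi : Integrable (fun z : (ℂ × Sing m) × (ℂ × Sing m) =>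
      branch ψ z.1 * (V z.2 * mollifier e (root z.1) (root z.2))) (volume.prod volume) := by
    have hdom := (integrable_branch hψ).abs.mul_prod ((integrable_mul_majorant hV).const_mul
      (4 * expo m * (expo m + 1) * K * c ^ (-expo m - 2)))
    refine hdom.mono' ?_ ?_
    · exact ((aestronglyMeasurable_branch hψ.smooth.continuous).comp_fst).mul
        (hVm.comp_snd.mul hm.aestronglyMeasurable)
    · have hne : ∀ᵐ z : (ℂ × Sing m) × (ℂ × Sing m) ∂(volume.prod volume), z.2.1 ≠ 0 :=
        Measure.quasiMeasurePreserving_snd.ae ae_fst_ne_zero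
      filter_upwards [hne] with z hz
      rw [norm_mul, Real.norm_eq_abs]
      by_cases h0 : ψ (root z.1) = 0
      · rw [branch_eq, h0]; simp
      gcongr
      exact norm_mul_le_majorant hz (norm_pow_mul_mollifier_le he he1 hc (hK _ h0)
        fun x => hq _ (hK _ h0) x _)
  have h2 := integral_integral_swap (f := fun y p =>
    branch ψ y * (V p * mollifier e (root y) (root p))) hi
  simp only [integral_const_mul] at h2
  rw [h2]
  congr 1; ext p
  rw [mollify, ← integral_const_mul]
  congr 1; ext y; ring

theorem measurable_mollify {m : ℕ} {ψ : ℂ × Sing m → ℝ} (hψ : Continuous ψ) {e : ℝ} (he : 0 < e) :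
    Measurable (mollify e ψ) := by
  have hm : Measurable fun z : (ℂ × Sing m) × (ℂ × Sing m) =>
      branch ψ z.2 * mollifier e (root z.2) z.1 := by
    have h1 : Measurable fun z : (ℂ × Sing m) × (ℂ × Sing m) => (root z.2, z.1) :=
      (measurable_root.comp measurable_snd).prodMk measurable_fst
    have h2 := (continuous_mollifier (m := m) he).measurable.comp h1
    have h3 : Measurable fun z : (ℂ × Sing m) × (ℂ × Sing m) => branch ψ z.2 :=
      hψ.measurable.comp (measurable_root.comp measurable_snd)
    exact h3.mul (by simpa only [Function.comp_def] using h2)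
  exact (StronglyMeasurable.integral_prod_right
    (f := fun p y => branch ψ y * mollifier e (root y) p) hm.stronglyMeasurable).measurable

/-- The representation of the weak solution by the Green's function, tested against `ψ`. -/
theorem tendsto_integral_green {m : ℕ} {φ : ℕ → ℂ × Sing m → ℝ} {V R : ℂ × Sing m → ℝ}
    (h : IsEnergyLimit φ V) (hRm : AEStronglyMeasurable R volume)
    (hR : MemLp (fun p => R p * ‖p.1‖) 2)
    (hw : ∀ ψ : ℂ × Sing m → ℝ, IsTestSection ψ →
      Tendsto (fun j => dirichletForm (φ j) ψ) atTop (𝓝 (-∫ p, R p * branch ψ p)))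
    {ψ : ℂ × Sing m → ℝ} (hψ : IsTestSection ψ) :
    Tendsto (fun ε : ℝ => ∫ y, branch ψ y * ∫ p, R p * green (ε ^ 2) (root y) (root p))
      (𝓝[>] 0) (𝓝 (-(mass m * ∫ p, V p * branch ψ p))) := by
  obtain ⟨B, K, hB0, hK0, hB, hK⟩ := exists_test_bounds hψ
  obtain ⟨C, hC0, hC⟩ := exists_mollify_bound hψ
  have hsmall : ∀ᶠ ε : ℝ in 𝓝[>] 0, 0 < ε ∧ ε ≤ 1 := by
    filter_upwards [Ioc_mem_nhdsGT (zero_lt_one' ℝ)] with ε hε using hε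
  have h1 : (fun ε : ℝ => ∫ y, branch ψ y * ∫ p, R p * green (ε ^ 2) (root y) (root p))
      =ᶠ[𝓝[>] 0] fun ε => -∫ p, V p * mollify (ε ^ 2) ψ (root p) := by
    filter_upwards [hsmall] with ε hε
    have he : 0 < ε ^ 2 := pow_pos hε.1 2
    rw [← integral_mul_mollify h.measurable h.memLp hψ he (pow_le_one₀ hε.1.le hε.2), ← integral_neg]
    congr 1; ext y
    rw [integral_mul_mollifier h hRm hR hw he]; ring
  refine Tendsto.congr' h1.symm (Tendsto.neg ?_)
  have h2 : mass m * ∫ p, V p * branch ψ p = ∫ p, V p * (mass m * ψ (root p)) := by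
    rw [← integral_const_mul]; congr 1; ext p; rw [branch_eq]; ring
  rw [h2]
  apply tendsto_integral_filter_of_dominated_convergence
    (fun p => C * (‖V p‖ / ‖p.1‖ * majorant (root p)))
  · filter_upwards [hsmall] with ε hε
    exact h.measurable.mul ((measurable_mollify hψ.smooth.continuous
      (pow_pos hε.1 2)).comp measurable_root).aestronglyMeasurable
  · filter_upwards [hsmall] with ε hε
    filter_upwards [ae_fst_ne_zero] with p hp
    exact norm_mul_le_majorant hp (hC ε hε.1 hε.2 _ (root_fst_ne_zero hp))
  · exact (integrable_mul_majorant h.memLp).const_mul _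
  · filter_upwards [ae_fst_ne_zero] with p hp
    exact (tendsto_mollify hψ.odd hψ.smooth.continuous hB (root_fst_ne_zero hp)).const_mul _

/-! ### Riesz kernels -/

/-- The Riesz kernel `|p - c| ^ (γ - n)`, cut off to the ball of radius `s`. -/
noncomputable def rieszNear {m : ℕ} (γ s : ℝ) (c p : ℂ × Sing m) : ℝ :=
  (Set.Iio s).indicator (fun y => y ^ (γ - ((m : ℝ) + 2))) ‖p - c‖

/-- The kernel `|p - c| ^ (-γ - n)`, cut off to the complement of the ball of radius `s`. -/
noncomputable def rieszFar {m : ℕ} (γ s : ℝ) (c p : ℂ × Sing m) : ℝ :=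
  (Set.Ici s).indicator (fun y => y ^ (-γ - ((m : ℝ) + 2))) ‖p - c‖

theorem rieszNear_nonneg {m : ℕ} (γ s : ℝ) (c p : ℂ × Sing m) : 0 ≤ rieszNear γ s c p :=
  Set.indicator_apply_nonneg fun _ => Real.rpow_nonneg (norm_nonneg _) _

theorem rieszFar_nonneg {m : ℕ} (γ s : ℝ) (c p : ℂ × Sing m) : 0 ≤ rieszFar γ s c p :=
  Set.indicator_apply_nonneg fun _ => Real.rpow_nonneg (norm_nonneg _) _

/-- The radial Jacobian `y ^ (n - 1)` in polar coordinates; it depends only on the homogeneity of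
the norm, so the maximum norm of the product does as well as the Euclidean one. -/
theorem pow_smul_indicator_eq {m : ℕ} (S : Set ℝ) (e : ℝ) {y : ℝ} (hy : 0 < y) :
    y ^ (Module.finrank ℝ (ℂ × Sing m) - 1) • S.indicator (fun y => y ^ (e - ((m : ℝ) + 2))) y =
      S.indicator (fun y => y ^ (e - 1)) y := by
  by_cases h : y ∈ S
  · rw [Set.indicator_of_mem h, Set.indicator_of_mem h, finrank_total, smul_eq_mul,
      ← Real.rpow_natCast, ← Real.rpow_add hy]
    congr 1
    rw [show m + 2 - 1 = m + 1 by omega]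
    push_cast; ring
  · rw [Set.indicator_of_notMem h, Set.indicator_of_notMem h, smul_zero]

theorem exists_rieszNear_bound (m : ℕ) {γ : ℝ} (hγ : 0 < γ) :
    ∃ C, 0 ≤ C ∧ ∀ (c : ℂ × Sing m) (s : ℝ), 0 < s →
      Integrable (rieszNear γ s c) ∧ ∫ p, rieszNear γ s c p ≤ C * s ^ γ := by
  set M := (Module.finrank ℝ (ℂ × Sing m) : ℝ) *
    (volume : Measure (ℂ × Sing m)).real (Metric.ball 0 1)
  refine ⟨M / γ, by positivity, fun c s hs => ?_⟩
  have hi : IntegrableOn (fun y : ℝ => (Set.Iio s).indicator (fun y => y ^ (γ - 1)) y)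
      (Set.Ioi 0) := by
    rw [IntegrableOn, integrable_indicator_iff measurableSet_Iio, IntegrableOn,
      Measure.restrict_restrict measurableSet_Iio]
    have := (intervalIntegral.intervalIntegrable_rpow' (a := 0) (b := s) (r := γ - 1) (by linarith)).1
    refine this.mono_set fun y hy => ⟨hy.2, hy.1.le⟩
  have h0 : Integrable (rieszNear γ s (0 : ℂ × Sing m)) := by
    unfold rieszNear
    simp only [sub_zero]
    refine (integrable_fun_norm_addHaar volume).2 (hi.congr_fun (fun y hy => ?_) measurableSet_Ioi)
    exact (pow_smul_indicator_eq _ _ hy).symm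
  have e0 : ∫ p, rieszNear γ s (0 : ℂ × Sing m) p = M / γ * s ^ γ := by
    unfold rieszNear
    simp only [sub_zero]
    rw [integral_fun_norm_addHaar volume,
      setIntegral_congr_fun measurableSet_Ioi fun y hy => pow_smul_indicator_eq _ _ hy,
      setIntegral_indicator measurableSet_Iio, Set.Ioi_inter_Iio, ← integral_Ioc_eq_integral_Ioo,
      ← intervalIntegral.integral_of_le hs.le, integral_rpow (Or.inl (by linarith)),
      sub_add_cancel, Real.zero_rpow hγ.ne', sub_zero, nsmul_eq_mul, smul_eq_mul]
    ring
  constructor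
  · exact (h0.comp_sub_right c).congr (Eventually.of_forall fun p => by simp [rieszNear])
  · have := integral_sub_right_eq_self (μ := (volume : Measure (ℂ × Sing m)))
      (rieszNear γ s (0 : ℂ × Sing m)) c
    rw [e0] at this
    rw [← this]
    simp [rieszNear]

theorem exists_rieszFar_bound (m : ℕ) {γ : ℝ} (hγ : 0 < γ) :
    ∃ C, 0 ≤ C ∧ ∀ (c : ℂ × Sing m) (s : ℝ), 0 < s →
      Integrable (rieszFar γ s c) ∧ ∫ p, rieszFar γ s c p ≤ C * s ^ (-γ) := by
  set M := (Module.finrank ℝ (ℂ × Sing m) : ℝ) *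
    (volume : Measure (ℂ × Sing m)).real (Metric.ball 0 1)
  refine ⟨M / γ, by positivity, fun c s hs => ?_⟩
  have hinter : Set.Ioi (0 : ℝ) ∩ Set.Ici s = Set.Ici s :=
    Set.inter_eq_right.2 fun y hy => hs.trans_le hy
  have hi : IntegrableOn (fun y : ℝ => (Set.Ici s).indicator (fun y => y ^ (-γ - 1)) y)
      (Set.Ioi 0) := by
    rw [IntegrableOn, integrable_indicator_iff measurableSet_Ici, IntegrableOn,
      Measure.restrict_restrict measurableSet_Ici, Set.inter_comm, hinter, ← IntegrableOn,
      integrableOn_Ici_iff_integrableOn_Ioi]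
    exact integrableOn_Ioi_rpow_of_lt (by linarith) hs
  have h0 : Integrable (rieszFar γ s (0 : ℂ × Sing m)) := by
    unfold rieszFar
    simp only [sub_zero]
    refine (integrable_fun_norm_addHaar volume).2 (hi.congr_fun (fun y hy => ?_) measurableSet_Ioi)
    exact (pow_smul_indicator_eq _ _ hy).symm
  have e0 : ∫ p, rieszFar γ s (0 : ℂ × Sing m) p = M / γ * s ^ (-γ) := by
    unfold rieszFar
    simp only [sub_zero]
    rw [integral_fun_norm_addHaar volume,
      setIntegral_congr_fun measurableSet_Ioi fun y hy => pow_smul_indicator_eq _ _ hy,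
      setIntegral_indicator measurableSet_Ici, hinter, integral_Ici_eq_integral_Ioi,
      integral_Ioi_rpow_of_lt (by linarith) hs, sub_add_cancel, nsmul_eq_mul, smul_eq_mul,
      neg_div_neg_eq]
    ring
  constructor
  · exact (h0.comp_sub_right c).congr (Eventually.of_forall fun p => by simp [rieszFar])
  · have := integral_sub_right_eq_self (μ := (volume : Measure (ℂ × Sing m)))
      (rieszFar γ s (0 : ℂ × Sing m)) c
    rw [e0] at this
    rw [← this]
    simp [rieszFar]

/-- The Riesz kernel on the unit ball. -/
noncomputable def rieszBall {m : ℕ} (γ : ℝ) (c p : ℂ × Sing m) : ℝ :=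
  (Metric.ball (0 : ℂ × Sing m) 1).indicator (fun p => ‖p - c‖ ^ (γ - ((m : ℝ) + 2))) p

theorem rieszBall_nonneg {m : ℕ} (γ : ℝ) (c p : ℂ × Sing m) : 0 ≤ rieszBall γ c p :=
  Set.indicator_apply_nonneg fun _ => Real.rpow_nonneg (norm_nonneg _) _

/-- Within distance `1` of `c` use `exists_rieszNear_bound`. Beyond it the kernel is at most `1`, as
`γ ≤ 2 ≤ n`. This makes the bound uniform in `c`. -/
theorem exists_rieszBall_bound (m : ℕ) {γ : ℝ} (hγ : 0 < γ) (hγ2 : γ ≤ 2) :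
    ∃ C, 0 ≤ C ∧ ∀ c : ℂ × Sing m, Integrable (rieszBall γ c) ∧ ∫ p, rieszBall γ c p ≤ C := by
  obtain ⟨C, hC0, hC⟩ := exists_rieszNear_bound m hγ
  set b : ℂ × Sing m → ℝ := (Metric.ball (0 : ℂ × Sing m) 1).indicator fun _ => 1
  have hb : Integrable b :=
    (integrable_indicator_iff Metric.isOpen_ball.measurableSet).2
      (integrableOn_const (measure_ball_lt_top).ne)
  have hb0 : ∀ p, 0 ≤ b p := fun p => Set.indicator_apply_nonneg fun _ => zero_le_one
  refine ⟨C + ∫ p, b p, add_nonneg hC0 (integral_nonneg hb0), fun c => ?_⟩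
  obtain ⟨hi, hint⟩ := hC c 1 one_pos
  rw [Real.one_rpow, mul_one] at hint
  have hle : ∀ p, rieszBall γ c p ≤ rieszNear γ 1 c p + b p := by
    intro p
    by_cases hp : p ∈ Metric.ball (0 : ℂ × Sing m) 1
    · rw [rieszBall, Set.indicator_of_mem hp]
      by_cases h1 : ‖p - c‖ < 1
      · rw [rieszNear, Set.indicator_of_mem (show ‖p - c‖ ∈ Set.Iio 1 from h1)]
        linarith [hb0 p]
      · have h2 : b p = 1 := Set.indicator_of_mem hp _
        rw [h2]
        have h3 : ‖p - c‖ ^ (γ - ((m : ℝ) + 2)) ≤ 1 :=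
          Real.rpow_le_one_of_one_le_of_nonpos (not_lt.1 h1) (by
            have : (0 : ℝ) ≤ m := by positivity
            linarith)
        linarith [rieszNear_nonneg γ 1 c p]
    · rw [rieszBall, Set.indicator_of_notMem hp]
      exact add_nonneg (rieszNear_nonneg γ 1 c p) (hb0 p)
  have hi2 : Integrable (rieszBall γ c) := by
    refine (hi.add hb).mono' (Measurable.aestronglyMeasurable ?_) (Eventually.of_forall fun p => ?_)
    · exact Measurable.indicator (by fun_prop) Metric.isOpen_ball.measurableSet
    · rw [Real.norm_of_nonneg (rieszBall_nonneg γ c p)]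
      exact hle p
  refine ⟨hi2, ?_⟩
  calc _ ≤ ∫ p, (rieszNear γ 1 c p + b p) := integral_mono hi2 (hi.add hb) hle
    _ = (∫ p, rieszNear γ 1 c p) + ∫ p, b p := integral_add hi hb
    _ ≤ _ := by linarith

/-! ### Pointwise bounds for sections with finite norm -/

section SectionBounds

variable {m : ℕ} {α : ℝ≥0} {ρ : ℂ × Sing m → ℝ}

theorem abs_sub_le_of_close (hN : sectionNorm α ρ ≠ ⊤) {p p' : ℂ × Sing m} (h : Close p p') :
    |ρ p - ρ p'| ≤ (sectionNorm α ρ).toReal *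
      eucNorm (p.1 ^ 2 - p'.1 ^ 2) (p.2 - p'.2) ^ (α : ℝ) := by
  have h1 : ‖ρ p - ρ p'‖ₑ / ENNReal.ofReal (eucNorm (p.1 ^ 2 - p'.1 ^ 2) (p.2 - p'.2)) ^ (α : ℝ) ≤
      sectionNorm α ρ := by
    unfold sectionNorm
    exact le_iSup_of_le p (le_iSup_of_le p' (le_iSup_of_le h le_rfl))
  have hd : 0 ≤ eucNorm (p.1 ^ 2 - p'.1 ^ 2) (p.2 - p'.2) := Real.sqrt_nonneg _
  rw [ENNReal.ofReal_rpow_of_nonneg hd α.coe_nonneg,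
    ENNReal.div_le_iff_le_mul (Or.inr hN) (Or.inl ENNReal.ofReal_ne_top)] at h1
  have h2 := ENNReal.toReal_mono (ENNReal.mul_ne_top hN ENNReal.ofReal_ne_top) h1
  rwa [ENNReal.toReal_mul, ENNReal.toReal_ofReal (Real.rpow_nonneg hd _), toReal_enorm,
    Real.norm_eq_abs] at h2

/-- Turning around the singular set in steps of angle `π / 8`. -/
theorem abs_sub_rotate_le (hN : sectionNorm α ρ ≠ ⊤) (w : ℂ) (t : Sing m) :
    |ρ (w, t) - ρ (w * Complex.exp (Complex.I * (Real.pi / 16 : ℝ)), t)| ≤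
      (sectionNorm α ρ).toReal * ‖w‖ ^ (2 * α : ℝ) := by
  rcases eq_or_ne w 0 with rfl | hw
  · simp; positivity
  set θ : ℂ := Complex.exp (Complex.I * (Real.pi / 16 : ℝ)) with hθ
  have hθn : ‖θ‖ = 1 := by rw [hθ, mul_comm, Complex.norm_exp_ofReal_mul_I]
  have hd : eucNorm (w ^ 2 - (w * θ) ^ 2) (t - t) ≤ 1 / 2 * ‖w‖ ^ 2 := by
    have h1 : eucNorm (w ^ 2 - (w * θ) ^ 2) (t - t) = ‖w ^ 2 - (w * θ) ^ 2‖ := by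
      simp [eucNorm, Real.sqrt_sq]
    have h2 : w ^ 2 - (w * θ) ^ 2 = -(w ^ 2 * (Complex.exp (Complex.I * (Real.pi / 8 : ℝ)) - 1)) := by
      have : θ ^ 2 = Complex.exp (Complex.I * (Real.pi / 8 : ℝ)) := by
        rw [hθ, ← Complex.exp_nat_mul]; congr 1; push_cast; ring
      rw [← this]; ring
    have h3 := Real.norm_exp_I_mul_ofReal_sub_one_le (x := Real.pi / 8)
    rw [Real.norm_of_nonneg (by positivity)] at h3
    rw [h1, h2, norm_neg, norm_mul, norm_pow]
    -- Why the step is `π / 8` on the base: the chord is at most `(π / 8) |z|`, hence below `|z| /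
    -- 2`, as `Close` demands.
    have h4 : Real.pi / 8 ≤ 1 / 2 := by linarith [Real.pi_le_four]
    nlinarith [sq_nonneg ‖w‖]
  have hclose : Close (w, t) (w * θ, t) := by
    refine ⟨?_, ?_⟩
    · simp only [norm_pow, norm_mul, hθn, mul_one, min_self]
      exact hd
    · have h1 : inner ℝ w (w * θ) = ‖w‖ ^ 2 * θ.re := by
        rw [inner_complex, norm_sq_complex]
        simp only [Complex.mul_re, Complex.mul_im]; ring
      have h2 : θ.re = Real.cos (Real.pi / 16) := by
        rw [hθ, mul_comm, Complex.exp_ofReal_mul_I_re]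
      simp only [h1, h2]
      have := norm_pos_iff.2 hw
      have hcos : 0 < Real.cos (Real.pi / 16) :=
        Real.cos_pos_of_mem_Ioo ⟨by linarith [Real.pi_pos], by linarith [Real.pi_pos]⟩
      positivity
  refine (abs_sub_le_of_close hN hclose).trans ?_
  have h5 : ‖w‖ ^ (2 * α : ℝ) = (‖w‖ ^ 2) ^ (α : ℝ) := by
    rw [← Real.rpow_natCast, ← Real.rpow_mul (norm_nonneg _)]; norm_num
  rw [h5]
  gcongr
  · exact Real.sqrt_nonneg _
  · refine hd.trans ?_
    nlinarith [sq_nonneg ‖w‖]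

/-- Sixteen steps of angle `π / 16` on the cover lead from `w` to `-w`, where the section has the
opposite value. So `2|ρ|` is at most sixteen times the bound for one step. -/
theorem abs_section_le (hρ : IsSection ρ) (hN : sectionNorm α ρ ≠ ⊤) (w : ℂ) (t : Sing m) :
    |ρ (w, t)| ≤ 8 * (sectionNorm α ρ).toReal * ‖w‖ ^ (2 * α : ℝ) := by
  set θ : ℂ := Complex.exp (Complex.I * (Real.pi / 16 : ℝ)) with hθ
  have hθn : ‖θ‖ = 1 := by rw [hθ, mul_comm, Complex.norm_exp_ofReal_mul_I]
  have hk : ∀ k : ℕ, |ρ (w, t) - ρ (w * θ ^ k, t)| ≤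
      k * ((sectionNorm α ρ).toReal * ‖w‖ ^ (2 * α : ℝ)) := by
    intro k
    induction k with
    | zero => simp
    | succ k ih =>
      have h1 := abs_sub_rotate_le hN (w * θ ^ k) t
      rw [norm_mul, norm_pow, hθn, one_pow, mul_one, ← hθ, mul_assoc, ← pow_succ] at h1
      have h2 := abs_sub_le (ρ (w, t)) (ρ (w * θ ^ k, t)) (ρ (w * θ ^ (k + 1), t))
      push_cast
      linarith
  have h16 : θ ^ 16 = -1 := by
    rw [hθ, ← Complex.exp_nat_mul, ← Complex.exp_pi_mul_I]; congr 1; push_cast; ring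
  have h := hk 16
  rw [h16, mul_neg_one, hρ w t, sub_neg_eq_add, ← two_mul, abs_mul, abs_two] at h
  push_cast at h
  linarith

/-- Off the singular set nearby points satisfy `Close`; at the singular set the decay of
`abs_section_le` takes over. -/
theorem continuous_section (hα : 0 < α) (hρ : IsSection ρ) (hN : sectionNorm α ρ ≠ ⊤) :
    Continuous ρ := by
  rw [continuous_iff_continuousAt]
  rintro ⟨w, t⟩
  have hα' : (0 : ℝ) < α := hα
  rcases eq_or_ne w 0 with rfl | hw
  · have h0 : ρ (0, t) = 0 := by
      have := hρ 0 t
      rw [neg_zero] at this; linarith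
    rw [ContinuousAt, h0]
    refine squeeze_zero_norm (a := fun p : ℂ × Sing m =>
      8 * (sectionNorm α ρ).toReal * ‖p.1‖ ^ (2 * α : ℝ)) (fun p => abs_section_le hρ hN p.1 p.2) ?_
    have hc : Continuous fun p : ℂ × Sing m =>
        8 * (sectionNorm α ρ).toReal * ‖p.1‖ ^ (2 * α : ℝ) :=
      continuous_const.mul (Continuous.rpow_const (by fun_prop) fun _ => Or.inr (by positivity))
    have := hc.tendsto ((0, t) : ℂ × Sing m)
    simpa [Real.zero_rpow (by positivity : (2 * α : ℝ) ≠ 0)] using this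
  · have hdc : Continuous fun p : ℂ × Sing m => eucNorm (w ^ 2 - p.1 ^ 2) (t - p.2) := by
      unfold eucNorm; fun_prop
    have hclose : ∀ᶠ p in 𝓝 ((w, t) : ℂ × Sing m), Close (w, t) p := by
      have hwn := norm_pos_iff.2 hw
      have h1 : ∀ᶠ p in 𝓝 ((w, t) : ℂ × Sing m),
          eucNorm (w ^ 2 - p.1 ^ 2) (t - p.2) < 1 / 2 * min ‖w ^ 2‖ ‖p.1 ^ 2‖ := by
        refine (hdc.tendsto _).eventually_lt (Continuous.tendsto (by fun_prop) _) ?_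
        simp [eucNorm, hwn]
      have h2 : ∀ᶠ p in 𝓝 ((w, t) : ℂ × Sing m), 0 < inner ℝ w p.1 := by
        have hc : Continuous fun p : ℂ × Sing m => inner ℝ w p.1 := by fun_prop
        refine (hc.tendsto _).eventually_const_lt ?_
        simp only [real_inner_self_eq_norm_sq]; positivity
      filter_upwards [h1, h2] with p hp1 hp2 using ⟨hp1.le, hp2⟩
    rw [ContinuousAt, tendsto_iff_norm_sub_tendsto_zero]
    refine squeeze_zero' (g := fun p : ℂ × Sing m => (sectionNorm α ρ).toReal *
      eucNorm (w ^ 2 - p.1 ^ 2) (t - p.2) ^ (α : ℝ)) (Eventually.of_forall fun p => norm_nonneg _) ?_ ?_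
    · filter_upwards [hclose] with p hp
      rw [Real.norm_eq_abs, abs_sub_comm]
      exact abs_sub_le_of_close hN hp
    · have hc : Continuous fun p : ℂ × Sing m => (sectionNorm α ρ).toReal *
          eucNorm (w ^ 2 - p.1 ^ 2) (t - p.2) ^ (α : ℝ) :=
        continuous_const.mul (hdc.rpow_const fun _ => Or.inr hα'.le)
      have := hc.tendsto ((w, t) : ℂ × Sing m)
      simpa [eucNorm, Real.zero_rpow hα'.ne'] using this

theorem abs_branch_le (hρ : IsSection ρ) (hN : sectionNorm α ρ ≠ ⊤) (p : ℂ × Sing m) :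
    |branch ρ p| ≤ 8 * (sectionNorm α ρ).toReal * ‖p.1‖ ^ (α : ℝ) := by
  have h := abs_section_le hρ hN (root p).1 (root p).2
  rwa [Real.rpow_mul (norm_nonneg _), Real.rpow_ofNat, norm_root_fst_sq] at h

/-- The Euclidean unit ball lies in the unit ball of the maximum norm, which is the one used in all
the integral estimates. -/
theorem branch_eq_zero (hs : ∀ w t, 1 ≤ eucNorm (w ^ 2) t → ρ (w, t) = 0) {p : ℂ × Sing m}
    (hp : p ∉ Metric.ball (0 : ℂ × Sing m) 1) : branch ρ p = 0 := by
  apply hs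
  rw [sqrt_sq, eucNorm, Real.le_sqrt' one_pos]
  rw [mem_ball_zero_iff, not_lt, Prod.norm_def, le_max_iff] at hp
  rcases hp with h | h <;> nlinarith [sq_nonneg ‖p.1‖, sq_nonneg ‖p.2‖]

end SectionBounds

/-! ### Removing the regularization: the potential of a source -/

theorem rpow_neg_le_of_sq_le {y d s : ℝ} (hd : 0 < d) (h : d ^ 2 ≤ y) (hs : 0 ≤ s) :
    y ^ (-s) ≤ d ^ (-(2 * s)) := by
  have h1 : d ^ (-(2 * s)) = (d ^ 2) ^ (-s) := by
    rw [← Real.rpow_natCast, ← Real.rpow_mul hd.le]; congr 1; push_cast; ring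
  rw [h1]
  exact Real.rpow_le_rpow_of_nonpos (by positivity) h (by linarith)

theorem abs_rpow_neg_sub_le {c x y s : ℝ} (hc : 0 < c) (hs : 0 ≤ s) (hx : c ≤ x) (hy : c ≤ y) :
    |x ^ (-s) - y ^ (-s)| ≤ s * c ^ (-s - 1) * |x - y| := by
  have h := (convex_Ici c).norm_image_sub_le_of_norm_deriv_le (f := fun x : ℝ => x ^ (-s))
    (C := s * c ^ (-s - 1)) (x := y) (y := x) ?_ ?_ hy hx
  · simpa only [Real.norm_eq_abs] using h
  · intro z hz
    have hz0 : 0 < z := hc.trans_le hz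
    exact (Real.hasDerivAt_rpow_const (Or.inl hz0.ne')).differentiableAt
  · intro z hz
    have hz0 : 0 < z := hc.trans_le hz
    rw [(Real.hasDerivAt_rpow_const (Or.inl hz0.ne')).deriv, norm_mul, norm_neg,
      Real.norm_of_nonneg hs, Real.norm_of_nonneg (by positivity)]
    gcongr ?_ * ?_
    exact Real.rpow_le_rpow_of_nonpos hc (show c ≤ z from hz) (by linarith)

theorem abs_rpow_neg_sub_taylor_le {c x y s : ℝ} (hc : 0 < c) (hs : 0 ≤ s) (hx : c ≤ x)
    (hy : c ≤ y) :
    |x ^ (-s) - y ^ (-s) + s * y ^ (-s - 1) * (x - y)| ≤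
      s * (s + 1) * c ^ (-s - 2) * |x - y| ^ 2 := by
  have hseg : ∀ z ∈ segment ℝ y x, c ≤ z ∧ |z - y| ≤ |x - y| := by
    intro z hz
    refine ⟨(convex_Ici c).segment_subset hy hx hz, ?_⟩
    have := norm_sub_le_of_mem_segment hz
    simpa only [Real.norm_eq_abs] using this
  have hder : ∀ z, 0 < z → HasDerivAt (fun x : ℝ => x ^ (-s) + s * y ^ (-s - 1) * x)
      (-s * z ^ (-s - 1) + s * y ^ (-s - 1)) z := by
    intro z hz
    have h1 := (Real.hasDerivAt_rpow_const (x := z) (p := -s) (Or.inl hz.ne')).fun_add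
      ((hasDerivAt_id z).const_mul (s * y ^ (-s - 1)))
    simpa using h1
  have h := (convex_segment y x).norm_image_sub_le_of_norm_deriv_le
    (f := fun x : ℝ => x ^ (-s) + s * y ^ (-s - 1) * x)
    (C := s * ((s + 1) * c ^ (-s - 2) * |x - y|)) (x := y) (y := x) ?_ ?_
    (left_mem_segment ℝ y x) (right_mem_segment ℝ y x)
  · simp only [Real.norm_eq_abs] at h
    calc _ = |x ^ (-s) + s * y ^ (-s - 1) * x - (y ^ (-s) + s * y ^ (-s - 1) * y)| := by
          congr 1; ring
      _ ≤ _ := h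
      _ = _ := by ring
  · intro z hz
    exact (hder z (hc.trans_le (hseg z hz).1)).differentiableAt
  · intro z hz
    obtain ⟨hz1, hz2⟩ := hseg z hz
    rw [(hder z (hc.trans_le hz1)).deriv]
    have h1 := abs_rpow_neg_sub_le (s := s + 1) hc (by linarith) hz1 hy
    have e1 : -(s + 1) = -s - 1 := by ring
    have e2 : -s - 1 - 1 = -s - 2 := by ring
    rw [e1, e2] at h1
    rw [show -s * z ^ (-s - 1) + s * y ^ (-s - 1) = -(s * (z ^ (-s - 1) - y ^ (-s - 1))) by ring,
      norm_neg, norm_mul, Real.norm_of_nonneg hs, Real.norm_eq_abs]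
    gcongr
    refine h1.trans ?_
    gcongr

/-- Interpolates between the trivial bound where `Q ≤ e` and the mean value theorem where `e ≤ Q`.
The quarter power of `e` is a rate of convergence that costs little enough of the singularity at `Q
= 0`. -/
theorem abs_rpow_neg_add_sub_le {Q e s : ℝ} (hQ : 0 < Q) (he : 0 < e) (hs : 0 ≤ s) :
    |(Q + e) ^ (-s) - Q ^ (-s)| ≤ (1 + s) * e ^ (1 / 4 : ℝ) * Q ^ (-(s + 1 / 4)) := by
  have e1 : Q ^ (-s) = Q ^ (1 / 4 : ℝ) * Q ^ (-(s + 1 / 4)) := by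
    rw [← Real.rpow_add hQ]; congr 1; ring
  have hP : 0 < Q ^ (-(s + 1 / 4)) := by positivity
  rcases le_total Q e with h | h
  · have h1 : (Q + e) ^ (-s) ≤ Q ^ (-s) :=
      Real.rpow_le_rpow_of_nonpos hQ (by linarith) (by linarith)
    have h2 : 0 ≤ (Q + e) ^ (-s) := by positivity
    rw [abs_sub_comm, abs_of_nonneg (by linarith)]
    have h3 : Q ^ (1 / 4 : ℝ) ≤ e ^ (1 / 4 : ℝ) := Real.rpow_le_rpow hQ.le h (by norm_num)
    calc _ ≤ Q ^ (-s) := by linarith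
      _ = 1 * Q ^ (1 / 4 : ℝ) * Q ^ (-(s + 1 / 4)) := by rw [e1]; ring
      _ ≤ _ := by gcongr; linarith
  · have h1 := abs_rpow_neg_sub_le (s := s) hQ hs (show Q ≤ Q + e by linarith) le_rfl
    rw [add_sub_cancel_left, abs_of_pos he] at h1
    refine h1.trans ?_
    have h2 : e = e ^ (1 / 4 : ℝ) * e ^ (3 / 4 : ℝ) := by
      rw [← Real.rpow_add he]; norm_num
    have h3 : Q ^ (-s - 1) * e ^ (3 / 4 : ℝ) ≤ Q ^ (-(s + 1 / 4)) := by
      calc _ ≤ Q ^ (-s - 1) * Q ^ (3 / 4 : ℝ) := by gcongr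
        _ = _ := by rw [← Real.rpow_add hQ]; congr 1; ring
    calc s * Q ^ (-s - 1) * e = s * e ^ (1 / 4 : ℝ) * (Q ^ (-s - 1) * e ^ (3 / 4 : ℝ)) := by
          nth_rewrite 1 [h2]; ring
      _ ≤ (1 + s) * e ^ (1 / 4 : ℝ) * Q ^ (-(s + 1 / 4)) := by gcongr; linarith

/-- The projection of the cover. -/
def cover {m : ℕ} (p : ℂ × Sing m) : ℂ × Sing m := (p.1 ^ 2, p.2)

theorem norm_sq_le_add {m : ℕ} (p : ℂ × Sing m) : ‖p‖ ^ 2 ≤ ‖p.1‖ ^ 2 + ‖p.2‖ ^ 2 := by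
  rw [Prod.norm_def]
  rcases max_choice ‖p.1‖ ‖p.2‖ with h | h <;> rw [h] <;>
    nlinarith [sq_nonneg ‖p.1‖, sq_nonneg ‖p.2‖]

theorem quad_root_ge {m : ℕ} (e x : ℝ) (p' p : ℂ × Sing m) :
    e + ‖p - cover p'‖ ^ 2 + 4 * x ^ 2 * inner ℝ p'.1 (root p).1 ^ 2 ≤ quad e x p' (root p) := by
  have h := norm_sq_le_add (p - cover p')
  have h1 : (root p).2 = p.2 := rfl
  rw [quad_eq, root_fst_sq, h1]
  simp only [cover, Prod.fst_sub, Prod.snd_sub] at h ⊢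
  linarith

theorem quad_add {m : ℕ} (e x : ℝ) (p' p : ℂ × Sing m) : quad e x p' p = quad 0 x p' p + e := by
  unfold quad; ring

theorem quad_root_pos {m : ℕ} {e : ℝ} (he : 0 ≤ e) (x : ℝ) {p' p : ℂ × Sing m}
    (hp : p ≠ cover p') : 0 < quad e x p' (root p) := by
  have h := quad_root_ge e x p' p
  have h1 : 0 < ‖p - cover p'‖ := norm_pos_iff.2 (sub_ne_zero.2 hp)
  have h2 : 0 ≤ 4 * x ^ 2 * inner ℝ p'.1 (root p).1 ^ 2 := by positivity
  nlinarith [sq_pos_of_pos h1]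

theorem continuous_quad_root_rpow {m : ℕ} {e : ℝ} (he : 0 ≤ e) {p' p : ℂ × Sing m}
    (hp : p ≠ cover p') (s : ℝ) : Continuous fun x => quad e x p' (root p) ^ s := by
  refine Continuous.rpow_const ?_ fun x => Or.inl (quad_root_pos he x hp).ne'
  unfold quad; fun_prop

/-- `Q` dominates both `d²` and `(xq)²`. Giving a quarter of a power to the second saves half a
power of the distance `d`, keeps `|q|^(1/2)`, and costs only `x^(-1/2)`, which is integrable on `[0,
1]`. -/
theorem abs_mul_quad_rpow_le {m : ℕ} {s x : ℝ} (hs : 1 / 4 ≤ s) (hx : 0 < x) {p' p : ℂ × Sing m}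
    (hp : p ≠ cover p') :
    |inner ℝ p'.1 (root p).1| * quad 0 x p' (root p) ^ (-s) ≤
      |inner ℝ p'.1 (root p).1| ^ (1 / 2 : ℝ) * ‖p - cover p'‖ ^ (-(2 * s - 1 / 2)) *
        x ^ (-(1 / 2) : ℝ) := by
  have hd : 0 < ‖p - cover p'‖ := norm_pos_iff.2 (sub_ne_zero.2 hp)
  have hQ := quad_root_pos le_rfl x hp
  have hge := quad_root_ge 0 x p' p
  set q := inner ℝ p'.1 (root p).1
  set Q := quad 0 x p' (root p)
  rcases eq_or_ne q 0 with h0 | h0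
  · rw [h0, abs_zero, zero_mul]; positivity
  have hq : 0 < |q| := abs_pos.2 h0
  have h1 : Q ^ (-(s - 1 / 4)) ≤ ‖p - cover p'‖ ^ (-(2 * (s - 1 / 4))) :=
    rpow_neg_le_of_sq_le hd (by nlinarith [sq_nonneg (x * q)]) (by linarith)
  have h2 : Q ^ (-(1 / 4 : ℝ)) ≤ (x * |q|) ^ (-(2 * (1 / 4 : ℝ))) := by
    apply rpow_neg_le_of_sq_le (by positivity) _ (by norm_num)
    rw [mul_pow, sq_abs]
    nlinarith [sq_nonneg (x * q), sq_nonneg ‖p - cover p'‖]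
  have h3 : Q ^ (-s) = Q ^ (-(s - 1 / 4)) * Q ^ (-(1 / 4 : ℝ)) := by
    rw [← Real.rpow_add hQ]; congr 1; ring
  have h4 : (x * |q|) ^ (-(2 * (1 / 4 : ℝ))) = x ^ (-(1 / 2) : ℝ) * |q| ^ (-(1 / 2) : ℝ) := by
    rw [Real.mul_rpow hx.le hq.le]; norm_num
  have h5 : |q| * |q| ^ (-(1 / 2) : ℝ) = |q| ^ (1 / 2 : ℝ) := by
    nth_rewrite 1 [← Real.rpow_one |q|]
    rw [← Real.rpow_add hq]; norm_num
  have h6 : -(2 * (s - 1 / 4)) = -(2 * s - 1 / 2) := by ring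
  rw [h4] at h2
  rw [h6] at h1
  rw [h3]
  calc _ ≤ |q| * (‖p - cover p'‖ ^ (-(2 * s - 1 / 2)) *
        (x ^ (-(1 / 2) : ℝ) * |q| ^ (-(1 / 2) : ℝ))) := by gcongr
    _ = (|q| * |q| ^ (-(1 / 2) : ℝ)) * ‖p - cover p'‖ ^ (-(2 * s - 1 / 2)) * x ^ (-(1 / 2) : ℝ) := by
      ring
    _ = _ := by rw [h5]

theorem abs_integral_le_of_le_rpow {f : ℝ → ℝ} {M : ℝ}
    (h : ∀ x, 0 < x → |f x| ≤ M * x ^ (-(1 / 2) : ℝ)) : |∫ x in (0 : ℝ)..1, f x| ≤ 2 * M := by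
  have hi : IntervalIntegrable (fun x : ℝ => M * x ^ (-(1 / 2) : ℝ)) volume 0 1 :=
    (intervalIntegral.intervalIntegrable_rpow' (by norm_num)).const_mul M
  have h1 := intervalIntegral.norm_integral_le_of_norm_le (f := f) zero_le_one
    (Eventually.of_forall fun x hx => h x hx.1) hi
  rw [intervalIntegral.integral_const_mul, integral_rpow (Or.inl (by norm_num))] at h1
  rw [← Real.norm_eq_abs]
  refine h1.trans (le_of_eq ?_)
  norm_num
  ring

theorem expo_ge (m : ℕ) : 1 / 2 ≤ expo m := by
  have : (0 : ℝ) ≤ m := by positivity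
  unfold expo; linarith

theorem abs_green_le {m : ℕ} {p' p : ℂ × Sing m} (hp : p ≠ cover p') :
    |green 0 p' (root p)| ≤ 2 * (|inner ℝ p'.1 (root p).1| ^ (1 / 2 : ℝ) *
      ‖p - cover p'‖ ^ (-(2 * expo m - 1 / 2))) := by
  apply abs_integral_le_of_le_rpow
  intro x hx
  rw [kern, abs_mul, abs_of_pos (Real.rpow_pos_of_pos (quad_root_pos le_rfl x hp) _)]
  exact abs_mul_quad_rpow_le (by linarith [expo_ge m]) hx hp

theorem abs_green_sub_le {m : ℕ} {e : ℝ} (he : 0 < e) {p' p : ℂ × Sing m} (hp : p ≠ cover p') :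
    |green e p' (root p) - green 0 p' (root p)| ≤ 2 * ((1 + expo m) * e ^ (1 / 4 : ℝ) *
      (|inner ℝ p'.1 (root p).1| ^ (1 / 2 : ℝ) * ‖p - cover p'‖ ^ (-(2 * expo m)))) := by
  have hi : ∀ e : ℝ, 0 ≤ e → IntervalIntegrable (fun x => kern e x p' (root p)) volume 0 1 := by
    intro e he
    have := continuous_quad_root_rpow he hp (-expo m)
    exact (continuous_const.mul this).intervalIntegrable _ _
  rw [green, green, ← intervalIntegral.integral_sub (hi e he.le) (hi 0 le_rfl)]
  apply abs_integral_le_of_le_rpow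
  intro x hx
  have hQ := quad_root_pos le_rfl x hp
  have h1 := abs_rpow_neg_add_sub_le hQ he (expo_pos m).le
  have h2 := abs_mul_quad_rpow_le (s := expo m + 1 / 4) (by linarith [expo_ge m]) hx hp
  rw [show 2 * (expo m + 1 / 4) - 1 / 2 = 2 * expo m by ring] at h2
  rw [kern, kern, ← mul_sub, abs_mul, quad_add e]
  have ha := expo_pos m
  calc _ ≤ |inner ℝ p'.1 (root p).1| *
        ((1 + expo m) * e ^ (1 / 4 : ℝ) * quad 0 x p' (root p) ^ (-(expo m + 1 / 4))) := by gcongr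
    _ = (1 + expo m) * e ^ (1 / 4 : ℝ) *
        (|inner ℝ p'.1 (root p).1| * quad 0 x p' (root p) ^ (-(expo m + 1 / 4))) := by ring
    _ ≤ (1 + expo m) * e ^ (1 / 4 : ℝ) * (|inner ℝ p'.1 (root p).1| ^ (1 / 2 : ℝ) *
        ‖p - cover p'‖ ^ (-(2 * expo m)) * x ^ (-(1 / 2) : ℝ)) := by gcongr
    _ = _ := by ring

theorem measurable_green {m : ℕ} (e : ℝ) (p' : ℂ × Sing m) : Measurable (green e p') := by
  have hk : Measurable fun z : (ℂ × Sing m) × ℝ => kern e z.2 p' z.1 := by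
    unfold kern quad; fun_prop
  have h : green e p' = fun p => ∫ x in Set.Ioc (0 : ℝ) 1, kern e x p' p := by
    ext p; rw [green, intervalIntegral.integral_of_le zero_le_one]
  rw [h]
  exact (StronglyMeasurable.integral_prod_right (ν := volume.restrict (Set.Ioc (0 : ℝ) 1))
    (f := fun p x => kern e x p' p) hk.stronglyMeasurable).measurable

theorem abs_inner_root_le {m : ℕ} {p' p : ℂ × Sing m}
    (hp : p ∈ Metric.ball (0 : ℂ × Sing m) 1) :
    |inner ℝ p'.1 (root p).1| ≤ ‖p'.1‖ := by
  have h1 : ‖(root p).1‖ ≤ 1 := by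
    have h2 : ‖(root p).1‖ ^ 2 ≤ 1 := by
      rw [norm_root_fst_sq]; exact (norm_fst_le p).trans (mem_ball_zero_iff.1 hp).le
    nlinarith [norm_nonneg (root p).1]
  refine (abs_real_inner_le_norm _ _).trans ?_
  nlinarith [norm_nonneg p'.1]

theorem ae_ne {m : ℕ} (c : ℂ × Sing m) : ∀ᵐ p : ℂ × Sing m, p ≠ c := by
  rw [ae_iff]; simp

/-- Integration of a source against a kernel which is dominated by a Riesz kernel. -/
theorem integrable_and_norm_integral_le {m : ℕ} {E : Type*} [NormedAddCommGroup E]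
    [NormedSpace ℝ E] {f : ℂ × Sing m → E} {g : ℂ × Sing m → ℝ} {M I : ℝ}
    (hf : AEStronglyMeasurable f volume) (hg : Integrable g) (hgI : ∫ p, g p ≤ I)
    (hM : 0 ≤ M) (h : ∀ᵐ p, ‖f p‖ ≤ M * g p) : Integrable f ∧ ‖∫ p, f p‖ ≤ M * I := by
  refine ⟨(hg.const_mul M).mono' hf h, (norm_integral_le_of_norm_le (hg.const_mul M) h).trans ?_⟩
  rw [integral_const_mul]
  gcongr

/-- The properties of the branch of a section with `‖ρ‖_{,α} < ∞` and support in the unit ball on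
which the estimates are based. -/
structure IsSource {m : ℕ} (α N : ℝ) (R : ℂ × Sing m → ℝ) : Prop where
  measurable : AEStronglyMeasurable R volume
  exponent_nonneg : 0 ≤ α
  nonneg : 0 ≤ N
  bound : ∀ p, |R p| ≤ N * ‖p.1‖ ^ α
  zero : ∀ p ∉ Metric.ball (0 : ℂ × Sing m) 1, R p = 0

theorem IsSource.abs_le {m : ℕ} {α N : ℝ} {R : ℂ × Sing m → ℝ} (h : IsSource α N R)
    (p : ℂ × Sing m) : |R p| ≤ N := by
  by_cases hp : p ∈ Metric.ball (0 : ℂ × Sing m) 1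
  · have h1 : ‖p.1‖ ≤ 1 := (norm_fst_le p).trans (mem_ball_zero_iff.1 hp).le
    have h2 := Real.rpow_le_one (norm_nonneg p.1) h1 h.exponent_nonneg
    have h3 := h.bound p
    nlinarith [h.nonneg]
  · rw [h.zero p hp, abs_zero]; exact h.nonneg

theorem isSource_branch {m : ℕ} {α : ℝ≥0} {ρ : ℂ × Sing m → ℝ} (hα : 0 < α) (hρ : IsSection ρ)
    (hs : ∀ w t, 1 ≤ eucNorm (w ^ 2) t → ρ (w, t) = 0) (hN : sectionNorm α ρ ≠ ⊤) :
    IsSource (α : ℝ) (8 * (sectionNorm α ρ).toReal) (branch ρ) where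
  measurable := aestronglyMeasurable_branch (continuous_section hα hρ hN)
  exponent_nonneg := α.coe_nonneg
  nonneg := by positivity
  bound := abs_branch_le hρ hN
  zero := fun _ hp => branch_eq_zero hs hp

theorem IsSource.memLp {m : ℕ} {α N : ℝ} {R : ℂ × Sing m → ℝ} (h : IsSource α N R) :
    MemLp (fun p => R p * ‖p.1‖) 2 := by
  have h1 : MemLp ((Metric.ball (0 : ℂ × Sing m) 1).indicator fun _ => N) 2 :=
    memLp_indicator_const 2 Metric.isOpen_ball.measurableSet N (Or.inr measure_ball_lt_top.ne)
  refine h1.mono (h.measurable.mul (by fun_prop)) (Eventually.of_forall fun p => ?_)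
  by_cases hp : p ∈ Metric.ball (0 : ℂ × Sing m) 1
  · rw [Set.indicator_of_mem hp, norm_mul, norm_norm, Real.norm_eq_abs, Real.norm_of_nonneg h.nonneg]
    have h2 : ‖p.1‖ ≤ 1 := (norm_fst_le p).trans (mem_ball_zero_iff.1 hp).le
    nlinarith [h.abs_le p, abs_nonneg (R p), norm_nonneg p.1, h.nonneg]
  · rw [h.zero p hp]; simp

/-- The integral of a source against the regularized Green's function. -/
noncomputable def potential {m : ℕ} (e : ℝ) (R : ℂ × Sing m → ℝ) (p' : ℂ × Sing m) : ℝ :=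
  ∫ p, R p * green e p' (root p)

theorem norm_mul_le_rieszBall {m : ℕ} {α N M γ G : ℝ} {R : ℂ × Sing m → ℝ} (h : IsSource α N R)
    {c p : ℂ × Sing m}
    (hG : p ∈ Metric.ball (0 : ℂ × Sing m) 1 → |G| ≤ M * ‖p - c‖ ^ (γ - ((m : ℝ) + 2))) :
    ‖R p * G‖ ≤ N * M * rieszBall γ c p := by
  by_cases hp : p ∈ Metric.ball (0 : ℂ × Sing m) 1
  · rw [rieszBall, Set.indicator_of_mem hp, norm_mul, Real.norm_eq_abs, Real.norm_eq_abs, mul_assoc]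
    exact mul_le_mul (h.abs_le p) (hG hp) (abs_nonneg _) h.nonneg
  · rw [h.zero p hp, rieszBall, Set.indicator_of_notMem hp]; simp

theorem IsSource.integrable_mul_green {m : ℕ} {α N : ℝ} {R : ℂ × Sing m → ℝ} (h : IsSource α N R)
    (p' : ℂ × Sing m) : Integrable fun p => R p * green 0 p' (root p) := by
  obtain ⟨C, hC0, hC⟩ := exists_rieszBall_bound m (γ := 3 / 2) (by norm_num) (by norm_num)
  refine ((hC (cover p')).1.const_mul (N * (2 * ‖p'.1‖ ^ (1 / 2 : ℝ)))).mono'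
    (h.measurable.mul ((measurable_green 0 p').comp measurable_root).aestronglyMeasurable) ?_
  filter_upwards [ae_ne (cover p')] with p hp
  refine norm_mul_le_rieszBall h fun hb => (abs_green_le hp).trans ?_
  rw [show -(2 * expo m - 1 / 2) = 3 / 2 - ((m : ℝ) + 2) by unfold expo; ring, mul_assoc]
  gcongr
  exact abs_inner_root_le hb

/-- After `abs_green_sub_le` the kernel is of order `d^(1 - n)`, a Riesz kernel with `γ = 1`; the
convergence is uniform on bounded sets. -/
theorem IsSource.exists_potential_sub_le {m : ℕ} {α N : ℝ} {R : ℂ × Sing m → ℝ}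
    (h : IsSource α N R) :
    ∃ C, 0 ≤ C ∧ ∀ e > 0, ∀ p', |potential e R p' - potential 0 R p'| ≤
      C * (e ^ (1 / 4 : ℝ) * ‖p'.1‖ ^ (1 / 2 : ℝ)) := by
  obtain ⟨C, hC0, hC⟩ := exists_rieszBall_bound m (γ := 1) (by norm_num) (by norm_num)
  have ha := expo_pos m
  have hN := h.nonneg
  refine ⟨N * (2 * (1 + expo m)) * C, by positivity, fun e he p' => ?_⟩
  have hb : ∀ᵐ p : ℂ × Sing m, ‖R p * (green e p' (root p) - green 0 p' (root p))‖ ≤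
      (N * (2 * ((1 + expo m) * e ^ (1 / 4 : ℝ) * ‖p'.1‖ ^ (1 / 2 : ℝ)))) *
        rieszBall 1 (cover p') p := by
    filter_upwards [ae_ne (cover p')] with p hp
    refine norm_mul_le_rieszBall h fun hb => (abs_green_sub_le he hp).trans ?_
    rw [show -(2 * expo m) = 1 - ((m : ℝ) + 2) by unfold expo; ring, mul_assoc 2,
      mul_assoc ((1 + expo m) * e ^ (1 / 4 : ℝ))]
    gcongr
    exact abs_inner_root_le hb
  obtain ⟨hi, hint⟩ := integrable_and_norm_integral_le
    (h.measurable.mul (((measurable_green e p').comp measurable_root).sub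
      ((measurable_green 0 p').comp measurable_root)).aestronglyMeasurable)
    (hC (cover p')).1 (hC (cover p')).2 (by positivity) hb
  have h1 : potential e R p' - potential 0 R p' =
      ∫ p, R p * (green e p' (root p) - green 0 p' (root p)) := by
    have h2 := h.integrable_mul_green p'
    have h3 : Integrable fun p => R p * green e p' (root p) := by
      refine (hi.add h2).congr (Eventually.of_forall fun p => ?_)
      simp only [Pi.add_apply, Function.comp, Pi.sub_apply, Pi.mul_apply]
      ring
    rw [potential, potential, ← integral_sub h3 h2]
    congr 1; ext p; ring
  rw [h1]
  refine (le_of_eq_of_le rfl hint).trans (le_of_eq ?_)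
  ring

theorem continuous_green {m : ℕ} {e : ℝ} (he : 0 < e) :
    Continuous fun y : (ℂ × Sing m) × (ℂ × Sing m) => green e y.1 y.2 := by
  have h1 : Continuous fun y : ((ℂ × Sing m) × (ℂ × Sing m)) × ℝ => kern e y.2 y.1.1 y.1.2 := by
    have h2 : Continuous fun y : ((ℂ × Sing m) × (ℂ × Sing m)) × ℝ => (y.2, y.1.1, y.1.2) := by
      fun_prop
    have := (continuous_kern (m := m) he).comp h2
    simpa only [Function.comp_def] using this
  exact intervalIntegral.continuous_parametric_intervalIntegral_of_continuous'
      (f := fun (y : (ℂ × Sing m) × (ℂ × Sing m)) x => kern e x y.1 y.2) h1 _ _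

theorem abs_green_le_of_pos {m : ℕ} {e : ℝ} (he : 0 < e) (p' p : ℂ × Sing m) :
    |green e p' p| ≤ ‖p'.1‖ * ‖p.1‖ * e ^ (-expo m) := by
  have := intervalIntegral.norm_integral_le_of_norm_le_const (a := 0) (b := 1)
    (f := fun x => kern e x p' p) (C := ‖p'.1‖ * ‖p.1‖ * e ^ (-expo m)) ?_
  · simpa [green] using this
  · intro x _
    rw [kern, norm_mul, Real.norm_of_nonneg (Real.rpow_nonneg (quad_pos he x p' p).le _)]
    exact mul_le_mul (abs_real_inner_le_norm _ _)
      (Real.rpow_le_rpow_of_nonpos he (le_quad e x p' p) (by linarith [expo_pos m]))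
      (Real.rpow_nonneg (quad_pos he x p' p).le _) (by positivity)

theorem IsSource.continuous_potential_of_pos {m : ℕ} {α N : ℝ} {R : ℂ × Sing m → ℝ}
    (h : IsSource α N R) {e : ℝ} (he : 0 < e) : Continuous (potential e R) := by
  rw [continuous_iff_continuousAt]
  intro p₀
  have hnear : ∀ᶠ p' in 𝓝 p₀, ‖p'.1‖ < ‖p₀.1‖ + 1 := by
    have hc : Continuous fun p' : ℂ × Sing m => ‖p'.1‖ := by fun_prop
    exact (hc.tendsto p₀).eventually_lt_const (by linarith)
  apply continuousAt_of_dominated (bound := (Metric.ball (0 : ℂ × Sing m) 1).indicator fun _ =>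
    N * ((‖p₀.1‖ + 1) * 1 * e ^ (-expo m)))
  · exact Eventually.of_forall fun p' => h.measurable.mul
      ((measurable_green e p').comp measurable_root).aestronglyMeasurable
  · filter_upwards [hnear] with p' hp'
    refine Eventually.of_forall fun p => ?_
    by_cases hp : p ∈ Metric.ball (0 : ℂ × Sing m) 1
    · rw [Set.indicator_of_mem hp, norm_mul, Real.norm_eq_abs, Real.norm_eq_abs]
      have h2 : ‖(root p).1‖ ≤ 1 := by
        have h2 : ‖(root p).1‖ ^ 2 ≤ 1 := by
          rw [norm_root_fst_sq]; exact (norm_fst_le p).trans (mem_ball_zero_iff.1 hp).le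
        nlinarith [norm_nonneg (root p).1]
      have h3 := abs_green_le_of_pos he p' (root p)
      refine mul_le_mul (h.abs_le p) (h3.trans ?_) (abs_nonneg _) h.nonneg
      gcongr
    · rw [h.zero p hp, Set.indicator_of_notMem hp]; simp
  · exact (integrable_indicator_iff Metric.isOpen_ball.measurableSet).2
      (integrableOn_const (measure_ball_lt_top).ne)
  · refine Eventually.of_forall fun p => ContinuousAt.mul continuousAt_const ?_
    have h2 : Continuous fun p' : ℂ × Sing m => (p', root p) := by fun_prop
    have := (continuous_green (m := m) he).comp h2
    simp only [Function.comp_def] at this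
    exact this.continuousAt

/-- A locally uniform limit of the regularized potentials, which are continuous by dominated
convergence. -/
theorem IsSource.continuous_potential {m : ℕ} {α N : ℝ} {R : ℂ × Sing m → ℝ}
    (h : IsSource α N R) : Continuous (potential 0 R) := by
  obtain ⟨C, hC0, hC⟩ := h.exists_potential_sub_le
  have hlim : TendstoLocallyUniformly (fun (e : ℝ) => potential e R) (potential 0 R) (𝓝[>] 0) := by
    rw [Metric.tendstoLocallyUniformly_iff]
    intro δ hδ p₀
    refine ⟨Metric.ball p₀ 1, Metric.ball_mem_nhds _ one_pos, ?_⟩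
    have h1 : Tendsto (fun e : ℝ => C * (e ^ (1 / 4 : ℝ) * (‖p₀‖ + 1) ^ (1 / 2 : ℝ))) (𝓝[>] 0)
        (𝓝 0) := by
      have hc : Continuous fun e : ℝ => C * (e ^ (1 / 4 : ℝ) * (‖p₀‖ + 1) ^ (1 / 2 : ℝ)) :=
        continuous_const.mul ((continuous_id.rpow_const fun _ => Or.inr (by norm_num)).mul
          continuous_const)
      have := hc.tendsto 0
      rw [Real.zero_rpow (by norm_num), zero_mul, mul_zero] at this
      exact this.mono_left nhdsWithin_le_nhds
    filter_upwards [self_mem_nhdsWithin, h1.eventually_lt_const hδ] with e he hlt p' hp'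
    rw [dist_comm, Real.dist_eq]
    refine (hC e he p').trans_lt (lt_of_le_of_lt ?_ hlt)
    have he' : 0 < e := he
    have h2 : ‖p'.1‖ ≤ ‖p₀‖ + 1 := by
      have h3 : ‖p' - p₀‖ < 1 := by simpa [dist_eq_norm] using hp'
      have h4 := norm_add_le (p' - p₀) p₀
      rw [sub_add_cancel] at h4
      linarith [norm_fst_le p']
    gcongr
  refine hlim.continuous (Eventually.frequently ?_)
  filter_upwards [self_mem_nhdsWithin] with e he
  exact h.continuous_potential_of_pos he

theorem isSection_potential {m : ℕ} (e : ℝ) (R : ℂ × Sing m → ℝ) : IsSection (potential e R) := by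
  intro w t
  have h : ∀ p : ℂ × Sing m, green e (-w, t) p = -green e (w, t) p := by
    intro p
    have hk : ∀ x, kern e x (-w, t) p = -kern e x (w, t) p := by
      intro x
      simp only [kern, quad, norm_neg, inner_neg_left, neg_sq, neg_mul]
    simp only [green, hk, intervalIntegral.integral_neg]
  simp only [potential, h, mul_neg, integral_neg]

/-- The weak solution, tested against `ψ`, is the potential of the source. -/
theorem IsSource.integral_limit_mul_test {m : ℕ} {α N : ℝ} {φ : ℕ → ℂ × Sing m → ℝ}
    {V R : ℂ × Sing m → ℝ} (hs : IsSource α N R) (h : IsEnergyLimit φ V)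
    (hw : ∀ ψ : ℂ × Sing m → ℝ, IsTestSection ψ →
      Tendsto (fun j => dirichletForm (φ j) ψ) atTop (𝓝 (-∫ p, R p * branch ψ p)))
    {ψ : ℂ × Sing m → ℝ} (hψ : IsTestSection ψ) :
    ∫ p, V p * branch ψ p = ∫ p, (kappa m * branch (potential 0 R) p) * branch ψ p := by
  have h1 := tendsto_integral_green h hs.measurable hs.memLp hw hψ
  obtain ⟨C, hC0, hC⟩ := hs.exists_potential_sub_le
  obtain ⟨B, K, hB0, hK0, hB, hK⟩ := exists_test_bounds hψ
  have hint : ∀ e, Continuous (potential e R) →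
      Integrable fun y => branch ψ y * potential e R (root y) := by
    intro e hc
    obtain ⟨D, hD⟩ := (isCompact_closedBall (0 : ℂ × Sing m) K).exists_bound_of_continuousOn
      hc.continuousOn
    refine ((integrable_branch hψ).norm.mul_const D).mono' ((integrable_branch hψ).1.mul
      (aestronglyMeasurable_branch hc)) (Eventually.of_forall fun y => ?_)
    rw [norm_mul]
    by_cases h0 : ψ (root y) = 0
    · rw [branch_eq, h0]; simp
    · gcongr
      exact hD _ (mem_closedBall_zero_iff.2 (hK _ h0))
  have h2 : Tendsto (fun ε : ℝ => ∫ y, branch ψ y * potential (ε ^ 2) R (root y)) (𝓝[>] 0)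
      (𝓝 (∫ y, branch ψ y * potential 0 R (root y))) := by
    rw [tendsto_iff_norm_sub_tendsto_zero]
    have h3 : Tendsto (fun ε : ℝ => (∫ y, ‖branch ψ y‖) *
        (C * ((ε ^ 2) ^ (1 / 4 : ℝ) * K ^ (1 / 2 : ℝ)))) (𝓝[>] 0) (𝓝 0) := by
      have hc : Continuous fun ε : ℝ => (∫ y, ‖branch ψ y‖) *
          (C * ((ε ^ 2) ^ (1 / 4 : ℝ) * K ^ (1 / 2 : ℝ))) :=
        continuous_const.mul (continuous_const.mul (((continuous_pow 2).rpow_const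
          fun _ => Or.inr (by norm_num)).mul continuous_const))
      have := hc.tendsto 0
      rw [zero_pow two_ne_zero, Real.zero_rpow (by norm_num), zero_mul, mul_zero, mul_zero] at this
      exact this.mono_left nhdsWithin_le_nhds
    refine squeeze_zero' (Eventually.of_forall fun _ => norm_nonneg _) ?_ h3
    filter_upwards [self_mem_nhdsWithin] with ε hε
    have he : 0 < ε ^ 2 := pow_pos hε 2
    rw [← integral_sub (hint _ (hs.continuous_potential_of_pos he)) (hint _ hs.continuous_potential),
      ← integral_mul_const]
    refine norm_integral_le_of_norm_le ((integrable_branch hψ).norm.mul_const _)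
      (Eventually.of_forall fun y => ?_)
    rw [← mul_sub, norm_mul]
    by_cases h0 : ψ (root y) = 0
    · rw [branch_eq, h0]; simp
    · gcongr
      refine (hC _ he _).trans ?_
      gcongr
      exact (norm_fst_le _).trans (hK _ h0)
  -- The same integrals converge by `tendsto_integral_green` and by uniform convergence of the
  -- potentials. Comparing the limits, `κ * mass = -1` gives the claim.
  have h3 := tendsto_nhds_unique h1 h2
  have h4 := kappa_mul_mass m
  have h5 : ∫ p, (kappa m * branch (potential 0 R) p) * branch ψ p =
      kappa m * ∫ y, branch ψ y * potential 0 R (root y) := by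
    rw [← integral_const_mul]
    congr 1; ext p
    rw [branch_eq (potential 0 R)]; ring
  rw [h5, ← h3]
  linear_combination (∫ p, V p * branch ψ p) * h4

/-! ### The leading coefficient and the remainder -/

/-- The square of the Euclidean distance from `p` to the point `t` of the singular set. -/
noncomputable def axisSq {m : ℕ} (t : Sing m) (p : ℂ × Sing m) : ℝ := ‖p.1‖ ^ 2 + ‖p.2 - t‖ ^ 2

theorem norm_sub_sq_le_axisSq {m : ℕ} (t : Sing m) (p : ℂ × Sing m) :
    ‖p - (0, t)‖ ^ 2 ≤ axisSq t p := by
  have := norm_sq_le_add (p - (0, t))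
  simpa [axisSq] using this

theorem axisSq_pos {m : ℕ} {t : Sing m} {p : ℂ × Sing m} (hp : p ≠ (0, t)) : 0 < axisSq t p :=
  (pow_pos (norm_pos_iff.2 (sub_ne_zero.2 hp)) 2).trans_le (norm_sub_sq_le_axisSq t p)

theorem leadIntegrand_eq {m : ℕ} (ρ : ℂ × Sing m → ℝ) (t : Sing m) (p : ℂ × Sing m) :
    leadIntegrand ρ t p =
      ((kappa m * branch ρ p * axisSq t p ^ (-expo m) : ℝ) : ℂ) * conj (root p).1 := by
  have h1 : eucNorm ((root p).1 ^ 2) (p.2 - t) ^ (m + 1) = axisSq t p ^ expo m := by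
    rw [root_fst_sq, eucNorm, Real.sqrt_eq_rpow, ← Real.rpow_natCast, ← Real.rpow_mul (by positivity)]
    rw [axisSq, expo]; congr 1; push_cast; ring
  have h2 : ((eucNorm ((root p).1 ^ 2) (p.2 - t) : ℝ) : ℂ) ^ (m + 1) =
      ((axisSq t p ^ expo m : ℝ) : ℂ) := by rw [← h1]; push_cast; rfl
  have h3 : leadIntegrand ρ t p = (kappa m : ℂ) * conj (root p).1 /
      ((eucNorm ((root p).1 ^ 2) (p.2 - t) : ℝ) : ℂ) ^ (m + 1) * ((branch ρ p : ℝ) : ℂ) := rfl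
  rw [h3, h2, Real.rpow_neg (by unfold axisSq; positivity)]
  push_cast
  ring

theorem norm_root_fst {m : ℕ} (p : ℂ × Sing m) : ‖(root p).1‖ = ‖p.1‖ ^ (1 / 2 : ℝ) := by
  rw [← norm_root_fst_sq p, ← Real.sqrt_eq_rpow, Real.sqrt_sq (norm_nonneg _)]

/-- The product of the source with a kernel of homogeneity `-2 s` around a point of the singular
set. -/
theorem IsSource.abs_mul_axisSq_le {m : ℕ} {α N s : ℝ} {R : ℂ × Sing m → ℝ} (h : IsSource α N R)
    (hs : 0 ≤ s) {t : Sing m} {p : ℂ × Sing m} (hp : p ≠ (0, t)) :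
    |R p| * ‖(root p).1‖ * axisSq t p ^ (-s) ≤ N * ‖p - (0, t)‖ ^ (α + 1 / 2 - 2 * s) := by
  have hd : 0 < ‖p - (0, t)‖ := norm_pos_iff.2 (sub_ne_zero.2 hp)
  have h1 : axisSq t p ^ (-s) ≤ ‖p - (0, t)‖ ^ (-(2 * s)) :=
    rpow_neg_le_of_sq_le hd (norm_sub_sq_le_axisSq t p) hs
  have h2 : ‖p.1‖ ≤ ‖p - (0, t)‖ := by
    have := norm_fst_le (p - (0, t))
    rwa [Prod.fst_sub, sub_zero] at this
  have h3 := h.exponent_nonneg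
  have h4 := h.nonneg
  have h5 : 0 < axisSq t p ^ (-s) := Real.rpow_pos_of_pos (axisSq_pos hp) _
  rw [norm_root_fst]
  calc _ ≤ (N * ‖p - (0, t)‖ ^ α) * ‖p - (0, t)‖ ^ (1 / 2 : ℝ) * ‖p - (0, t)‖ ^ (-(2 * s)) := by
        gcongr
        exact (h.bound p).trans (by gcongr)
    _ = _ := by
      rw [mul_assoc, mul_assoc, ← Real.rpow_add hd, ← Real.rpow_add hd]
      congr 2; ring

theorem measurable_leadIntegrand {m : ℕ} {α N : ℝ} {ρ : ℂ × Sing m → ℝ}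
    (h : IsSource α N (branch ρ)) (t : Sing m) :
    AEStronglyMeasurable (leadIntegrand ρ t) volume := by
  have h1 : Measurable fun p : ℂ × Sing m => axisSq t p ^ (-expo m) := by
    unfold axisSq; fun_prop
  have h2 : Measurable fun p : ℂ × Sing m => conj (root p).1 := by
    have : Measurable fun p : ℂ × Sing m => (root p).1 := measurable_fst.comp measurable_root
    fun_prop
  have h3 : leadIntegrand ρ t = fun p =>
      ((kappa m * branch ρ p * axisSq t p ^ (-expo m) : ℝ) : ℂ) * conj (root p).1 := by
    ext p; exact leadIntegrand_eq ρ t p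
  rw [h3]
  refine AEStronglyMeasurable.mul ?_ h2.aestronglyMeasurable
  exact Complex.continuous_ofReal.comp_aestronglyMeasurable
    ((h.measurable.const_mul _).mul h1.aestronglyMeasurable)

theorem norm_leadIntegrand {m : ℕ} (ρ : ℂ × Sing m → ℝ) (t : Sing m) (p : ℂ × Sing m) :
    ‖leadIntegrand ρ t p‖ =
      |kappa m| * (|branch ρ p| * ‖(root p).1‖ * axisSq t p ^ (-expo m)) := by
  have h : 0 ≤ axisSq t p := by unfold axisSq; positivity
  rw [leadIntegrand_eq, norm_mul, Complex.norm_real, RCLike.norm_conj, norm_mul, norm_mul,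
    Real.norm_eq_abs, Real.norm_eq_abs, Real.norm_of_nonneg (Real.rpow_nonneg h _)]
  ring

/-- By homogeneity the integrand is of order `d^(α + 1/2 - (n - 1))`, which is a Riesz kernel with
`γ = 3/2 + α`. -/
theorem exists_lead_bound (m : ℕ) {α : ℝ} (hα0 : 0 < α) (hα1 : α < 1 / 2) :
    ∃ C, 0 ≤ C ∧ ∀ (N : ℝ) (ρ : ℂ × Sing m → ℝ), IsSource α N (branch ρ) →
      ∀ t, Integrable (leadIntegrand ρ t) ∧ ‖leadCoeff ρ t‖ ≤ C * N := by
  obtain ⟨C, hC0, hC⟩ := exists_rieszBall_bound m (γ := 3 / 2 + α) (by linarith) (by linarith)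
  refine ⟨|kappa m| * C, by positivity, fun N ρ h t => ?_⟩
  have h1 : ∀ᵐ p, ‖leadIntegrand ρ t p‖ ≤ |kappa m| * N * rieszBall (3 / 2 + α) (0, t) p := by
    filter_upwards [ae_ne ((0, t) : ℂ × Sing m)] with p hp
    rw [norm_leadIntegrand]
    by_cases hb : p ∈ Metric.ball (0 : ℂ × Sing m) 1
    · rw [mul_assoc |kappa m| N, rieszBall, Set.indicator_of_mem hb,
        show 3 / 2 + α - ((m : ℝ) + 2) = α + 1 / 2 - 2 * expo m by unfold expo; ring]
      exact mul_le_mul_of_nonneg_left (h.abs_mul_axisSq_le (expo_pos m).le hp) (abs_nonneg _)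
    · rw [h.zero p hb, rieszBall, Set.indicator_of_notMem hb]; simp
  obtain ⟨hi, hn⟩ := integrable_and_norm_integral_le (measurable_leadIntegrand h t) (hC (0, t)).1
    (hC (0, t)).2 (mul_nonneg (abs_nonneg _) h.nonneg) h1
  exact ⟨hi, hn.trans (le_of_eq (by ring))⟩

/-- The remainder of the Green's function after its leading term at the singular set. -/
theorem exists_green_sub_lead_le (m : ℕ) :
    ∃ C, 0 ≤ C ∧ ∀ p' p : ℂ × Sing m, p ≠ cover p' → p ≠ (0, p'.2) →
      |green 0 p' (root p) - inner ℝ p'.1 (root p).1 * axisSq p'.2 p ^ (-expo m)| ≤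
        C * ‖p'.1‖ ^ 3 * (‖(root p).1‖ * axisSq p'.2 p ^ (-(expo m + 1 / 2)) +
          ‖p - cover p'‖ ^ (1 / 2 - ((m : ℝ) + 2))) := by
  have ha := expo_pos m
  set D := expo m * (1 / 4 : ℝ) ^ (-expo m - 1) * (9 / 4) with hD
  have hD0 : 0 ≤ D := by positivity
  refine ⟨D + 20, by positivity, fun p' p hp hp0 => ?_⟩
  set W := ‖p'.1‖ with hW
  set Z := ‖(root p).1‖ with hZ
  set q := inner ℝ p'.1 (root p).1 with hq
  set y := axisSq p'.2 p with hy
  have hypos : 0 < y := axisSq_pos hp0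
  set Y := Real.sqrt y with hYdef
  have hY : 0 < Y := Real.sqrt_pos.2 hypos
  have hYy : Y ^ 2 = y := Real.sq_sqrt hypos.le
  have hW0 : 0 ≤ W := norm_nonneg _
  have hZ0 : 0 ≤ Z := norm_nonneg _
  have hZsq : Z ^ 2 = ‖p.1‖ := norm_root_fst_sq p
  have hZY : Z ^ 2 ≤ Y := by
    rw [hZsq]; apply Real.le_sqrt_of_sq_le
    rw [hy, axisSq]; nlinarith [sq_nonneg ‖p.2 - p'.2‖]
  have hqWZ : |q| ≤ W * Z := abs_real_inner_le_norm _ _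
  set T := ‖p - cover p'‖ ^ (1 / 2 - ((m : ℝ) + 2)) with hT
  have hT0 : 0 ≤ T := by positivity
  set S := y ^ (-(expo m + 1 / 2)) with hS
  have hS0 : 0 < S := by positivity
  have hSy : y ^ (-expo m) = Y * S := by
    rw [hS, hYdef, Real.sqrt_eq_rpow, ← Real.rpow_add hypos]; congr 1; ring
  have hSy1 : y ^ (-expo m - 1) * Y = S := by
    rw [hS, hYdef, Real.sqrt_eq_rpow, ← Real.rpow_add hypos]; congr 1; ring
  -- `Y` is the distance from `p` to the projection of `p'` to the singular set, and `W²` the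
  -- distance of `p'` itself to that set. Far away the two kernels are compared; nearby each is
  -- estimated alone.
  rcases le_or_gt (4 * W ^ 2) Y with hfar | hnear
  · have hmain : |∫ x in (0 : ℝ)..1, (quad 0 x p' (root p) ^ (-expo m) - y ^ (-expo m))| ≤
        D * (W ^ 2 * S) := by
      have := intervalIntegral.norm_integral_le_of_norm_le_const (a := 0) (b := 1)
        (f := fun x => quad 0 x p' (root p) ^ (-expo m) - y ^ (-expo m)) (C := D * (W ^ 2 * S)) ?_
      · simpa using this
      intro x hx
      rw [Set.uIoc_of_le zero_le_one] at hx
      have hx0 : 0 ≤ x ^ 2 := sq_nonneg x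
      have hx1 : x ^ 2 ≤ 1 := pow_le_one₀ hx.1.le hx.2
      have hquad : quad 0 x p' (root p) - y = 2 * Z ^ 2 * W ^ 2 + W ^ 4 - 4 * (1 - x ^ 2) * q ^ 2 := by
        have h2 : (root p).2 = p.2 := rfl
        rw [quad, hy, axisSq, ← hZsq, ← hq, ← hW, ← hZ, h2]; ring
      have hq2 : q ^ 2 ≤ W ^ 2 * Z ^ 2 := by
        rw [← mul_pow, ← sq_abs]; gcongr
      have hq20 : 0 ≤ q ^ 2 := sq_nonneg q
      -- `9/4` is `2` from the term `2 Z² W²` and `1/4` from `W⁴`. The negative term is at most `4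
      -- Z² W²` and is half compensated by the first.
      have hdiff : |quad 0 x p' (root p) - y| ≤ 9 / 4 * (Y * W ^ 2) := by
        rw [hquad, abs_le]
        have a1 : Z ^ 2 * W ^ 2 ≤ Y * W ^ 2 := by gcongr
        have a2 : W ^ 4 ≤ 1 / 4 * (Y * W ^ 2) := by
          calc W ^ 4 = W ^ 2 * W ^ 2 := by ring
            _ ≤ (1 / 4 * Y) * W ^ 2 := by gcongr; linarith
            _ = _ := by ring
        have a6 : 0 ≤ Y * W ^ 2 := by positivity
        have a3 : 0 ≤ W ^ 4 := by positivity
        have a4 : 0 ≤ (1 - x ^ 2) * q ^ 2 := mul_nonneg (by linarith) hq20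
        have a5 : (1 - x ^ 2) * q ^ 2 ≤ q ^ 2 := mul_le_of_le_one_left hq20 (by linarith)
        have a7 : 0 ≤ Z ^ 2 * W ^ 2 := by positivity
        constructor <;> linarith
      have hlow : 1 / 4 * y ≤ quad 0 x p' (root p) := by
        have a1 : Y * W ^ 2 ≤ 1 / 4 * y := by
          calc Y * W ^ 2 ≤ Y * (1 / 4 * Y) := by gcongr; linarith
            _ = _ := by rw [← hYy]; ring
        have := (abs_le.1 hdiff).1
        linarith
      rw [Real.norm_eq_abs]
      refine (abs_rpow_neg_sub_le (c := 1 / 4 * y) (by positivity) ha.le hlow (by linarith)).trans ?_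
      rw [Real.mul_rpow (by norm_num) hypos.le]
      calc _ ≤ expo m * ((1 / 4 : ℝ) ^ (-expo m - 1) * y ^ (-expo m - 1)) * (9 / 4 * (Y * W ^ 2)) := by
            gcongr
        _ = D * (W ^ 2 * (y ^ (-expo m - 1) * Y)) := by rw [hD]; ring
        _ = _ := by rw [hSy1]
    have hgreen : green 0 p' (root p) - q * y ^ (-expo m) =
        q * ∫ x in (0 : ℝ)..1, (quad 0 x p' (root p) ^ (-expo m) - y ^ (-expo m)) := by
      rw [intervalIntegral.integral_sub
        ((continuous_quad_root_rpow le_rfl hp (-expo m)).intervalIntegrable _ _)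
        (by simp), mul_sub, ← intervalIntegral.integral_const_mul]
      simp only [green, kern, intervalIntegral.integral_const, sub_zero, one_smul, ← hq]
    rw [hgreen, abs_mul]
    calc _ ≤ (W * Z) * (D * (W ^ 2 * S)) := by gcongr
      _ = D * W ^ 3 * (Z * S + 0) := by ring
      _ ≤ (D + 20) * W ^ 3 * (Z * S + T) := by gcongr; linarith
  -- Here `Y < 4W²`, so missing powers of `W` can be traded for powers of the distance: `Y` in the
  -- leading term, and one power of `|p - cover p'|` in the bound of `abs_green_le`.
  · have h1 : |q * y ^ (-expo m)| ≤ 4 * W ^ 3 * (Z * S) := by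
      rw [hSy, abs_mul, abs_of_pos (by positivity : 0 < Y * S)]
      calc _ ≤ (W * Z) * (4 * W ^ 2 * S) := by gcongr
        _ = _ := by ring
    have hd : 0 < ‖p - cover p'‖ := norm_pos_iff.2 (sub_ne_zero.2 hp)
    have hZW : Z ≤ 2 * W :=
      (sq_le_sq₀ hZ0 (by positivity)).1 (by rw [mul_pow]; linarith)
    have hq2 : |q| ^ (1 / 2 : ℝ) ≤ 2 * W := by
      have a1 : |q| ≤ (2 * W) ^ 2 := by
        calc |q| ≤ W * Z := hqWZ
          _ ≤ (2 * W) * (2 * W) := by gcongr; linarith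
          _ = _ := by ring
      have a2 : |q| ^ (1 / 2 : ℝ) ≤ ((2 * W) ^ 2) ^ (1 / 2 : ℝ) := by gcongr
      rwa [← Real.sqrt_eq_rpow ((2 * W) ^ 2), Real.sqrt_sq (by positivity)] at a2
    have hdW : ‖p - cover p'‖ ≤ 5 * W ^ 2 := by
      have a1 : ‖p - (0, p'.2)‖ ≤ Y := Real.le_sqrt_of_sq_le (norm_sub_sq_le_axisSq p'.2 p)
      have a2 : ‖((0, p'.2) : ℂ × Sing m) - cover p'‖ = W ^ 2 := by simp [cover, Prod.norm_def, hW]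
      have a3 := norm_add_le (p - (0, p'.2)) ((0, p'.2) - cover p')
      rw [sub_add_sub_cancel, a2] at a3
      linarith
    have hexp : ‖p - cover p'‖ ^ (-(2 * expo m - 1 / 2)) = ‖p - cover p'‖ * T := by
      nth_rewrite 2 [← Real.rpow_one ‖p - cover p'‖]
      rw [hT, ← Real.rpow_add hd]; congr 1; unfold expo; ring
    have h2 : |green 0 p' (root p)| ≤ 20 * W ^ 3 * T := by
      refine (abs_green_le hp).trans ?_
      rw [hexp]
      calc _ ≤ 2 * (2 * W * (5 * W ^ 2 * T)) := by gcongr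
        _ = _ := by ring
    have hW3 : 0 ≤ W ^ 3 := by positivity
    calc _ ≤ |green 0 p' (root p)| + |q * y ^ (-expo m)| := abs_sub _ _
      _ ≤ 20 * W ^ 3 * T + 20 * W ^ 3 * (Z * S) := by
        have : 0 ≤ W ^ 3 * (Z * S) := by positivity
        linarith
      _ = 20 * W ^ 3 * (Z * S + T) := by ring
      _ ≤ _ := by gcongr; linarith

/-- The conjugate root in `leadKernel` is there because the real part of `conj w' * w` is the inner
product occurring in the Green's function. -/
theorem re_leadCoeff_mul {m : ℕ} {ρ : ℂ × Sing m → ℝ} {t : Sing m}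
    (hi : Integrable (leadIntegrand ρ t)) (w : ℂ) :
    (leadCoeff ρ t * w).re =
      kappa m * ∫ p, branch ρ p * (inner ℝ w (root p).1 * axisSq t p ^ (-expo m)) := by
  rw [leadCoeff, ← integral_mul_const, ← RCLike.re_eq_complex_re, ← integral_re (hi.mul_const w),
    ← integral_const_mul]
  congr 1; ext p
  rw [leadIntegrand_eq, inner_complex, RCLike.re_eq_complex_re, mul_assoc, Complex.re_ofReal_mul]
  simp only [Complex.mul_re, Complex.conj_re, Complex.conj_im]
  ring

/-- Integrates `exists_green_sub_lead_le` against the source. Both kernels on its right are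
integrable, being Riesz kernels around `(0, t)` and around the image of `(w, t)`; the factor `|w|³`
is `r^(3/2)`. -/
theorem exists_remainder_bound (m : ℕ) {α : ℝ} (hα0 : 0 < α) (hα1 : α < 1 / 2) :
    ∃ C, 0 ≤ C ∧ ∀ (N : ℝ) (ρ : ℂ × Sing m → ℝ), IsSource α N (branch ρ) → ∀ w t,
      |kappa m * potential 0 (branch ρ) (w, t) - (leadCoeff ρ t * w).re| ≤ C * ‖w‖ ^ 3 * N := by
  obtain ⟨C₁, hC₁0, hC₁⟩ := exists_rieszBall_bound m (γ := 1 / 2 + α) (by linarith) (by linarith)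
  obtain ⟨C₂, hC₂0, hC₂⟩ := exists_rieszBall_bound m (γ := 1 / 2) (by norm_num) (by norm_num)
  obtain ⟨D, hD0, hD⟩ := exists_green_sub_lead_le m
  obtain ⟨L, hL0, hL⟩ := exists_lead_bound m hα0 hα1
  refine ⟨|kappa m| * (D * (C₁ + C₂)), by positivity, fun N ρ h w t => ?_⟩
  have hN := h.nonneg
  have hk : kappa m ≠ 0 := by
    intro h0
    have := kappa_mul_mass m
    rw [h0] at this; norm_num at this
  have hli := (hL N ρ h t).1
  have i2 : Integrable fun p => branch ρ p * (inner ℝ w (root p).1 * axisSq t p ^ (-expo m)) := by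
    have h1 := ((hli.mul_const w).re).const_mul (kappa m)⁻¹
    refine h1.congr (Eventually.of_forall fun p => ?_)
    simp only
    rw [leadIntegrand_eq, inner_complex, RCLike.re_eq_complex_re, mul_assoc, Complex.re_ofReal_mul]
    simp only [Complex.mul_re, Complex.conj_re, Complex.conj_im]
    field_simp
    ring
  rw [re_leadCoeff_mul hli, ← mul_sub, abs_mul, potential,
    ← integral_sub (h.integrable_mul_green (w, t)) i2]
  have hb : ∀ᵐ p, ‖branch ρ p * green 0 (w, t) (root p) -
      branch ρ p * (inner ℝ w (root p).1 * axisSq t p ^ (-expo m))‖ ≤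
      (D * ‖w‖ ^ 3 * N) * (rieszBall (1 / 2 + α) (0, t) p + rieszBall (1 / 2) (cover (w, t)) p) := by
    filter_upwards [ae_ne ((0, t) : ℂ × Sing m), ae_ne (cover (w, t) : ℂ × Sing m)] with p hp0 hp
    have h1 := hD (w, t) p hp hp0
    rw [← mul_sub, norm_mul, Real.norm_eq_abs, Real.norm_eq_abs]
    by_cases hb : p ∈ Metric.ball (0 : ℂ × Sing m) 1
    · have h2 := h.abs_mul_axisSq_le (s := expo m + 1 / 2) (by linarith [expo_pos m]) hp0
      rw [show α + 1 / 2 - 2 * (expo m + 1 / 2) = 1 / 2 + α - ((m : ℝ) + 2) by unfold expo; ring] at h2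
      have h3 := h.abs_le p
      rw [rieszBall, rieszBall, Set.indicator_of_mem hb, Set.indicator_of_mem hb]
      simp only at h1
      calc _ ≤ |branch ρ p| * (D * ‖w‖ ^ 3 * (‖(root p).1‖ * axisSq t p ^ (-(expo m + 1 / 2)) +
            ‖p - cover (w, t)‖ ^ (1 / 2 - ((m : ℝ) + 2)))) := by gcongr
        _ = D * ‖w‖ ^ 3 * (|branch ρ p| * ‖(root p).1‖ * axisSq t p ^ (-(expo m + 1 / 2)) +
            |branch ρ p| * ‖p - cover (w, t)‖ ^ (1 / 2 - ((m : ℝ) + 2))) := by ring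
        _ ≤ D * ‖w‖ ^ 3 * (N * ‖p - (0, t)‖ ^ (1 / 2 + α - ((m : ℝ) + 2)) +
            N * ‖p - cover (w, t)‖ ^ (1 / 2 - ((m : ℝ) + 2))) := by gcongr
        _ = _ := by ring
    · rw [h.zero p hb, rieszBall, rieszBall, Set.indicator_of_notMem hb, Set.indicator_of_notMem hb]
      simp
  have hI : ∫ p, (rieszBall (1 / 2 + α) (0, t) p + rieszBall (1 / 2) (cover (w, t)) p) ≤ C₁ + C₂ := by
    rw [integral_add (hC₁ _).1 (hC₂ _).1]
    exact add_le_add (hC₁ _).2 (hC₂ _).2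
  have hfin := (integrable_and_norm_integral_le
    ((h.integrable_mul_green (w, t)).sub i2).1 ((hC₁ (0, t)).1.add (hC₂ (cover (w, t))).1) hI
    (by positivity) hb).2
  rw [Real.norm_eq_abs] at hfin
  calc _ ≤ |kappa m| * ((D * ‖w‖ ^ 3 * N) * (C₁ + C₂)) := by gcongr; exact hfin
    _ = _ := by ring

/-! ### Hölder continuity of the derivative of the leading coefficient -/

section Taylor

variable {E F : Type*} [NormedAddCommGroup E] [NormedSpace ℝ E] [NormedAddCommGroup F]
  [NormedSpace ℝ F] {A : E → F} {B : E → E →L[ℝ] F} {M β : ℝ}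

theorem hasFDerivAt_of_taylor_bound (hβ : 0 < β)
    (h : ∀ t k, ‖A (t + k) - A t - B t k‖ ≤ M * ‖k‖ ^ (1 + β)) (t : E) : HasFDerivAt A (B t) t := by
  rw [hasFDerivAt_iff_isLittleO_nhds_zero]
  have h1 : (fun k => A (t + k) - A t - B t k) =O[𝓝 0] fun k => ‖k‖ ^ (1 + β) := by
    refine Asymptotics.IsBigO.of_bound M (Eventually.of_forall fun k => ?_)
    rw [Real.norm_of_nonneg (by positivity)]
    exact h t k
  refine h1.trans_isLittleO ?_
  rw [← Asymptotics.isLittleO_norm_right]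
  have h2 : (fun k : E => ‖k‖ ^ (1 + β)) = fun k => ‖k‖ * ‖k‖ ^ β := by
    ext k; rw [Real.rpow_add_of_nonneg (norm_nonneg _) zero_le_one hβ.le, Real.rpow_one]
  rw [h2]
  have h3 : (fun k : E => ‖k‖ ^ β) =o[𝓝 0] fun _ => (1 : ℝ) := by
    rw [Asymptotics.isLittleO_one_iff]
    have hc : Continuous fun k : E => ‖k‖ ^ β :=
      continuous_norm.rpow_const fun _ => Or.inr hβ.le
    have := hc.tendsto 0
    rwa [norm_zero, Real.zero_rpow hβ.ne'] at this
  have := (Asymptotics.isBigO_refl (fun k : E => ‖k‖) (𝓝 0)).mul_isLittleO h3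
  simpa using this

/-- The converse of Taylor's theorem: the value at `t + k + l` is expanded once from `t` and once
via `s = t + k`, with `|l| = |k|`. The three remainders contribute `4 + 1 + 1 = 6`, as `2^(1 + β) ≤
4`. -/
theorem norm_sub_le_of_taylor_bound (hβ : 0 < β) (hβ1 : β ≤ 1) (hM : 0 ≤ M)
    (h : ∀ t k, ‖A (t + k) - A t - B t k‖ ≤ M * ‖k‖ ^ (1 + β)) (s t : E) :
    ‖B s - B t‖ ≤ 6 * M * ‖s - t‖ ^ β := by
  rcases eq_or_ne s t with rfl | hst
  · rw [sub_self, norm_zero]; positivity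
  set k := s - t with hk
  have hk0 : 0 < ‖k‖ := norm_pos_iff.2 (sub_ne_zero.2 hst)
  have hs : s = t + k := by rw [hk]; abel
  have key : ∀ l : E, ‖l‖ = ‖k‖ → ‖(B s - B t) l‖ ≤ 6 * M * ‖k‖ ^ (1 + β) := by
    intro l hl
    have e : (B s - B t) l = (A (t + (k + l)) - A t - B t (k + l)) - (A (t + k) - A t - B t k) -
        (A (s + l) - A s - B s l) := by
      rw [hs, ← add_assoc, map_add, _root_.sub_apply]; abel
    have h1 := h t (k + l)
    have h2 := h t k
    have h3 := h s l
    rw [hl] at h3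
    have h4 : ‖k + l‖ ^ (1 + β) ≤ 4 * ‖k‖ ^ (1 + β) := by
      have h5 : ‖k + l‖ ≤ 2 * ‖k‖ := (norm_add_le k l).trans (by rw [hl]; linarith)
      calc _ ≤ (2 * ‖k‖) ^ (1 + β) := by gcongr
        _ = 2 ^ (1 + β) * ‖k‖ ^ (1 + β) := Real.mul_rpow (by norm_num) (norm_nonneg _)
        _ ≤ 2 ^ (2 : ℝ) * ‖k‖ ^ (1 + β) := by
          gcongr
          · norm_num
          · linarith
        _ = _ := by norm_num
    have h6 : M * ‖k + l‖ ^ (1 + β) ≤ M * (4 * ‖k‖ ^ (1 + β)) := by gcongr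
    rw [e]
    refine (norm_sub_le _ _).trans ?_
    have h7 := norm_sub_le (A (t + (k + l)) - A t - B t (k + l)) (A (t + k) - A t - B t k)
    linarith
  refine ContinuousLinearMap.opNorm_le_bound _ (by positivity) fun l => ?_
  rcases eq_or_ne l 0 with rfl | hl
  · simp
  have hl0 : 0 < ‖l‖ := norm_pos_iff.2 hl
  have h1 := key ((‖k‖ / ‖l‖) • l) (by
    rw [norm_smul, norm_div, norm_norm, norm_norm]; field_simp)
  rw [map_smul, norm_smul, norm_div, norm_norm, norm_norm, Real.rpow_add hk0, Real.rpow_one] at h1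
  have h2 : ‖k‖ / ‖l‖ * ‖(B s - B t) l‖ ≤ ‖k‖ / ‖l‖ * (6 * M * ‖k‖ ^ β * ‖l‖) := by
    refine h1.trans (le_of_eq ?_)
    field_simp
  exact le_of_mul_le_mul_left h2 (by positivity)

end Taylor

/-- The derivative with respect to `t` of the integrand of the leading coefficient. -/
noncomputable def leadDerivIntegrand {m : ℕ} (ρ : ℂ × Sing m → ℝ) (t : Sing m) (p : ℂ × Sing m) :
    Sing m →L[ℝ] ℂ :=
  ContinuousLinearMap.smulRightL ℝ (Sing m) ℂ (innerSL ℝ (p.2 - t))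
    (((kappa m * branch ρ p * (2 * expo m * axisSq t p ^ (-expo m - 1)) : ℝ) : ℂ) *
      conj (root p).1)

/-- The derivative of the leading coefficient. -/
noncomputable def leadDeriv {m : ℕ} (ρ : ℂ × Sing m → ℝ) (t : Sing m) : Sing m →L[ℝ] ℂ :=
  ∫ p, leadDerivIntegrand ρ t p

theorem leadDerivIntegrand_eq {m : ℕ} (ρ : ℂ × Sing m → ℝ) (t : Sing m) (p : ℂ × Sing m) :
    leadDerivIntegrand ρ t p = (innerSL ℝ (p.2 - t)).smulRight
      (((kappa m * branch ρ p * (2 * expo m * axisSq t p ^ (-expo m - 1)) : ℝ) : ℂ) *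
        conj (root p).1) := rfl

theorem leadDerivIntegrand_apply {m : ℕ} (ρ : ℂ × Sing m → ℝ) (t k : Sing m) (p : ℂ × Sing m) :
    leadDerivIntegrand ρ t p k =
      ((kappa m * branch ρ p * (2 * expo m * axisSq t p ^ (-expo m - 1) * inner ℝ (p.2 - t) k) : ℝ)
        : ℂ) * conj (root p).1 := by
  rw [leadDerivIntegrand_eq, ContinuousLinearMap.smulRight_apply, innerSL_apply_apply,
    Complex.real_smul]
  push_cast; ring

theorem measurable_leadDerivIntegrand {m : ℕ} {α N : ℝ} {ρ : ℂ × Sing m → ℝ}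
    (h : IsSource α N (branch ρ)) (t : Sing m) :
    AEStronglyMeasurable (leadDerivIntegrand ρ t) volume := by
  have h1 : Measurable fun p : ℂ × Sing m => 2 * expo m * axisSq t p ^ (-expo m - 1) := by
    unfold axisSq; fun_prop
  have h2 : Measurable fun p : ℂ × Sing m => conj (root p).1 := by
    have : Measurable fun p : ℂ × Sing m => (root p).1 := measurable_fst.comp measurable_root
    fun_prop
  unfold leadDerivIntegrand
  refine ContinuousLinearMap.aestronglyMeasurable_comp₂ _ ?_ ?_
  · have : Continuous fun p : ℂ × Sing m => innerSL ℝ (p.2 - t) := by fun_prop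
    exact this.aestronglyMeasurable
  · refine AEStronglyMeasurable.mul ?_ h2.aestronglyMeasurable
    exact Complex.continuous_ofReal.comp_aestronglyMeasurable
      ((h.measurable.const_mul _).mul h1.aestronglyMeasurable)

theorem norm_snd_le_axisSq_rpow {m : ℕ} (t : Sing m) (p : ℂ × Sing m) :
    ‖p.2 - t‖ ≤ axisSq t p ^ (1 / 2 : ℝ) := by
  rw [← Real.sqrt_eq_rpow]
  apply Real.le_sqrt_of_sq_le
  unfold axisSq; nlinarith [sq_nonneg ‖p.1‖]

theorem IsSource.norm_leadDerivIntegrand_le {m : ℕ} {α N : ℝ} {ρ : ℂ × Sing m → ℝ}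
    (h : IsSource α N (branch ρ)) {t : Sing m} {p : ℂ × Sing m} (hp : p ≠ (0, t)) :
    ‖leadDerivIntegrand ρ t p‖ ≤
      |kappa m| * (2 * expo m) * N * ‖p - (0, t)‖ ^ (α + 1 / 2 - ((m : ℝ) + 2)) := by
  have ha := expo_pos m
  have hy := axisSq_pos hp
  have h1 : ‖p.2 - t‖ * axisSq t p ^ (-expo m - 1) ≤ axisSq t p ^ (-(expo m + 1 / 2)) := by
    calc _ ≤ axisSq t p ^ (1 / 2 : ℝ) * axisSq t p ^ (-expo m - 1) := by
          gcongr; exact norm_snd_le_axisSq_rpow t p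
      _ = _ := by rw [← Real.rpow_add hy]; congr 1; ring
  have h2 := h.abs_mul_axisSq_le (s := expo m + 1 / 2) (by linarith) hp
  rw [show α + 1 / 2 - 2 * (expo m + 1 / 2) = α + 1 / 2 - ((m : ℝ) + 2) by unfold expo; ring] at h2
  rw [leadDerivIntegrand_eq, ContinuousLinearMap.norm_smulRight_apply,
    innerSL_apply_norm, norm_mul, Complex.norm_real, RCLike.norm_conj, norm_mul, norm_mul,
    Real.norm_eq_abs, Real.norm_eq_abs, Real.norm_of_nonneg (by positivity)]
  calc _ = |kappa m| * (2 * expo m) * (|branch ρ p| * ‖(root p).1‖ *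
        (‖p.2 - t‖ * axisSq t p ^ (-expo m - 1))) := by ring
    _ ≤ |kappa m| * (2 * expo m) * (|branch ρ p| * ‖(root p).1‖ *
        axisSq t p ^ (-(expo m + 1 / 2))) := by gcongr
    _ ≤ |kappa m| * (2 * expo m) * (N * ‖p - (0, t)‖ ^ (α + 1 / 2 - ((m : ℝ) + 2))) := by gcongr
    _ = _ := by ring

theorem IsSource.integrable_leadDerivIntegrand {m : ℕ} {α N : ℝ} (hα : α < 1 / 2)
    {ρ : ℂ × Sing m → ℝ} (h : IsSource α N (branch ρ)) (t : Sing m) :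
    Integrable (leadDerivIntegrand ρ t) := by
  have hα0 := h.exponent_nonneg
  obtain ⟨C, hC0, hC⟩ := exists_rieszBall_bound m (γ := α + 1 / 2) (by linarith) (by linarith)
  refine ((hC (0, t)).1.const_mul (|kappa m| * (2 * expo m) * N)).mono'
    (measurable_leadDerivIntegrand h t) ?_
  filter_upwards [ae_ne ((0, t) : ℂ × Sing m)] with p hp
  by_cases hb : p ∈ Metric.ball (0 : ℂ × Sing m) 1
  · rw [rieszBall, Set.indicator_of_mem hb]
    exact h.norm_leadDerivIntegrand_le hp
  · have h0 : leadDerivIntegrand ρ t p = 0 := by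
      ext k; rw [leadDerivIntegrand_apply, h.zero p hb]; simp
    rw [h0, rieszBall, Set.indicator_of_notMem hb]; simp

theorem axisSq_add {m : ℕ} (t k : Sing m) (p : ℂ × Sing m) :
    axisSq (t + k) p = axisSq t p - 2 * inner ℝ (p.2 - t) k + ‖k‖ ^ 2 := by
  rw [axisSq, axisSq, ← sub_sub, norm_sub_sq_real]; ring

/-- Taylor's formula for the kernel, at a distance from the singularity. -/
theorem abs_axisSq_taylor_le {m : ℕ} {t k : Sing m} {p : ℂ × Sing m} (hp : p ≠ (0, t))
    (hk : 2 * ‖k‖ ≤ ‖p - (0, t)‖) :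
    |axisSq (t + k) p ^ (-expo m) - axisSq t p ^ (-expo m) -
        2 * expo m * axisSq t p ^ (-expo m - 1) * inner ℝ (p.2 - t) k| ≤
      (expo m * (expo m + 1) * (1 / 4 : ℝ) ^ (-expo m - 2) * (25 / 4) + expo m) * ‖k‖ ^ 2 *
        axisSq t p ^ (-(expo m + 1)) := by
  have ha := expo_pos m
  have hy := axisSq_pos hp
  have hdy := norm_sub_sq_le_axisSq t p
  have hin : |inner ℝ (p.2 - t) k| ≤ ‖p.2 - t‖ * ‖k‖ := abs_real_inner_le_norm _ _
  have hsnd := norm_snd_le_axisSq_rpow t p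
  rw [← Real.sqrt_eq_rpow] at hsnd
  have hadd := axisSq_add t k p
  set y := axisSq t p
  set y' := axisSq (t + k) p
  set Y := Real.sqrt y with hYdef
  set i := inner ℝ (p.2 - t) k
  have hYy : Y ^ 2 = y := Real.sq_sqrt hy.le
  have hY : 0 < Y := Real.sqrt_pos.2 hy
  have hk0 : 0 ≤ ‖k‖ := norm_nonneg k
  have hdY : ‖p - (0, t)‖ ≤ Y := Real.le_sqrt_of_sq_le hdy
  have hkY : 2 * ‖k‖ ≤ Y := hk.trans hdY
  have hiY : |i| ≤ Y * ‖k‖ := hin.trans (by gcongr)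
  obtain ⟨hi1, hi2⟩ := abs_le.1 hiY
  have hkk : ‖k‖ ^ 2 ≤ 1 / 2 * (Y * ‖k‖) := by nlinarith
  have hYk : Y * ‖k‖ ≤ 1 / 2 * y := by rw [← hYy]; nlinarith
  -- The shift `k` is at most half the distance `Y`, so the squared distance shrinks to no less than
  -- a quarter.
  have hlow : 1 / 4 * y ≤ y' := by
    rw [hadd, ← hYy]
    nlinarith [sq_nonneg (Y / 2 - ‖k‖), mul_nonneg hY.le (sub_nonneg.2 hkY)]
  have hdiff : |y' - y| ≤ 5 / 2 * (Y * ‖k‖) := by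
    rw [hadd, abs_le]
    constructor <;> nlinarith [sq_nonneg ‖k‖]
  have hT := abs_rpow_neg_sub_taylor_le (c := 1 / 4 * y) (y := y) (by positivity) ha.le hlow
    (by linarith)
  have h1 : y ^ (-expo m - 2) * y = y ^ (-(expo m + 1)) := by
    rw [← Real.rpow_add_one hy.ne']; congr 1; ring
  have h2 : -expo m - 1 = -(expo m + 1) := by ring
  have h3 : |y' - y| ^ 2 ≤ 25 / 4 * (y * ‖k‖ ^ 2) := by
    calc _ ≤ (5 / 2 * (Y * ‖k‖)) ^ 2 := by gcongr
      _ = _ := by rw [← hYy]; ring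
  have h4 : y' ^ (-expo m) - y ^ (-expo m) - 2 * expo m * y ^ (-expo m - 1) * i =
      (y' ^ (-expo m) - y ^ (-expo m) + expo m * y ^ (-expo m - 1) * (y' - y)) -
        expo m * y ^ (-expo m - 1) * ‖k‖ ^ 2 := by rw [hadd]; ring
  have h5 : |expo m * y ^ (-expo m - 1) * ‖k‖ ^ 2| = expo m * ‖k‖ ^ 2 * y ^ (-(expo m + 1)) := by
    rw [abs_of_nonneg (by positivity), h2]; ring
  rw [h4]
  refine (abs_sub _ _).trans ?_
  rw [h5, add_mul, add_mul]
  gcongr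
  refine hT.trans ?_
  rw [Real.mul_rpow (by norm_num) hy.le]
  calc _ ≤ expo m * (expo m + 1) * ((1 / 4 : ℝ) ^ (-expo m - 2) * y ^ (-expo m - 2)) *
        (25 / 4 * (y * ‖k‖ ^ 2)) := by gcongr
    _ = expo m * (expo m + 1) * (1 / 4 : ℝ) ^ (-expo m - 2) * (25 / 4) * ‖k‖ ^ 2 *
        (y ^ (-expo m - 2) * y) := by ring
    _ = _ := by rw [h1]

/-- At distance less than `2|k|` from `(0, t)` the three terms are estimated one by one, as they are
locally integrable. Beyond that, the second-order Taylor remainder `|k|² d^(β - 1 - n)` is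
integrable at infinity. All contributions scale like `|k|^(1 + β)`. -/
theorem exists_lead_taylor_bound (m : ℕ) {α : ℝ} (hα0 : 0 < α) (hα1 : α < 1 / 2) :
    ∃ C, 0 ≤ C ∧ ∀ (N : ℝ) (ρ : ℂ × Sing m → ℝ), IsSource α N (branch ρ) → ∀ t k,
      ‖leadCoeff ρ (t + k) - leadCoeff ρ t - leadDeriv ρ t k‖ ≤
        C * N * ‖k‖ ^ (1 + (α + 1 / 2)) := by
  set β := α + 1 / 2 with hβ
  have ha := expo_pos m
  obtain ⟨C₁, hC₁0, hC₁⟩ := exists_rieszNear_bound m (γ := 1 + β) (by linarith)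
  obtain ⟨C₂, hC₂0, hC₂⟩ := exists_rieszNear_bound m (γ := β) (by linarith)
  -- Convergence of the far integral needs `β < 1`, which is where `α < 1/2` enters.
  obtain ⟨C₃, hC₃0, hC₃⟩ := exists_rieszFar_bound m (γ := 1 - β) (by linarith)
  obtain ⟨L, hL0, hL⟩ := exists_lead_bound m hα0 hα1
  set K := expo m * (expo m + 1) * (1 / 4 : ℝ) ^ (-expo m - 2) * (25 / 4) + expo m with hK
  have hK0 : 0 ≤ K := by positivity
  set S := C₁ * 3 ^ (1 + β) + C₁ * 2 ^ (1 + β) + 2 * expo m * (C₂ * 2 ^ β) +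
    K * (C₃ * 2 ^ (-(1 - β))) with hS
  refine ⟨|kappa m| * S, by positivity, fun N ρ h t k => ?_⟩
  have hN := h.nonneg
  rcases eq_or_ne k 0 with rfl | hk
  · simp only [add_zero, sub_self, map_zero, norm_zero]; positivity
  have hk0 : 0 < ‖k‖ := norm_pos_iff.2 hk
  obtain ⟨i1, b1⟩ := hC₁ (0, t + k) (3 * ‖k‖) (by positivity)
  obtain ⟨i2, b2⟩ := hC₁ (0, t) (2 * ‖k‖) (by positivity)
  obtain ⟨i3, b3⟩ := hC₂ (0, t) (2 * ‖k‖) (by positivity)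
  obtain ⟨i4, b4⟩ := hC₃ (0, t) (2 * ‖k‖) (by positivity)
  -- The radius `3|k|` around `t + k` is taken so that this ball contains the ball of radius `2|k|`
  -- around `t`.
  set g : ℂ × Sing m → ℝ := fun p => rieszNear (1 + β) (3 * ‖k‖) (0, t + k) p +
    rieszNear (1 + β) (2 * ‖k‖) (0, t) p +
    2 * expo m * ‖k‖ * rieszNear β (2 * ‖k‖) (0, t) p +
    K * ‖k‖ ^ 2 * rieszFar (1 - β) (2 * ‖k‖) (0, t) p with hg
  have i12 : Integrable fun p : ℂ × Sing m => rieszNear (1 + β) (3 * ‖k‖) (0, t + k) p +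
    rieszNear (1 + β) (2 * ‖k‖) (0, t) p := i1.add i2
  have i123 : Integrable fun p : ℂ × Sing m => rieszNear (1 + β) (3 * ‖k‖) (0, t + k) p +
    rieszNear (1 + β) (2 * ‖k‖) (0, t) p +
    2 * expo m * ‖k‖ * rieszNear β (2 * ‖k‖) (0, t) p := i12.add (i3.const_mul _)
  have hgi : Integrable g := i123.add (i4.const_mul _)
  have hgI : ∫ p, g p ≤ S * ‖k‖ ^ (1 + β) := by
    have e1 : ∫ p, g p = (∫ p, rieszNear (1 + β) (3 * ‖k‖) (0, t + k) p) +
        (∫ p, rieszNear (1 + β) (2 * ‖k‖) (0, t) p) +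
        2 * expo m * ‖k‖ * (∫ p, rieszNear β (2 * ‖k‖) (0, t) p) +
        K * ‖k‖ ^ 2 * ∫ p, rieszFar (1 - β) (2 * ‖k‖) (0, t) p := by
      rw [hg, integral_add i123 (i4.const_mul _), integral_add i12 (i3.const_mul _),
        integral_add i1 i2, integral_const_mul, integral_const_mul]
    rw [Real.mul_rpow (by norm_num) hk0.le] at b1 b2 b3 b4
    have e2 : ‖k‖ * ‖k‖ ^ β = ‖k‖ ^ (1 + β) := by rw [Real.rpow_add hk0 1 β, Real.rpow_one]
    have e3 : ‖k‖ ^ 2 * ‖k‖ ^ (-(1 - β)) = ‖k‖ ^ (1 + β) := by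
      rw [← Real.rpow_natCast, ← Real.rpow_add hk0]; congr 1; push_cast; ring
    rw [e1]
    calc _ ≤ C₁ * (3 ^ (1 + β) * ‖k‖ ^ (1 + β)) + C₁ * (2 ^ (1 + β) * ‖k‖ ^ (1 + β)) +
          2 * expo m * ‖k‖ * (C₂ * (2 ^ β * ‖k‖ ^ β)) +
          K * ‖k‖ ^ 2 * (C₃ * (2 ^ (-(1 - β)) * ‖k‖ ^ (-(1 - β)))) := by gcongr
      _ = C₁ * 3 ^ (1 + β) * ‖k‖ ^ (1 + β) + C₁ * 2 ^ (1 + β) * ‖k‖ ^ (1 + β) +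
          2 * expo m * (C₂ * 2 ^ β) * (‖k‖ * ‖k‖ ^ β) +
          K * (C₃ * 2 ^ (-(1 - β))) * (‖k‖ ^ 2 * ‖k‖ ^ (-(1 - β))) := by ring
      _ = _ := by rw [e2, e3]; ring
  have hi := h.integrable_leadDerivIntegrand hα1 t
  have hi1 := (hL N ρ h (t + k)).1
  have hi0 := (hL N ρ h t).1
  have hi2 : Integrable fun p => leadDerivIntegrand ρ t p k := hi.apply_continuousLinearMap k
  have hsub : Integrable fun p => leadIntegrand ρ (t + k) p - leadIntegrand ρ t p := hi1.sub hi0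
  have hrepr : leadCoeff ρ (t + k) - leadCoeff ρ t - leadDeriv ρ t k =
      ∫ p, (leadIntegrand ρ (t + k) p - leadIntegrand ρ t p - leadDerivIntegrand ρ t p k) := by
    rw [integral_sub hsub hi2, integral_sub hi1 hi0, leadDeriv,
      ContinuousLinearMap.integral_apply hi, leadCoeff, leadCoeff]
  have hbound : ∀ᵐ p, ‖leadIntegrand ρ (t + k) p - leadIntegrand ρ t p -
      leadDerivIntegrand ρ t p k‖ ≤ |kappa m| * N * g p := by
    filter_upwards [ae_ne ((0, t) : ℂ × Sing m), ae_ne ((0, t + k) : ℂ × Sing m)] with p hp hp1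
    have n1 := rieszNear_nonneg (1 + β) (3 * ‖k‖) (0, t + k) p
    have n2 := rieszNear_nonneg (1 + β) (2 * ‖k‖) (0, t) p
    have n3 := rieszNear_nonneg β (2 * ‖k‖) (0, t) p
    have n4 := rieszFar_nonneg (1 - β) (2 * ‖k‖) (0, t) p
    rcases lt_or_ge ‖p - (0, t)‖ (2 * ‖k‖) with hnear | hfar
    · have hnear1 : ‖p - (0, t + k)‖ < 3 * ‖k‖ := by
        have e1 : p - (0, t + k) = (p - (0, t)) - (0, k) := by ext1 <;> simp [sub_sub]
        have e2 : ‖((0, k) : ℂ × Sing m)‖ = ‖k‖ := by simp [Prod.norm_def]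
        rw [e1]
        refine (norm_sub_le _ _).trans_lt ?_
        rw [e2]; linarith
      have a1 : ‖leadIntegrand ρ (t + k) p‖ ≤
          |kappa m| * N * rieszNear (1 + β) (3 * ‖k‖) (0, t + k) p := by
        rw [norm_leadIntegrand, rieszNear,
          Set.indicator_of_mem (show ‖p - (0, t + k)‖ ∈ Set.Iio (3 * ‖k‖) from hnear1), mul_assoc |_| N,
          show 1 + β - ((m : ℝ) + 2) = α + 1 / 2 - 2 * expo m by rw [hβ]; unfold expo; ring]
        exact mul_le_mul_of_nonneg_left (h.abs_mul_axisSq_le ha.le hp1) (abs_nonneg _)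
      have a2 : ‖leadIntegrand ρ t p‖ ≤
          |kappa m| * N * rieszNear (1 + β) (2 * ‖k‖) (0, t) p := by
        rw [norm_leadIntegrand, rieszNear,
          Set.indicator_of_mem (show ‖p - (0, t)‖ ∈ Set.Iio (2 * ‖k‖) from hnear), mul_assoc |_| N,
          show 1 + β - ((m : ℝ) + 2) = α + 1 / 2 - 2 * expo m by rw [hβ]; unfold expo; ring]
        exact mul_le_mul_of_nonneg_left (h.abs_mul_axisSq_le ha.le hp) (abs_nonneg _)
      have a3 : ‖leadDerivIntegrand ρ t p k‖ ≤
          |kappa m| * N * (2 * expo m * ‖k‖ * rieszNear β (2 * ‖k‖) (0, t) p) := by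
        rw [rieszNear, Set.indicator_of_mem (show ‖p - (0, t)‖ ∈ Set.Iio (2 * ‖k‖) from hnear)]
        refine (ContinuousLinearMap.le_opNorm _ _).trans ?_
        calc _ ≤ (|kappa m| * (2 * expo m) * N * ‖p - (0, t)‖ ^ (β - ((m : ℝ) + 2))) * ‖k‖ := by
              gcongr; exact h.norm_leadDerivIntegrand_le hp
          _ = _ := by ring
      have a4 := norm_sub_le (leadIntegrand ρ (t + k) p - leadIntegrand ρ t p)
        (leadDerivIntegrand ρ t p k)
      have a5 := norm_sub_le (leadIntegrand ρ (t + k) p) (leadIntegrand ρ t p)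
      have a6 : 0 ≤ |kappa m| * N * (K * ‖k‖ ^ 2 * rieszFar (1 - β) (2 * ‖k‖) (0, t) p) := by
        positivity
      simp only [hg]
      rw [mul_add, mul_add, mul_add]
      linarith
    · have a1 := abs_axisSq_taylor_le hp hfar
      have a2 := h.abs_mul_axisSq_le (s := expo m + 1) (by linarith) hp
      rw [← hK] at a1
      have e1 : leadIntegrand ρ (t + k) p - leadIntegrand ρ t p - leadDerivIntegrand ρ t p k =
          ((kappa m * branch ρ p * (axisSq (t + k) p ^ (-expo m) - axisSq t p ^ (-expo m) -
            2 * expo m * axisSq t p ^ (-expo m - 1) * inner ℝ (p.2 - t) k) : ℝ) : ℂ) *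
              conj (root p).1 := by
        rw [leadIntegrand_eq, leadIntegrand_eq, leadDerivIntegrand_apply]
        push_cast; ring
      have e2 : rieszFar (1 - β) (2 * ‖k‖) (0, t) p =
          ‖p - (0, t)‖ ^ (α + 1 / 2 - 2 * (expo m + 1)) := by
        rw [rieszFar, Set.indicator_of_mem (show ‖p - (0, t)‖ ∈ Set.Ici (2 * ‖k‖) from hfar)]
        congr 1; rw [hβ]; unfold expo; ring
      have a3 : ‖leadIntegrand ρ (t + k) p - leadIntegrand ρ t p - leadDerivIntegrand ρ t p k‖ ≤
          |kappa m| * N * (K * ‖k‖ ^ 2 * rieszFar (1 - β) (2 * ‖k‖) (0, t) p) := by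
        rw [e1, e2, norm_mul, Complex.norm_real, RCLike.norm_conj, norm_mul, norm_mul,
          Real.norm_eq_abs, Real.norm_eq_abs, Real.norm_eq_abs]
        calc _ ≤ |kappa m| * |branch ρ p| * (K * ‖k‖ ^ 2 * axisSq t p ^ (-(expo m + 1))) *
              ‖(root p).1‖ := by gcongr
          _ = |kappa m| * (K * ‖k‖ ^ 2) * (|branch ρ p| * ‖(root p).1‖ *
              axisSq t p ^ (-(expo m + 1))) := by ring
          _ ≤ |kappa m| * (K * ‖k‖ ^ 2) * (N * ‖p - (0, t)‖ ^ (α + 1 / 2 - 2 * (expo m + 1))) := by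
              gcongr
          _ = _ := by ring
      refine a3.trans ?_
      simp only [hg]
      gcongr
      have : 0 ≤ 2 * expo m * ‖k‖ * rieszNear β (2 * ‖k‖) (0, t) p := by positivity
      linarith
  have hfin := (integrable_and_norm_integral_le (hsub.sub hi2).1 hgi hgI (by positivity) hbound).2
  rw [hrepr]
  exact hfin.trans (le_of_eq (by ring))

theorem exists_c1HolderNorm_bound (m : ℕ) {α : ℝ≥0} (hα0 : 0 < α) (hα1 : α < 1 / 2) :
    ∃ C : ℝ≥0, ∀ (N : ℝ≥0) (ρ : ℂ × Sing m → ℝ), IsSource (α : ℝ) N (branch ρ) →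
      ContDiff ℝ 1 (leadCoeff ρ) ∧ c1HolderNorm (α + 1 / 2) (leadCoeff ρ) ≤ C * N := by
  have hα0' : (0 : ℝ) < α := hα0
  have hα1' : (α : ℝ) < 1 / 2 := by
    have := NNReal.coe_lt_coe.2 hα1
    simpa using this
  obtain ⟨L, hL0, hL⟩ := exists_lead_bound m hα0' hα1'
  obtain ⟨T, hT0, hT⟩ := exists_lead_taylor_bound m hα0' hα1'
  lift L to ℝ≥0 using hL0
  lift T to ℝ≥0 using hT0
  refine ⟨L + 6 * T, fun N ρ h => ?_⟩
  have hTN : 0 ≤ (T : ℝ) * (N : ℝ) := by positivity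
  have hder := hasFDerivAt_of_taylor_bound (by linarith) (hT N ρ h)
  have hfd : fderiv ℝ (leadCoeff ρ) = leadDeriv ρ := by ext1 t; exact (hder t).fderiv
  have hcoe : ((α + 1 / 2 : ℝ≥0) : ℝ) = (α : ℝ) + 1 / 2 := by push_cast; rfl
  have hhol : HolderWith (6 * T * N) (α + 1 / 2) (fderiv ℝ (leadCoeff ρ)) := by
    intro s t
    have h1 := norm_sub_le_of_taylor_bound (by linarith) (by linarith) hTN (hT N ρ h) s t
    rw [hfd, hcoe, edist_dist, edist_dist, dist_eq_norm, dist_eq_norm,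
      ENNReal.ofReal_rpow_of_nonneg (norm_nonneg _) (by linarith)]
    refine (ENNReal.ofReal_le_ofReal h1).trans (le_of_eq ?_)
    rw [show 6 * (T * (N : ℝ)) * ‖s - t‖ ^ ((α : ℝ) + 1 / 2) =
      ((6 * T * N : ℝ≥0) : ℝ) * ‖s - t‖ ^ ((α : ℝ) + 1 / 2) by push_cast; ring,
      ENNReal.ofReal_mul (NNReal.coe_nonneg _), ENNReal.ofReal_coe_nnreal]
  refine ⟨?_, ?_⟩
  · rw [contDiff_one_iff_fderiv]
    exact ⟨fun t => (hder t).differentiableAt, hhol.continuous (by positivity)⟩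
  · rw [c1HolderNorm, ENNReal.coe_add, add_mul]
    refine add_le_add (iSup_le fun t => ?_) ?_
    · have h1 := (hL N ρ h t).2
      rw [← ofReal_norm, ← ENNReal.coe_mul, ← ENNReal.ofReal_coe_nnreal]
      exact ENNReal.ofReal_le_ofReal (h1.trans (le_of_eq (by push_cast; rfl)))
    · rw [← ENNReal.coe_mul]
      exact hhol.eHolderNorm_le

/-! ### Identification and uniqueness of the weak solution -/

/-- The section which is given by the function `g` on the principal branch. -/
noncomputable def liftTest {m : ℕ} (g : ℂ × Sing m → ℝ) (p : ℂ × Sing m) : ℝ :=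
  if 0 < p.1.re then g (cover p) else if p.1.re < 0 then -g (cover p) else 0

theorem contDiff_cover {m : ℕ} : ContDiff ℝ ∞ (cover (m := m)) := by
  unfold cover; fun_prop

theorem cover_notMem_of_re_eq_zero {m : ℕ} {p : ℂ × Sing m} (h : p.1.re = 0) :
    (cover p).1 ∉ Complex.slitPlane := by
  rw [Complex.mem_slitPlane_iff, not_or]
  simp only [cover, pow_two, Complex.mul_re, Complex.mul_im, h]
  constructor
  · nlinarith [mul_self_nonneg p.1.im]
  · simp

/-- The support of `g` avoids the cut, so the odd lift vanishes near `Re w = 0` and its two halves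
fit together smoothly. -/
theorem isTestSection_liftTest {m : ℕ} {g : ℂ × Sing m → ℝ} (hg : ContDiff ℝ ∞ g)
    (hc : HasCompactSupport g) (hs : tsupport g ⊆ {p | p.1 ∈ Complex.slitPlane}) :
    IsTestSection (liftTest g) := by
  have hcov := contDiff_cover (m := m)
  have hsub : Function.support (liftTest g) ⊆ cover ⁻¹' tsupport g := by
    intro p hp
    by_contra h
    have h0 : g (cover p) = 0 := image_eq_zero_of_notMem_tsupport h
    exact hp (by simp [liftTest, h0])
  have hclosed : IsClosed (cover ⁻¹' tsupport g : Set (ℂ × Sing m)) :=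
    (isClosed_tsupport g).preimage hcov.continuous
  have htsub : tsupport (liftTest g) ⊆ cover ⁻¹' tsupport g := closure_minimal hsub hclosed
  refine ⟨?_, ?_, ?_, ?_⟩
  · intro w t
    have h1 : cover (-w, t) = cover (w, t) := by simp [cover]
    simp only [liftTest, h1, Complex.neg_re]
    rcases lt_trichotomy w.re 0 with h | h | h
    · simp [h, not_lt.2 h.le]
    · simp [h]
    · simp [h, not_lt.2 h.le]
  · rw [contDiff_iff_contDiffAt]
    intro p
    rcases lt_trichotomy p.1.re 0 with h | h | h
    · have hev : ∀ᶠ y : ℂ × Sing m in 𝓝 p, y.1.re < 0 :=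
        (Complex.continuous_re.comp continuous_fst).continuousAt.eventually_lt_const h
      refine ContDiffAt.congr_of_eventuallyEq ((hg.comp hcov).neg.contDiffAt) ?_
      filter_upwards [hev] with y hy
      simp [liftTest, hy, not_lt.2 hy.le]
    · have hn : p ∉ cover ⁻¹' tsupport g := fun hp => cover_notMem_of_re_eq_zero h (hs hp)
      have hev : ∀ᶠ y in 𝓝 p, y ∉ cover ⁻¹' tsupport g := hclosed.isOpen_compl.mem_nhds hn
      refine ContDiffAt.congr_of_eventuallyEq (contDiffAt_const (c := (0 : ℝ))) ?_
      filter_upwards [hev] with y hy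
      exact Function.notMem_support.1 fun hy' => hy (hsub hy')
    · have hev : ∀ᶠ y : ℂ × Sing m in 𝓝 p, 0 < y.1.re :=
        (Complex.continuous_re.comp continuous_fst).continuousAt.eventually_const_lt h
      refine ContDiffAt.congr_of_eventuallyEq ((hg.comp hcov).contDiffAt) ?_
      filter_upwards [hev] with y hy
      simp [liftTest, hy]
  · obtain ⟨K, hK⟩ := hc.isBounded.exists_norm_le
    refine IsCompact.of_isClosed_subset (isCompact_closedBall (0 : ℂ × Sing m) (1 + K))
      (isClosed_tsupport _) fun p hp => ?_
    have h1 := hK _ (htsub hp)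
    have h2 : ‖p.1‖ ^ 2 ≤ K := by
      have := (norm_fst_le _).trans h1
      simpa [cover] using this
    have h3 : ‖p.2‖ ≤ K := (norm_snd_le (cover p)).trans h1
    rw [mem_closedBall_zero_iff, Prod.norm_def]
    exact max_le (by nlinarith [sq_nonneg (‖p.1‖ - 1)]) (by linarith)
  · intro p hp h0
    have := hs (htsub hp)
    simp only [cover, Set.mem_ofPred_eq] at this h0
    rw [h0] at this
    simp at this

theorem branch_liftTest {m : ℕ} (g : ℂ × Sing m → ℝ) {p : ℂ × Sing m}
    (hp : p.1 ∈ Complex.slitPlane) : branch (liftTest g) p = g p := by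
  have h1 : 0 < (root p).1.re := re_sqrt_pos hp
  have h2 : cover (root p) = p := by
    ext1
    · exact root_fst_sq p
    · rfl
  rw [branch_eq, liftTest, if_pos h1, h2]

theorem locallyIntegrable_branch {m : ℕ} {u : ℂ × Sing m → ℝ} (hu : Continuous u) :
    LocallyIntegrable (branch u) := by
  rw [locallyIntegrable_iff]
  intro K hK
  obtain ⟨M, hM⟩ := hK.isBounded.exists_norm_le
  obtain ⟨B, hB⟩ := (isCompact_closedBall (0 : ℂ × Sing m) (1 + M)).exists_bound_of_continuousOn
    hu.continuousOn
  refine Measure.integrableOn_of_bounded (M := B) hK.measure_lt_top.ne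
    (aestronglyMeasurable_branch hu) ?_
  filter_upwards [ae_restrict_mem hK.measurableSet] with p hp
  refine hB _ ?_
  have h1 := hM p hp
  have h2 : ‖(root p).1‖ ^ 2 ≤ M := by rw [norm_root_fst_sq]; exact (norm_fst_le p).trans h1
  have h3 : ‖p.2‖ ≤ M := (norm_snd_le p).trans h1
  rw [mem_closedBall_zero_iff]
  change ‖root p‖ ≤ _
  rw [Prod.norm_def]
  exact max_le (by nlinarith [sq_nonneg (‖(root p).1‖ - 1)]) (by change ‖p.2‖ ≤ _; linarith)

theorem IsEnergyLimit.locallyIntegrable {m : ℕ} {φ : ℕ → ℂ × Sing m → ℝ} {V : ℂ × Sing m → ℝ}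
    (h : IsEnergyLimit φ V) : LocallyIntegrable V := by
  have h1 : LocallyIntegrable fun p => V p / ‖p.1‖ := h.memLp.locallyIntegrable (by norm_num)
  rw [locallyIntegrable_iff]
  intro K hK
  have h2 : IntegrableOn (fun p => V p / ‖p.1‖ * ‖p.1‖) K :=
    (h1.integrableOn_isCompact hK).mul_continuousOn (by fun_prop) hK
  refine h2.congr (ae_restrict_of_ae ?_)
  filter_upwards [ae_fst_ne_zero] with p hp
  have := norm_ne_zero_iff.2 hp
  field_simp

theorem ae_fst_mem_slitPlane {m : ℕ} : ∀ᵐ p : ℂ × Sing m, p.1 ∈ Complex.slitPlane :=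
  Measure.quasiMeasurePreserving_fst.ae ae_mem_slitPlane

/-- The fundamental lemma of the calculus of variations on the complement of the cut, where every
test function lifts to a test section; the cut is null. -/
theorem ae_eq_of_integral_mul_test_eq {m : ℕ} {f g : ℂ × Sing m → ℝ} (hf : LocallyIntegrable f)
    (hg : LocallyIntegrable g)
    (h : ∀ ψ : ℂ × Sing m → ℝ, IsTestSection ψ →
      ∫ p, f p * branch ψ p = ∫ p, g p * branch ψ p) : f =ᵐ[volume] g := by
  have hopen : IsOpen {p : ℂ × Sing m | p.1 ∈ Complex.slitPlane} :=
    Complex.isOpen_slitPlane.preimage continuous_fst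
  have h1 := hopen.ae_eq_zero_of_integral_contDiff_smul_eq_zero (μ := volume) (f := fun p => f p - g p)
    ((hf.sub hg).locallyIntegrableOn _) (fun χ hχ hχc hχs => by
      have h2 := h _ (isTestSection_liftTest hχ hχc hχs)
      have h3 : ∀ k : ℂ × Sing m → ℝ, ∫ p, k p * branch (liftTest χ) p = ∫ p, χ p • k p := by
        intro k
        apply integral_congr_ae
        filter_upwards [ae_fst_mem_slitPlane] with p hp
        rw [branch_liftTest χ hp, smul_eq_mul, mul_comm]
      rw [h3, h3] at h2
      simp only [smul_sub]
      rw [integral_sub (hf.integrable_smul_left_of_hasCompactSupport hχ.continuous hχc)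
        (hg.integrable_smul_left_of_hasCompactSupport hχ.continuous hχc), h2, sub_self])
  filter_upwards [h1, ae_fst_mem_slitPlane] with p hp hslit
  exact sub_eq_zero.1 (hp hslit)

/-- The solution, as a section. -/
noncomputable def solution {m : ℕ} (R : ℂ × Sing m → ℝ) (p : ℂ × Sing m) : ℝ :=
  kappa m * potential 0 R p

theorem IsSource.continuous_solution {m : ℕ} {α N : ℝ} {R : ℂ × Sing m → ℝ}
    (h : IsSource α N R) : Continuous (solution R) := by
  have := h.continuous_potential
  unfold solution; fun_prop

/-- Valid for every energy limit that solves the weak equation. Applied to the constructed limit it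
gives a continuous representative, and applied to an arbitrary weak solution it gives uniqueness. -/
theorem IsSource.ae_eq_solution {m : ℕ} {α N : ℝ} {φ : ℕ → ℂ × Sing m → ℝ}
    {V R : ℂ × Sing m → ℝ} (hs : IsSource α N R) (h : IsEnergyLimit φ V)
    (hw : ∀ ψ : ℂ × Sing m → ℝ, IsTestSection ψ →
      Tendsto (fun j => dirichletForm (φ j) ψ) atTop (𝓝 (-∫ p, R p * branch ψ p))) :
    V =ᵐ[volume] branch (solution R) :=
  ae_eq_of_integral_mul_test_eq h.locallyIntegrable
    (locallyIntegrable_branch hs.continuous_solution) fun _ hψ =>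
      hs.integral_limit_mul_test h hw hψ

theorem IsSource.isWeakSolution {m : ℕ} {α N : ℝ} {ρ : ℂ × Sing m → ℝ}
    (h : IsSource α N (branch ρ)) : IsWeakSolution ρ (solution (branch ρ)) := by
  obtain ⟨φ, ht, hc, hw⟩ := exists_cauchy_weak h.memLp
  obtain ⟨V, hVm, hV⟩ := exists_locL2_limit ht hc
  have hae := h.ae_eq_solution ⟨ht, hc, hVm, hV⟩ hw
  refine ⟨?_, aestronglyMeasurable_branch h.continuous_solution, φ, ht, hc, fun K hK => ?_, hw⟩
  · intro w t
    simp only [solution, isSection_potential 0 (branch ρ) w t, mul_neg]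
  · refine (hV K hK).congr fun j => lintegral_congr_ae (ae_restrict_of_ae ?_)
    filter_upwards [hae] with p hp
    rw [hp]

theorem IsSource.ae_eq_of_isWeakSolution {m : ℕ} {α N : ℝ} {ρ v : ℂ × Sing m → ℝ}
    (h : IsSource α N (branch ρ)) (hv : IsWeakSolution ρ v) :
    branch v =ᵐ[volume] branch (solution (branch ρ)) := by
  obtain ⟨φ, ht, hc, hK, hw⟩ := hv.approx
  exact h.ae_eq_solution ⟨ht, hc, hv.measurable, hK⟩ hw

end FlatModel

/-! ### Assembly -/

theorem proposition2 (m : ℕ) (α : ℝ≥0) (hα₀ : 0 < α) (hα₁ : α < 1 / 2) :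
    ∃ C : ℝ≥0, ∀ ρ : ℂ × FlatModel.Sing m → ℝ,
      FlatModel.IsSection ρ →
      (∀ w t, 1 ≤ FlatModel.eucNorm (w ^ 2) t → ρ (w, t) = 0) →
      FlatModel.sectionNorm α ρ ≠ ⊤ →
      ((∀ t, Integrable (FlatModel.leadIntegrand ρ t)) ∧
        ContDiff ℝ 1 (FlatModel.leadCoeff ρ) ∧
        FlatModel.c1HolderNorm (α + 1 / 2) (FlatModel.leadCoeff ρ) ≤
          C * FlatModel.sectionNorm α ρ) ∧
      ∃ u : ℂ × FlatModel.Sing m → ℝ,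
        Continuous u ∧ FlatModel.IsWeakSolution ρ u ∧
        (∀ v, FlatModel.IsWeakSolution ρ v → FlatModel.branch v =ᵐ[volume] FlatModel.branch u) ∧
        ∀ w t, |u (w, t) - (FlatModel.leadCoeff ρ t * w).re| ≤
          C * ‖w ^ 2‖ ^ (3 / 2 : ℝ) * (FlatModel.sectionNorm α ρ).toReal := by
  have hα0' : (0 : ℝ) < α := hα₀
  have hα1' : (α : ℝ) < 1 / 2 := by
    have := NNReal.coe_lt_coe.2 hα₁
    simpa using this
  obtain ⟨L, hL0, hL⟩ := FlatModel.exists_lead_bound m hα0' hα1'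
  obtain ⟨D, hD0, hD⟩ := FlatModel.exists_remainder_bound m hα0' hα1'
  obtain ⟨T, hT⟩ := FlatModel.exists_c1HolderNorm_bound m hα₀ hα₁
  lift D to ℝ≥0 using hD0
  -- The factor `8` is that of `abs_section_le`: the constant of the source is `8 ‖ρ‖`.
  refine ⟨8 * T + 8 * D, fun ρ hρ hs hN => ?_⟩
  have hsrc := FlatModel.isSource_branch hα₀ hρ hs hN
  have hsrc' : FlatModel.IsSource (α : ℝ) ((8 * (FlatModel.sectionNorm α ρ).toNNReal : ℝ≥0) : ℝ)
      (FlatModel.branch ρ) := by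
    rwa [NNReal.coe_mul]
  obtain ⟨hC1, hnorm⟩ := hT _ ρ hsrc'
  refine ⟨⟨fun t => (hL _ ρ hsrc t).1, hC1, hnorm.trans ?_⟩,
    FlatModel.solution (FlatModel.branch ρ), hsrc.continuous_solution, hsrc.isWeakSolution,
    fun v hv => hsrc.ae_eq_of_isWeakSolution hv, fun w t => ?_⟩
  · rw [ENNReal.coe_mul, ENNReal.coe_toNNReal hN, ← mul_assoc]
    gcongr
    push_cast
    rw [mul_comm]
    exact le_self_add
  · refine (hD _ ρ hsrc w t).trans ?_
    have h1 : ‖w ^ 2‖ ^ (3 / 2 : ℝ) = ‖w‖ ^ 3 := by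
      rw [norm_pow, ← Real.rpow_natCast, ← Real.rpow_natCast, ← Real.rpow_mul (norm_nonneg _)]
      norm_num
    rw [h1]
    push_cast
    have h2 : 0 ≤ (T : ℝ) * ‖w‖ ^ 3 * (FlatModel.sectionNorm α ρ).toReal := by positivity
    linarith
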